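/- Let $\Pi=\{x=(x_1,x_2): x_1>0,\ 0<x_2<\pi\}$ and, for $R,s>0$ and $a>0$, let $\Pi_R=\Pi\cap\{x_1<R\}$ and $\Pi_{R,s}=\Pi_R\setminus\{(x_1-a)^2+x_2^2\le s^2\}$. Fix $a>0$ and a parity (even or odd). For $m\in\mathbb C$ and compactly supported $f\in L^2(\Pi)$ consider the boundary value problem $$(\Delta+1)u=m^2u+f\ \text{ in }\Pi,\qquad u=0\ \text{ on }\{x_2=\pi,\ x_1>0\}\cup\{x_2=0,\ x_1>a\},\qquad \frac{\partial u}{\partial x_2}=0\ \text{ on }\{x_2=0,\ 0<x_1<a\},$$ with $\partial u/\partial x_1=0$ (even case) or $u=0$ (odd case) on $\{x_1=0,\ 0<x_2<\pi\}$. By a solution we mean a function $u$ that belongs to $H^1(\Pi_r)$ for every $r>0$, satisfies the problem in the weak sense (Dirichlet conditions in the sense of traces), and for some constant $c\in\mathbb C$ has the asymptotics $$u(x)=c\,e^{-mx_1}\sin x_2+\mathcal O\big(e^{-\sqrt{3+m^2}\,x_1}\big),\qquad x_1\to+\infty .$$ Suppose that $a$ is critical for the given parity, that is, for $m=0$ and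 $f=0$ there is such a solution $\psi^{(0)}$, with the normalization $c=\sqrt{2/\pi}$. Then there is an open disc $\mathcal D\subset\mathbb C$ centred at $0$ such that for every $R>a$ the following holds. 1. For every $m\in\mathcal D\setminus\{0\}$ and every $f\in L^2(\Pi_R)$ (extended by zero) the problem has a unique solution $u=A(m)f$, and $A(m)$ is linear. 2. For all $\widetilde R,s>0$, $A(\cdot)$ is a meromorphic function on $\mathcal D$ with values in the bounded operators $\mathcal L(L^2(\Pi_R),H^1(\Pi_{\widetilde R}))$ and also with values in $\mathcal L(L^2(\Pi_R),H^2(\Pi_{\widetilde R,s}))$; in particular, $m\mapsto A(m)f$ is meromorphic on $\mathcal D$ with values in $H^1(\Pi_{\widetilde R})$ and in $H^2(\Pi_{\widetilde R,s})$ for each $f\in L^2(\Pi_R)$. The only pole of $A(\cdot)$ in $\mathcal D$ is $m=0$, and it is simple (in the case of $H^2(\Pi_{\widetilde R,s})$, provided that $\Pi_{\widetilde R,s}\neq\emptyset$). 3. For $m\in\mathcal D\setminus\{0\}$ and $f\in L^2(\Pi_R)$, $$A(m)f=\frac{K_0[f]}{m}\,\psi^{(0)}+A_1(m)f,\qquad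 K_0[f]=-\int_{\Pi}f\,\psi^{(0)}\,d^2x,$$ where, for all $\widetilde R,s>0$, $A_1(\cdot)$ is holomorphic on all of $\mathcal D$ with values in $\mathcal L(L^2(\Pi_R),H^1(\Pi_{\widetilde R}))$ and in $\mathcal L(L^2(\Pi_R),H^2(\Pi_{\widetilde R,s}))$. -/

import Mathlib

open MeasureTheory Set
open scoped ContDiff

noncomputable section

namespace Halfstrip

/-- The partial derivative `∂φ/∂x₁`. -/
def pd₁ (φ : ℝ × ℝ → ℂ) : ℝ × ℝ → ℂ := fun x => fderiv ℝ φ x (1, 0)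

/-- The partial derivative `∂φ/∂x₂`. -/
def pd₂ (φ : ℝ × ℝ → ℂ) : ℝ × ℝ → ℂ := fun x => fderiv ℝ φ x (0, 1)

/-- The iterated partial derivative `∂₁^i ∂₂^j φ`. -/
def partialD (i j : ℕ) (φ : ℝ × ℝ → ℂ) : ℝ × ℝ → ℂ := pd₁^[i] (pd₂^[j] φ)

/-- Smooth compactly supported functions on the plane. -/
def IsTest (φ : ℝ × ℝ → ℂ) : Prop := ContDiff ℝ ∞ φ ∧ HasCompactSupport φ

theorem IsTest.fderiv_apply {φ : ℝ × ℝ → ℂ} (h : IsTest φ) (v : ℝ × ℝ) :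
    IsTest (fun x => fderiv ℝ φ x v) :=
  ⟨(h.1.fderiv_right (m := ∞) (by simp)).clm_apply contDiff_const, h.2.fderiv_apply ℝ v⟩

theorem IsTest.partialD {φ : ℝ × ℝ → ℂ} (h : IsTest φ) (i j : ℕ) :
    IsTest (partialD i j φ) := by
  have h₂ : IsTest (pd₂^[j] φ) := by
    induction j with
    | zero => exact h
    | succ j ih =>
      rw [Function.iterate_succ_apply']
      exact ih.fderiv_apply (0, 1)
  unfold Halfstrip.partialD
  induction i with
  | zero => exact h₂
  | succ i ih =>
    rw [Function.iterate_succ_apply']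
    exact ih.fderiv_apply (1, 0)

/-- The complex Hilbert space `L²(Ω)`. -/
abbrev L2 (Ω : Set (ℝ × ℝ)) : Type := Lp ℂ 2 (volume.restrict Ω)

theorem integrable_mul_test {Ω : Set (ℝ × ℝ)} (u : L2 Ω) {φ : ℝ × ℝ → ℂ} (h : IsTest φ) :
    Integrable (fun x => u x * φ x) (volume.restrict Ω) :=
  (Lp.memLp u).integrable_mul (q := 2) (h.1.continuous.memLp_of_hasCompactSupport h.2)

/-- The multi-indices `(i, j)` with `i + j ≤ k`. -/
abbrev MultiIndex (k : ℕ) : Type :=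
  {α : Fin (k + 1) × Fin (k + 1) // (α.1 : ℕ) + (α.2 : ℕ) ≤ k}

/-- The multi-index `(0, 0)`. -/
def MultiIndex.zero (k : ℕ) : MultiIndex k := ⟨(0, 0), by simp⟩

/-- The Sobolev space `H^k(Ω)` of complex functions on an open set `Ω` of the plane. A function `u`
is represented by the tuple of its weak derivatives `∂^α u`, `|α| ≤ k` (which `u` determines), and
the norm is `(∑_α ‖∂^α u‖²_{L²})^{1/2}`. -/
def Sobolev (k : ℕ) (Ω : Set (ℝ × ℝ)) : Submodule ℂ (PiLp 2 (fun _ : MultiIndex k => L2 Ω)) where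
  carrier := {U | ∀ α : MultiIndex k, ∀ φ : ℝ × ℝ → ℂ, IsTest φ → tsupport φ ⊆ Ω →
    ∫ x in Ω, (U α) x * φ x =
      (-1) ^ ((α.1.1 : ℕ) + (α.1.2 : ℕ)) *
        ∫ x in Ω, (U (MultiIndex.zero k)) x * partialD α.1.1 α.1.2 φ x}
  add_mem' := by
    intro U V hU hV α φ hφ hs
    have key : ∀ (β : MultiIndex k) (χ : ℝ × ℝ → ℂ), IsTest χ →
        ∫ x in Ω, ((U + V) β) x * χ x =
          (∫ x in Ω, (U β) x * χ x) + ∫ x in Ω, (V β) x * χ x := by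
      intro β χ hχ
      rw [← integral_add (integrable_mul_test _ hχ) (integrable_mul_test _ hχ)]
      refine integral_congr_ae ?_
      filter_upwards [Lp.coeFn_add (U β) (V β)] with x hx
      simp only [PiLp.add_apply, hx, Pi.add_apply, add_mul]
    rw [key α φ hφ, key _ _ (hφ.partialD _ _), hU α φ hφ hs, hV α φ hφ hs, mul_add]
  zero_mem' := by
    intro α φ hφ hs
    have key : ∀ (β : MultiIndex k) (χ : ℝ × ℝ → ℂ),
        ∫ x in Ω, ((0 : PiLp 2 (fun _ : MultiIndex k => L2 Ω)) β) x * χ x = 0 := by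
      intro β χ
      refine integral_eq_zero_of_ae ?_
      filter_upwards [Lp.coeFn_zero ℂ 2 (volume.restrict Ω)] with x hx
      simp only [PiLp.zero_apply, hx, Pi.zero_apply, zero_mul]
    rw [key, key, mul_zero]
  smul_mem' := by
    intro c U hU α φ hφ hs
    have key : ∀ (β : MultiIndex k) (χ : ℝ × ℝ → ℂ),
        ∫ x in Ω, ((c • U) β) x * χ x = c * ∫ x in Ω, (U β) x * χ x := by
      intro β χ
      rw [← integral_const_mul]
      refine integral_congr_ae ?_
      filter_upwards [Lp.coeFn_smul c (U β)] with x hx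
      simp only [PiLp.smul_apply, hx, Pi.smul_apply, smul_eq_mul, mul_assoc]
    rw [key, key, hU α φ hφ hs]
    ring

/-- The weak derivative `∂₁^i ∂₂^j u` of an element of `H^k(Ω)`. -/
def weakD {k : ℕ} {Ω : Set (ℝ × ℝ)} (U : Sobolev k Ω) (α : MultiIndex k) : L2 Ω :=
  (U : PiLp 2 (fun _ : MultiIndex k => L2 Ω)) α

/-- The element `U` of `H^k(Ω)` is (the class of) the function `u` restricted to `Ω`. -/
def Represents {k : ℕ} {Ω : Set (ℝ × ℝ)} (U : Sobolev k Ω) (u : ℝ × ℝ → ℂ) : Prop :=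
  weakD U (MultiIndex.zero k) =ᵐ[volume.restrict Ω] u

/-- The multi-index `(1, 0)`. -/
def e₁ : MultiIndex 1 := ⟨(1, 0), by simp⟩

/-- The multi-index `(0, 1)`. -/
def e₂ : MultiIndex 1 := ⟨(0, 1), by simp⟩

/-- The halfstrip `Π = {x₁ > 0, 0 < x₂ < π}`. -/
def strip : Set (ℝ × ℝ) := {x | 0 < x.1 ∧ 0 < x.2 ∧ x.2 < Real.pi}

/-- The truncated halfstrip `Π_R = Π ∩ {x₁ < R}`. -/
def stripTo (R : ℝ) : Set (ℝ × ℝ) := strip ∩ {x | x.1 < R}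

/-- The truncated halfstrip `Π_R` without the closed disc of radius `s` about `(a, 0)`. -/
def stripCut (a R s : ℝ) : Set (ℝ × ℝ) :=
  stripTo R ∩ {x | s ^ 2 < (x.1 - a) ^ 2 + x.2 ^ 2}

/-- Functions on the halfstrip, up to equality almost everywhere. -/
abbrev StripFun : Type := (ℝ × ℝ) →ₘ[(volume : Measure (ℝ × ℝ)).restrict strip] ℂ

/-- The symmetry sector: the condition on the cut `x₁ = 0` is Neumann (`even`) or
Dirichlet (`odd`). -/
inductive Parity : Type
  | even : Parity
  | odd : Parity

/-- The (closed) part of the boundary of the halfstrip that carries the Dirichlet condition. -/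
def dirichletSet (a : ℝ) (p : Parity) : Set (ℝ × ℝ) :=
  {x | x.2 = Real.pi ∧ 0 ≤ x.1} ∪ {x | x.2 = 0 ∧ a ≤ x.1} ∪
    {x | p = Parity.odd ∧ x.1 = 0 ∧ 0 ≤ x.2 ∧ x.2 ≤ Real.pi}

/-- Test functions vanishing near the Dirichlet part of the boundary. -/
def IsBdryTest (a : ℝ) (p : Parity) (φ : ℝ × ℝ → ℂ) : Prop :=
  IsTest φ ∧ Disjoint (tsupport φ) (dirichletSet a p)

/-- The functions of `H¹(Π_r)` with zero trace on the Dirichlet part of the boundary: the closure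
in `H¹(Π_r)` of the smooth functions that vanish near this part. -/
def energySpace (a : ℝ) (p : Parity) (r : ℝ) : Set (Sobolev 1 (stripTo r)) :=
  closure {V | ∃ φ, IsBdryTest a p φ ∧
    ∀ α : MultiIndex 1, weakD V α =ᵐ[volume.restrict (stripTo r)] partialD α.1.1 α.1.2 φ}

/-- `u` is a weak solution, in `H¹(Π_r)` for every `r`, of `(Δ + 1)u = m² u + f` in `Π` with
`u = 0` on the Dirichlet part of the boundary and zero normal derivative on the rest of it. -/
def IsWeakSolution (a : ℝ) (p : Parity) (m : ℂ) (f : ℝ × ℝ → ℂ) (u : StripFun) : Prop :=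
  ∀ r : ℝ, 0 < r → ∃ U ∈ energySpace a p r, Represents U u ∧
    ∀ φ, IsBdryTest a p φ → tsupport φ ⊆ {x | x.1 < r} →
      ∫ x in stripTo r, (weakD U e₁ x * pd₁ φ x + weakD U e₂ x * pd₂ φ x) =
        ∫ x in stripTo r, ((1 - m ^ 2) * u x - f x) * φ x

/-- `u = c e^{-m x₁} sin x₂ + O(e^{-√(3+m²) x₁})` as `x₁ → +∞` (principal square root). -/
def HasAsymptotics (m c : ℂ) (u : StripFun) : Prop :=
  ∃ C X : ℝ, ∀ᵐ x ∂(volume.restrict strip), X < x.1 →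
    ‖u x - c * Complex.exp (-m * x.1) * Real.sin x.2‖ ≤
      C * ‖Complex.exp (-(3 + m ^ 2) ^ (1 / 2 : ℂ) * x.1)‖

/-- Solutions of the boundary value problem with the prescribed behaviour at infinity. -/
def IsSolution (a : ℝ) (p : Parity) (m : ℂ) (f : ℝ × ℝ → ℂ) (u : StripFun) : Prop :=
  IsWeakSolution a p m f u ∧ ∃ c : ℂ, HasAsymptotics m c u

/-- The normalized threshold resonance function: a solution of the homogeneous problem with
`m = 0` that behaves as `√(2/π) sin x₂ + O(e^{-√3 x₁})` at infinity. -/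
def IsThresholdResonance (a : ℝ) (p : Parity) (ψ : StripFun) : Prop :=
  IsWeakSolution a p 0 0 ψ ∧ HasAsymptotics 0 (Real.sqrt (2 / Real.pi) : ℝ) ψ

/-- The functional `K₀[f] = -∫ f ψ`. -/
def K₀ (R : ℝ) (ψ : StripFun) (f : L2 (stripTo R)) : ℂ := -∫ x in stripTo R, f x * ψ x

/-- The operator family `A`, followed by the restriction to `Ω`, is a meromorphic function on the
disc `|m| < ρ` with values in the bounded operators from `L²(Π_R)` to `H^k(Ω)`; its only pole is
`m = 0`, which is simple (if `Ω` is not empty), and it decomposes as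
`A(m) f = K₀[f] ψ / m + A₁(m) f` with `A₁` holomorphic on the whole disc. -/
def HasSimplePole (k : ℕ) (Ω : Set (ℝ × ℝ)) (ρ R : ℝ) (ψ : StripFun)
    (A : ℂ → L2 (stripTo R) →ₗ[ℂ] StripFun) : Prop :=
  ∃ (B B₁ : ℂ → L2 (stripTo R) →L[ℂ] Sobolev k Ω) (B₀ : L2 (stripTo R) →L[ℂ] Sobolev k Ω),
    (∀ m ∈ Metric.ball (0 : ℂ) ρ, m ≠ 0 → ∀ f, Represents (B m f) (A m f)) ∧
    MeromorphicOn B (Metric.ball 0 ρ) ∧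
    DifferentiableOn ℂ B (Metric.ball 0 ρ \ {0}) ∧
    (Ω.Nonempty → meromorphicOrderAt B 0 = -1) ∧
    (∀ f, MeromorphicOn (fun m => B m f) (Metric.ball 0 ρ)) ∧
    (∀ m ∈ Metric.ball (0 : ℂ) ρ, m ≠ 0 → B m = m⁻¹ • B₀ + B₁ m) ∧
    (∀ f, Represents (B₀ f) (K₀ R ψ f • ψ : StripFun)) ∧
    DifferentiableOn ℂ B₁ (Metric.ball 0 ρ)

end Halfstrip

end

noncomputable section

namespace Halfstrip

open Filter Topology Complex Metric
open scoped InnerProductSpace Real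
open Real (pi_pos norm_eq_abs pi_gt_three norm_of_nonneg pi_lt_four le_sqrt_of_sq_le sq_sqrt
  smoothTransition)

local notation "ℝ²" => ℝ × ℝ
local notation "μ[" Ω "]" => Measure.restrict volume Ω
local notation "Smooth" => ContDiff ℝ ∞
local notation "conj" => starRingEnd ℂ

variable {a L R r s : ℝ} {p : Parity} {m : ℂ} {x : ℝ²} {η k : ℝ → ℂ} {Ω Ω' : Set ℝ²}
  {D F G G₁ S S₁ S₂ f g g' g₁ g₂ u u' u₁ u₂ v v₁ v₂ w w₁ w₂ z θ φ χ ψ : ℝ² → ℂ}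


/-! ### Integrals with their values, and convergence in `L²`. -/

section

/-! The obstacle is that the leading term `e^{-m x₁} sin x₂` is not square integrable for `Re m ≤
0`, so solutions do not live in one Hilbert space. It is traded for a decaying one. Fix `L > a` to
the right of the support of `f`. A solution is written as `u = v + τ Γ_m`, where `Γ_m = √(2/π)
(e^{-m(x₁-L)} - e^{-(x₁-L)}) sin x₂` for `x₁ > L` and zero elsewhere, and `v` belongs to `H¹` of the
whole halfstrip. On the tail the first sine mode of `v` is then the harmonic function `τ E`, `E =
√(2/π) e^{-(x₁-L)} sin x₂`. Since `Γ_m` vanishes for `x₁ ≤ L`, `u` and `v` agree there.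

For `v` the problem becomes `redOp m v = -src f` in the energy space, with the form `⟨∇v, ∇w⟩ - (1 -
m²)⟨Pv, w⟩ + (m - 1) τ(v) τ(w)`. Here `P` removes the first mode on the tail, which makes that mode
harmonic, `τ` is its trace at `x₁ = L`, and the last term is the jump of the flux of `Γ_m`. The two
problems are equivalent by `redOp_isSolution` and `exists_redOp_of_isWeakSolution`. The new family
is a polynomial `T + m² K + m τ*τ` of bounded operators.

The transverse eigenvalues over the Neumann window are `1/4, 9/4, ...` and over the rest `1, 4,
...`. Only the lowest mode over each of the bounded intervals `(0, a)` and `(a, L)`, together with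
the functional `τ`, can destroy coercivity, and these are compact perturbations of the energy
(`redOp_compactBdd`). Hence injectivity implies invertibility (`isUnit_of_compactBdd`).

At `m = 0` the kernel is at most one-dimensional (`redOp_ker_one_dim`): the mode `cos(x₂/2)` over
the window solves `q'' = -(3/4) q` with the parity condition at `0`, hence is known up to a factor,
and if it vanishes an energy estimate kills the whole element. The resonance provides a kernel
element `v₀` with `τ(v₀) = 1`. Because `τ(v₀) ≠ 0`, the term linear in `m` moves the kernel at first
order: `T + τ*τ` is invertible, and dividing the family by `m` in the direction of `v₀` produces a
holomorphic family that is invertible near `0`. So the inverse has a simple pole with residue `v₀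
⟨v₀, ·⟩` (`exists_pencil_inverse`). The disc does not depend on `R`, because uniqueness for the
original problem does not depend on `L` (`exists_resolvent`). The resonance is real, by uniqueness
(`IsThresholdResonance.star`), which turns the residue into `K₀[f] ψ`.

Regularity in `H²` away from the point `(a, 0)` follows by cutting off, reflecting in the sides and
using the Fourier transform in the plane (`WeakTo.exists_sobolev_two`). The closed graph theorem
turns it into one bounded operator that does not depend on `m` (`exists_reg_weakTo`), which carries
the Laurent expansion from the energy space to `H¹` and `H²` (`hasSimplePole_of_reg`). The pole is
present on every nonempty domain since `ψ` vanishes on no open set, by unique continuation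
(`IsThresholdResonance.not_ae_eq_zero`). -/

lemma eq_zero_off {X E : Type*} [TopologicalSpace X] [Zero E] {f : X → E} {x : X}
    (h : x ∉ tsupport f) : f x = 0 := image_eq_zero_of_notMem_tsupport h

variable {α : Type*} [MeasurableSpace α] {μ : Measure α}

/-- `f` is integrable with integral `c`. -/
def HasInt (μ : Measure α) (f : α → ℂ) (c : ℂ) : Prop := Integrable f μ ∧ ∫ x, f x ∂μ = c

lemma _root_.MeasureTheory.Integrable.hi {f : α → ℂ} (h : Integrable f μ) :
    HasInt μ f (∫ x, f x ∂μ) := ⟨h, rfl⟩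

namespace HasInt

variable {f g : α → ℂ} {b c : ℂ}

lemma add (hf : HasInt μ f b) (hg : HasInt μ g c) : HasInt μ (fun x => f x + g x) (b + c) :=
  ⟨hf.1.add hg.1, by rw [integral_add hf.1 hg.1, hf.2, hg.2]⟩

lemma sub (hf : HasInt μ f b) (hg : HasInt μ g c) : HasInt μ (fun x => f x - g x) (b - c) :=
  ⟨hf.1.sub hg.1, by rw [integral_sub hf.1 hg.1, hf.2, hg.2]⟩

lemma mul (hf : HasInt μ f b) (c : ℂ) : HasInt μ (fun x => c * f x) (c * b) :=
  ⟨hf.1.const_mul c, by rw [integral_const_mul, hf.2]⟩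

lemma congr (hf : HasInt μ f b) (h : ∀ᵐ x ∂μ, g x = f x) : HasInt μ g b :=
  ⟨hf.1.congr (h.mono fun _ h => h.symm), by rw [integral_congr_ae h, hf.2]⟩

end HasInt

/-! ### Convergence in `L²` -/

/-- Convergence in `L²(μ)` of a sequence of square integrable functions. -/
structure L2Lim (μ : Measure α) (fn : ℕ → α → ℂ) (f : α → ℂ) : Prop where
  mem : ∀ n, MemLp (fn n) 2 μ
  mem_lim : MemLp f 2 μ
  tendsto : Tendsto (fun n => eLpNorm (fn n - f) 2 μ) atTop (𝓝 0)

lemma _root_.MeasureTheory.MemLp.mono_set {f : α → ℂ} {s t : Set α}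
    (hf : MemLp f 2 (μ.restrict t)) (h : s ⊆ t) : MemLp f 2 (μ.restrict s) :=
  hf.mono_measure (Measure.restrict_mono h le_rfl)

namespace L2Lim

variable {fn gn : ℕ → α → ℂ} {f g : α → ℂ}

lemma add (hf : L2Lim μ fn f) (hg : L2Lim μ gn g) :
    L2Lim μ (fun n x => fn n x + gn n x) (fun x => f x + g x) := by
  refine ⟨fun n => (hf.mem n).add (hg.mem n), hf.mem_lim.add hg.mem_lim, ?_⟩
  have h := hf.tendsto.add hg.tendsto
  rw [add_zero] at h
  refine tendsto_const_nhds.squeeze h (fun _ => zero_le) fun n => ?_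
  rw [show ((fun x => fn n x + gn n x) - fun x => f x + g x) = (fn n - f) + (gn n - g) from
    funext fun x => add_sub_add_comm _ _ _ _]
  exact eLpNorm_add_le ((hf.mem n).sub hf.mem_lim).1 ((hg.mem n).sub hg.mem_lim).1 (by norm_num)

lemma bdd_mul (hf : L2Lim μ fn f) {W : α → ℂ} (hW : AEStronglyMeasurable W μ) {C : ℝ}
    (hC : ∀ᵐ x ∂μ, ‖W x‖ ≤ C) : L2Lim μ (fun n x => W x * fn n x) (fun x => W x * f x) := by
  have key : ∀ h : α → ℂ, MemLp h 2 μ → MemLp (fun x => W x * h x) 2 μ := fun h hh =>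
    MemLp.of_le_mul (c := C) hh (hW.mul hh.1) (by
      filter_upwards [hC] with x hx
      rw [norm_mul]
      exact mul_le_mul_of_nonneg_right hx (norm_nonneg _))
  refine ⟨fun n => key _ (hf.mem n), key _ hf.mem_lim, ?_⟩
  have h := ENNReal.Tendsto.const_mul (a := ENNReal.ofReal C) hf.tendsto (Or.inr (by simp))
  rw [mul_zero] at h
  refine tendsto_const_nhds.squeeze h (fun _ => zero_le) fun n => ?_
  refine eLpNorm_le_mul_eLpNorm_of_ae_le_mul ?_ 2
  filter_upwards [hC] with x hx
  simp only [Pi.sub_apply]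
  rw [← mul_sub, norm_mul]
  exact mul_le_mul_of_nonneg_right hx (norm_nonneg _)

lemma star (hf : L2Lim μ fn f) : L2Lim μ (fun n x => conj (fn n x)) (fun x => conj (f x)) :=
  ⟨fun n => (hf.mem n).star, hf.mem_lim.star, hf.tendsto.congr fun n =>
    eLpNorm_congr_norm_ae (ae_of_all _ fun x => by simp [← map_sub])⟩

lemma const (hf : MemLp f 2 μ) : L2Lim μ (fun _ => f) f :=
  ⟨fun _ => hf, hf, by simp⟩

lemma congr_seq (hf : L2Lim μ fn f) (h : ∀ n x, gn n x = fn n x) : L2Lim μ gn f :=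
  funext₂ h ▸ hf

lemma congr_lim (hf : L2Lim μ fn f) (h : f =ᵐ[μ] g) : L2Lim μ fn g :=
  ⟨hf.mem, hf.mem_lim.ae_eq h, by
    refine hf.tendsto.congr fun n => eLpNorm_congr_ae ?_
    filter_upwards [h] with x hx
    simp [hx]⟩

lemma mono_set {s t : Set α} (hf : L2Lim (μ.restrict t) fn f) (h : s ⊆ t) :
    L2Lim (μ.restrict s) fn f :=
  ⟨fun n => (hf.mem n).mono_set h, hf.mem_lim.mono_set h, tendsto_const_nhds.squeeze hf.tendsto
    (fun _ => zero_le) (fun _ => eLpNorm_mono_measure _ (Measure.restrict_mono h le_rfl))⟩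

lemma integral_mul (hf : L2Lim μ fn f) (hg : L2Lim μ gn g) :
    Tendsto (fun n => ∫ x, fn n x * gn n x ∂μ) atTop (𝓝 (∫ x, f x * g x ∂μ)) := by
  have hf' := hf.star
  have key : ∀ u v : α → ℂ, ∀ (hu : MemLp (fun x => conj (u x)) 2 μ) (hv : MemLp v 2 μ),
      ∫ x, u x * v x ∂μ = inner ℂ (hu.toLp _) (hv.toLp _) := fun u v hu hv => by
    rw [L2.inner_def]
    refine integral_congr_ae ?_
    filter_upwards [hu.coeFn_toLp, hv.coeFn_toLp] with x h1 h2
    simp [h1, h2, mul_comm]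
  have h1 := (Lp.tendsto_Lp_iff_tendsto_eLpNorm'' _ hf'.mem _ hf'.mem_lim).2 hf'.tendsto
  have h2 := (Lp.tendsto_Lp_iff_tendsto_eLpNorm'' _ hg.mem _ hg.mem_lim).2 hg.tendsto
  rw [key f g hf'.mem_lim hg.mem_lim]
  exact (h1.inner (𝕜 := ℂ) h2).congr fun n => (key _ _ (hf'.mem n) (hg.mem n)).symm

lemma integral_mul_const (hf : L2Lim μ fn f) (hg : MemLp g 2 μ) :
    Tendsto (fun n => ∫ x, fn n x * g x ∂μ) atTop (𝓝 (∫ x, f x * g x ∂μ)) :=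
  hf.integral_mul (const hg)

lemma norm_sq (hf : L2Lim μ fn f) :
    Tendsto (fun n => ∫ x, ‖fn n x‖ ^ 2 ∂μ) atTop (𝓝 (∫ x, ‖f x‖ ^ 2 ∂μ)) := by
  have key : ∀ u : α → ℂ, (∫ x, u x * conj (u x) ∂μ).re = ∫ x, ‖u x‖ ^ 2 ∂μ := fun u => by
    rw [← ofReal_re (∫ x, ‖u x‖ ^ 2 ∂μ), ← integral_complex_ofReal]
    simp [mul_conj']
  rw [← key f]
  exact ((continuous_re.tendsto _).comp (hf.integral_mul hf.star)).congr fun n => key _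

end L2Lim

lemma memLp_norm_sq {f : α → ℂ}
    (hf : MemLp f 2 μ) : Integrable (fun x => ‖f x‖ ^ 2) μ := by
  simpa using hf.integrable_norm_pow (by norm_num)

lemma memLp_mul {f g : α → ℂ}
    (hf : MemLp f 2 μ) (hg : MemLp g 2 μ) : Integrable (fun x => f x * g x) μ :=
  hf.integrable_mul hg

lemma memLp_bdd_mul {f W : α → ℂ}
    (hf : MemLp f 2 μ) (hW : AEStronglyMeasurable W μ) {C : ℝ} (hC : ∀ᵐ x ∂μ, ‖W x‖ ≤ C) :
    MemLp (fun x => W x * f x) 2 μ :=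
  ((L2Lim.const hf).bdd_mul hW hC).mem_lim

/-! ### Test functions -/

lemma IsTest.memLp (h : IsTest φ) (μ : Measure (ℝ²)) [IsFiniteMeasureOnCompacts μ] : MemLp φ 2 μ :=
  h.1.continuous.memLp_of_hasCompactSupport h.2

lemma IsTest.integrable (h : IsTest φ) (μ : Measure (ℝ²))
    [IsFiniteMeasureOnCompacts μ] : Integrable φ μ :=
  h.1.continuous.integrable_of_hasCompactSupport h.2

lemma _root_.ContDiff.diff {E G : Type*} [NormedAddCommGroup E] [NormedSpace ℝ E]
    [NormedAddCommGroup G] [NormedSpace ℝ G] {f : E → G} (h : ContDiff ℝ ∞ f) : Differentiable ℝ f :=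
  h.differentiable (by simp)

lemma IsTest.diff (h : IsTest φ) : Differentiable ℝ φ := h.1.diff

lemma IsTest.d₁ (h : IsTest φ) : IsTest (pd₁ φ) := h.fderiv_apply _

lemma IsTest.d₂ (h : IsTest φ) : IsTest (pd₂ φ) := h.fderiv_apply _

lemma tsupport_pd₁ (φ : ℝ² → ℂ) : tsupport (pd₁ φ) ⊆ tsupport φ :=
  tsupport_fderiv_apply_subset ℝ _

lemma tsupport_pd₂ (φ : ℝ² → ℂ) : tsupport (pd₂ φ) ⊆ tsupport φ :=
  tsupport_fderiv_apply_subset ℝ _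

lemma contDiff_pd₁ (h : Smooth φ) : Smooth (pd₁ φ) :=
  (h.fderiv_right (m := ∞) (by simp)).clm_apply contDiff_const

lemma contDiff_pd₂ (h : Smooth φ) : Smooth (pd₂ φ) :=
  (h.fderiv_right (m := ∞) (by simp)).clm_apply contDiff_const

lemma IsTest.mul (h : IsTest φ) (hχ : Smooth χ) :
    IsTest (fun x => χ x * φ x) := ⟨hχ.mul h.1, h.2.mul_left⟩

lemma IsTest.star (h : IsTest φ) : IsTest (fun x => conj (φ x)) :=
  ⟨conjCLE.contDiff.comp h.1, h.2.comp_left (g := conj) (map_zero _)⟩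

lemma pd₁_mul (hχ : DifferentiableAt ℝ χ x) (h : DifferentiableAt ℝ φ x) :
    pd₁ (fun x => χ x * φ x) x = χ x * pd₁ φ x + pd₁ χ x * φ x := by
  simp [pd₁, fderiv_fun_mul hχ h]; ring

lemma pd₂_mul (hχ : DifferentiableAt ℝ χ x) (h : DifferentiableAt ℝ φ x) :
    pd₂ (fun x => χ x * φ x) x = χ x * pd₂ φ x + pd₂ χ x * φ x := by
  simp [pd₂, fderiv_fun_mul hχ h]; ring

lemma pd₁_conj : pd₁ (fun x => conj (φ x)) x = conj (pd₁ φ x) :=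
  congrArg (· (1, 0)) (conjCLE.comp_fderiv (f := φ) (x := x))

lemma pd₂_conj : pd₂ (fun x => conj (φ x)) x = conj (pd₂ φ x) :=
  congrArg (· (0, 1)) (conjCLE.comp_fderiv (f := φ) (x := x))

lemma hasDerivAt_pd₁ {s t : ℝ} (h : DifferentiableAt ℝ φ (s, t)) :
    HasDerivAt (fun s' => φ (s', t)) (pd₁ φ (s, t)) s :=
  h.hasFDerivAt.comp_hasDerivAt s ((hasDerivAt_id s).prodMk (hasDerivAt_const s t))

lemma hasDerivAt_pd₂ {s t : ℝ} (h : DifferentiableAt ℝ φ (s, t)) :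
    HasDerivAt (fun t' => φ (s, t')) (pd₂ φ (s, t)) t :=
  h.hasFDerivAt.comp_hasDerivAt t ((hasDerivAt_const t s).prodMk (hasDerivAt_id t))

lemma IsBdryTest.mul (h : IsBdryTest a p φ) (hχ : Smooth χ) : IsBdryTest a p (fun x => χ x * φ x) :=
  ⟨h.1.mul hχ, h.2.mono_left (tsupport_mul_subset_right)⟩

lemma IsBdryTest.star (h : IsBdryTest a p φ) : IsBdryTest a p (fun x => conj (φ x)) :=
  ⟨h.1.star, h.2.mono_left (closure_mono (by intro x; simp))⟩

lemma IsTest.add (h : IsTest φ) (hχ : IsTest χ) :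
    IsTest (fun x => φ x + χ x) := ⟨h.1.add hχ.1, h.2.add hχ.2⟩

lemma IsBdryTest.add (h : IsBdryTest a p φ)
    (hχ : IsBdryTest a p χ) : IsBdryTest a p (fun x => φ x + χ x) :=
  ⟨h.1.add hχ.1, (h.2.union_left hχ.2).mono_left (tsupport_add φ χ)⟩

lemma IsBdryTest.of_support (h : IsTest φ) (hs : tsupport φ ⊆ strip) : IsBdryTest a p φ := by
  refine ⟨h, disjoint_left.2 fun x hx hD => ?_⟩
  obtain ⟨h1, h2, h3⟩ := hs hx
  rcases hD with (⟨h, -⟩ | ⟨h, -⟩) | ⟨-, h, -⟩ <;> linarith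

lemma IsBdryTest.eq_zero (h : IsBdryTest a p φ) (hx : x ∈ dirichletSet a p) : φ x = 0 :=
  eq_zero_off fun hx' => disjoint_left.1 h.2 hx' hx

/-! ### The domains -/

/-- The part of the halfstrip over `I`. -/
def box (I : Set ℝ) : Set ℝ² := I ×ˢ Ioo 0 π

lemma strip_eq_box : strip = box (Ioi 0) := by
  ext x; simp [strip, box]

lemma isOpen_strip : IsOpen strip := by
  rw [strip_eq_box]; exact isOpen_Ioi.prod isOpen_Ioo

lemma stripTo_eq_box (r : ℝ) : stripTo r = box (Ioo 0 r) := by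
  ext x; simp [stripTo, strip, box]; tauto

lemma isOpen_stripTo (r : ℝ) : IsOpen (stripTo r) := by
  rw [stripTo_eq_box]; exact isOpen_Ioo.prod isOpen_Ioo

lemma restrict_box (I : Set ℝ) : μ[box I] = μ[I].prod μ[Ioo 0 π] := by
  rw [box, Measure.prod_restrict]; rfl

lemma stripTo_subset (r : ℝ) : stripTo r ⊆ strip := inter_subset_left

lemma stripTo_mono (h : r ≤ s) : stripTo r ⊆ stripTo s :=
  fun _ hx => ⟨hx.1, lt_of_lt_of_le hx.2 h⟩

lemma restrict_strip : μ[strip] = μ[Ioi 0].prod μ[Ioo 0 π] := by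
  rw [strip_eq_box, restrict_box]

/-! ### The divergence theorem on the halfstrip -/

lemma integral_strip_pd₂ (hF : ContDiff ℝ 1 F) (hc : HasCompactSupport F)
    (h0 : ∀ s, 0 < s → F (s, 0) = F (s, π)) : ∫ x in strip, pd₂ F x = 0 := by
  have hcont : Continuous (pd₂ F) := (hF.continuous_fderiv (by norm_num)).clm_apply continuous_const
  have hI : Integrable (pd₂ F) μ[strip] :=
    (hcont.integrable_of_hasCompactSupport (hc.fderiv_apply ℝ _)).restrict
  rw [restrict_strip] at hI ⊢
  rw [integral_prod _ hI]
  have : ∀ s ∈ Ioi (0 : ℝ), ∫ t in Ioo 0 π, pd₂ F (s, t) = 0 := by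
    intro s hs
    rw [← integral_Ioc_eq_integral_Ioo, ← intervalIntegral.integral_of_le pi_pos.le,
      intervalIntegral.integral_eq_sub_of_hasDerivAt (f := fun t => F (s, t))]
    · simp [h0 s hs]
    · intro t _
      exact hasDerivAt_pd₂ (hF.differentiable (by norm_num) _)
    · exact (hcont.comp (by fun_prop)).intervalIntegrable _ _
  rw [setIntegral_congr_fun measurableSet_Ioi this]
  simp

lemma integral_strip_pd₁ (hF : ContDiff ℝ 1 F) (hc : HasCompactSupport F)
    (h0 : ∀ t, 0 < t → t < π → F (0, t) = 0) : ∫ x in strip, pd₁ F x = 0 := by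
  have hcont : Continuous (pd₁ F) := (hF.continuous_fderiv (by norm_num)).clm_apply continuous_const
  have hI : Integrable (pd₁ F) μ[strip] :=
    (hcont.integrable_of_hasCompactSupport (hc.fderiv_apply ℝ _)).restrict
  rw [restrict_strip] at hI ⊢
  rw [integral_prod_symm _ hI]
  have : ∀ t ∈ Ioo (0 : ℝ) π, ∫ s in Ioi 0, pd₁ F (s, t) = 0 := by
    intro t ht
    have h1 : HasCompactSupport (fun s => F (s, t)) := hc.comp_isClosedEmbedding
      (Function.LeftInverse.isClosedEmbedding (f := Prod.fst) (fun _ => rfl) (by fun_prop)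
        (by fun_prop))
    refine (integral_congr_ae (ae_of_all _ fun s => (hasDerivAt_pd₁ (hF.differentiable
      (by norm_num) _)).deriv.symm)).trans ((h1.integral_Ioi_deriv_eq (hF.comp (by fun_prop))
      0).trans ?_)
    simp [h0 t ht.1 ht.2]
  rw [setIntegral_congr_fun measurableSet_Ioo this]
  simp

end

/-! ### Dominated convergence and the energy space of triples of functions. -/

section

lemma L2Lim.of_dominated {α : Type*} [MeasurableSpace α] {μ : Measure α} {fn : ℕ → α → ℂ}
    {f : α → ℂ} {g : α → ℝ} (hfn : ∀ n, AEStronglyMeasurable (fn n) μ) (hg : MemLp g 2 μ)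
    (hb : ∀ n, ∀ᵐ x ∂μ, ‖fn n x‖ ≤ g x)
    (hl : ∀ᵐ x ∂μ, Tendsto (fun n => fn n x) atTop (𝓝 (f x))) : L2Lim μ fn f := by
  have hf : AEStronglyMeasurable f μ := aestronglyMeasurable_of_tendsto_ae atTop hfn hl
  have hb' : ∀ᵐ x ∂μ, ‖f x‖ ≤ g x := by
    filter_upwards [hl, ae_all_iff.2 hb] with x hx hx'
    exact le_of_tendsto hx.norm (Eventually.of_forall hx')
  have hm : ∀ n, MemLp (fn n) 2 μ := fun n => hg.of_le (hfn n) (by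
    filter_upwards [hb n] with x hx using hx.trans (le_abs_self _))
  have hm' : MemLp f 2 μ := hg.of_le hf (by
    filter_upwards [hb'] with x hx using hx.trans (le_abs_self _))
  refine ⟨hm, hm', ?_⟩
  have key : Tendsto (fun n => ∫⁻ x, ‖fn n x - f x‖ₑ ^ (2 : ℝ) ∂μ) atTop (𝓝 0) := by
    have h0 : (0 : ENNReal) = ∫⁻ x, 0 ∂μ := by simp
    rw [h0]
    refine tendsto_lintegral_of_dominated_convergence' (fun x => ‖2 * g x‖ₑ ^ (2 : ℝ))
      (fun n => (((hfn n).sub hf).enorm.pow_const _)) ?_ ?_ ?_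
    · intro n
      filter_upwards [hb n, hb'] with x h1 h2
      refine ENNReal.rpow_le_rpow ?_ (by norm_num)
      refine enorm_le_iff_norm_le.2 ?_
      rw [norm_eq_abs, abs_of_nonneg (by linarith [norm_nonneg (f x)])]
      exact (norm_sub_le _ _).trans (by linarith)
    · have := (hg.const_mul 2)
      have h2 := lintegral_rpow_enorm_lt_top_of_eLpNorm_lt_top (by norm_num) (by norm_num) this.2
      simpa using h2.ne
    · filter_upwards [hl] with x hx
      have h1 : Tendsto (fun n => ‖fn n x - f x‖ₑ) atTop (𝓝 0) := by
        have := (hx.sub_const (f x)).enorm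
        simpa using this
      have := (ENNReal.continuous_rpow_const (y := 2)).tendsto 0 |>.comp h1
      simpa [Function.comp_def] using this
  have h2 := ((ENNReal.continuous_rpow_const (y := 1 / 2)).tendsto 0).comp key
  simp only [one_div, inv_pos, Nat.ofNat_pos, ENNReal.zero_rpow_of_pos] at h2
  refine h2.congr fun n => ?_
  rw [eLpNorm_eq_lintegral_rpow_enorm_toReal (by norm_num) (by norm_num)]
  simp

/-! ### The energy space in terms of functions -/

/-- The triple `(u, u₁, u₂)` is the limit in `L²(Ω)³` of test functions vanishing near the Dirichlet
part of the boundary, together with their first derivatives. -/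
def InEnergy (a : ℝ) (p : Parity) (Ω : Set ℝ²) (u u₁ u₂ : ℝ² → ℂ) : Prop :=
  ∃ φ : ℕ → ℝ² → ℂ, (∀ n, IsBdryTest a p (φ n)) ∧ L2Lim μ[Ω] φ u ∧
    L2Lim μ[Ω] (fun n => pd₁ (φ n)) u₁ ∧
    L2Lim μ[Ω] (fun n => pd₂ (φ n)) u₂

namespace InEnergy

lemma memLp (h : InEnergy a p Ω u u₁ u₂) : MemLp u 2 μ[Ω] := by
  obtain ⟨φ, -, h, -⟩ := h; exact h.mem_lim

lemma memLp₁ (h : InEnergy a p Ω u u₁ u₂) : MemLp u₁ 2 μ[Ω] := by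
  obtain ⟨φ, -, -, h, -⟩ := h; exact h.mem_lim

lemma memLp₂ (h : InEnergy a p Ω u u₁ u₂) : MemLp u₂ 2 μ[Ω] := by
  obtain ⟨φ, -, -, -, h⟩ := h; exact h.mem_lim

lemma mono (h : InEnergy a p Ω u u₁ u₂) (hs : Ω' ⊆ Ω) : InEnergy a p Ω' u u₁ u₂ := by
  obtain ⟨φ, h0, h1, h2, h3⟩ := h
  exact ⟨φ, h0, h1.mono_set hs, h2.mono_set hs, h3.mono_set hs⟩

lemma of_test (h : IsBdryTest a p φ) : InEnergy a p Ω φ (pd₁ φ) (pd₂ φ) :=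
  ⟨fun _ => φ, fun _ => h, L2Lim.const (h.1.memLp _), L2Lim.const (h.1.d₁.memLp _),
    L2Lim.const (h.1.d₂.memLp _)⟩

lemma congr (h : InEnergy a p Ω u u₁ u₂) (h0 : u =ᵐ[μ[Ω]] v)
    (h1 : u₁ =ᵐ[μ[Ω]] v₁) (h2 : u₂ =ᵐ[μ[Ω]] v₂) :
    InEnergy a p Ω v v₁ v₂ := by
  obtain ⟨φ, hφ, l0, l1, l2⟩ := h
  exact ⟨φ, hφ, l0.congr_lim h0, l1.congr_lim h1, l2.congr_lim h2⟩

/-- Multiplication by a smooth function. -/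
lemma mul (h : InEnergy a p Ω u u₁ u₂) (hχ : Smooth χ) {C : ℝ}
    (h0 : ∀ᵐ x ∂μ[Ω], ‖χ x‖ ≤ C) (h1 : ∀ᵐ x ∂μ[Ω], ‖pd₁ χ x‖ ≤ C)
    (h2 : ∀ᵐ x ∂μ[Ω], ‖pd₂ χ x‖ ≤ C) :
    InEnergy a p Ω (fun x => χ x * u x) (fun x => χ x * u₁ x + pd₁ χ x * u x)
      (fun x => χ x * u₂ x + pd₂ χ x * u x) := by
  obtain ⟨φ, hφ, l0, l1, l2⟩ := h
  have m0 := hχ.continuous.aestronglyMeasurable (μ := μ[Ω])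
  have m1 := (contDiff_pd₁ hχ).continuous.aestronglyMeasurable (μ := μ[Ω])
  have m2 := (contDiff_pd₂ hχ).continuous.aestronglyMeasurable (μ := μ[Ω])
  exact ⟨fun n x => χ x * φ n x, fun n => (hφ n).mul hχ, l0.bdd_mul m0 h0,
    ((l1.bdd_mul m0 h0).add (l0.bdd_mul m1 h1)).congr_seq fun n x =>
      pd₁_mul (hχ.diff x) ((hφ n).1.diff x),
    ((l2.bdd_mul m0 h0).add (l0.bdd_mul m2 h2)).congr_seq fun n x =>
      pd₂_mul (hχ.diff x) ((hφ n).1.diff x)⟩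

lemma _root_.Halfstrip.IsTest.bdd (hχ : IsTest χ) :
    ∃ C, (∀ x, ‖χ x‖ ≤ C) ∧ (∀ x, ‖pd₁ χ x‖ ≤ C) ∧ ∀ x, ‖pd₂ χ x‖ ≤ C := by
  obtain ⟨C0, h0⟩ := hχ.1.continuous.bounded_above_of_compact_support hχ.2
  obtain ⟨C1, h1⟩ := hχ.d₁.1.continuous.bounded_above_of_compact_support hχ.d₁.2
  obtain ⟨C2, h2⟩ := hχ.d₂.1.continuous.bounded_above_of_compact_support hχ.d₂.2
  exact ⟨max C0 (max C1 C2), fun x => (h0 x).trans (by simp), fun x => (h1 x).trans (by simp),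
    fun x => (h2 x).trans (by simp)⟩

lemma mul_test (h : InEnergy a p Ω u u₁ u₂) (hχ : IsTest χ) :
    InEnergy a p Ω (fun x => χ x * u x) (fun x => χ x * u₁ x + pd₁ χ x * u x)
      (fun x => χ x * u₂ x + pd₂ χ x * u x) := by
  obtain ⟨C, h0, h1, h2⟩ := hχ.bdd
  exact h.mul hχ.1 (ae_of_all _ h0) (ae_of_all _ h1) (ae_of_all _ h2)

lemma const_mul (h : InEnergy a p Ω u u₁ u₂) (c : ℂ) :
    InEnergy a p Ω (fun x => c * u x) (fun x => c * u₁ x) (fun x => c * u₂ x) := by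
  have e1 : pd₁ (fun _ => c) = fun _ => 0 := by ext x; simp [pd₁]
  have e2 : pd₂ (fun _ => c) = fun _ => 0 := by ext x; simp [pd₂]
  have := h.mul (χ := fun _ => c) contDiff_const (C := ‖c‖) (by simp) (by simp [e1]) (by simp [e2])
  simpa [e1, e2] using this

lemma add (h : InEnergy a p Ω u u₁ u₂) (h' : InEnergy a p Ω v v₁ v₂) :
    InEnergy a p Ω (fun x => u x + v x) (fun x => u₁ x + v₁ x) (fun x => u₂ x + v₂ x) := by
  obtain ⟨φ, hφ, l0, l1, l2⟩ := h
  obtain ⟨χ, hχ, k0, k1, k2⟩ := h'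
  refine ⟨fun n x => φ n x + χ n x, fun n => (hφ n).add (hχ n), l0.add k0, ?_, ?_⟩
  · exact (l1.add k1).congr_seq fun n x => by
      simp [pd₁, fderiv_fun_add ((hφ n).1.diff x) ((hχ n).1.diff x)]
  · exact (l2.add k2).congr_seq fun n x => by
      simp [pd₂, fderiv_fun_add ((hφ n).1.diff x) ((hχ n).1.diff x)]

lemma sub (h : InEnergy a p Ω u u₁ u₂) (h' : InEnergy a p Ω v v₁ v₂) :
    InEnergy a p Ω (fun x => u x - v x) (fun x => u₁ x - v₁ x) (fun x => u₂ x - v₂ x) := by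
  simpa [sub_eq_add_neg] using h.add (h'.const_mul (-1))

lemma star (h : InEnergy a p Ω u u₁ u₂) :
    InEnergy a p Ω (fun x => conj (u x)) (fun x => conj (u₁ x)) (fun x => conj (u₂ x)) := by
  obtain ⟨φ, hφ, l0, l1, l2⟩ := h
  refine ⟨fun n x => conj (φ n x), fun n => (hφ n).star, l0.star, ?_, ?_⟩
  · exact l1.star.congr_seq fun _ _ => pd₁_conj
  · exact l2.star.congr_seq fun _ _ => pd₂_conj

/-- A continuous linear identity that holds for test functions holds in the energy space. -/
lemma integral_eq_zero (h : InEnergy a p Ω u u₁ u₂) (hg : MemLp g 2 μ[Ω]) (hg₁ : MemLp g₁ 2 μ[Ω])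
    (hg₂ : MemLp g₂ 2 μ[Ω])
    (hφ : ∀ φ, IsBdryTest a p φ → ∫ x in Ω, (φ x * g x + pd₁ φ x * g₁ x + pd₂ φ x * g₂ x) = 0) :
    ∫ x in Ω, (u x * g x + u₁ x * g₁ x + u₂ x * g₂ x) = 0 := by
  obtain ⟨φ, hb, l0, l1, l2⟩ := h
  have e : ∀ f f₁ f₂ : ℝ² → ℂ, MemLp f 2 μ[Ω] → MemLp f₁ 2 μ[Ω] →
      MemLp f₂ 2 μ[Ω] → ∫ x in Ω, (f x * g x + f₁ x * g₁ x + f₂ x * g₂ x) =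
      (∫ x in Ω, f x * g x) + (∫ x in Ω, f₁ x * g₁ x) + ∫ x in Ω, f₂ x * g₂ x := by
    intro f f₁ f₂ hf hf₁ hf₂
    rw [integral_add (f := fun x => f x * g x + f₁ x * g₁ x)
      ((memLp_mul hf hg).add (memLp_mul hf₁ hg₁)) (memLp_mul hf₂ hg₂),
      integral_add (memLp_mul hf hg) (memLp_mul hf₁ hg₁)]
  have ht := ((l0.integral_mul_const hg).add (l1.integral_mul_const hg₁)).add
    (l2.integral_mul_const hg₂)
  rw [e _ _ _ l0.mem_lim l1.mem_lim l2.mem_lim]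
  refine tendsto_nhds_unique ht ((tendsto_const_nhds (x := (0 : ℂ))).congr fun n => ?_)
  rw [← e _ _ _ (l0.mem n) (l1.mem n) (l2.mem n), hφ _ (hb n)]

end InEnergy

end

section

/-! ### Continuous functions in the energy space -/

/-- A smooth cutoff on the line: `0` on `(-∞, 1]`, `1` on `[2, ∞)`. -/
def stepFun (s : ℝ) : ℝ := smoothTransition (s - 1)

lemma contDiff_stepFun : Smooth stepFun :=
  smoothTransition.contDiff.comp (contDiff_id.sub contDiff_const)

lemma stepFun_of_le (h : s ≤ 1) : stepFun s = 0 :=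
  smoothTransition.zero_of_nonpos (by linarith)

lemma stepFun_of_ge (h : 2 ≤ s) : stepFun s = 1 :=
  smoothTransition.one_of_one_le (by linarith)

lemma stepFun_nonneg (s : ℝ) : 0 ≤ stepFun s := smoothTransition.nonneg _

lemma stepFun_le_one (s : ℝ) : stepFun s ≤ 1 := smoothTransition.le_one _

lemma deriv_stepFun_of_lt (h : s < 1) : deriv stepFun s = 0 := by
  have : stepFun =ᶠ[𝓝 s] fun _ => 0 := by
    filter_upwards [Iio_mem_nhds h] with t ht using stepFun_of_le (le_of_lt ht)
  rw [this.deriv_eq, deriv_const]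

lemma deriv_stepFun_of_gt (h : 2 < s) : deriv stepFun s = 0 := by
  have : stepFun =ᶠ[𝓝 s] fun _ => 1 := by
    filter_upwards [Ioi_mem_nhds h] with t ht using stepFun_of_ge (le_of_lt ht)
  rw [this.deriv_eq, deriv_const]

lemma exists_deriv_stepFun_le : ∃ C : ℝ, 0 ≤ C ∧ ∀ s, |deriv stepFun s| ≤ C := by
  have hc : Continuous (deriv stepFun) := contDiff_stepFun.continuous_deriv (by simp)
  obtain ⟨C, hC⟩ := (isCompact_Icc (a := (1 : ℝ)) (b := 2)).exists_bound_of_continuousOn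
    hc.continuousOn
  refine ⟨max C 0, le_max_right _ _, fun s => ?_⟩
  by_cases h1 : s < 1
  · simp [deriv_stepFun_of_lt h1]
  by_cases h2 : 2 < s
  · simp [deriv_stepFun_of_gt h2]
  · exact (hC s ⟨not_lt.1 h1, not_lt.1 h2⟩).trans (le_max_left _ _)

/-- The truncation `S · 1_{|S| > ε}`, smoothed. -/
def truncAt (k : ℝ) (S : ℝ² → ℂ) : ℝ² → ℂ := fun x =>
  (stepFun (k * ‖S x‖ ^ 2) : ℝ) * S x

lemma truncAt_eventuallyEq_zero {k : ℝ} (hS : Continuous S) (hx : S x = 0) : truncAt k S =ᶠ[𝓝 x] fun _ => 0 := by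
  have hc : Continuous fun y => k * ‖S y‖ ^ 2 := by fun_prop
  have : ∀ᶠ y in 𝓝 x, k * ‖S y‖ ^ 2 < 1 := by
    refine hc.continuousAt.eventually_lt continuousAt_const ?_
    simp [hx]
  filter_upwards [this] with y hy
  simp [truncAt, stepFun_of_le hy.le]

lemma contDiff_truncAt {k : ℝ} (hS : Continuous S)
    (hsm : ∀ x, S x ≠ 0 → ContDiffAt ℝ ∞ S x) : Smooth (truncAt k S) := by
  refine contDiff_iff_contDiffAt.2 fun x => ?_
  by_cases hx : S x = 0
  · exact contDiffAt_const.congr_of_eventuallyEq (truncAt_eventuallyEq_zero hS hx)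
  · have h1 := hsm x hx
    refine ContDiffAt.mul ?_ h1
    exact ofRealCLM.contDiff.contDiffAt.comp x (contDiff_stepFun.contDiffAt.comp x
      (contDiffAt_const.mul (h1.norm_sq ℝ)))

/-- The bound does not depend on `k`: the derivative of the cutoff contributes at most `2 C k |S|²
|∂S|`, and it is nonzero only where `k |S|² ≤ 2`. This is what allows dominated convergence as the
truncation level tends to zero. -/
lemma norm_fderiv_truncAt_le {k C : ℝ} (hk : 0 ≤ k) (hC : ∀ s, |deriv stepFun s| ≤ C)
    {x v : ℝ²} (hx : ContDiffAt ℝ ∞ S x) :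
    ‖fderiv ℝ (truncAt k S) x v‖ ≤ (1 + 4 * C) * ‖fderiv ℝ S x v‖ := by
  have hd : HasFDerivAt S (fderiv ℝ S x) x := (hx.differentiableAt (by simp)).hasFDerivAt
  have h2 : HasFDerivAt (fun y => k * ‖S y‖ ^ 2)
      (k • (2 • (innerSL ℝ (S x)).comp (fderiv ℝ S x))) x := hd.norm_sq.const_mul k
  have h3 : HasDerivAt stepFun (deriv stepFun (k * ‖S x‖ ^ 2)) (k * ‖S x‖ ^ 2) :=
    ((contDiff_stepFun.diff) _).hasDerivAt
  have h4 := (ofRealCLM.hasFDerivAt.comp x (h3.comp_hasFDerivAt x h2)).mul hd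
  have e : fderiv ℝ (truncAt k S) x = _ := h4.fderiv
  rw [e]
  have hC0 : 0 ≤ C := (abs_nonneg _).trans (hC 0)
  simp only [Function.comp_apply, add_apply, smul_apply,
    ContinuousLinearMap.comp_apply, smul_eq_mul, ofRealCLM_apply, innerSL_apply_apply,
    nsmul_eq_mul, Nat.cast_ofNat]
  set s := k * ‖S x‖ ^ 2 with hs
  set w := fderiv ℝ S x v
  have b1 : ‖((stepFun s : ℝ) : ℂ) * w‖ ≤ ‖w‖ := by
    rw [norm_mul, norm_real, norm_eq_abs, abs_of_nonneg (stepFun_nonneg _)]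
    exact mul_le_of_le_one_left (norm_nonneg _) (stepFun_le_one _)
  have b2 : ‖S x * ((deriv stepFun s * (k * (2 * inner ℝ (S x) w)) : ℝ) : ℂ)‖ ≤ 4 * C * ‖w‖ := by
    rw [norm_mul, norm_real, norm_eq_abs, abs_mul, abs_mul, abs_mul, abs_of_nonneg hk, abs_two]
    have hi : |inner ℝ (S x) w| ≤ ‖S x‖ * ‖w‖ := abs_real_inner_le_norm _ _
    by_cases hs2 : 2 < s
    · rw [deriv_stepFun_of_gt hs2]
      simp only [abs_zero, zero_mul, mul_zero]
      positivity
    · have hs2' : s ≤ 2 := not_lt.1 hs2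
      calc ‖S x‖ * (|deriv stepFun s| * (k * (2 * |inner ℝ (S x) w|)))
          ≤ ‖S x‖ * (C * (k * (2 * (‖S x‖ * ‖w‖)))) := by gcongr; exact hC s
        _ = 2 * C * s * ‖w‖ := by rw [hs]; ring
        _ ≤ 2 * C * 2 * ‖w‖ := by gcongr
        _ = 4 * C * ‖w‖ := by ring
  refine (norm_add_le _ _).trans ?_
  have := add_le_add b1 b2
  exact le_trans (le_of_eq rfl) (this.trans (le_of_eq (by ring)))

/-- The truncations of `S` vanish near the zero set of `S`, so they are smooth and vanish near the
Dirichlet set even if `S` merely vanishes on it. They converge with their derivatives by domination.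
On the zero set the limit of the derivatives is zero, hence the indicators. -/
lemma inEnergy_of_continuous (hS : Continuous S) (hc : HasCompactSupport S)
    (hD : ∀ x ∈ dirichletSet a p, S x = 0) (hsm : ∀ x, S x ≠ 0 → ContDiffAt ℝ ∞ S x)
    (h1 : MemLp (pd₁ S) 2 μ[Ω]) (h2 : MemLp (pd₂ S) 2 μ[Ω]) :
    InEnergy a p Ω S ({x | S x ≠ 0}.indicator (pd₁ S)) ({x | S x ≠ 0}.indicator (pd₂ S)) := by
  obtain ⟨C, hC0, hC⟩ := exists_deriv_stepFun_le
  set T : ℕ → ℝ² → ℂ := fun n => truncAt (n : ℝ) S with hT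
  have hTc : ∀ n, Smooth (T n) := fun n => contDiff_truncAt hS hsm
  have hTt : ∀ n, IsBdryTest a p (T n) := fun n => by
    refine ⟨⟨hTc n, hc.mul_left⟩, disjoint_left.2 fun x hx hxD => ?_⟩
    exact (notMem_tsupport_iff_eventuallyEq.2 (truncAt_eventuallyEq_zero hS (hD x hxD))) hx
  have hlarge : ∀ x, S x ≠ 0 → ∀ᶠ n : ℕ in atTop, T n =ᶠ[𝓝 x] S := by
    intro x hx
    have hpos : 0 < ‖S x‖ ^ 2 := by positivity
    obtain ⟨N, hN⟩ := exists_nat_gt (2 / ‖S x‖ ^ 2)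
    filter_upwards [eventually_ge_atTop N] with n hn
    have hlt : (2 : ℝ) < n * ‖S x‖ ^ 2 := by
      rw [div_lt_iff₀ hpos] at hN
      exact hN.trans_le (by gcongr)
    have hcc : Continuous fun y => (n : ℝ) * ‖S y‖ ^ 2 := by fun_prop
    filter_upwards [continuousAt_const.eventually_lt hcc.continuousAt hlt] with y hy
    simp [hT, truncAt, stepFun_of_ge hy.le]
  have hdz : ∀ n x v, S x = 0 → fderiv ℝ (T n) x v = 0 := by
    intro n x v hx
    rw [(truncAt_eventuallyEq_zero (k := n) hS hx).fderiv_eq]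
    simp
  have main : ∀ v : ℝ², MemLp (fun x => fderiv ℝ S x v) 2 μ[Ω] →
      L2Lim μ[Ω] (fun n x => fderiv ℝ (T n) x v)
        ({x | S x ≠ 0}.indicator (fun x => fderiv ℝ S x v)) := by
    intro v hv
    refine L2Lim.of_dominated (g := fun x => (1 + 4 * C) * ‖fderiv ℝ S x v‖) (fun n => ?_)
      (hv.norm.const_mul _) ?_ ?_
    · exact (((hTc n).continuous_fderiv (by simp)).clm_apply continuous_const).aestronglyMeasurable
    · intro n
      refine ae_of_all _ fun x => ?_
      by_cases hx : S x = 0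
      · rw [hdz n x v hx, norm_zero]; positivity
      · exact norm_fderiv_truncAt_le (by positivity) hC (hsm x hx)
    · refine ae_of_all _ fun x => ?_
      by_cases hx : S x = 0
      · simp [hdz _ x v hx, hx]
      · refine tendsto_const_nhds.congr' ?_
        filter_upwards [hlarge x hx] with n hn
        rw [hn.fderiv_eq]
        simp [hx]
  refine ⟨T, hTt, ?_, main _ h1, main _ h2⟩
  refine L2Lim.of_dominated (g := fun x => ‖S x‖) (fun n => (hTc n).continuous.aestronglyMeasurable)
    (hS.memLp_of_hasCompactSupport hc).norm ?_ ?_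
  · intro n
    refine ae_of_all _ fun x => ?_
    simp only [hT, truncAt]
    rw [norm_mul, norm_real, norm_eq_abs, abs_of_nonneg (stepFun_nonneg _)]
    exact mul_le_of_le_one_left (norm_nonneg _) (stepFun_le_one _)
  · refine ae_of_all _ fun x => ?_
    by_cases hx : S x = 0
    · simp [hT, truncAt, hx]
    · refine tendsto_const_nhds.congr' ?_
      filter_upwards [hlarge x hx] with n hn using hn.eq_of_nhds.symm

/-! ### Weak derivatives -/

lemma integral_mul_test_eq {fn : ℕ → ℝ² → ℂ} {v : ℝ²} (hf : ∀ n, IsTest (fn n))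
    (l : L2Lim μ[Ω] fn u) (l' : L2Lim μ[Ω] (fun n x => fderiv ℝ (fn n) x v) w) (hφ : IsTest φ)
    (hs : tsupport φ ⊆ Ω) : ∫ x in Ω, w x * φ x = - ∫ x in Ω, u x * fderiv ℝ φ x v := by
  refine tendsto_nhds_unique (l'.integral_mul_const (hφ.memLp _))
    ((l.integral_mul_const ((hφ.fderiv_apply v).memLp _)).neg.congr fun n => ?_)
  rw [setIntegral_eq_integral_of_forall_compl_eq_zero fun x hx => by
      rw [eq_zero_off fun h => hx (hs (tsupport_fderiv_apply_subset ℝ v h)), mul_zero],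
    setIntegral_eq_integral_of_forall_compl_eq_zero fun x hx => by
      rw [eq_zero_off fun h => hx (hs h), mul_zero],
    integral_mul_fderiv_eq_neg_fderiv_mul_of_integrable ((hφ.mul ((hf n).fderiv_apply v).1).integrable _)
      (((hφ.fderiv_apply v).mul (hf n).1).integrable _) ((hφ.mul (hf n).1).integrable _)
      (fun x _ => (hf n).diff x) (fun x _ => hφ.diff x), neg_neg]

namespace InEnergy

lemma weak₁ (h : InEnergy a p Ω u u₁ u₂) (hφ : IsTest φ)
    (hs : tsupport φ ⊆ Ω) : ∫ x in Ω, u₁ x * φ x = - ∫ x in Ω, u x * pd₁ φ x := by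
  obtain ⟨ψ, hψ, l0, l1, -⟩ := h
  exact integral_mul_test_eq (fun n => (hψ n).1) l0 l1 hφ hs

lemma weak₂ (h : InEnergy a p Ω u u₁ u₂) (hφ : IsTest φ)
    (hs : tsupport φ ⊆ Ω) : ∫ x in Ω, u₂ x * φ x = - ∫ x in Ω, u x * pd₂ φ x := by
  obtain ⟨ψ, hψ, l0, -, l2⟩ := h
  exact integral_mul_test_eq (fun n => (hψ n).1) l0 l2 hφ hs

end InEnergy

section

variable {E : Type*} [NormedAddCommGroup E] [NormedSpace ℝ E] [FiniteDimensional ℝ E]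
  [MeasureSpace E] [BorelSpace E] {I : Set E} {f g χ : E → ℂ}

lemma integrable_mul_of_tsupport (hq : LocallyIntegrableOn f I)
    (hχ : Continuous χ) (hc : HasCompactSupport χ) (hs : tsupport χ ⊆ I) :
    Integrable (fun x => f x * χ x) := by
  have h1 : IntegrableOn f (tsupport χ) := hq.integrableOn_compact_subset hs hc
  have h2 := h1.continuousOn_mul (g := χ) hχ.continuousOn hc
  have h3 : (fun x => f x * χ x) = (tsupport χ).indicator (fun x => χ x * f x) := by
    ext x
    by_cases hx : x ∈ tsupport χ
    · simp [hx, mul_comm]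
    · simp [hx, eq_zero_off hx]
  rw [h3]
  exact h2.integrable_indicator (isClosed_tsupport χ).measurableSet

/-- Locally integrable functions that agree as distributions agree almost everywhere. -/
lemma ae_eq_of_integral_smooth (hI : IsOpen I) (hf : LocallyIntegrableOn f I)
    (hg : LocallyIntegrableOn g I) (h : ∀ χ : E → ℂ, Smooth χ → HasCompactSupport χ →
      tsupport χ ⊆ I → ∫ x, f x * χ x = ∫ x, g x * χ x) : ∀ᵐ x, x ∈ I → f x = g x := by
  have key := hI.ae_eq_zero_of_integral_contDiff_smul_eq_zero (μ := (volume : Measure E))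
    (f := fun x => f x - g x) (hf.sub hg) (fun k hk hkc hks => by
      have ht : Smooth (fun x => (k x : ℂ)) := ofRealCLM.contDiff.comp hk
      have htc : HasCompactSupport (fun x => (k x : ℂ)) := hkc.comp_left (g := ofReal) (by simp)
      have hsup : tsupport (fun x => (k x : ℂ)) ⊆ I := by
        refine (closure_mono fun x hx => ?_).trans hks
        simpa using hx
      refine (((integrable_mul_of_tsupport hf ht.continuous htc hsup).hi.sub
        (integrable_mul_of_tsupport hg ht.continuous htc hsup).hi).congr (ae_of_all _ fun x => ?_)).2.trans
        (sub_eq_zero.2 (h _ ht htc hsup))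
      rw [real_smul]; ring)
  filter_upwards [key] with x hx hx'
  exact sub_eq_zero.1 (hx hx')

end

lemma ae_eq_of_integral_test (hΩ : IsOpen Ω) (hf : LocallyIntegrableOn f Ω)
    (hg : LocallyIntegrableOn g Ω)
    (h : ∀ φ, IsTest φ → tsupport φ ⊆ Ω → ∫ x in Ω, f x * φ x = ∫ x in Ω, g x * φ x) :
    f =ᵐ[μ[Ω]] g := by
  refine (ae_restrict_iff' hΩ.measurableSet).2 (ae_eq_of_integral_smooth hΩ hf hg fun χ h1 h2 hs => ?_)
  have e (f : ℝ² → ℂ) : ∫ x in Ω, f x * χ x = ∫ x, f x * χ x :=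
    setIntegral_eq_integral_of_forall_compl_eq_zero fun x hx => by
      simp [eq_zero_off fun h => hx (hs h)]
  rw [← e, ← e, h χ ⟨h1, h2⟩ hs]

lemma locallyIntegrableOn_of_memLp (hf : MemLp f 2 μ[Ω]) : LocallyIntegrableOn f Ω :=
  locallyIntegrableOn_of_locallyIntegrable_restrict (hf.locallyIntegrable (by norm_num))

/-- Both `w` and `z` are the weak derivative in direction `v` of the same function, and weak
derivatives are unique. -/
lemma ae_eq_of_L2Lim {fn gn : ℕ → ℝ² → ℂ} {v : ℝ²} (hΩ : IsOpen Ω) (hf : ∀ n, IsTest (fn n))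
    (hg : ∀ n, IsTest (gn n)) (l : L2Lim μ[Ω] fn u) (k : L2Lim μ[Ω] gn u') (e : u =ᵐ[μ[Ω]] u')
    (l' : L2Lim μ[Ω] (fun n x => fderiv ℝ (fn n) x v) w)
    (k' : L2Lim μ[Ω] (fun n x => fderiv ℝ (gn n) x v) z) : w =ᵐ[μ[Ω]] z := by
  refine ae_eq_of_integral_test hΩ (locallyIntegrableOn_of_memLp l'.mem_lim)
    (locallyIntegrableOn_of_memLp k'.mem_lim) fun φ hφ hs => ?_
  rw [integral_mul_test_eq hf l l' hφ hs, integral_mul_test_eq hg k k' hφ hs]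
  exact congrArg _ (integral_congr_ae (by filter_upwards [e] with x hx using by rw [hx]))

namespace InEnergy

lemma unique₁ (h : InEnergy a p Ω u u₁ u₂) (h' : InEnergy a p Ω v v₁ v₂) (hΩ : IsOpen Ω)
    (e : u =ᵐ[μ[Ω]] v) : u₁ =ᵐ[μ[Ω]] v₁ := by
  obtain ⟨φ, hφ, l0, l1, -⟩ := h
  obtain ⟨ψ, hψ, k0, k1, -⟩ := h'
  exact ae_eq_of_L2Lim hΩ (fun n => (hφ n).1) (fun n => (hψ n).1) l0 k0 e l1 k1

lemma unique₂ (h : InEnergy a p Ω u u₁ u₂) (h' : InEnergy a p Ω v v₁ v₂) (hΩ : IsOpen Ω)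
    (e : u =ᵐ[μ[Ω]] v) : u₂ =ᵐ[μ[Ω]] v₂ := by
  obtain ⟨φ, hφ, l0, -, l2⟩ := h
  obtain ⟨ψ, hψ, k0, -, k2⟩ := h'
  exact ae_eq_of_L2Lim hΩ (fun n => (hφ n).1) (fun n => (hψ n).1) l0 k0 e l2 k2

/-- A test function that vanishes on the Dirichlet part of the boundary is in the energy space. -/
lemma of_vanish (hS : IsTest S) (hD : ∀ x ∈ dirichletSet a p, S x = 0) :
    InEnergy a p Ω S (pd₁ S) (pd₂ S) := by
  have h := inEnergy_of_continuous (a := a) (p := p) (Ω := univ) hS.1.continuous hS.2 hD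
    (fun x _ => hS.1.contDiffAt) (hS.d₁.memLp _) (hS.d₂.memLp _)
  obtain ⟨φ, hφ, l0, l1, l2⟩ := id h
  have k {v w} (l : L2Lim μ[univ] (fun n x => fderiv ℝ (φ n) x v) w) :=
    ae_eq_of_L2Lim isOpen_univ (fun n => (hφ n).1) (fun _ => hS) l0 (L2Lim.const (hS.memLp _))
      EventuallyEq.rfl l (L2Lim.const ((hS.fderiv_apply v).memLp _))
  exact (h.congr EventuallyEq.rfl (k l1) (k l2)).mono (subset_univ _)

/-- Singularities of `S` on the Dirichlet set do no harm, since `φ` vanishes in a neighbourhood of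
it. -/
lemma contDiff_test_mul (hφ : IsBdryTest a p φ)
    (hS : ∀ x ∉ dirichletSet a p, ContDiffAt ℝ ∞ S x) : Smooth (fun x => φ x * S x) := by
  refine contDiff_iff_contDiffAt.2 fun x => ?_
  by_cases hx : x ∈ dirichletSet a p
  · have : φ =ᶠ[𝓝 x] 0 := notMem_tsupport_iff_eventuallyEq.1 fun h => disjoint_left.1 hφ.2 h hx
    refine (contDiffAt_const (c := (0 : ℂ))).congr_of_eventuallyEq ?_
    filter_upwards [this] with y hy
    simp [hy]
  · exact hφ.1.1.contDiffAt.mul (hS x hx)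

/-- Integration by parts against a vector field `(S₁, S₂)` that is smooth off the Dirichlet part
and tangential on the Neumann part of the boundary. -/
lemma ibp (h : InEnergy a p Ω u u₁ u₂) (hΩs : Ω ⊆ strip)
    (c1 : ∀ x ∉ dirichletSet a p, ContDiffAt ℝ ∞ S₁ x)
    (c2 : ∀ x ∉ dirichletSet a p, ContDiffAt ℝ ∞ S₂ x)
    (m1 : MemLp S₁ 2 μ[Ω]) (m2 : MemLp S₂ 2 μ[Ω])
    (mG : MemLp (fun x => pd₁ S₁ x + pd₂ S₂ x) 2 μ[Ω])
    (hs1 : strip ∩ tsupport S₁ ⊆ Ω) (hs2 : strip ∩ tsupport S₂ ⊆ Ω)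
    (hb : ∀ s, 0 < s → s < a → S₂ (s, 0) = 0)
    (hl : p = Parity.even → ∀ t, 0 < t → t < π → S₁ (0, t) = 0) :
    ∫ x in Ω, (u x * (pd₁ S₁ x + pd₂ S₂ x) + u₁ x * S₁ x + u₂ x * S₂ x) = 0 := by
  refine h.integral_eq_zero mG m1 m2 fun φ hφ => ?_
  have k1 := contDiff_test_mul hφ c1
  have k2 := contDiff_test_mul hφ c2
  have hc1 : HasCompactSupport (fun x => φ x * S₁ x) := hφ.1.2.mul_right
  have hc2 : HasCompactSupport (fun x => φ x * S₂ x) := hφ.1.2.mul_right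
  have i1 := integral_strip_pd₁ (k1.of_le (by simp)) hc1 (fun t h0 h1 => by
    cases p with
    | even => simp [hl rfl t h0 h1]
    | odd => rw [hφ.eq_zero (Or.inr ⟨rfl, rfl, h0.le, h1.le⟩), zero_mul])
  have i2 := integral_strip_pd₂ (k2.of_le (by simp)) hc2 (fun s h0 => by
    have : φ (s, π) = 0 := hφ.eq_zero (Or.inl (Or.inl ⟨rfl, h0.le⟩))
    rw [this, zero_mul]
    by_cases hs : s < a
    · rw [hb s h0 hs, mul_zero]
    · rw [hφ.eq_zero (Or.inl (Or.inr ⟨rfl, not_lt.1 hs⟩)), zero_mul])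
  have t1 : IsTest (fun x => φ x * S₁ x) := ⟨k1, hc1⟩
  have t2 : IsTest (fun x => φ x * S₂ x) := ⟨k2, hc2⟩
  have e : ∀ x ∈ strip, φ x * (pd₁ S₁ x + pd₂ S₂ x) + pd₁ φ x * S₁ x + pd₂ φ x * S₂ x =
      pd₁ (fun x => φ x * S₁ x) x + pd₂ (fun x => φ x * S₂ x) x := by
    intro x hx
    have hx' : x ∉ dirichletSet a p := by
      obtain ⟨h1, h2, h3⟩ := hx
      rintro ((⟨h, -⟩ | ⟨h, -⟩) | ⟨-, h, -⟩) <;> linarith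
    rw [pd₁_mul (hφ.1.diff x) ((c1 x hx').differentiableAt (by simp)),
      pd₂_mul (hφ.1.diff x) ((c2 x hx').differentiableAt (by simp))]
    ring
  have hsub : ∫ x in Ω, (φ x * (pd₁ S₁ x + pd₂ S₂ x) + pd₁ φ x * S₁ x + pd₂ φ x * S₂ x) =
      ∫ x in strip, (φ x * (pd₁ S₁ x + pd₂ S₂ x) + pd₁ φ x * S₁ x + pd₂ φ x * S₂ x) := by
    refine (setIntegral_eq_of_subset_of_forall_sdiff_eq_zero isOpen_strip.measurableSet hΩs ?_).symm
    intro x hx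
    rw [eq_zero_off fun h => hx.2 (hs1 ⟨hx.1, h⟩), eq_zero_off fun h => hx.2 (hs2 ⟨hx.1, h⟩),
      eq_zero_off fun h => hx.2 (hs1 ⟨hx.1, tsupport_pd₁ _ h⟩),
      eq_zero_off fun h => hx.2 (hs2 ⟨hx.1, tsupport_pd₂ _ h⟩)]
    ring
  rw [hsub, setIntegral_congr_fun isOpen_strip.measurableSet e,
    integral_add (t1.d₁.integrable _) (t2.d₂.integrable _), i1, i2, add_zero]

end InEnergy

end

section

/-! ### The energy space as a Hilbert space -/

lemma MultiIndex.cases_one (α : MultiIndex 1) : α = MultiIndex.zero 1 ∨ α = e₁ ∨ α = e₂ := by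
  obtain ⟨⟨i, j⟩, h⟩ := α
  fin_cases i <;> fin_cases j <;> simp_all [MultiIndex.zero, e₁, e₂]
  exact absurd h (by decide)

/-- First order tuples of square integrable functions on `Ω`. -/
abbrev Tuple (Ω : Set ℝ²) : Type := PiLp 2 (fun _ : MultiIndex 1 => L2 Ω)

/-- The tuple with given components. -/
def Tuple.mk (u u₁ u₂ : L2 Ω) : Tuple Ω :=
  WithLp.toLp 2 fun α : MultiIndex 1 => if α = e₁ then u₁ else if α = e₂ then u₂ else u

lemma MultiIndex.zero_ne_e₁ : MultiIndex.zero 1 ≠ e₁ := by simp [MultiIndex.zero, e₁]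

lemma MultiIndex.zero_ne_e₂ : MultiIndex.zero 1 ≠ e₂ := by simp [MultiIndex.zero, e₂]

lemma MultiIndex.e₂_ne_e₁ : e₂ ≠ e₁ := by simp [e₁, e₂]

@[simp] theorem Tuple.mk_zero (u u₁ u₂ : L2 Ω) : Tuple.mk u u₁ u₂ (MultiIndex.zero 1) = u := by
  simp [Tuple.mk, MultiIndex.zero_ne_e₁, MultiIndex.zero_ne_e₂]

@[simp] theorem Tuple.mk_e₁ (u u₁ u₂ : L2 Ω) : Tuple.mk u u₁ u₂ e₁ = u₁ := by
  simp [Tuple.mk]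

@[simp] theorem Tuple.mk_e₂ (u u₁ u₂ : L2 Ω) : Tuple.mk u u₁ u₂ e₂ = u₂ := by
  simp [Tuple.mk, MultiIndex.e₂_ne_e₁]

lemma Tuple.ext {U V : Tuple Ω}
    (h0 : U (MultiIndex.zero 1) = V (MultiIndex.zero 1)) (h1 : U e₁ = V e₁) (h2 : U e₂ = V e₂) :
    U = V := by
  refine PiLp.ext fun α => ?_
  rcases α.cases_one with rfl | rfl | rfl <;> assumption

lemma Tuple.sum {M : Type*} [AddCommMonoid M] (f : MultiIndex 1 → M) :
    ∑ α, f α = f (MultiIndex.zero 1) + f e₁ + f e₂ := by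
  have : (Finset.univ : Finset (MultiIndex 1)) = {MultiIndex.zero 1, e₁, e₂} := by
    ext α
    simpa using α.cases_one
  rw [this, Finset.sum_insert, Finset.sum_insert, Finset.sum_singleton, add_assoc]
  · simp [MultiIndex.e₂_ne_e₁.symm]
  · simp [MultiIndex.zero_ne_e₁, MultiIndex.zero_ne_e₂]

lemma Tuple.tendsto_iff {U : ℕ → Tuple Ω} {V : Tuple Ω} : Tendsto U atTop (𝓝 V) ↔
      Tendsto (fun n => U n (MultiIndex.zero 1)) atTop (𝓝 (V (MultiIndex.zero 1))) ∧
      Tendsto (fun n => U n e₁) atTop (𝓝 (V e₁)) ∧ Tendsto (fun n => U n e₂) atTop (𝓝 (V e₂)) := by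
  have h : Tendsto U atTop (𝓝 V) ↔ ∀ α, Tendsto (fun n => U n α) atTop (𝓝 (V α)) := by
    rw [(PiLp.homeomorph 2 (fun _ : MultiIndex 1 => L2 Ω)).isInducing.tendsto_nhds_iff,
      tendsto_pi_nhds]
    rfl
  rw [h]
  constructor
  · exact fun h => ⟨h _, h _, h _⟩
  · rintro ⟨h0, h1, h2⟩ α
    rcases α.cases_one with rfl | rfl | rfl <;> assumption

lemma partialD_zero (φ : ℝ² → ℂ) :
    partialD (MultiIndex.zero 1).1.1 (MultiIndex.zero 1).1.2 φ = φ := rfl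

lemma partialD_e₁ (φ : ℝ² → ℂ) : partialD e₁.1.1 e₁.1.2 φ = pd₁ φ := rfl

lemma partialD_e₂ (φ : ℝ² → ℂ) : partialD e₂.1.1 e₂.1.2 φ = pd₂ φ := rfl

/-- The tuples of test functions vanishing near the Dirichlet part of the boundary. -/
def testTuples (a : ℝ) (p : Parity) (Ω : Set ℝ²) : Set (Tuple Ω) :=
  {U | ∃ φ, IsBdryTest a p φ ∧ ∀ α : MultiIndex 1, U α =ᵐ[μ[Ω]] partialD α.1.1 α.1.2 φ}

/-- Allows the rest of the proof to work with functions and sequences instead of closures of sets of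
tuples of classes. -/
lemma mem_closure_testTuples_iff {U : Tuple Ω} :
    U ∈ closure (testTuples a p Ω) ↔ InEnergy a p Ω (U (MultiIndex.zero 1)) (U e₁) (U e₂) := by
  rw [mem_closure_iff_seq_limit]
  have key : ∀ (V : ℕ → L2 Ω) (W : L2 Ω) (fn : ℕ → ℝ² → ℂ),
      (∀ n, MemLp (fn n) 2 μ[Ω]) → (∀ n, V n =ᵐ[μ[Ω]] fn n) →
      (Tendsto V atTop (𝓝 W) ↔ L2Lim μ[Ω] fn W) := by
    intro V W fn hm h
    have e : (fun n => eLpNorm (fn n - ⇑W) 2 μ[Ω]) = fun n => eLpNorm (⇑(V n) - ⇑W) 2 μ[Ω] := by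
      ext n
      refine eLpNorm_congr_ae ?_
      filter_upwards [h n] with x hx
      simp [hx]
    rw [Lp.tendsto_Lp_iff_tendsto_eLpNorm']
    constructor
    · exact fun ht => ⟨hm, Lp.memLp W, by rw [e]; exact ht⟩
    · exact fun ht => by rw [← e]; exact ht.tendsto
  constructor
  · rintro ⟨V, hV, hl⟩
    choose φ hφ hVφ using hV
    obtain ⟨l0, l1, l2⟩ := Tuple.tendsto_iff.1 hl
    exact ⟨φ, hφ, (key _ _ _ (fun n => (hφ n).1.memLp _) fun n => hVφ n _).1 l0,
      (key _ _ _ (fun n => (hφ n).1.d₁.memLp _) fun n => hVφ n e₁).1 l1,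
      (key _ _ _ (fun n => (hφ n).1.d₂.memLp _) fun n => hVφ n e₂).1 l2⟩
  · rintro ⟨φ, hφ, l0, l1, l2⟩
    refine ⟨fun n => Tuple.mk (((hφ n).1.memLp _).toLp _) (((hφ n).1.d₁.memLp _).toLp _)
      (((hφ n).1.d₂.memLp _).toLp _), fun n => ⟨φ n, hφ n, fun α => ?_⟩, ?_⟩
    · rcases α.cases_one with rfl | rfl | rfl
      · rw [Tuple.mk_zero]; exact MemLp.coeFn_toLp _
      · rw [Tuple.mk_e₁]; exact MemLp.coeFn_toLp _
      · rw [Tuple.mk_e₂]; exact MemLp.coeFn_toLp _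
    · refine Tuple.tendsto_iff.2 ⟨?_, ?_, ?_⟩
      · simp only [Tuple.mk_zero]
        exact (key _ _ _ l0.mem fun n => MemLp.coeFn_toLp _).2 l0
      · simp only [Tuple.mk_e₁]
        exact (key _ _ _ l1.mem fun n => MemLp.coeFn_toLp _).2 l1
      · simp only [Tuple.mk_e₂]
        exact (key _ _ _ l2.mem fun n => MemLp.coeFn_toLp _).2 l2

/-- The closure of the boundary test functions in `H¹(Ω)`. -/
def energyMod (a : ℝ) (p : Parity) (Ω : Set ℝ²) : Submodule ℂ (Tuple Ω) where
  carrier := closure (testTuples a p Ω)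
  add_mem' := by
    intro U V hU hV
    rw [mem_closure_testTuples_iff] at *
    exact (hU.add hV).congr (Lp.coeFn_add _ _).symm (Lp.coeFn_add _ _).symm (Lp.coeFn_add _ _).symm
  zero_mem' := by
    refine subset_closure ⟨fun _ => 0, ⟨⟨contDiff_const, HasCompactSupport.zero⟩, by simp [tsupport]⟩,
      fun α => ?_⟩
    have h0 : ∀ x, partialD α.1.1 α.1.2 (fun _ => (0 : ℂ)) x = 0 := by
      rcases α.cases_one with rfl | rfl | rfl <;> intro x <;>
        simp [partialD_zero, partialD_e₁, partialD_e₂, pd₁, pd₂]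
    filter_upwards [Lp.coeFn_zero ℂ 2 μ[Ω]] with x hx
    rw [h0]
    exact hx
  smul_mem' := by
    intro c U hU
    rw [mem_closure_testTuples_iff] at *
    exact (hU.const_mul c).congr (Lp.coeFn_smul c (U (MultiIndex.zero 1))).symm
      (Lp.coeFn_smul c (U e₁)).symm (Lp.coeFn_smul c (U e₂)).symm

lemma mem_energyMod_iff {U : Tuple Ω} :
    U ∈ energyMod a p Ω ↔ InEnergy a p Ω (U (MultiIndex.zero 1)) (U e₁) (U e₂) :=
  mem_closure_testTuples_iff

lemma isClosed_energyMod (a : ℝ) (p : Parity) (Ω : Set ℝ²) :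
    IsClosed (energyMod a p Ω : Set (Tuple Ω)) := isClosed_closure

instance (a : ℝ) (p : Parity) (Ω : Set ℝ²) : CompleteSpace (energyMod a p Ω) :=
  (isClosed_energyMod a p Ω).completeSpace_coe

lemma mem_sobolev_one_iff {U : Tuple Ω} : U ∈ Sobolev 1 Ω ↔ ∀ φ, IsTest φ → tsupport φ ⊆ Ω →
      (∫ x in Ω, U e₁ x * φ x = - ∫ x in Ω, U (MultiIndex.zero 1) x * pd₁ φ x) ∧
      (∫ x in Ω, U e₂ x * φ x = - ∫ x in Ω, U (MultiIndex.zero 1) x * pd₂ φ x) := by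
  refine ⟨fun h φ hφ hs => ⟨?_, ?_⟩, fun h α φ hφ hs => ?_⟩
  · simpa [e₁, show partialD 1 0 φ = pd₁ φ from rfl] using h e₁ φ hφ hs
  · simpa [e₂, show partialD 0 1 φ = pd₂ φ from rfl] using h e₂ φ hφ hs
  · obtain ⟨h1, h2⟩ := h φ hφ hs
    rcases α.cases_one with rfl | rfl | rfl
    · rw [partialD_zero]; simp [MultiIndex.zero]
    · rw [partialD_e₁, h1]; simp [e₁]
    · rw [partialD_e₂, h2]; simp [e₂]

lemma energyMod_le_sobolev (a : ℝ) (p : Parity) (Ω : Set ℝ²) :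
    energyMod a p Ω ≤ Sobolev 1 Ω := fun U hU => mem_sobolev_one_iff.2 fun φ hφ hs => by
  rw [mem_energyMod_iff] at hU
  exact ⟨hU.weak₁ hφ hs, hU.weak₂ hφ hs⟩

lemma mem_energySpace_iff {U : Sobolev 1 (stripTo r)} :
    U ∈ energySpace a p r ↔ InEnergy a p (stripTo r) (weakD U (MultiIndex.zero 1)) (weakD U e₁)
      (weakD U e₂) := by
  have key := mem_closure_testTuples_iff (a := a) (p := p) (U := (U : Tuple (stripTo r)))
  simp only [weakD]
  rw [← key, energySpace,
    Topology.IsInducing.subtypeVal.closure_eq_preimage_closure_image, mem_preimage]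
  have : ((↑) : Sobolev 1 (stripTo r) → Tuple (stripTo r)) '' {V | ∃ φ, IsBdryTest a p φ ∧
      ∀ α : MultiIndex 1, weakD V α =ᵐ[μ[stripTo r]] partialD α.1.1 α.1.2 φ} =
      testTuples a p (stripTo r) := by
    ext W
    constructor
    · rintro ⟨V, ⟨φ, hφ, h⟩, rfl⟩
      exact ⟨φ, hφ, h⟩
    · intro hW
      exact ⟨⟨W, energyMod_le_sobolev a p _ (subset_closure hW)⟩, hW, rfl⟩
  rw [← this]
  rfl

/-- The tuple of a triple of functions. -/
def InEnergy.toTuple (h : InEnergy a p Ω u u₁ u₂) : energyMod a p Ω :=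
  ⟨Tuple.mk (h.memLp.toLp _) (h.memLp₁.toLp _) (h.memLp₂.toLp _), by
    rw [mem_energyMod_iff]
    simp only [Tuple.mk_zero, Tuple.mk_e₁, Tuple.mk_e₂]
    exact h.congr (MemLp.coeFn_toLp _).symm (MemLp.coeFn_toLp _).symm (MemLp.coeFn_toLp _).symm⟩

lemma InEnergy.toTuple_zero (h : InEnergy a p Ω u u₁ u₂) :
    (h.toTuple : Tuple Ω) (MultiIndex.zero 1) =ᵐ[μ[Ω]] u := by
  simp only [toTuple, Tuple.mk_zero]; exact MemLp.coeFn_toLp _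

lemma InEnergy.toTuple_e₁ (h : InEnergy a p Ω u u₁ u₂) : (h.toTuple : Tuple Ω) e₁ =ᵐ[μ[Ω]] u₁ := by
  simp only [toTuple, Tuple.mk_e₁]; exact MemLp.coeFn_toLp _

lemma InEnergy.toTuple_e₂ (h : InEnergy a p Ω u u₁ u₂) : (h.toTuple : Tuple Ω) e₂ =ᵐ[μ[Ω]] u₂ := by
  simp only [toTuple, Tuple.mk_e₂]; exact MemLp.coeFn_toLp _

/-! ### Weak solutions with a global gradient -/

/-- `u` is locally in the energy space, with gradient `(u₁, u₂)`, and solves `-Δ u = g` weakly with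
the natural boundary condition on the rest of the boundary. -/
structure LocSol (a : ℝ) (p : Parity) (u u₁ u₂ g : ℝ² → ℂ) : Prop where
  energy : ∀ r, 0 < r → InEnergy a p (stripTo r) u u₁ u₂
  source : ∀ r, 0 < r → MemLp g 2 μ[stripTo r]
  weak : ∀ φ, IsBdryTest a p φ → ∫ x in strip, (u₁ x * pd₁ φ x + u₂ x * pd₂ φ x) =
    ∫ x in strip, g x * φ x

lemma IsTest.exists_support_lt (h : IsTest φ) : ∃ r, 0 < r ∧ tsupport φ ⊆ {x | x.1 < r} := by
  obtain ⟨r, hr⟩ := h.2.isCompact.isBounded.subset_ball (0 : ℝ²)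
  refine ⟨max r 1, by positivity, fun x hx => ?_⟩
  have := hr hx
  rw [mem_ball, dist_zero_right, Prod.norm_def, max_lt_iff] at this
  exact lt_max_of_lt_left (lt_of_le_of_lt (le_abs_self _) this.1)

lemma setIntegral_strip_eq (h : ∀ x, r ≤ x.1 → F x = 0) :
    ∫ x in strip, F x = ∫ x in stripTo r, F x := by
  refine setIntegral_eq_of_subset_of_forall_sdiff_eq_zero isOpen_strip.measurableSet
    (stripTo_subset r) fun x hx => h x ?_
  by_contra h'
  exact hx.2 ⟨hx.1, not_le.1 h'⟩

lemma integrable_strip_mul (hw : ∀ r, 0 < r → MemLp w 2 μ[stripTo r]) (hφ : IsTest φ) :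
    Integrable (fun x => w x * φ x) μ[strip] := by
  obtain ⟨r, hr, hs⟩ := hφ.exists_support_lt
  have : IntegrableOn (fun x => w x * φ x) (stripTo r) := memLp_mul (hw r hr) (hφ.memLp _)
  exact this.of_forall_diff_eq_zero isOpen_strip.measurableSet fun x hx => by
    simp [eq_zero_off fun h => hx.2 ⟨hx.1, hs h⟩]

lemma locMemLp (hw : MemLp w 2 μ[strip]) (r : ℝ) (_ : 0 < r) : MemLp w 2 μ[stripTo r] :=
  hw.mono_set (stripTo_subset r)

/-- Square integrability on the bounded parts of the strip. -/
def LocL2 (w : ℝ² → ℂ) : Prop := ∀ r, 0 < r → MemLp w 2 μ[stripTo r]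

lemma LocL2.add_mul (hf : LocL2 f) (hg : LocL2 g) (c : ℂ) : LocL2 fun x => f x + c * g x :=
  fun r hr => (hf r hr).add ((hg r hr).const_mul c)

lemma LocL2.congr (hf : LocL2 f) (h : f =ᵐ[μ[strip]] g) : LocL2 g := fun r hr =>
  (hf r hr).ae_eq (ae_restrict_of_ae_restrict_of_subset (stripTo_subset r) h)

lemma LocL2.pair (hf : LocL2 f) (hg : LocL2 g) (hφ : IsTest φ) (hψ : IsTest ψ) :
    Integrable (fun x => f x * φ x + g x * ψ x) μ[strip] :=
  (integrable_strip_mul hf hφ).add (integrable_strip_mul hg hψ)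

/-- The vector field `(w₁, w₂)` satisfies `-div w = G - ∂₁ G₁` weakly. -/
structure WeakSol (a : ℝ) (p : Parity) (w₁ w₂ G G₁ : ℝ² → ℂ) : Prop where
  mem₁ : LocL2 w₁
  mem₂ : LocL2 w₂
  source : LocL2 G
  source₁ : LocL2 G₁
  weak : ∀ φ, IsBdryTest a p φ → ∫ x in strip, (w₁ x * pd₁ φ x + w₂ x * pd₂ φ x) =
    ∫ x in strip, (G x * φ x + G₁ x * pd₁ φ x)

lemma LocSol.weakSol (h : LocSol a p u u₁ u₂ g) : WeakSol a p u₁ u₂ g 0 :=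
  ⟨fun r hr => (h.energy r hr).memLp₁, fun r hr => (h.energy r hr).memLp₂, h.source,
    fun _ _ => MemLp.zero, fun φ hφ => by simpa using h.weak φ hφ⟩

lemma WeakSol.add_mul (h : WeakSol a p w₁ w₂ G G₁) (h' : WeakSol a p v₁ v₂ F S) (c : ℂ) :
    WeakSol a p (fun x => w₁ x + c * v₁ x) (fun x => w₂ x + c * v₂ x) (fun x => G x + c * F x)
      (fun x => G₁ x + c * S x) :=
  ⟨h.mem₁.add_mul h'.mem₁ c, h.mem₂.add_mul h'.mem₂ c, h.source.add_mul h'.source c,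
    h.source₁.add_mul h'.source₁ c, fun φ hφ =>
    (((h.mem₁.pair h.mem₂ hφ.1.d₁ hφ.1.d₂).hi.add
      ((h'.mem₁.pair h'.mem₂ hφ.1.d₁ hφ.1.d₂).hi.mul c)).congr (ae_of_all _ fun x => by ring)).2.trans
      (.trans (by rw [h.weak φ hφ, h'.weak φ hφ]) (((h.source.pair h.source₁ hφ.1 hφ.1.d₁).hi.add
      ((h'.source.pair h'.source₁ hφ.1 hφ.1.d₁).hi.mul c)).congr
        (ae_of_all _ fun x => by ring)).2.symm)⟩

lemma WeakSol.congr (h : WeakSol a p w₁ w₂ G G₁) (e₁ : w₁ =ᵐ[μ[strip]] v₁)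
    (e₂ : w₂ =ᵐ[μ[strip]] v₂) (e : G =ᵐ[μ[strip]] F) (e' : G₁ =ᵐ[μ[strip]] S) :
    WeakSol a p v₁ v₂ F S :=
  ⟨h.mem₁.congr e₁, h.mem₂.congr e₂, h.source.congr e, h.source₁.congr e', fun φ hφ => by
    rw [← integral_congr_ae (f := fun x => w₁ x * pd₁ φ x + w₂ x * pd₂ φ x), h.weak φ hφ]
    · exact integral_congr_ae (by filter_upwards [e, e'] with x h h' using by rw [h, h'])
    · filter_upwards [e₁, e₂] with x h h' using by rw [h, h']⟩

lemma eq_zero_of_support_lt (h : tsupport φ ⊆ {x | x.1 < r})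
    (hx : r ≤ x.1) : φ x = 0 ∧ pd₁ φ x = 0 ∧ pd₂ φ x = 0 :=
  ⟨eq_zero_off fun h' => absurd (h h') (not_lt.2 hx),
    eq_zero_off fun h' => absurd (h (tsupport_pd₁ _ h')) (not_lt.2 hx),
    eq_zero_off fun h' => absurd (h (tsupport_pd₂ _ h')) (not_lt.2 hx)⟩

/-- The definition offers a separate gradient on each `Π_r`. Weak derivatives are unique, so these
agree on overlaps and glue to a single gradient on the halfstrip. -/
lemma isWeakSolution_iff {u : StripFun} (hf : ∀ r, 0 < r → MemLp f 2 μ[stripTo r]) :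
    IsWeakSolution a p m f u ↔ ∃ u₁ u₂, LocSol a p u u₁ u₂ (fun x => (1 - m ^ 2) * u x - f x) := by
  constructor
  · intro h
    choose! U hU hrep hw using h
    have hE : ∀ r, 0 < r → InEnergy a p (stripTo r) u (weakD (U r) e₁) (weakD (U r) e₂) :=
      fun r hr => ((mem_energySpace_iff.1 (hU r hr)).congr (hrep r hr) EventuallyEq.rfl
        EventuallyEq.rfl)
    -- At `x` the glued gradient is read off from a truncation with an integer end beyond `x₁`, so
    -- that only countably many null sets are involved.
    set N : ℝ² → ℝ := fun x => (⌈x.1⌉₊ : ℝ) + 1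
    set u₁ : ℝ² → ℂ := fun x => weakD (U (N x)) e₁ x
    set u₂ : ℝ² → ℂ := fun x => weakD (U (N x)) e₂ x
    have agree : ∀ r, 0 < r → ∀ s, 0 < s → ∀ᵐ x ∂volume, x ∈ stripTo r → x ∈ stripTo s →
        weakD (U r) e₁ x = weakD (U s) e₁ x ∧ weakD (U r) e₂ x = weakD (U s) e₂ x := by
      intro r hr s hs
      have m : ∀ x, x ∈ stripTo r → x ∈ stripTo s → x ∈ stripTo (min r s) := fun x h h' =>
        ⟨h.1, show x.1 < min r s from lt_min h.2 h'.2⟩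
      have g1 := (hE r hr).mono (stripTo_mono (min_le_left r s))
      have g2 := (hE s hs).mono (stripTo_mono (min_le_right r s))
      have k1 := (ae_restrict_iff' (isOpen_stripTo _).measurableSet).1
        (g1.unique₁ g2 (isOpen_stripTo _) EventuallyEq.rfl)
      have k2 := (ae_restrict_iff' (isOpen_stripTo _).measurableSet).1
        (g1.unique₂ g2 (isOpen_stripTo _) EventuallyEq.rfl)
      filter_upwards [k1, k2] with x h1 h2 hx hx'
      exact ⟨h1 (m x hx hx'), h2 (m x hx hx')⟩
    have agree' : ∀ r, 0 < r → ∀ᵐ x ∂μ[stripTo r],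
        weakD (U r) e₁ x = u₁ x ∧ weakD (U r) e₂ x = u₂ x := by
      intro r hr
      refine (ae_restrict_iff' (isOpen_stripTo _).measurableSet).2 ?_
      have := ae_all_iff.2 fun n : ℕ => agree r hr ((n : ℝ) + 1) (by positivity)
      filter_upwards [this] with x hx hxr
      exact hx ⌈x.1⌉₊ hxr ⟨hxr.1, show x.1 < _ from lt_of_le_of_lt (Nat.le_ceil _) (lt_add_one _)⟩
    have en : ∀ r, 0 < r → InEnergy a p (stripTo r) u u₁ u₂ := fun r hr =>
      (hE r hr).congr EventuallyEq.rfl ((agree' r hr).mono fun x hx => hx.1)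
        ((agree' r hr).mono fun x hx => hx.2)
    refine ⟨u₁, u₂, en, fun r hr => ((en r hr).memLp.const_mul _).sub (hf r hr), fun φ hφ => ?_⟩
    obtain ⟨r, hr, hs⟩ := hφ.1.exists_support_lt
    rw [setIntegral_strip_eq (r := r) fun x hx => by
        obtain ⟨-, h1, h2⟩ := eq_zero_of_support_lt hs hx; simp [h1, h2],
      setIntegral_strip_eq (r := r) fun x hx => by
        obtain ⟨h0, -⟩ := eq_zero_of_support_lt hs hx; simp [h0], ← hw r hr φ hφ hs]
    refine integral_congr_ae ?_
    filter_upwards [agree' r hr] with x hx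
    rw [hx.1, hx.2]
  · rintro ⟨u₁, u₂, h⟩ r hr
    have hE := h.energy r hr
    refine ⟨⟨hE.toTuple, energyMod_le_sobolev a p _ hE.toTuple.2⟩, mem_energySpace_iff.2 ?_,
      hE.toTuple_zero, fun φ hφ hs => ?_⟩
    · exact mem_energyMod_iff.1 hE.toTuple.2
    · have := h.weak φ hφ
      rw [setIntegral_strip_eq (r := r) fun x hx => by
          obtain ⟨-, h1, h2⟩ := eq_zero_of_support_lt hs hx; simp [h1, h2],
        setIntegral_strip_eq (r := r) fun x hx => by
          obtain ⟨h0, -⟩ := eq_zero_of_support_lt hs hx; simp [h0]] at this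
      rw [← this]
      refine integral_congr_ae ?_
      filter_upwards [hE.toTuple_e₁, hE.toTuple_e₂] with x h1 h2
      simp only [weakD]
      rw [h1, h2]

namespace LocSol

/-- The weak equation can be tested with compactly supported elements of the energy space. -/
lemma weak_energy (h : LocSol a p u u₁ u₂ g) (hr : 0 < r) (hw : InEnergy a p (stripTo r) w w₁ w₂) (hχ : IsTest χ)
    (hs : tsupport χ ⊆ {x | x.1 < r}) :
    ∫ x in stripTo r, (u₁ x * (χ x * w₁ x + pd₁ χ x * w x) +
      u₂ x * (χ x * w₂ x + pd₂ χ x * w x)) = ∫ x in stripTo r, g x * (χ x * w x) := by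
  have hE := h.energy r hr
  have bd : ∀ {f W : ℝ² → ℂ}, MemLp f 2 μ[stripTo r] → IsTest W →
      MemLp (fun x => W x * f x) 2 μ[stripTo r] := by
    intro f W hf hW
    obtain ⟨C, hC⟩ := hW.1.continuous.bounded_above_of_compact_support hW.2
    exact memLp_bdd_mul hf hW.1.continuous.aestronglyMeasurable (ae_of_all _ hC)
  have key := hw.integral_eq_zero
    (g := fun x => pd₁ χ x * u₁ x + pd₂ χ x * u₂ x - χ x * g x) (g₁ := fun x => χ x * u₁ x)
    (g₂ := fun x => χ x * u₂ x)
    (((bd hE.memLp₁ hχ.d₁).add (bd hE.memLp₂ hχ.d₂)).sub (bd (h.source r hr) hχ))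
    (bd hE.memLp₁ hχ) (bd hE.memLp₂ hχ) ?_
  · rw [← sub_eq_zero, ← integral_sub]
    · rw [← key]
      congr 1
      ext x
      ring
    · exact (memLp_mul hE.memLp₁ ((bd hw.memLp₁ hχ).add (bd hw.memLp hχ.d₁))).add
        (memLp_mul hE.memLp₂ ((bd hw.memLp₂ hχ).add (bd hw.memLp hχ.d₂)))
    · exact memLp_mul (h.source r hr) (bd hw.memLp hχ)
  · intro φ hφ
    have hw := h.weak _ (hφ.mul hχ.1)
    have hs' : tsupport (fun x => χ x * φ x) ⊆ {x | x.1 < r} :=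
      (tsupport_mul_subset_left).trans hs
    rw [setIntegral_strip_eq (r := r) fun x hx => by
        obtain ⟨-, h1, h2⟩ := eq_zero_of_support_lt hs' hx; simp [h1, h2],
      setIntegral_strip_eq (r := r) fun x hx => by
        obtain ⟨h0, -⟩ := eq_zero_of_support_lt hs' hx; simp only [h0, mul_zero],
      ← sub_eq_zero, ← integral_sub] at hw
    · rw [← hw]
      congr 1
      ext x
      rw [pd₁_mul (hχ.1.diff x) (hφ.1.diff x),
        pd₂_mul (hχ.1.diff x) (hφ.1.diff x)]
      ring
    · exact (memLp_mul hE.memLp₁ ((hφ.mul hχ.1).1.d₁.memLp _)).add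
        (memLp_mul hE.memLp₂ ((hφ.mul hχ.1).1.d₂.memLp _))
    · exact memLp_mul (h.source r hr) ((hφ.mul hχ.1).1.memLp _)

end LocSol

end

section

variable {I : Set ℝ}

/-! ### Weak solutions of ordinary differential equations -/

section WeakODE

lemma contDiff_deriv {χ : ℝ → ℂ} (h : Smooth χ) : Smooth (deriv χ) :=
  (contDiff_infty_iff_deriv.1 h).2

lemma tsupport_deriv_subset (χ : ℝ → ℂ) : tsupport (deriv χ) ⊆ tsupport χ :=
  closure_minimal support_deriv_subset (isClosed_tsupport χ)

lemma hasDerivAt_cexp_mul (κ : ℂ) (x : ℝ) :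
    HasDerivAt (fun x : ℝ => exp (κ * x)) (κ * exp (κ * x)) x := by
  have h1 : HasDerivAt (fun x : ℝ => κ * (x : ℂ)) κ x := by
    simpa using (ofRealCLM.hasDerivAt (x := x)).const_mul κ
  refine h1.cexp.congr_deriv (mul_comm _ _)

lemma contDiff_primitive {f : ℝ → ℂ} {T : ℝ} (hf : Smooth f) :
    Smooth (fun t => ∫ τ in T..t, f τ) ∧ deriv (fun t => ∫ τ in T..t, f τ) = f := by
  have h : ∀ t, HasDerivAt (fun t => ∫ τ in T..t, f τ) (f t) t := fun t =>
    (hf.continuous.integral_hasStrictDerivAt T t).hasDerivAt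
  have e : deriv (fun t => ∫ τ in T..t, f τ) = f := funext fun t => (h t).deriv
  exact ⟨contDiff_infty_iff_deriv.2 ⟨fun t => (h t).differentiableAt, e.symm ▸ hf⟩, e⟩

lemma contDiff_cexp_mul (κ : ℂ) : Smooth (fun x : ℝ => exp (κ * x)) :=
  contDiff_exp.comp (contDiff_const.mul ofRealCLM.contDiff)

lemma _root_.HasCompactSupport.exists_tsupport_lt (hc : HasCompactSupport η) :
    ∃ r, 0 < r ∧ tsupport η ⊆ Iio r := by
  obtain ⟨r, hr⟩ := hc.isCompact.isBounded.subset_ball (0 : ℝ)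
  refine ⟨max r 1, by positivity, fun x hx => ?_⟩
  have : |x| < r := by simpa using hr hx
  exact ((le_abs_self x).trans_lt this).trans_le (le_max_left _ _)

/-- Test functions on a subset of the line. -/
def TestOn (I : Set ℝ) (χ : ℝ → ℂ) : Prop := Smooth χ ∧ HasCompactSupport χ ∧ tsupport χ ⊆ I

namespace TestOn

variable {χ ζ q : ℝ → ℂ}

lemma sub_mul (h : TestOn I χ) (h' : TestOn I ζ) (c : ℂ) : TestOn I fun x => χ x - c * ζ x :=
  ⟨h.1.sub (contDiff_const.mul h'.1), h.2.1.sub (h'.2.1.mul_left (f := fun _ => c)),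
    (tsupport_sub _ _).trans (union_subset h.2.2 ((tsupport_mul_subset_right).trans h'.2.2))⟩

lemma deriv (h : TestOn I χ) : TestOn I (deriv χ) :=
  ⟨contDiff_deriv h.1, h.2.1.deriv, (tsupport_deriv_subset χ).trans h.2.2⟩

lemma mul (h : TestOn I χ) (hζ : Smooth ζ) : TestOn I fun x => χ x * ζ x :=
  ⟨h.1.mul hζ, h.2.1.mul_right, tsupport_mul_subset_left.trans h.2.2⟩

lemma int (h : TestOn I χ) (hq : LocallyIntegrableOn q I) : Integrable (fun x => q x * χ x) :=
  integrable_mul_of_tsupport hq h.1.continuous h.2.1 h.2.2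

lemma hasDerivAt (h : TestOn I χ) (x : ℝ) : HasDerivAt χ (_root_.deriv χ x) x :=
  (h.1.diff x).hasDerivAt

end TestOn

lemma exists_bump (hI : IsOpen I) {x₀ : ℝ} (hx : x₀ ∈ I) :
    ∃ β : ℝ → ℂ, TestOn I β ∧ β =ᶠ[𝓝 x₀] (fun _ => 1) ∧ ∫ x, β x ≠ 0 := by
  obtain ⟨ε, hε, hb⟩ := isOpen_iff.1 hI x₀ hx
  let b : ContDiffBump x₀ := ⟨ε / 4, ε / 2, by positivity, by linarith⟩
  have : tsupport (fun x => ((b x : ℝ) : ℂ)) ⊆ tsupport b :=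
    closure_mono fun s hs hs' => hs (by simp [hs'])
  refine ⟨fun x => (b x : ℝ), ⟨ofRealCLM.contDiff.comp b.contDiff, b.hasCompactSupport.comp_left
    (g := ofReal) rfl, this.trans
    (b.tsupport_eq.trans_subset ((closedBall_subset_ball (half_lt_self hε)).trans hb))⟩, ?_, ?_⟩
  · filter_upwards [b.eventuallyEq_one] with x hx
    simp [hx]
  · rw [integral_complex_ofReal]
    exact_mod_cast b.integral_pos.ne'

/-- Compactly supported solutions of `ζ' - κ ζ = χ`. -/
lemma exists_primitive_twisted (hI : I.OrdConnected) {χ : ℝ → ℂ} (κ : ℂ) (h : TestOn I χ)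
    (h0 : ∫ x, χ x * exp (-κ * x) = 0) :
    ∃ ζ : ℝ → ℂ, TestOn I ζ ∧ ∀ x, deriv ζ x - κ * ζ x = χ x := by
  rcases (tsupport χ).eq_empty_or_nonempty with he | hne
  · refine ⟨fun _ => 0, ⟨contDiff_const, HasCompactSupport.zero, by simp [tsupport]⟩, fun x => ?_⟩
    have : χ x = 0 := eq_zero_off (by simp [he])
    simp [this]
  obtain ⟨c, hc1, hc2⟩ := h.2.1.isCompact.exists_isLeast hne
  obtain ⟨d, hd1, hd2⟩ := h.2.1.isCompact.exists_isGreatest hne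
  set G : ℝ → ℂ := fun y => χ y * exp (-κ * y) with hG
  have hGz : ∀ y, y ∉ Icc c d → G y = 0 := fun y hy => by
    simp [hG, eq_zero_off fun h => hy ⟨hc2 h, hd2 h⟩]
  -- The base point `c - 1` is strictly to the left of the support, so that the half-open interval
  -- of integration contains all of it.
  obtain ⟨hQc, hQd⟩ := contDiff_primitive (T := c - 1) (f := G) (h.1.mul (contDiff_cexp_mul _))
  set Q : ℝ → ℂ := fun x => ∫ y in (c - 1)..x, G y with hQ
  set ζ : ℝ → ℂ := fun x => exp (κ * x) * Q x with hζ
  have hzs : Function.support ζ ⊆ Icc c d := by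
    intro x hx
    by_contra h'
    refine hx ?_
    suffices Q x = 0 by simp [hζ, this]
    rcases lt_or_ge x c with hxc | hxc
    · refine intervalIntegral.integral_zero_ae (ae_of_all _ fun y hy => hGz y fun h => ?_)
      exact absurd h.1 (not_le.2 ((mem_uIoc.1 hy).elim (fun h => h.2.trans_lt hxc)
        fun h => h.2.trans_lt (by linarith)))
    · refine (intervalIntegral.integral_eq_integral_of_support_subset fun y hy => ?_).trans h0
      have hy' : y ∈ Icc c d := not_not.1 fun h => hy (hGz y h)
      exact ⟨by linarith [hy'.1], hy'.2.trans (not_le.1 fun h => h' ⟨hxc, h⟩).le⟩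
  refine ⟨ζ, ⟨(contDiff_cexp_mul κ).mul hQc, HasCompactSupport.of_support_subset_isCompact
    isCompact_Icc hzs, (closure_minimal hzs isClosed_Icc).trans (hI.out (h.2.2 hc1) (h.2.2 hd1))⟩,
    fun x => ?_⟩
  have hd := (hasDerivAt_cexp_mul κ x).mul (hQc.diff x).hasDerivAt
  rw [hQd] at hd
  rw [show deriv ζ x = _ from hd.deriv]
  have : exp (κ * x) * exp (-κ * x) = 1 := by rw [← exp_add]; simp
  simp only [hζ, hG]
  linear_combination χ x * this

/-- A functional on test functions that vanishes on the range of `d/dx - κ` is a multiple of the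
integral against `e^{-κ x}`. -/
lemma exists_const_of_twisted (hI : IsOpen I) (hI' : I.OrdConnected) (hne : I.Nonempty) (κ : ℂ)
    {Λ : (ℝ → ℂ) → ℂ} (lin : ∀ {χ θ : ℝ → ℂ} (s : ℂ), TestOn I χ → TestOn I θ →
      Λ (fun x => χ x - s * θ x) = Λ χ - s * Λ θ)
    (h : ∀ ζ, TestOn I ζ → Λ (fun x => deriv ζ x - κ * ζ x) = 0) :
    ∃ K, ∀ χ, TestOn I χ → Λ χ = K * ∫ x, χ x * exp (-κ * x) := by
  obtain ⟨x₀, hx₀⟩ := hne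
  obtain ⟨b, hb, -, hbi⟩ := exists_bump hI hx₀
  -- The reference function `b e^{κ x}` has the nonzero integral `∫ b` against `e^{-κ x}`.
  -- Subtracting a multiple of it from `χ` gives an element of the range of `d/dx - κ`.
  have hθ := hb.mul (contDiff_cexp_mul κ)
  refine ⟨Λ (fun x => b x * exp (κ * x)) / ∫ x, b x, fun χ hχ => ?_⟩
  set s := (∫ x, χ x * exp (-κ * x)) / ∫ x, b x with hs
  have hi : ∀ {χ : ℝ → ℂ}, TestOn I χ → Integrable (fun x : ℝ => χ x * exp (-κ * x)) := fun h =>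
    (h.mul (contDiff_cexp_mul (-κ))).1.continuous.integrable_of_hasCompactSupport h.2.1.mul_right
  have hbx : ∀ x : ℝ, b x * exp (κ * x) * exp (-κ * x) = b x := fun x => by
    rw [mul_assoc, ← exp_add]; simp
  obtain ⟨ζ, hζ, e⟩ := exists_primitive_twisted hI' κ (hχ.sub_mul hθ s) (by
    refine (((hi hχ).hi.sub ((hi hθ).hi.mul s)).congr (ae_of_all _ fun x => by ring)).2.trans ?_
    simp only [hbx]
    rw [hs, div_mul_cancel₀ _ hbi, sub_self])
  have z := h ζ hζ
  rw [funext e, lin s hχ hθ] at z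
  rw [div_mul_eq_mul_div, mul_div_assoc, ← hs]
  linear_combination z

/-- A distributional solution of `q'' = κ² q` on an interval is a classical one. Here `F` is a
solution of `F' + κ F = e^{κ x}`. -/
lemma weak_ode (hI : IsOpen I) (hI' : I.OrdConnected) {q : ℝ → ℂ}
    (hq : LocallyIntegrableOn q I) (κ : ℂ) {F : ℝ → ℂ}
    (hF : ∀ x : ℝ, HasDerivAt F (exp (κ * x) - κ * F x) x)
    (h : ∀ η : ℝ → ℂ, Smooth η → HasCompactSupport η → tsupport η ⊆ I →
      ∫ x, q x * (deriv (deriv η) x - κ ^ 2 * η x) = 0) :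
    ∃ A B : ℂ, ∀ᵐ x, x ∈ I → q x = A * F x + B * exp (-κ * x) := by
  rcases I.eq_empty_or_nonempty with rfl | hne
  · exact ⟨0, 0, by simp⟩
  have tw : ∀ {ζ : ℝ → ℂ}, TestOn I ζ → TestOn I fun x => deriv ζ x - κ * ζ x := fun hζ =>
    hζ.deriv.sub_mul hζ κ
  have dsub : ∀ {χ ζ : ℝ → ℂ} (s : ℂ) (x : ℝ), TestOn I χ → TestOn I ζ →
      deriv (fun x => χ x - s * ζ x) x = deriv χ x - s * deriv ζ x := fun s x h h' =>
    ((h.hasDerivAt x).sub ((h'.hasDerivAt x).const_mul s)).deriv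
  -- The operator is factored as `(d/dx - κ)(d/dx + κ)`. The functional `ζ ↦ ∫ q (ζ' - κ ζ)`
  -- vanishes on the range of `d/dx + κ`, hence it is integration against `c e^{κ x}`.
  obtain ⟨c, hc⟩ := exists_const_of_twisted hI hI' hne (-κ)
    (Λ := fun ζ => ∫ x, q x * (deriv ζ x - κ * ζ x)) (fun {χ θ} s hχ hθ => by
      refine ((((tw hχ).int hq).hi.sub (((tw hθ).int hq).hi.mul s)).congr
        (ae_of_all _ fun x => ?_)).2
      rw [dsub s x hχ hθ]; ring) (fun ζ hζ => by
      rw [← h ζ hζ.1 hζ.2.1 hζ.2.2]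
      congr 1; ext x
      rw [dsub _ x hζ.deriv hζ]; ring)
  simp only [neg_neg] at hc
  have Fc : Continuous F := continuous_iff_continuousAt.2 fun x => (hF x).continuousAt
  have Fl : LocallyIntegrableOn F I := Fc.locallyIntegrable.locallyIntegrableOn I
  have ql : LocallyIntegrableOn (fun x => q x + c * F x) I :=
    hq.add ((continuous_const.mul Fc).locallyIntegrable.locallyIntegrableOn I)
  have el : ∀ κ : ℂ, LocallyIntegrableOn (fun x : ℝ => exp (κ * x)) I := fun κ =>
    (contDiff_cexp_mul κ).continuous.locallyIntegrable.locallyIntegrableOn I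
  -- Since `F' + κ F = e^{κ x}`, adding `c F` to `q` cancels that term, and the second factor can be
  -- treated in the same way.
  obtain ⟨K, hK⟩ := exists_const_of_twisted hI hI' hne κ
    (Λ := fun χ => ∫ x, (q x + c * F x) * χ x) (fun {χ θ} s hχ hθ =>
      (((hχ.int ql).hi.sub ((hθ.int ql).hi.mul s)).congr (ae_of_all _ fun x => by ring)).2)
    (fun ζ hζ => by
      have i2 := hζ.int Fl
      have i3 := hζ.int (el κ)
      have parts := integral_mul_deriv_eq_deriv_mul_of_integrable (fun x _ => hF x)
        (fun x _ => hζ.hasDerivAt x) (hζ.deriv.int Fl) ((i3.sub (i2.const_mul κ)).congr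
          (ae_of_all _ fun x => by simp only [Pi.sub_apply, Pi.mul_apply]; ring)) i2
      have e := hc ζ hζ
      refine ((((tw hζ).int hq).hi.add (((hζ.deriv.int Fl).hi.sub (i2.hi.mul κ)).mul c)).congr
        (ae_of_all _ fun x => by ring)).2.trans ?_
      rw [e, parts, ((i3.hi.sub (i2.hi.mul κ)).congr (g := fun x : ℝ => (exp (κ * x) - κ * F x) *
        ζ x) (ae_of_all _ fun x => by ring)).2]
      simp only [mul_comm (ζ _)]
      ring)
  refine ⟨-c, K, ?_⟩
  filter_upwards [ae_eq_of_integral_smooth hI ql (g := fun x : ℝ => K * exp (-κ * x))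
    ((continuous_const.mul (contDiff_cexp_mul _).continuous).locallyIntegrable.locallyIntegrableOn
      I) fun χ h1 h2 h3 => by
        rw [hK χ ⟨h1, h2, h3⟩, ← integral_const_mul]; congr 1; ext x; ring] with x hx hx'
  linear_combination hx hx'

end WeakODE

end

section

/-! ### Parseval identities and Wirtinger inequalities on `(0, π)` -/

lemma hasSum_of_eq {f g : ℤ → ℝ} {x y : ℝ} (h : HasSum f x) (hf : ∀ k, g k = f k)
    (hx : y = x) : HasSum g y := by
  rw [hx, funext hf]; exact h

/-- Parseval on `(-π, π)` for the function equal to `f` on the right half and to `ε f(-x)` on the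
left half, multiplied by `e^{isx}`. The signs `ε = ±1` produce cosines and sines, and the shift `s`
moves the frequencies from integers to half-integers. -/
lemma parseval_aux (s : ℝ) {ε : ℂ} (hε : ‖ε‖ = 1) {f : ℝ → ℂ} (hf : MemLp f 2 μ[Ioo 0 π]) :
    HasSum (fun k : ℤ => ‖∫ y in Ioo 0 π, f y *
      (exp (-(I * (k - s)) * y) + ε * exp (I * (k - s) * y))‖ ^ 2)
      (4 * π * ∫ y in Ioo 0 π, ‖f y‖ ^ 2) := by
  have hpi := pi_pos
  set e : ℂ → ℝ → ℂ := fun ν y => exp (I * ν * y) with he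
  have hec : ∀ ν, Continuous (e ν) := fun ν => by fun_prop
  have hen : ∀ (r y : ℝ), ‖e r y‖ = 1 := fun r y => by
    simp only [he]
    rw [show I * (r : ℂ) * y = ((r * y : ℝ) : ℂ) * I by push_cast; ring, norm_exp_ofReal_mul_I]
  set F : ℝ → ℂ := fun x => e s x * (if 0 < x then f x else ε * f (-x)) with hF
  have hfc : MemLp f 2 μ[Ioc 0 π] := by
    rwa [Measure.restrict_congr_set Ioo_ae_eq_Ioc] at hf
  have hfn : MemLp (fun x => f (-x)) 2 μ[Ioo (-π) 0] := by
    have := (Measure.measurePreserving_neg (volume : Measure ℝ)).restrict_preimage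
      (s := Ioo 0 π) measurableSet_Ioo
    have h2 : (Neg.neg ⁻¹' Ioo 0 π : Set ℝ) = Ioo (-π) 0 := by
      ext x; simp only [mem_preimage, mem_Ioo]; constructor <;> intro h <;> constructor <;> linarith [h.1, h.2]
    rw [h2] at this
    exact hf.comp_measurePreserving this
  have hfn' : MemLp (fun x => f (-x)) 2 μ[Ioc (-π) 0] := by
    rwa [Measure.restrict_congr_set Ioo_ae_eq_Ioc] at hfn
  have hFL : MemLp F 2 μ[Ioc (-π) π] := by
    have hG : MemLp (fun x => if 0 < x then f x else ε * f (-x)) 2 μ[Ioc (-π) π] := by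
      have hu : Ioc (-π) π = Ioc (-π) 0 ∪ Ioc 0 π :=
        (Ioc_union_Ioc_eq_Ioc (by linarith) hpi.le).symm
      have hd : Disjoint (Ioc (-π) 0) (Ioc 0 π) := by
        rw [Set.disjoint_left]; intro x h1 h2; exact absurd h1.2 (not_le.2 h2.1)
      have e1 : (fun x => if 0 < x then f x else ε * f (-x)) =
          (Ioi 0).indicator f + (Iic 0).indicator (fun x => ε * f (-x)) := by
        ext x
        by_cases hx : 0 < x
        · simp [hx, not_le.2 hx]
        · simp [hx, not_lt.1 hx]
      rw [e1]
      refine MemLp.add ?_ ?_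
      · rw [memLp_indicator_iff_restrict measurableSet_Ioi, Measure.restrict_restrict measurableSet_Ioi]
        refine hfc.mono_set ?_
        intro x hx; exact ⟨hx.1, hx.2.2⟩
      · rw [memLp_indicator_iff_restrict measurableSet_Iic, Measure.restrict_restrict measurableSet_Iic]
        refine (hfn'.const_mul ε).mono_set ?_
        intro x hx; exact ⟨hx.2.1, hx.1⟩
    exact memLp_bdd_mul (C := 1) hG (hec _).aestronglyMeasurable
      (Eventually.of_forall fun x => (hen s x).le)
  have hab : -π < π := by linarith
  have key := hasSum_sq_fourierCoeffOn hab hFL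
  have fint : IntervalIntegrable f volume 0 π := by
    rw [intervalIntegrable_iff_integrableOn_Ioc_of_le hpi.le]
    exact hfc.integrable (by norm_num)
  have sq1 : IntervalIntegrable (fun x => ‖f x‖ ^ 2) volume 0 π := by
    rw [intervalIntegrable_iff_integrableOn_Ioc_of_le hpi.le]
    exact (memLp_two_iff_integrable_sq_norm hfc.1).1 hfc
  have split : ∀ {E : Type} [NormedAddCommGroup E] [NormedSpace ℝ E] (G H : ℝ → E)
      (K : ℝ → E), (∀ x, 0 < x → K x = G x) → (∀ x, x < 0 → K x = H (-x)) →
      IntervalIntegrable G volume 0 π → IntervalIntegrable H volume 0 π →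
      ∫ x in (-π)..π, K x = ∫ x in Ioo 0 π, (G x + H x) := by
    intro E _ _ G H K h1 h2 iG iH
    have iH' : IntervalIntegrable (fun x => H (-x)) volume (-π) 0 := by
      simpa using ((IntervalIntegrable.iff_comp_neg (f := H) (a := 0) (b := π)).1 iH).symm
    have eG : ∫ x in (0)..π, K x = ∫ x in (0)..π, G x := by
      rw [intervalIntegral.integral_of_le hpi.le, intervalIntegral.integral_of_le hpi.le]
      exact setIntegral_congr_fun measurableSet_Ioc fun x hx => h1 x hx.1
    have eH : ∫ x in (-π)..0, K x = ∫ x in (0)..π, H x := by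
      have : ∫ x in (-π)..0, K x = ∫ x in (-π)..0, H (-x) := by
        rw [intervalIntegral.integral_of_le (by linarith), intervalIntegral.integral_of_le (by linarith),
          integral_Ioc_eq_integral_Ioo, integral_Ioc_eq_integral_Ioo]
        exact setIntegral_congr_fun measurableSet_Ioo fun x hx => h2 x hx.2
      rw [this, intervalIntegral.integral_comp_neg]
      simp
    have kG : IntervalIntegrable K volume 0 π := by
      refine iG.congr ?_
      intro x hx; rw [uIoc_of_le hpi.le] at hx; exact (h1 x hx.1).symm
    have kH : IntervalIntegrable K volume (-π) 0 := by
      refine iH'.congr_ae ?_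
      rw [uIoc_of_le (by linarith), ← Measure.restrict_congr_set Ioo_ae_eq_Ioc]
      filter_upwards [ae_restrict_mem measurableSet_Ioo] with x hx
      exact (h2 x hx.2).symm
    rw [← intervalIntegral.integral_add_adjacent_intervals kH kG, eG, eH,
      ← integral_Ioc_eq_integral_Ioo, ← intervalIntegral.integral_of_le hpi.le,
      intervalIntegral.integral_add iG iH, add_comm]
  have hn : ∫ x in (-π)..π, ‖F x‖ ^ 2 = 2 * ∫ y in Ioo 0 π, ‖f y‖ ^ 2 := by
    rw [split (fun x => ‖f x‖ ^ 2) (fun x => ‖f x‖ ^ 2) _ ?_ ?_ sq1 sq1, ← integral_const_mul]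
    · congr 1; ext x; ring
    · intro x hx; simp [hF, hx, hen]
    · intro x hx; simp [hF, not_lt.2 hx.le, hen, hε]
  have hcf : ∀ k : ℤ, fourierCoeffOn hab F k = (1 / (2 * π) : ℝ) •
      ∫ y in Ioo 0 π, f y * (exp (-(I * (k - s)) * y) + ε * exp (I * (k - s) * y)) := by
    intro k
    rw [fourierCoeffOn_eq_integral, show π - -π = 2 * π by ring]
    congr 1
    have hfx : ∀ x : ℝ, fourier (-k) (x : AddCircle (2 * π)) = e (-k) x := by
      intro x
      rw [fourier_coe_apply]
      simp only [he]
      congr 1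
      have : (π : ℂ) ≠ 0 := by exact_mod_cast hpi.ne'
      push_cast
      field_simp
    rw [split (fun x => f x * exp (-(I * (k - s)) * x))
      (fun x => f x * (ε * exp (I * (k - s) * x)))]
    · congr 1; ext x; ring
    · intro x hx
      rw [hfx]
      simp only [hF, hx, if_true, he, smul_eq_mul, ← mul_assoc, ← exp_add]
      rw [mul_comm (f x)]; congr 2; ring
    · intro x hx
      rw [hfx]
      simp only [hF, not_lt.2 hx.le, if_false, he, smul_eq_mul, ← mul_assoc, ← exp_add]
      have : I * -(k : ℂ) * x + I * s * x = I * (k - s) * ((-x : ℝ) : ℂ) := by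
        push_cast; ring
      rw [this]; ring
    · exact fint.mul_continuousOn (by fun_prop)
    · exact fint.mul_continuousOn (by fun_prop)
  have := key.mul_left ((2 * π) ^ 2)
  refine hasSum_of_eq this (fun k => ?_) ?_
  · rw [hcf, norm_smul, mul_pow ‖(1 / (2 * π) : ℝ)‖, norm_eq_abs, sq_abs]
    field_simp
  · rw [hn, smul_eq_mul]
    field_simp
    ring

/-- The sum runs over all integers, so opposite frequencies `k - s` are counted separately. Doing so
avoids a special treatment of the frequency zero and of the half-integer case. -/
lemma parseval_cos (s : ℝ) {f : ℝ → ℂ} (hf : MemLp f 2 μ[Ioo 0 π]) :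
    HasSum (fun k : ℤ => ‖∫ y in Ioo 0 π, f y * (Real.cos ((k - s) * y) : ℝ)‖ ^ 2)
      (π * ∫ y in Ioo 0 π, ‖f y‖ ^ 2) := by
  refine hasSum_of_eq ((parseval_aux s (ε := 1) (by simp) hf).mul_left (1 / 4)) (fun k => ?_) ?_
  · have : ∀ y : ℝ, f y * (exp (-(I * (k - s)) * y) + 1 * exp (I * (k - s) * y)) =
        2 * (f y * (Real.cos ((k - s) * y) : ℝ)) := fun y => by
      push_cast
      rw [cos]
      ring_nf
    simp_rw [this]
    rw [integral_const_mul, norm_mul, mul_pow]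
    norm_num
    ring
  · ring

lemma parseval_sin (s : ℝ) {f : ℝ → ℂ} (hf : MemLp f 2 μ[Ioo 0 π]) :
    HasSum (fun k : ℤ => ‖∫ y in Ioo 0 π, f y * (Real.sin ((k - s) * y) : ℝ)‖ ^ 2)
      (π * ∫ y in Ioo 0 π, ‖f y‖ ^ 2) := by
  refine hasSum_of_eq ((parseval_aux s (ε := -1) (by simp) hf).mul_left (1 / 4)) (fun k => ?_) ?_
  · have : ∀ y : ℝ, f y * (exp (-(I * (k - s)) * y) + -1 * exp (I * (k - s) * y)) =
        (-2 * I) * (f y * (Real.sin ((k - s) * y) : ℝ)) := fun y => by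
      push_cast
      rw [sin]
      ring_nf
      rw [I_sq]
      ring_nf
    simp_rw [this]
    rw [integral_const_mul, norm_mul, mul_pow]
    norm_num
    ring
  · ring

/-- A square integrable function orthogonal to all `sin (n y)` vanishes. -/
lemma ae_eq_zero_of_sine {f : ℝ → ℂ} (hf : MemLp f 2 μ[Ioo 0 π])
    (h : ∀ n : ℕ, 1 ≤ n → ∫ y in Ioo 0 π, f y * (Real.sin (n * y) : ℝ) = 0) :
    f =ᵐ[μ[Ioo 0 π]] 0 := by
  have h0 : ∀ k : ℤ, ‖∫ y in Ioo 0 π, f y * (Real.sin ((k - (0 : ℝ)) * y) : ℝ)‖ ^ 2 = 0 := by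
    intro k
    obtain ⟨n, rfl | rfl⟩ := k.eq_nat_or_neg
    · rcases Nat.eq_zero_or_pos n with rfl | hn
      · simp
      · have := h n hn
        push_cast at this
        simp [this]
    · rcases Nat.eq_zero_or_pos n with rfl | hn
      · simp
      · have := h n hn
        push_cast at this
        simp [integral_neg, this]
  have p := parseval_sin 0 hf
  simp_rw [h0] at p
  have z := p.unique hasSum_zero
  have z' : ∫ y in Ioo 0 π, ‖f y‖ ^ 2 = 0 :=
    (mul_eq_zero.1 z).resolve_left pi_pos.ne'
  rw [integral_eq_zero_iff_of_nonneg (fun _ => by positivity)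
    ((memLp_two_iff_integrable_sq_norm hf.1).1 hf)] at z'
  filter_upwards [z'] with y hy
  simpa using hy

lemma integral_deriv_mul_Ioo {f f' : ℝ → ℂ} (hf : ∀ y, HasDerivAt f (f' y) y)
    (hf' : Continuous f') {g g' : ℝ → ℝ} (hg : ∀ y, HasDerivAt g (g' y) y)
    (hg' : Continuous g') (h0 : f 0 * g 0 = 0) (hpi : f π * g π = 0) :
    ∫ y in Ioo 0 π, f' y * (g y : ℂ) = - ∫ y in Ioo 0 π, f y * (g' y : ℂ) := by
  have hgc : ∀ y, HasDerivAt (fun y => (g y : ℂ)) (g' y : ℂ) y := fun y => (hg y).ofReal_comp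
  have := intervalIntegral.integral_deriv_mul_eq_sub (a := 0) (b := π)
    (u := f) (v := fun y => (g y : ℂ)) (fun y _ => hf y) (fun y _ => hgc y)
    (hf'.intervalIntegrable _ _) ((continuous_ofReal.comp hg').intervalIntegrable _ _)
  rw [hpi, h0, sub_self, intervalIntegral.integral_of_le pi_pos.le,
    integral_Ioc_eq_integral_Ioo, integral_add] at this
  · exact eq_neg_of_add_eq_zero_left this
  · exact ((hf'.mul (continuous_iff_continuousAt.2 fun y => (hgc y).continuousAt)).integrableOn_Icc
      (a := 0) (b := π)).mono_set Ioo_subset_Icc_self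
  · exact (((continuous_iff_continuousAt.2 fun y => (hf y).continuousAt).mul
      (continuous_ofReal.comp hg')).integrableOn_Icc
      (a := 0) (b := π)).mono_set Ioo_subset_Icc_self

lemma memLp_Ioo_of_continuous {g : ℝ → ℂ} (hg : Continuous g) : MemLp g 2 μ[Ioo 0 π] := by
  obtain ⟨C, hC⟩ := (isCompact_Icc (a := 0) (b := π)).exists_bound_of_continuousOn hg.continuousOn
  exact MemLp.of_bound hg.aestronglyMeasurable C ((ae_restrict_mem measurableSet_Ioo).mono
    fun x hx => hC x (Ioo_subset_Icc_self hx))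

/-- Raises the constant of a spectral inequality to the second eigenvalue `c`, at the cost of `c'`
times the coefficients of the lowest one, which occurs at the two indices `i` and `j`. -/
lemma le_of_hasSum_weights {u v : ℤ → ℝ} {A B c c' : ℝ} (i j : ℤ) (hij : i ≠ j)
    (hu : HasSum u A) (hv : HasSum v B) (hi : c * u i - c' * u i ≤ v i)
    (hj : c * u j - c' * u j ≤ v j) (h : ∀ k, k ≠ i → k ≠ j → c * u k ≤ v k) :
    c * A - c' * (u i + u j) ≤ B := by
  have h2 : HasSum (fun k => c' * (if k = i then u i else 0) + c' * (if k = j then u j else 0))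
      (c' * u i + c' * u j) :=
    ((hasSum_ite_eq i (u i)).mul_left c').add ((hasSum_ite_eq j (u j)).mul_left c')
  have := hasSum_le (fun k => ?_) ((hu.mul_left c).sub h2) hv
  · linarith
  · by_cases h1 : k = i
    · subst h1; simp [hij]; linarith
    · by_cases h3 : k = j
      · subst h3; simp [h1]; linarith
      · simpa [h1, h3] using h k h1 h3

/-- The eigenvalues are `k²`. The lowest one, `1`, occurs at `k = ±1` and the next one is `4`. The
deficit `4 - 1 = 3`, counted twice and divided by the `π` of Parseval, gives `6/π`. -/
lemma wirtinger_dirichlet {f f' : ℝ → ℂ} (hf : ∀ y, HasDerivAt f (f' y) y)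
    (hf' : Continuous f') (h0 : f 0 = 0) (hpi : f π = 0) :
    4 * (∫ y in Ioo 0 π, ‖f y‖ ^ 2) - 6 / π * ‖∫ y in Ioo 0 π, f y * (Real.sin y : ℝ)‖ ^ 2 ≤
      ∫ y in Ioo 0 π, ‖f' y‖ ^ 2 := by
  have hfc : Continuous f := continuous_iff_continuousAt.2 fun y => (hf y).continuousAt
  have p1 := parseval_sin 0 (memLp_Ioo_of_continuous hfc)
  have p2 := parseval_cos 0 (memLp_Ioo_of_continuous hf')
  have e : ∀ k : ℤ, ‖∫ y in Ioo 0 π, f' y * (Real.cos ((k - (0 : ℝ)) * y) : ℝ)‖ ^ 2 =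
      (k : ℝ) ^ 2 * ‖∫ y in Ioo 0 π, f y * (Real.sin ((k - (0 : ℝ)) * y) : ℝ)‖ ^ 2 := by
    intro k
    rw [integral_deriv_mul_Ioo hf hf' (g' := fun y => -Real.sin ((k - (0 : ℝ)) * y) * (k - 0))
      (fun y => (by simpa using ((hasDerivAt_id y).const_mul ((k : ℝ) - 0)).cos)) (by fun_prop)
      (by simp [h0]) (by simp [hpi])]
    have : ∀ y : ℝ, f y * ((-Real.sin ((k - (0 : ℝ)) * y) * (k - 0) : ℝ) : ℂ) =
      (-k : ℂ) * (f y * (Real.sin ((k - (0 : ℝ)) * y) : ℝ)) := fun y => by push_cast; ring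
    simp_rw [this]
    rw [integral_const_mul, norm_neg, norm_mul, mul_pow, norm_neg]
    simp
  simp_rw [e] at p2
  have key := le_of_hasSum_weights (c := 4) (c' := 3) 1 (-1) (by norm_num) p1 p2
    (by push_cast; linarith) (by push_cast; linarith) ?_
  · have e1 : ∀ y : ℝ, f y * (Real.sin (((-1 : ℤ) - (0 : ℝ)) * y) : ℝ) = - (f y * (Real.sin y : ℝ)) :=
      fun y => by simp
    simp_rw [e1] at key
    simp only [Int.cast_one, sub_zero, one_mul, integral_neg, norm_neg] at key
    have hp := pi_pos
    rw [← sub_nonneg] at key ⊢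
    have : ∀ A B C : ℝ, A - (4 * B - 6 / π * C) = π⁻¹ * (π * A - (4 * (π * B) - 3 * (C + C))) := by
      intros; field_simp; ring
    rw [this]
    positivity
  · intro k h1 h2
    by_cases hk : k = 0
    · subst hk; simp
    · refine mul_le_mul_of_nonneg_right ?_ (by positivity)
      have : 4 ≤ k ^ 2 := by
        rcases lt_or_gt_of_ne hk with h | h
        · have : k ≤ -2 := by omega
          nlinarith
        · have : 2 ≤ k := by omega
          nlinarith
      exact_mod_cast this

/-- The eigenvalues are `(k - 1/2)²`. The lowest one, `1/4`, occurs at `k = 0, 1` and the next one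
is `9/4`, so the deficit `2` counted twice gives `4/π`. -/
lemma wirtinger_mixed {f f' : ℝ → ℂ} (hf : ∀ y, HasDerivAt f (f' y) y)
    (hf' : Continuous f') (hpi : f π = 0) :
    9 / 4 * (∫ y in Ioo 0 π, ‖f y‖ ^ 2) -
      4 / π * ‖∫ y in Ioo 0 π, f y * (Real.cos (y / 2) : ℝ)‖ ^ 2 ≤
      ∫ y in Ioo 0 π, ‖f' y‖ ^ 2 := by
  have hfc : Continuous f := continuous_iff_continuousAt.2 fun y => (hf y).continuousAt
  have p1 := parseval_cos (1 / 2) (memLp_Ioo_of_continuous hfc)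
  have p2 := parseval_sin (1 / 2) (memLp_Ioo_of_continuous hf')
  have e : ∀ k : ℤ, ‖∫ y in Ioo 0 π, f' y * (Real.sin ((k - (1 / 2 : ℝ)) * y) : ℝ)‖ ^ 2 =
      (k - 1 / 2 : ℝ) ^ 2 * ‖∫ y in Ioo 0 π, f y * (Real.cos ((k - (1 / 2 : ℝ)) * y) : ℝ)‖ ^ 2 := by
    intro k
    rw [integral_deriv_mul_Ioo hf hf' (g' := fun y => Real.cos ((k - (1 / 2 : ℝ)) * y) * (k - 1 / 2))
      (fun y => (by simpa using ((hasDerivAt_id y).const_mul ((k : ℝ) - 1 / 2)).sin)) (by fun_prop)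
      (by simp) (by simp [hpi])]
    have : ∀ y : ℝ, f y * ((Real.cos ((k - (1 / 2 : ℝ)) * y) * (k - 1 / 2) : ℝ) : ℂ) =
      ((k - 1 / 2 : ℝ) : ℂ) * (f y * (Real.cos ((k - (1 / 2 : ℝ)) * y) : ℝ)) := fun y => by
        push_cast; ring
    simp_rw [this]
    rw [integral_const_mul, norm_neg, norm_mul, mul_pow, norm_real, norm_eq_abs, sq_abs]
  simp_rw [e] at p2
  have key := le_of_hasSum_weights (c := 9 / 4) (c' := 2) 1 0 (by norm_num) p1 p2
    (by push_cast; linarith) (by push_cast; linarith) ?_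
  · have e1 : ∀ y : ℝ, f y * (Real.cos (((1 : ℤ) - (1 / 2 : ℝ)) * y) : ℝ) =
      f y * (Real.cos (y / 2) : ℝ) := fun y => by congr 3; push_cast; ring
    have e2 : ∀ y : ℝ, f y * (Real.cos (((0 : ℤ) - (1 / 2 : ℝ)) * y) : ℝ) =
      f y * (Real.cos (y / 2) : ℝ) := fun y => by
        rw [← Real.cos_neg]; congr 3; push_cast; ring
    simp_rw [e1, e2] at key
    have hp := pi_pos
    rw [← sub_nonneg] at key ⊢
    have : ∀ A B C : ℝ, A - (9 / 4 * B - 4 / π * C) =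
      π⁻¹ * (π * A - (9 / 4 * (π * B) - 2 * (C + C))) := by
      intros; field_simp; ring
    rw [this]
    positivity
  · intro k h1 h2
    refine mul_le_mul_of_nonneg_right ?_ (by positivity)
    rcases lt_or_gt_of_ne h2 with h | h
    · have : (k : ℝ) ≤ -1 := by exact_mod_cast (by omega : k ≤ -1)
      nlinarith
    · have : (2 : ℝ) ≤ k := by exact_mod_cast (by omega : 2 ≤ k)
      nlinarith

end

section

variable {I : Set ℝ}

/-! ### Test functions with separated variables -/

/-- A smooth cutoff that equals `1` on `[-4, 4]`. -/
def bump₄ : ContDiffBump (0 : ℝ) := ⟨4, 5, by norm_num, by norm_num⟩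

lemma bump₄_eq_one {y : ℝ} (h : |y| ≤ 4) : bump₄ y = 1 :=
  bump₄.one_of_mem_closedBall (by simpa [bump₄] using h)

lemma abs_le_four_of_mem (hx : x ∈ strip) : |x.2| < 4 := by
  rw [abs_lt]; constructor <;> linarith [hx.2.1, hx.2.2, pi_lt_four]

/-- The function `η(x₁) k(x₂)`, cut off in the direction of `x₂` outside of the strip. -/
def sep (η k : ℝ → ℂ) : ℝ² → ℂ := fun x => η x.1 * (((bump₄ x.2 : ℝ) : ℂ) * k x.2)

lemma sep_eq (hx : |x.2| ≤ 4) : sep η k x = η x.1 * k x.2 := by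
  simp [sep, bump₄_eq_one hx]

section sep

lemma contDiff_sep (hη : Smooth η) (hk : Smooth k) : Smooth (sep η k) :=
  (hη.comp contDiff_fst).mul (((ofRealCLM.contDiff.comp
    (bump₄.contDiff)).comp contDiff_snd).mul (hk.comp contDiff_snd))

lemma tsupport_sep : tsupport (sep η k) ⊆ tsupport η ×ˢ Icc (-5) 5 := by
  refine closure_minimal (fun x hx => ?_) ((isClosed_tsupport η).prod isClosed_Icc)
  have h1 : η x.1 ≠ 0 := fun h => hx (by simp [sep, h])
  have h2 : bump₄ x.2 ≠ 0 := fun h => hx (by simp [sep, h])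
  refine ⟨subset_tsupport _ h1, ?_⟩
  have : x.2 ∈ Function.support bump₄ := h2
  rw [bump₄.support_eq, mem_ball, dist_zero_right, norm_eq_abs, abs_lt] at this
  exact ⟨this.1.le, this.2.le⟩

lemma isTest_sep (hη : Smooth η) (hc : HasCompactSupport η) (hk : Smooth k) : IsTest (sep η k) :=
  ⟨contDiff_sep hη hk, (hc.isCompact.prod isCompact_Icc).of_isClosed_subset (isClosed_tsupport _)
    tsupport_sep⟩

lemma sep_eventuallyEq (hx : |x.2| < 4) : sep η k =ᶠ[𝓝 x] fun x => η x.1 * k x.2 := by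
  have : ∀ᶠ z : ℝ² in 𝓝 x, |z.2| < 4 :=
    (continuous_abs.comp continuous_snd).continuousAt.eventually_lt continuousAt_const hx
  filter_upwards [this] with z hz
  exact sep_eq hz.le

lemma hasFDerivAt_prod_mul (hη : DifferentiableAt ℝ η x.1) (hk : DifferentiableAt ℝ k x.2) :
    pd₁ (fun x => η x.1 * k x.2) x = deriv η x.1 * k x.2 ∧
    pd₂ (fun x => η x.1 * k x.2) x = η x.1 * deriv k x.2 := by
  have d : DifferentiableAt ℝ (fun x : ℝ² => η x.1 * k x.2) x :=
    (hη.comp x differentiableAt_fst).mul (hk.comp x differentiableAt_snd)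
  exact ⟨(hasDerivAt_pd₁ (s := x.1) (t := x.2) d).unique (hη.hasDerivAt.mul_const (k x.2)),
    (hasDerivAt_pd₂ (s := x.1) (t := x.2) d).unique (hk.hasDerivAt.const_mul (η x.1))⟩

lemma pd₁_sep (hη : Smooth η) (hk : Smooth k) (hx : |x.2| < 4) :
    pd₁ (sep η k) x = deriv η x.1 * k x.2 := by
  rw [← (hasFDerivAt_prod_mul (hη.diff _) (hk.diff _)).1]
  unfold pd₁
  rw [(sep_eventuallyEq hx).fderiv_eq]

lemma pd₂_sep (hη : Smooth η) (hk : Smooth k) (hx : |x.2| < 4) :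
    pd₂ (sep η k) x = η x.1 * deriv k x.2 := by
  rw [← (hasFDerivAt_prod_mul (hη.diff _) (hk.diff _)).2]
  unfold pd₂
  rw [(sep_eventuallyEq hx).fderiv_eq]

end sep

section ModeEquation

/-- Integration by parts against a test function with separated variables. -/
lemma integral_sep_laplacian (h : ∀ r, 0 < r → InEnergy a p (stripTo r) u u₁ u₂)
    (hη : Smooth η) (hc : HasCompactSupport η) (hk : Smooth k) {ν : ℂ}
    (hk2 : ∀ y, deriv (deriv k) y = ν * k y)
    (hb : ∀ s, 0 < s → s < a → η s * deriv k 0 = 0) (hl : p = Parity.even → deriv η 0 = 0) :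
    ∫ x in strip, u x * ((deriv (deriv η) x.1 + ν * η x.1) * k x.2) =
      - ∫ x in strip, (u₁ x * pd₁ (sep η k) x + u₂ x * pd₂ (sep η k) x) := by
  have t0 := isTest_sep hη hc hk
  have t1 : IsTest (sep (deriv η) k) := isTest_sep (contDiff_deriv hη) hc.deriv hk
  have t2 : IsTest (sep η (deriv k)) := isTest_sep hη hc (contDiff_deriv hk)
  obtain ⟨r, hr, hs⟩ := hc.exists_tsupport_lt
  have sub : ∀ {η' k' : ℝ → ℂ}, tsupport η' ⊆ tsupport η →
      strip ∩ tsupport (sep η' k') ⊆ stripTo r := by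
    intro η' k' h' x hx
    exact ⟨hx.1, hs (h' (tsupport_sep hx.2).1)⟩
  have key := (h r hr).ibp (stripTo_subset r) (S₁ := sep (deriv η) k) (S₂ := sep η (deriv k))
    (fun x _ => t1.1.contDiffAt) (fun x _ => t2.1.contDiffAt) (t1.memLp _) (t2.memLp _)
    ((t1.d₁.memLp _).add (t2.d₂.memLp _)) (sub (tsupport_deriv_subset η)) (sub subset_rfl)
    (fun s h1 h2 => by rw [sep_eq (by simp)]; exact hb s h1 h2)
    (fun he t h1 h2 => by simp [sep, hl he])
  have e : ∀ x ∈ stripTo r, u x * (pd₁ (sep (deriv η) k) x + pd₂ (sep η (deriv k)) x) +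
      u₁ x * sep (deriv η) k x + u₂ x * sep η (deriv k) x =
      u x * ((deriv (deriv η) x.1 + ν * η x.1) * k x.2) +
      (u₁ x * pd₁ (sep η k) x + u₂ x * pd₂ (sep η k) x) := by
    intro x hx
    have h4 := abs_le_four_of_mem hx.1
    rw [pd₁_sep (contDiff_deriv hη) hk h4, pd₂_sep hη (contDiff_deriv hk) h4, sep_eq h4.le,
      sep_eq h4.le, pd₁_sep hη hk h4, pd₂_sep hη hk h4, hk2]
    ring
  have t3 : IsTest (sep (fun s => deriv (deriv η) s + ν * η s) k) :=
    isTest_sep ((contDiff_deriv (contDiff_deriv hη)).add (contDiff_const.mul hη))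
      (hc.deriv.deriv.add (hc.mul_left (f := fun _ => ν))) hk
  have hE := h r hr
  rw [setIntegral_congr_fun (isOpen_stripTo r).measurableSet e, ← setIntegral_strip_eq (r := r)
    fun x hx => ?_, integral_add ?_ ?_] at key
  · exact eq_neg_of_add_eq_zero_left key
  · refine (integrable_strip_mul (fun r hr => (h r hr).memLp) t3).congr ?_
    filter_upwards [ae_restrict_mem isOpen_strip.measurableSet] with x hx
    rw [sep_eq (abs_le_four_of_mem hx).le]
  · exact (integrable_strip_mul (fun r hr => (h r hr).memLp₁) t0.d₁).add
      (integrable_strip_mul (fun r hr => (h r hr).memLp₂) t0.d₂)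
  · obtain ⟨-, h1, h2⟩ := eq_zero_of_support_lt (r := r) (φ := sep η k)
      (fun x hx => hs (tsupport_sep hx).1) hx
    have hn : x.1 ∉ tsupport η := fun h => absurd (hs h) (not_lt.2 hx)
    simp [h1, h2, eq_zero_off hn, eq_zero_off fun h => hn (tsupport_deriv_subset _
      (tsupport_deriv_subset _ h))]

/-- The weak equation may be tested with test functions that vanish on the Dirichlet part. -/
lemma LocSol.weak_vanish (h : LocSol a p u u₁ u₂ g) (hS : IsTest S)
    (hD : ∀ x ∈ dirichletSet a p, S x = 0) :
    ∫ x in strip, (u₁ x * pd₁ S x + u₂ x * pd₂ S x) = ∫ x in strip, g x * S x := by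
  obtain ⟨r, hr⟩ := hS.2.isCompact.isBounded.subset_ball (0 : ℝ²)
  let b : ContDiffBump (0 : ℝ²) := ⟨max r 1, max r 1 + 1, by positivity, by linarith⟩
  set χ : ℝ² → ℂ := fun x => ((b x : ℝ) : ℂ) with hχ
  have tχ : IsTest χ := ⟨ofRealCLM.contDiff.comp b.contDiff,
    b.hasCompactSupport.comp_left (g := ofReal) (by simp)⟩
  have e0 : ∀ x, χ x * S x = S x := fun x => by
    by_cases hx : x ∈ tsupport S
    · simp [hχ, b.one_of_mem_closedBall (closedBall_subset_closedBall (le_max_left _ _)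
        (ball_subset_closedBall (hr hx)))]
    · rw [eq_zero_off hx, mul_zero]
  obtain ⟨R, hR0, hR⟩ := tχ.exists_support_lt
  have hSχ : tsupport S ⊆ tsupport χ := closure_mono fun x hx h => hx (by rw [← e0, h, zero_mul])
  have hSR := hSχ.trans hR
  have key := h.weak_energy hR0 (InEnergy.of_vanish hS hD) tχ hR
  rw [setIntegral_strip_eq (r := R) fun x hx => by
        obtain ⟨-, h1, h2⟩ := eq_zero_of_support_lt hSR hx; simp [h1, h2],
      setIntegral_strip_eq (r := R) fun x hx => by
        obtain ⟨h0, -⟩ := eq_zero_of_support_lt hSR hx; simp only [h0, mul_zero]]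
  have e1 : ∀ x, χ x * pd₁ S x + pd₁ χ x * S x = pd₁ S x := fun x => by
    rw [← pd₁_mul (tχ.1.diff x) (hS.1.diff x)]
    exact congrFun (congrArg pd₁ (funext e0)) x
  have e2 : ∀ x, χ x * pd₂ S x + pd₂ χ x * S x = pd₂ S x := fun x => by
    rw [← pd₂_mul (tχ.1.diff x) (hS.1.diff x)]
    exact congrFun (congrArg pd₂ (funext e0)) x
  simpa only [e0, e1, e2] using key

end ModeEquation

/-! ### Modes -/

/-- The coefficient `∫ u(s, y) k(y) dy`. -/
def mode (k : ℝ → ℂ) (u : ℝ² → ℂ) (s : ℝ) : ℂ := ∫ y in Ioo 0 π, u (s, y) * k y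

/-- The profiles whose coefficient functional is bounded by `π^{1/2}` on `L²(0, π)`. -/
def IsProfile (k : ℝ → ℂ) : Prop := Continuous k ∧ ∀ f : ℝ → ℂ, MemLp f 2 μ[Ioo 0 π] →
    ‖∫ y in Ioo 0 π, f y * k y‖ ^ 2 ≤ π * ∫ y in Ioo 0 π, ‖f y‖ ^ 2

lemma isProfile_sin (n : ℤ) : IsProfile (fun y => (Real.sin (n * y) : ℝ)) := by
  refine ⟨by fun_prop, fun f hf => ?_⟩
  have := le_hasSum (parseval_sin 0 hf) n (fun _ _ => by positivity)
  simpa using this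

lemma isProfile_cos : IsProfile (fun y => (Real.cos (y / 2) : ℝ)) := by
  refine ⟨by fun_prop, fun f hf => ?_⟩
  have := le_hasSum (parseval_cos (1 / 2) hf) 1 (fun _ _ => by positivity)
  refine le_trans (le_of_eq ?_) this
  have e : ∀ y : ℝ, ((1 : ℤ) - (1 / 2 : ℝ)) * y = y / 2 := fun y => by push_cast; ring
  simp only [e]

section Mode

lemma ae_slice_memLp (hu : MemLp u 2 μ[box I]) :
    ∀ᵐ s ∂μ[I], MemLp (fun y => u (s, y)) 2 μ[Ioo 0 π] := by
  rw [restrict_box] at hu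
  filter_upwards [hu.1.prodMk_left, (memLp_norm_sq hu).prod_right_ae] with s h1 h2
  exact (memLp_two_iff_integrable_sq_norm h1).2 h2

lemma memLp_mode (hu : MemLp u 2 μ[box I]) (hk : IsProfile k) : MemLp (mode k u) 2 μ[I] ∧
      ∫ s in I, ‖mode k u s‖ ^ 2 ≤ π * ∫ x in box I, ‖u x‖ ^ 2 := by
  have hs := ae_slice_memLp hu
  rw [restrict_box] at hu ⊢
  have hm : AEStronglyMeasurable (mode k u) μ[I] :=
    (hu.1.mul (hk.1.comp continuous_snd).aestronglyMeasurable).integral_prod_right'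
  have hi := (memLp_norm_sq hu).integral_prod_left
  have hle : ∀ᵐ s ∂μ[I], ‖mode k u s‖ ^ 2 ≤ π * ∫ y in Ioo 0 π, ‖u (s, y)‖ ^ 2 := by
    filter_upwards [hs] with s h
    exact hk.2 _ h
  have hI : Integrable (fun s => ‖mode k u s‖ ^ 2) μ[I] :=
    (hi.const_mul π).mono' (hm.norm.pow 2) (hle.mono fun s h => by simpa using h)
  refine ⟨(memLp_two_iff_integrable_sq_norm hm).2 hI, ?_⟩
  rw [integral_prod _ (memLp_norm_sq hu), ← integral_const_mul]
  exact integral_mono_ae hI (hi.const_mul _) hle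

lemma integral_mode (hu : Integrable (fun x => u x * (η x.1 * k x.2)) μ[box I]) :
    ∫ x in box I, u x * (η x.1 * k x.2) = ∫ s in I, mode k u s * η s := by
  rw [restrict_box] at hu ⊢
  rw [integral_prod _ hu]
  congr 1
  ext s
  rw [mode, ← integral_mul_const]
  congr 1
  ext y
  ring

/-- The equation for a mode of a solution, tested with `η`. -/
lemma LocSol.mode_test (h : LocSol a p u u₁ u₂ g) (hη : Smooth η) (hc : HasCompactSupport η)
    (hk : Smooth k) {ν b : ℂ} (hk2 : ∀ y, deriv (deriv k) y = ν * k y)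
    (hb : ∀ s, 0 < s → s < a → η s * deriv k 0 = 0) (hl : p = Parity.even → deriv η 0 = 0)
    (hD : ∀ x ∈ dirichletSet a p, sep η k x = 0)
    (hg : ∀ᵐ x ∂μ[strip], η x.1 = 0 ∨ g x = b * u x) :
    ∫ s in Ioi (0 : ℝ), mode k u s * (deriv (deriv η) s + (ν + b) * η s) = 0 := by
  have i : ∀ {ζ : ℝ → ℂ}, Smooth ζ → HasCompactSupport ζ →
      Integrable (fun x => u x * (ζ x.1 * k x.2)) μ[strip] := fun h1 h2 =>
    (integrable_strip_mul (fun r hr => (h.energy r hr).memLp) (isTest_sep h1 h2 hk)).congr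
      ((ae_restrict_mem isOpen_strip.measurableSet).mono fun x hx => by
        simp only [sep_eq (abs_le_four_of_mem hx).le])
  have j := fun ν : ℂ => i (ζ := fun s => deriv (deriv η) s + ν * η s)
    ((contDiff_deriv (contDiff_deriv hη)).add (contDiff_const.mul hη))
    (hc.deriv.deriv.add (hc.mul_left (f := fun _ => ν)))
  have e := integral_sep_laplacian h.energy hη hc hk hk2 hb hl
  rw [h.weak_vanish (isTest_sep hη hc hk) hD] at e
  rw [← integral_mode (by have := j (ν + b); rwa [strip_eq_box] at this), ← strip_eq_box]
  refine (((j ν).hi.add ((i hη hc).hi.mul b)).congr (ae_of_all _ fun x => by ring)).2.trans ?_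
  rw [e, ← integral_const_mul, neg_add_eq_zero]
  refine integral_congr_ae ?_
  filter_upwards [hg, ae_restrict_mem isOpen_strip.measurableSet] with x hx hxs
  rw [sep_eq (abs_le_four_of_mem hxs).le]
  rcases hx with hx | hx
  · simp [hx]
  · rw [hx]; ring

end Mode

end

section

variable {I : Set ℝ}

/-! ### The tail of the halfstrip -/

lemma measurableSet_box (hI : MeasurableSet I) : MeasurableSet (box I) :=
  hI.prod measurableSet_Ioo

lemma box_mono {I J : Set ℝ} (h : I ⊆ J) : box I ⊆ box J := prod_mono h subset_rfl

lemma tail_subset (hL : 0 ≤ L) : box (Ioi L) ⊆ strip := by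
  rw [strip_eq_box]; exact box_mono (Ioi_subset_Ioi hL)

lemma integral_tail_translate (L : ℝ) (G : ℝ² → ℂ) :
    ∫ x in box (Ioi L), G x = ∫ x in strip, G (x + (L, 0)) := by
  have h := (measurePreserving_add_right (volume : Measure (ℝ²)) (L, 0)).setIntegral_preimage_emb
    (MeasurableEquiv.addRight ((L, 0) : ℝ²)).measurableEmbedding G (box (Ioi L))
  rw [← h]
  congr 2
  ext x
  simp [strip, box]

lemma pd₁_translate (c x : ℝ²) : pd₁ (fun x => F (x + c)) x = pd₁ F (x + c) := by
  simp only [pd₁]; rw [fderiv_comp_add_right]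

lemma pd₂_translate (c x : ℝ²) : pd₂ (fun x => F (x + c)) x = pd₂ F (x + c) := by
  simp only [pd₂]; rw [fderiv_comp_add_right]

lemma integral_tail_pd₁ (hF : IsTest F)
    (h0 : ∀ t, 0 < t → t < π → F (L, t) = 0) : ∫ x in box (Ioi L), pd₁ F x = 0 := by
  rw [integral_tail_translate]
  simp_rw [← pd₁_translate]
  exact integral_strip_pd₁ ((hF.1.comp (contDiff_id.add contDiff_const)).of_le (by simp))
    (hF.2.comp_homeomorph (Homeomorph.addRight _)) (fun t h1 h2 => by simpa using h0 t h1 h2)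

lemma integral_tail_pd₂ (hF : IsTest F)
    (h0 : ∀ s, L < s → F (s, 0) = F (s, π)) : ∫ x in box (Ioi L), pd₂ F x = 0 := by
  rw [integral_tail_translate]
  simp_rw [← pd₂_translate]
  exact integral_strip_pd₂ ((hF.1.comp (contDiff_id.add contDiff_const)).of_le (by simp))
    (hF.2.comp_homeomorph (Homeomorph.addRight _)) (fun s hs => by simpa using h0 (s + L) (by linarith))

/-- The function `η(x₁) k(x₂)` on the tail `x₁ > L`, extended by zero. -/
def onTail (L : ℝ) (η k : ℝ → ℂ) : ℝ² → ℂ :=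
  {x | L < x.1}.indicator fun x => η x.1 * k x.2

lemma measurableSet_lt_fst (L : ℝ) : MeasurableSet {x : ℝ² | L < x.1} :=
  measurableSet_lt measurable_const measurable_fst

lemma strip_inter_lt (hL : 0 ≤ L) : strip ∩ {x | L < x.1} = box (Ioi L) := by
  ext x; simp [strip, box]; constructor
  · rintro ⟨⟨_, h⟩, h'⟩; exact ⟨h', h⟩
  · rintro ⟨h, h'⟩; exact ⟨⟨by linarith, h'⟩, h⟩

lemma integral_strip_indicator (hL : 0 ≤ L) (F w : ℝ² → ℂ) :
    ∫ x in strip, {x | L < x.1}.indicator F x * w x = ∫ x in box (Ioi L), F x * w x := by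
  simp_rw [← indicator_mul_left]
  rw [setIntegral_indicator (measurableSet_lt_fst L), strip_inter_lt hL]

lemma integral_strip_onTail (hL : 0 ≤ L) (η k : ℝ → ℂ) (w : ℝ² → ℂ) :
    ∫ x in strip, w x * onTail L η k x = ∫ x in box (Ioi L), w x * (η x.1 * k x.2) := by
  simp only [mul_comm (w _)]
  exact integral_strip_indicator hL _ w

def csin (y : ℝ) : ℂ := (Real.sin y : ℝ)
def ccos (y : ℝ) : ℂ := (Real.cos y : ℝ)

lemma hasDerivAt_csin (y : ℝ) : HasDerivAt csin (ccos y) y := (Real.hasDerivAt_sin y).ofReal_comp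
lemma hasDerivAt_ccos (y : ℝ) : HasDerivAt ccos (-csin y) y := by
  have := (Real.hasDerivAt_cos y).ofReal_comp
  rwa [ofReal_neg] at this
lemma contDiff_csin : Smooth csin := ofRealCLM.contDiff.comp Real.contDiff_sin
lemma contDiff_ccos : Smooth ccos := ofRealCLM.contDiff.comp Real.contDiff_cos
lemma deriv_csin : deriv csin = ccos := funext fun y => (hasDerivAt_csin y).deriv
lemma deriv_ccos : deriv ccos = fun y => -csin y := funext fun y => (hasDerivAt_ccos y).deriv
lemma csin_zero : csin 0 = 0 := by simp [csin]
lemma csin_pi : csin π = 0 := by simp [csin]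
lemma norm_csin_le (y : ℝ) : ‖csin y‖ ≤ 1 := by
  rw [csin, norm_real]; exact Real.abs_sin_le_one y

/-- A smooth cutoff in `x₁`, equal to `1` for `-N ≤ x₁ ≤ N`. -/
def plateau (N : ℝ) (s : ℝ) : ℂ := ((1 - stepFun (s ^ 2 / (N ^ 2 + 1)) : ℝ) : ℂ)

lemma contDiff_plateau (N : ℝ) : Smooth (plateau N) :=
  ofRealCLM.contDiff.comp (contDiff_const.sub (contDiff_stepFun.comp
    ((contDiff_id.pow 2).div_const _)))

lemma plateau_eq_one {N s : ℝ} (h : |s| ≤ |N|) : plateau N s = 1 := by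
  rw [plateau, stepFun_of_le]
  · simp
  · rw [div_le_one (by positivity)]
    have := sq_le_sq' (by linarith [neg_abs_le s, abs_nonneg s] : -|N| ≤ |s|) h
    rw [sq_abs, sq_abs] at this
    linarith

lemma tsupport_plateau (N : ℝ) :
    tsupport (plateau N) ⊆ Icc (-(2 * (N ^ 2 + 1))) (2 * (N ^ 2 + 1)) := by
  refine closure_minimal (fun s hs => ?_) isClosed_Icc
  by_contra h
  refine hs ?_
  rw [plateau, stepFun_of_ge]
  · simp
  · have h1 : 2 * (N ^ 2 + 1) < |s| := not_le.1 fun h2 => h (abs_le.1 h2)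
    rw [le_div_iff₀ (by positivity), ← sq_abs s]
    nlinarith [sq_nonneg N]

lemma hasCompactSupport_plateau (N : ℝ) : HasCompactSupport (plateau N) :=
  isCompact_Icc.of_isClosed_subset (isClosed_tsupport _) (tsupport_plateau N)

/-- A function on the tail that vanishes at its end `x₁ = L` belongs to the energy space. -/
lemma inEnergy_onTail (ha : 0 < a) (hL : a ≤ L) (r : ℝ) (hη : Smooth η) (h0 : η L = 0) :
    InEnergy a p (stripTo r) (onTail L η csin) (onTail L (deriv η) csin) (onTail L η ccos) := by
  have hL0 := (ha.trans_le hL).le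
  set ζ : ℝ → ℂ := fun s => plateau (|r| + 1) s * η s with hζ
  have cζ : Smooth ζ := (contDiff_plateau _).mul hη
  set T := sep ζ csin
  have hT : IsTest T := isTest_sep cζ (hasCompactSupport_plateau _).mul_right contDiff_csin
  have T0 : ∀ x : ℝ², x.1 = L → T x = 0 := fun x hx => by simp [T, sep, hζ, hx, h0]
  have Tb : ∀ x : ℝ², x.2 = 0 ∨ x.2 = π → T x = 0 := fun x hx => by
    rcases hx with hx | hx
    · exact (sep_eq (by rw [hx]; simp)).trans (by rw [hx, csin_zero, mul_zero])
    · exact (sep_eq (by rw [hx, abs_of_pos pi_pos]; exact Real.pi_le_four)).trans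
        (by rw [hx, csin_pi, mul_zero])
  set A := {x : ℝ² | L < x.1}
  have mA : MeasurableSet A := measurableSet_lt_fst L
  have nA : ∀ {x : ℝ²}, L < x.1 → A.indicator T =ᶠ[𝓝 x] T := fun hx => by
    filter_upwards [continuousAt_const.eventually_lt continuous_fst.continuousAt hx] with y hy
    exact indicator_of_mem (by exact hy) T
  have dS : ∀ v, (fun x => fderiv ℝ (A.indicator T) x v) =ᵐ[μ[strip]]
      A.indicator fun x => fderiv ℝ T x v := fun v => ae_restrict_of_ae (by
    filter_upwards [(Measure.quasiMeasurePreserving_fst (μ := (volume : Measure ℝ))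
      (ν := (volume : Measure ℝ))).ae (p := (· ≠ L)) (by simp [ae_iff])] with x hx
    rcases lt_or_gt_of_ne hx with h | h
    · have : A.indicator T =ᶠ[𝓝 x] fun _ => 0 := by
        filter_upwards [continuous_fst.continuousAt.eventually_lt continuousAt_const h] with y hy
        exact indicator_of_notMem (s := A) (fun h' => lt_asymm hy h') T
      rw [this.fderiv_eq, indicator_of_notMem (s := A) (fun h' => lt_asymm h h')]
      simp
    · rw [(nA h).fderiv_eq, indicator_of_mem (s := A) h])
  have mS : ∀ v, MemLp (A.indicator fun x => fderiv ℝ T x v) 2 μ[strip] := fun v =>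
    ((hT.fderiv_apply v).memLp _).indicator mA
  have h := inEnergy_of_continuous (a := a) (p := p) (S := A.indicator T) (Ω := strip)
    (continuous_indicator (fun x hx => T0 x (frontier_lt_subset_eq continuous_const continuous_fst
      hx).symm) hT.1.continuous.continuousOn)
    (hT.2.mono (by rw [support_indicator]; exact inter_subset_right))
    (fun x hx => by
      rcases hx with (⟨hx, -⟩ | ⟨hx, -⟩) | ⟨-, hx, -⟩
      · rw [indicator_apply, Tb x (Or.inr hx), ite_self]
      · rw [indicator_apply, Tb x (Or.inl hx), ite_self]
      · exact indicator_of_notMem (s := A) (fun h : L < x.1 => by linarith) T)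
    (fun x hx => hT.1.contDiffAt.congr_of_eventuallyEq (nA (mem_of_indicator_ne_zero (s := A) hx)))
    ((mS _).ae_eq (dS _).symm) ((mS _).ae_eq (dS _).symm)
  -- The approximation by truncations yields the derivatives only up to the zero set of the
  -- function. They are identified with the expected ones as weak derivatives. There is no boundary
  -- term at `x₁ = L` because `η(L) = 0`.
  have key : ∀ {φ : ℝ² → ℂ} {v}, IsTest φ → ∫ x in box (Ioi L), fderiv ℝ (fun x => T x * φ x) x v = 0 →
      -∫ x in strip, A.indicator T x * fderiv ℝ φ x v =
        ∫ x in strip, A.indicator (fun x => fderiv ℝ T x v) x * φ x := fun {φ v} hφ e => by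
    rw [integral_strip_indicator hL0, integral_strip_indicator hL0]
    have := ((((hφ.fderiv_apply v).mul hT.1).integrable μ[box (Ioi L)]).hi.add
      ((hφ.mul (hT.fderiv_apply v).1).integrable _).hi).congr
      (g := fun x => fderiv ℝ (fun x => T x * φ x) x v) (ae_of_all _ fun x => by
        simp [fderiv_fun_mul (hT.diff x) (hφ.diff x)]; ring)
    linear_combination -(this.2.symm.trans e)
  have e1 := ae_eq_of_integral_test isOpen_strip (locallyIntegrableOn_of_memLp h.memLp₁)
    (locallyIntegrableOn_of_memLp (mS (1, 0))) fun φ hφ hs => (h.weak₁ hφ hs).trans (key hφ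
      (integral_tail_pd₁ (hφ.mul hT.1) fun t _ _ => by rw [T0 _ rfl, zero_mul]))
  have e2 := ae_eq_of_integral_test isOpen_strip (locallyIntegrableOn_of_memLp h.memLp₂)
    (locallyIntegrableOn_of_memLp (mS (0, 1))) fun φ hφ hs => (h.weak₂ hφ hs).trans (key hφ
      (integral_tail_pd₂ (hφ.mul hT.1) fun t _ => by
        rw [Tb _ (Or.inl rfl), Tb _ (Or.inr rfl), zero_mul, zero_mul]))
  have hζ' : ∀ x ∈ stripTo r, ζ =ᶠ[𝓝 x.1] η := fun x hx => by
    have h1 : |x.1| < |(|r| + 1)| := by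
      rw [abs_of_pos hx.1.1, abs_of_pos (by positivity)]
      exact (lt_of_lt_of_le hx.2 (le_abs_self r)).trans (by linarith)
    filter_upwards [(continuous_abs.continuousAt (x := x.1)).eventually_lt continuousAt_const h1]
      with s hs
    simp [hζ, plateau_eq_one hs.le]
  have fin : ∀ {F : ℝ² → ℂ} {η k : ℝ → ℂ}, (∀ x ∈ stripTo r, F x = η x.1 * k x.2) →
      A.indicator F =ᵐ[μ[stripTo r]] onTail L η k := fun hF =>
    (ae_restrict_mem (isOpen_stripTo r).measurableSet).mono fun x hx => by
      by_cases hx' : x ∈ A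
      · rw [onTail, indicator_of_mem hx', indicator_of_mem hx', hF x hx]
      · rw [onTail, indicator_of_notMem hx', indicator_of_notMem hx']
  exact ((h.congr EventuallyEq.rfl e1 e2).mono (stripTo_subset r)).congr
    (fin fun x hx => by rw [← (hζ' x hx).eq_of_nhds]; exact sep_eq (abs_le_four_of_mem hx.1).le)
    (fin fun x hx => by
      rw [← (hζ' x hx).deriv_eq]; exact pd₁_sep cζ contDiff_csin (abs_le_four_of_mem hx.1))
    (fin fun x hx => by
      rw [← (hζ' x hx).eq_of_nhds, ← deriv_csin]
      exact pd₂_sep cζ contDiff_csin (abs_le_four_of_mem hx.1))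

end

section

variable {I : Set ℝ}

/-! ### The first mode on the tail -/

/-- The normalization constant `√(2/π)`. -/
def nrm : ℂ := (√(2 / π) : ℝ)

lemma nrm_sq : nrm * nrm * (π / 2 : ℝ) = 1 := by
  rw [nrm, ← ofReal_mul, ← ofReal_mul, Real.mul_self_sqrt (by positivity)]
  have := pi_pos
  rw [← ofReal_one]
  congr 1
  field_simp

lemma nrm_ne_zero : nrm ≠ 0 := fun h => by simpa [h] using nrm_sq

/-- The function `√(2/π) e^{-κ (s - L)}`. -/
def nexp (L : ℝ) (κ : ℂ) (s : ℝ) : ℂ := nrm * exp (-κ * (s - L))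

lemma hasDerivAt_nexp (L : ℝ) (κ : ℂ) (s : ℝ) : HasDerivAt (nexp L κ) (-κ * nexp L κ s) s := by
  have h1 : HasDerivAt (fun s : ℝ => -κ * ((s : ℂ) - L)) (-κ) s := by
    simpa using ((ofRealCLM.hasDerivAt (x := s)).sub_const (L : ℂ)).const_mul (-κ)
  have := h1.cexp.const_mul nrm
  refine this.congr_deriv ?_
  simp only [nexp]; ring

lemma deriv_nexp (L : ℝ) (κ : ℂ) : deriv (nexp L κ) = fun s => -κ * nexp L κ s :=
  funext fun s => (hasDerivAt_nexp L κ s).deriv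

lemma contDiff_nexp (L : ℝ) (κ : ℂ) : Smooth (nexp L κ) :=
  contDiff_const.mul (contDiff_exp.comp (contDiff_const.mul
    (ofRealCLM.contDiff.sub contDiff_const)))

lemma norm_nexp (L : ℝ) (κ : ℂ) (s : ℝ) : ‖nexp L κ s‖ = ‖nrm‖ * Real.exp (-κ.re * (s - L)) := by
  rw [nexp, norm_mul, norm_exp]
  congr 2
  rw [← ofReal_sub, mul_re, ofReal_re, ofReal_im]
  simp

/-- The profile `e^{-m(s-L)} - e^{-(s-L)}` of the correction on the tail. -/
def gam (L : ℝ) (m : ℂ) (s : ℝ) : ℂ := nexp L m s - nexp L 1 s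

lemma contDiff_gam (L : ℝ) (m : ℂ) : Smooth (gam L m) :=
  (contDiff_nexp L m).sub (contDiff_nexp L 1)

lemma deriv_gam (L : ℝ) (m : ℂ) : deriv (gam L m) = fun s => -m * nexp L m s + nexp L 1 s :=
  funext fun s => by
    refine ((hasDerivAt_nexp L m s).sub (hasDerivAt_nexp L 1 s)).deriv.trans ?_
    ring

lemma gam_self (L : ℝ) (m : ℂ) : gam L m L = 0 := by simp [gam, nexp]

/-- The decaying first mode on the tail. -/
def Efun (L : ℝ) : ℝ² → ℂ := onTail L (nexp L 1) csin

lemma integral_csin_sq : ∫ y in Ioo 0 π, csin y * csin y = (π / 2 : ℝ) := by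
  have h : ∀ y : ℝ, csin y * csin y = ((Real.sin y ^ 2 : ℝ) : ℂ) := fun y => by
    simp [csin]; ring
  simp_rw [h]
  rw [integral_complex_ofReal, ← integral_Ioc_eq_integral_Ioo,
    ← intervalIntegral.integral_of_le pi_pos.le, integral_sin_sq]
  simp

lemma integrableOn_exp_neg (c L : ℝ) (hc : 0 < c) :
    IntegrableOn (fun s : ℝ => Real.exp (-c * (s - L))) (Ioi L) := by
  have := (exp_neg_integrableOn_Ioi L hc).const_mul (Real.exp (c * L))
  refine this.congr (Eventually.of_forall fun s => ?_)
  change Real.exp (c * L) * Real.exp (-c * s) = _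
  rw [← Real.exp_add]; congr 1; ring

lemma memLp_onTail (hη : MemLp η 2 μ[Ioi L])
    (hk : Continuous k) (hk1 : ∀ y, ‖k y‖ ≤ 1) (hL : 0 ≤ L) :
    MemLp (onTail L η k) 2 μ[strip] := by
  rw [onTail, memLp_indicator_iff_restrict (measurableSet_lt_fst L),
    Measure.restrict_restrict (measurableSet_lt_fst L), inter_comm, strip_inter_lt hL,
    restrict_box]
  have h1 : AEStronglyMeasurable (fun x : ℝ² => η x.1) (μ[Ioi L].prod μ[Ioo 0 π]) := hη.1.comp_fst
  have h2 : MemLp (fun x : ℝ² => η x.1) 2 (μ[Ioi L].prod μ[Ioo 0 π]) := by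
    refine (memLp_two_iff_integrable_sq_norm h1).2 ?_
    have := (memLp_norm_sq hη).mul_prod (integrable_const (1 : ℝ) (μ := μ[Ioo 0 π]))
    simpa using this
  have := memLp_bdd_mul (W := fun x : ℝ² => k x.2) (C := 1) h2
    (hk.comp continuous_snd).aestronglyMeasurable (ae_of_all _ fun x => hk1 _)
  exact this.congr_norm (h1.mul (hk.comp continuous_snd).aestronglyMeasurable)
    (ae_of_all _ fun x => by simp [mul_comm])

lemma memLp_nexp {κ : ℂ} (hκ : 0 < κ.re) : MemLp (nexp L κ) 2 μ[Ioi L] := by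
  rw [memLp_two_iff_integrable_sq_norm (contDiff_nexp L κ).continuous.aestronglyMeasurable]
  refine ((integrableOn_exp_neg (2 * κ.re) L (by linarith)).const_mul (‖nrm‖ ^ 2)).congr
    (ae_of_all _ fun s => ?_)
  simp only [norm_nexp]
  rw [mul_pow, ← Real.exp_nat_mul]
  congr 2
  push_cast; ring

lemma memLp_Efun (hL : 0 ≤ L) : MemLp (Efun L) 2 μ[strip] :=
  memLp_onTail (memLp_nexp (by simp)) contDiff_csin.continuous norm_csin_le hL

/-- The functions without first mode on the tail. -/
def TailFree (L : ℝ) (w : ℝ² → ℂ) : Prop := ∀ᵐ s, s ∈ Ioi L → mode csin w s = 0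

lemma isProfile_csin : IsProfile csin := by
  have h : csin = fun y => ((Real.sin ((1 : ℤ) * y) : ℝ) : ℂ) := by funext y; simp [csin]
  rw [h]; exact isProfile_sin 1

lemma locallyIntegrableOn_mode (hk : IsProfile k) (hw : ∀ r, MemLp w 2 μ[box (Ioo L r)]) :
    LocallyIntegrableOn (mode k w) (Ioi L) := by
  intro s hs
  have h := (memLp_mode (hw (s + 1)) hk).1
  refine ⟨Ioo L (s + 1), ?_, h.integrable (by norm_num)⟩
  exact mem_nhdsWithin_of_mem_nhds (Ioo_mem_nhds hs (by linarith))

lemma memLp_box_of_strip (hL : 0 ≤ L) (hw : ∀ r, 0 < r → MemLp w 2 μ[stripTo r]) (r : ℝ) :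
    MemLp w 2 μ[box (Ioo L r)] := by
  refine (hw (max r 1) (by positivity)).mono_set ?_
  rw [stripTo_eq_box]
  exact box_mono fun s hs => ⟨lt_of_le_of_lt hL hs.1, lt_of_lt_of_le hs.2 (le_max_left _ _)⟩

/-- Integrals against `η(x₁) k(x₂)` in terms of the mode. -/
lemma integral_strip_mode (hL : 0 ≤ L) (hk : IsProfile k) (hw : ∀ r, 0 < r → MemLp w 2 μ[stripTo r])
    (hη : Continuous η) (hc : HasCompactSupport η) (hs : tsupport η ⊆ Ioi L) :
    ∫ x in strip, w x * (η x.1 * k x.2) = ∫ s, mode k w s * η s := by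
  obtain ⟨r, -, hr⟩ := hc.exists_tsupport_lt
  have hz : ∀ s, s ∉ Ioo L r → η s = 0 := fun s h => eq_zero_off fun h' => h ⟨hs h', hr h'⟩
  have hwb := memLp_box_of_strip hL hw r
  have hsub : box (Ioo L r) ⊆ strip := by
    rw [strip_eq_box]; exact box_mono fun s hs => lt_of_le_of_lt hL hs.1
  rw [setIntegral_eq_of_subset_of_forall_sdiff_eq_zero isOpen_strip.measurableSet hsub
    fun x hx => ?_, integral_mode, setIntegral_eq_integral_of_forall_compl_eq_zero]
  · intro s hs'; rw [hz s hs', mul_zero]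
  · have : IsFiniteMeasure μ[box (Ioo L r)] := by
      rw [restrict_box]; infer_instance
    obtain ⟨C, hC⟩ := hη.bounded_above_of_compact_support hc
    obtain ⟨C', hC'⟩ := (isCompact_Icc (a := 0) (b := π)).exists_bound_of_continuousOn
      hk.1.continuousOn
    refine (hwb.integrable (by norm_num)).mul_bdd (c := C * C')
      ((hη.comp continuous_fst).mul (hk.1.comp continuous_snd)).aestronglyMeasurable ?_
    filter_upwards [ae_restrict_mem (measurableSet_box measurableSet_Ioo)] with x hx
    rw [norm_mul]
    exact mul_le_mul (hC _) (hC' _ (Ioo_subset_Icc_self hx.2)) (norm_nonneg _)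
      ((norm_nonneg _).trans (hC 0))
  · have : x.1 ∉ Ioo L r := fun h => hx.2 ⟨h, hx.1.2⟩
    rw [hz _ this]; ring

/-- Integrals over the whole tail in terms of the mode. -/
lemma integral_tail_mode (hk : IsProfile k) (hk1 : ∀ y, ‖k y‖ ≤ 1)
    (hL : 0 ≤ L) (hw : MemLp w 2 μ[strip])
    (hη : MemLp η 2 μ[Ioi L]) :
    ∫ x in strip, w x * onTail L η k x = ∫ s in Ioi L, mode k w s * η s := by
  rw [integral_strip_onTail hL, integral_mode]
  have h := IntegrableOn.mono_set (memLp_mul hw (memLp_onTail hη hk.1 hk1 hL)) (tail_subset hL)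
  refine h.congr ?_
  filter_upwards [ae_restrict_mem (measurableSet_box measurableSet_Ioi)] with x hx
  simp [onTail, show L < x.1 from hx.1]

lemma mode_congr (k : ℝ → ℂ) (h : u =ᵐ[μ[box I]] v) : mode k u =ᵐ[μ[I]] mode k v := by
  rw [restrict_box] at h
  filter_upwards [Measure.ae_ae_of_ae_prod h] with s hs
  exact integral_congr_ae (hs.mono fun y hy => by simp only [hy])

lemma mode_add (hk : IsProfile k) (hu : MemLp u 2 μ[box I]) (hv : MemLp v 2 μ[box I]) (c : ℂ) :
    ∀ᵐ s ∂μ[I], mode k (fun x => u x + c * v x) s = mode k u s + c * mode k v s := by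
  filter_upwards [ae_slice_memLp hu, ae_slice_memLp hv] with s h1 h2
  have i : ∀ {f : ℝ → ℂ}, MemLp f 2 μ[Ioo 0 π] →
      Integrable (fun y => f y * k y) μ[Ioo 0 π] := fun hf =>
    memLp_mul hf (memLp_Ioo_of_continuous hk.1)
  simp only [mode]
  rw [← integral_const_mul, ← integral_add (i h1) ((i h2).const_mul c)]
  congr 1; ext y; ring

lemma mode_onTail {η k l : ℝ → ℂ} (hs : L < s) :
    mode l (onTail L η k) s = η s * ∫ y in Ioo 0 π, k y * l y := by
  rw [mode, ← integral_const_mul]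
  congr 1; ext y
  simp [onTail, hs, mul_assoc]

end

/-! ### The flux of the correction at the end of the tail, and the trace functional of the first
mode. -/

section

lemma onTail_of_lt (h : L < x.1) : onTail L η k x = η x.1 * k x.2 := by simp [onTail, h]

lemma onTail_of_le (h : x.1 ≤ L) : onTail L η k x = 0 := by
  simp [onTail, not_lt.2 h]

lemma IsBdryTest.eq_zero_zero (hL : a ≤ L) (hφ : IsBdryTest a p φ) (hs : L < s) : φ (s, 0) = 0 :=
  hφ.eq_zero (Or.inl (Or.inr ⟨rfl, (hL.trans hs.le)⟩))

lemma IsBdryTest.eq_zero_pi (hφ : IsBdryTest a p φ) (hs : 0 ≤ s) : φ (s, π) = 0 := hφ.eq_zero (Or.inl (Or.inl ⟨rfl, hs⟩))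

lemma aestronglyMeasurable_onTail (hη : Continuous η) (hk : Continuous k)
    (μ : Measure (ℝ²)) : AEStronglyMeasurable (onTail L η k) μ :=
  (((hη.comp continuous_fst).mul (hk.comp continuous_snd)).aestronglyMeasurable).indicator
    (measurableSet_lt_fst L)

/-- The correction on the tail balances the boundary term of the reduced equation. -/
lemma weakSol_gam (ha : 0 < a) (hL : a ≤ L) (m : ℂ) :
    WeakSol a p (onTail L (deriv (gam L m)) csin) (onTail L (gam L m) ccos)
      (fun x => (m - m ^ 2) * Efun L x + (1 - m ^ 2) * onTail L (gam L m) csin x)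
      (fun x => (1 - m) * Efun L x) := by
  have hE := fun r => inEnergy_onTail (p := p) ha hL r (contDiff_gam L m) (gam_self L m)
  have hEf := memLp_Efun (ha.le.trans hL)
  have l1 : LocL2 _ := fun r _ => (hE r).memLp₁
  have l2 : LocL2 _ := fun r _ => (hE r).memLp₂
  have l3 : LocL2 fun x => (m - m ^ 2) * Efun L x + (1 - m ^ 2) * onTail L (gam L m) csin x :=
    (LocL2.add_mul (locMemLp (hEf.const_mul _)) (fun r _ => (hE r).memLp) _)
  have l4 : LocL2 _ := locMemLp (hEf.const_mul (1 - m))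
  refine ⟨l1, l2, l3, l4, fun φ hφ => ?_⟩
  have hLp : 0 < L := ha.trans_le hL
  -- Since `γ' = -m γ + (1 - m) e` for `γ = gam L m` and `e = nexp L 1`, subtracting the term with
  -- `G₁` from `∂₁Γ_m` leaves `-m Γ_m`. The remaining field `(-m Γ_m, ∂₂Γ_m)` vanishes at `x₁ = L`,
  -- so the divergence theorem on the tail has no boundary terms.
  set F₁ : ℝ² → ℂ := fun x => (-m * (gam L m x.1 * csin x.2)) * φ x with hF₁
  set F₂ : ℝ² → ℂ := fun x => (gam L m x.1 * ccos x.2) * φ x with hF₂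
  have cg1 : Smooth (fun x : ℝ² => gam L m x.1 * csin x.2) :=
    ((contDiff_gam L m).comp contDiff_fst).mul (contDiff_csin.comp contDiff_snd)
  have cg2 : Smooth (fun x : ℝ² => gam L m x.1 * ccos x.2) :=
    ((contDiff_gam L m).comp contDiff_fst).mul (contDiff_ccos.comp contDiff_snd)
  have t1 : IsTest F₁ := hφ.1.mul (contDiff_const.mul cg1)
  have t2 : IsTest F₂ := hφ.1.mul cg2
  have i1 := integral_tail_pd₁ (L := L) t1 (fun t _ _ => by simp [hF₁, gam_self])
  have i2 := integral_tail_pd₂ (L := L) t2 (fun s hs => by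
    simp [hF₂, hφ.eq_zero_zero hL hs, hφ.eq_zero_pi (hLp.trans hs).le])
  have hd : ∀ x, DifferentiableAt ℝ φ x := fun x => hφ.1.diff x
  have e1 : ∀ x, pd₁ F₁ x = -m * (gam L m x.1 * csin x.2) * pd₁ φ x +
      -m * (deriv (gam L m) x.1 * csin x.2) * φ x := fun x => by
    have d := hasFDerivAt_prod_mul (x := x) ((contDiff_gam L m).diff _)
      (contDiff_csin.diff _)
    have dd : pd₁ (fun x : ℝ² => -m * (gam L m x.1 * csin x.2)) x =
        -m * (deriv (gam L m) x.1 * csin x.2) := by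
      rw [← d.1]
      simp only [pd₁]
      rw [fderiv_const_mul (cg1.diff x)]
      rfl
    rw [hF₁, pd₁_mul ((contDiff_const.mul cg1).diff x) (hd x), dd]
  have e2 : ∀ x, pd₂ F₂ x = (gam L m x.1 * ccos x.2) * pd₂ φ x +
      (gam L m x.1 * -csin x.2) * φ x := fun x => by
    have d := hasFDerivAt_prod_mul (x := x) ((contDiff_gam L m).diff _)
      (contDiff_ccos.diff _)
    rw [hF₂, pd₂_mul (cg2.diff x) (hd x), d.2, deriv_ccos]
  have key : ∫ x in box (Ioi L), (pd₁ F₁ x + pd₂ F₂ x) = 0 := by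
    rw [integral_add (t1.d₁.integrable _) (t2.d₂.integrable _), i1, i2, add_zero]
  rw [← strip_inter_lt hLp.le, ← setIntegral_indicator (measurableSet_lt_fst L)] at key
  rw [← sub_eq_zero, ← integral_sub (l1.pair l2 hφ.1.d₁ hφ.1.d₂) (l3.pair l4 hφ.1 hφ.1.d₁), ← key]
  congr 1
  ext x
  by_cases hx : L < x.1
  · rw [indicator_of_mem (by exact hx), e1, e2, Efun, onTail_of_lt hx, onTail_of_lt hx,
      onTail_of_lt hx, onTail_of_lt hx, deriv_gam, gam]
    ring
  · rw [indicator_of_notMem (by exact hx), Efun, onTail_of_le (not_lt.1 hx),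
      onTail_of_le (not_lt.1 hx), onTail_of_le (not_lt.1 hx), onTail_of_le (not_lt.1 hx)]
    ring

lemma integral_nexp_sq (L : ℝ) : ∫ s in Ioi L, nexp L 1 s * nexp L 1 s = nrm * nrm * (1 / 2) := by
  have h : ∀ s : ℝ, nexp L 1 s * nexp L 1 s = nrm * nrm * ((Real.exp (-2 * (s - L)) : ℝ) : ℂ) := by
    intro s
    simp only [nexp]
    push_cast
    rw [mul_mul_mul_comm, ← exp_add]
    congr 2; ring
  simp_rw [h]
  rw [integral_const_mul, integral_complex_ofReal]
  congr 1
  have h1 : ∀ s : ℝ, Real.exp (-2 * (s - L)) = Real.exp (2 * L) * Real.exp ((-2) * s) := fun s => by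
    rw [← Real.exp_add]; congr 1; ring
  simp_rw [h1]
  rw [integral_const_mul, integral_exp_mul_Ioi (by norm_num), ← mul_div_assoc, mul_neg,
    ← Real.exp_add]
  norm_num

/-- The weak derivative of a mode. -/
lemma InEnergy.integral_mode_deriv (h : InEnergy a p strip v v₁ v₂) (hη : Smooth η) (hc : HasCompactSupport η) (hs : tsupport η ⊆ Ioi 0) :
    (∫ s, mode csin v s * deriv η s) + ∫ s, mode csin v₁ s * η s = 0 := by
  have t : IsTest (sep η csin) := isTest_sep hη hc contDiff_csin
  have key := h.ibp subset_rfl (S₁ := sep η csin) (S₂ := fun _ => 0)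
    (fun x _ => t.1.contDiffAt) (fun x _ => contDiffAt_const) (t.memLp _) MemLp.zero
    (by simpa [pd₂] using t.d₁.memLp _) inter_subset_left inter_subset_left (fun _ _ _ => rfl)
    (fun _ t _ _ => by
      have : (0 : ℝ) ∉ tsupport η := fun h => lt_irrefl (0 : ℝ) (hs h)
      simp [sep, eq_zero_off this])
  have loc : ∀ {w : ℝ² → ℂ}, MemLp w 2 μ[strip] → ∀ r, 0 < r →
      MemLp w 2 μ[stripTo r] := fun hw r _ =>
    hw.mono_set (stripTo_subset r)
  rw [← integral_strip_mode le_rfl isProfile_csin (loc h.memLp) (contDiff_deriv hη).continuous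
      hc.deriv ((tsupport_deriv_subset η).trans hs),
    ← integral_strip_mode le_rfl isProfile_csin (loc h.memLp₁) hη.continuous hc hs]
  have i1 : Integrable (fun x => v x * pd₁ (sep η csin) x) μ[strip] :=
    memLp_mul h.memLp (t.d₁.memLp _)
  have i2 : Integrable (fun x => v₁ x * sep η csin x) μ[strip] :=
    memLp_mul h.memLp₁ (t.memLp _)
  have e1 : ∀ x ∈ strip, v x * (deriv η x.1 * csin x.2) = v x * pd₁ (sep η csin) x := fun x hx => by
    rw [pd₁_sep hη contDiff_csin (abs_le_four_of_mem hx)]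
  have e2 : ∀ x ∈ strip, v₁ x * (η x.1 * csin x.2) = v₁ x * sep η csin x := fun x hx => by
    rw [sep_eq (abs_le_four_of_mem hx).le]
  rw [setIntegral_congr_fun isOpen_strip.measurableSet e1,
    setIntegral_congr_fun isOpen_strip.measurableSet e2, ← integral_add i1 i2, ← key]
  congr 1; ext x; simp [pd₂]

/-- The integrand is the derivative of `nexp L 1 * η`. The boundary value at `L` is what detects a
jump of a mode there. -/
lemma integral_nexp_mul_deriv (hη : Smooth η) (hc : HasCompactSupport η) :
    ∫ s in Ioi L, (nexp L 1 s * deriv η s - nexp L 1 s * η s) = -(nrm * η L) := by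
  refine (integral_congr_ae (ae_of_all _ fun s => ?_)).trans
    (((hc.mul_left (f := nexp L 1)).integral_Ioi_deriv_eq
      (((contDiff_nexp L 1).mul hη).of_le (by simp)) L).trans (by simp [nexp]))
  refine (((hasDerivAt_nexp L 1 s).mul
    (hη.diff s).hasDerivAt).congr_deriv ?_).deriv.symm
  ring

lemma mode_Efun (hs : L < s) : mode csin (Efun L) s = nexp L 1 s * (π / 2 : ℝ) := by
  rw [Efun, mode_onTail hs, integral_csin_sq]

/-- If the first mode of `v` on the tail is `β e^{-(s - L)}`, the same holds for `-∂₁ v`. -/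
lemma InEnergy.mode_of_tailFree (h : InEnergy a p strip v v₁ v₂) (hL : 0 ≤ L) {β : ℂ}
    (hf : TailFree L (fun x => v x - β * Efun L x)) :
    (∀ᵐ s, s ∈ Ioi L → mode csin v s = β * (nexp L 1 s * (π / 2 : ℝ))) ∧
    ∀ᵐ s, s ∈ Ioi L → mode csin v₁ s = -(β * (nexp L 1 s * (π / 2 : ℝ))) := by
  have loc : ∀ {w : ℝ² → ℂ}, MemLp w 2 μ[strip] → MemLp w 2 μ[box (Ioi L)] := fun hw =>
    hw.mono_set (tail_subset hL)
  have h1 : ∀ᵐ s, s ∈ Ioi L → mode csin v s = β * (nexp L 1 s * (π / 2 : ℝ)) := by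
    have := mode_add isProfile_csin (loc h.memLp) (loc (memLp_Efun hL)) (-β)
    rw [ae_restrict_iff' measurableSet_Ioi] at this
    filter_upwards [this, hf] with s h1 h2 hs
    have h3 := h1 hs
    have e : (fun x => v x + -β * Efun L x) = fun x => v x - β * Efun L x := by ext x; ring
    rw [e, h2 hs, mode_Efun hs] at h3
    linear_combination -h3
  refine ⟨h1, ?_⟩
  have cn : Continuous fun s => -(β * (nexp L 1 s * ((π / 2 : ℝ) : ℂ))) :=
    (continuous_const.mul ((contDiff_nexp L 1).continuous.mul continuous_const)).neg
  refine ae_eq_of_integral_smooth isOpen_Ioi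
    (locallyIntegrableOn_mode isProfile_csin fun r => (loc h.memLp₁).mono_set (box_mono Ioo_subset_Ioi_self))
    (cn.locallyIntegrable.locallyIntegrableOn _) ?_
  intro η c1 c2 c3
  have key := h.integral_mode_deriv c1 c2 (c3.trans (Ioi_subset_Ioi hL))
  have z : ∀ s, s ∉ Ioi L → η s = 0 ∧ deriv η s = 0 := fun s hs =>
    ⟨eq_zero_off fun h' => hs (c3 h'), eq_zero_off fun h' => hs (c3 (tsupport_deriv_subset _ h'))⟩
  have e0 : ∫ s, mode csin v s * deriv η s =
      ∫ s in Ioi L, β * (nexp L 1 s * (π / 2 : ℝ)) * deriv η s := by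
    rw [← setIntegral_eq_integral_of_forall_compl_eq_zero (s := Ioi L)
      (fun s hs => by rw [(z s hs).2, mul_zero])]
    refine setIntegral_congr_ae measurableSet_Ioi ?_
    filter_upwards [h1] with s hs hs'
    rw [hs hs']
  have e1 : ∫ s, -(β * (nexp L 1 s * (π / 2 : ℝ))) * η s =
      ∫ s in Ioi L, -(β * (nexp L 1 s * (π / 2 : ℝ))) * η s := by
    rw [setIntegral_eq_integral_of_forall_compl_eq_zero]
    intro s hs; rw [(z s hs).1, mul_zero]
  have e2 := integral_nexp_mul_deriv (L := L) c1 c2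
  rw [(z L (lt_irrefl L)).1, mul_zero, neg_zero, integral_sub] at e2
  · rw [e0] at key
    rw [e1]
    have f1 : ∀ s, β * (nexp L 1 s * (π / 2 : ℝ)) * deriv η s =
      β * (π / 2 : ℝ) * (nexp L 1 s * deriv η s) := fun s => by ring
    have f2 : ∀ s, -(β * (nexp L 1 s * (π / 2 : ℝ))) * η s =
      -(β * (π / 2 : ℝ)) * (nexp L 1 s * η s) := fun s => by ring
    simp_rw [f1, integral_const_mul] at key
    simp_rw [f2, integral_const_mul]
    linear_combination key - β * (π / 2 : ℝ) * e2
  · exact (((contDiff_nexp L 1).continuous.mul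
      (contDiff_deriv c1).continuous).integrable_of_hasCompactSupport c2.deriv.mul_left).integrableOn
  · exact (((contDiff_nexp L 1).continuous.mul
      c1.continuous).integrable_of_hasCompactSupport c2.mul_left).integrableOn

/-- The trace at `x₁ = L` is written as a volume integral, because `(v - ∂₁v) E = -∂₁(v E)` on the
tail. With first mode `β E` the integrand doubles, and the normalization `nrm² π/2 = 1` returns
exactly `β`. -/
lemma InEnergy.tau_eq (h : InEnergy a p strip v v₁ v₂) (hL : 0 ≤ L) {β : ℂ}
    (hf : TailFree L (fun x => v x - β * Efun L x)) :
    ∫ x in strip, (v x - v₁ x) * Efun L x = β := by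
  obtain ⟨h1, h2⟩ := h.mode_of_tailFree hL hf
  have loc : ∀ {w : ℝ² → ℂ}, MemLp w 2 μ[strip] → MemLp w 2 μ[box (Ioi L)] := fun hw =>
    hw.mono_set (tail_subset hL)
  rw [Efun, integral_tail_mode (w := fun x => v x - v₁ x) isProfile_csin norm_csin_le hL
    (h.memLp.sub h.memLp₁) (memLp_nexp (by simp))]
  have h3 := mode_add isProfile_csin (loc h.memLp) (loc h.memLp₁) (-1)
  rw [ae_restrict_iff' measurableSet_Ioi] at h3
  have e : ∫ s in Ioi L, mode csin (fun x => v x - v₁ x) s * nexp L 1 s =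
      ∫ s in Ioi L, (β * (π : ℝ)) * (nexp L 1 s * nexp L 1 s) := by
    refine setIntegral_congr_ae measurableSet_Ioi ?_
    filter_upwards [h1, h2, h3] with s k1 k2 k3 hs
    have k4 := k3 hs
    rw [k1 hs, k2 hs] at k4
    have : (fun x => v x + -1 * v₁ x) = fun x => v x - v₁ x := by ext x; ring
    rw [this] at k4
    rw [k4]; push_cast; ring
  change ∫ s in Ioi L, mode csin (fun x => v x - v₁ x) s * nexp L 1 s = β
  rw [e, integral_const_mul, integral_nexp_sq]
  have := nrm_sq
  push_cast at this ⊢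
  linear_combination β * this

end

section

/-! ### The reduced operator -/

lemma inner_eq_integral {A B : L2 Ω} (hA : A =ᵐ[μ[Ω]] fun x => conj (w x)) :
    ⟪A, B⟫_ℂ = ∫ x in Ω, B x * w x := by
  rw [L2.inner_def]
  refine integral_congr_ae ?_
  filter_upwards [hA] with x hx
  rw [RCLike.inner_apply, hx, conj_conj]

lemma csin_conj (y : ℝ) : conj (csin y) = csin y := conj_ofReal _

lemma contDiff_conj (hη : Smooth η) : Smooth (fun s => conj (η s)) :=
  conjCLE.toContinuousLinearMap.contDiff.comp hη

/-- The elements of `L²` that consist of a first mode on the tail. -/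
def tailSpan (L : ℝ) : Submodule ℂ (L2 strip) :=
  Submodule.span ℂ {g | ∃ η : ℝ → ℂ, Smooth η ∧ HasCompactSupport η ∧ tsupport η ⊆ Ioi L ∧
    g =ᵐ[μ[strip]] sep η csin}

/-- Pairing with `η(x₁) sin x₂` tests the first mode with the conjugate of `η`, and `η` runs through
all test functions on the tail. -/
lemma mem_orthogonal_tailSpan_iff (hL : 0 ≤ L) {w : L2 strip} :
    w ∈ (tailSpan L)ᗮ ↔ TailFree L w := by
  have hw := Lp.memLp w
  have key : ∀ η : ℝ → ℂ, Smooth η → HasCompactSupport η → tsupport η ⊆ Ioi L →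
      ∀ g : L2 strip, g =ᵐ[μ[strip]] sep (fun s => conj (η s)) csin →
      ⟪g, w⟫_ℂ = ∫ s, mode csin w s * η s := by
    intro η h1 h2 h3 g hg
    rw [inner_eq_integral (w := sep η csin), ← integral_strip_mode hL isProfile_csin (locMemLp hw)
      h1.continuous h2 h3]
    · refine setIntegral_congr_fun isOpen_strip.measurableSet fun x hx => ?_
      simp only [sep_eq (abs_le_four_of_mem hx).le]
    · filter_upwards [hg] with x hx
      rw [hx]
      simp [sep, csin_conj, conj_ofReal]
  have supp : ∀ η : ℝ → ℂ, tsupport (fun s => conj (η s)) = tsupport η := fun η => by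
    unfold tsupport; congr 1; ext s; simp
  have cc : ∀ {η : ℝ → ℂ}, HasCompactSupport η → HasCompactSupport fun s => conj (η s) :=
    fun h => h.comp_left (g := conj) (by simp)
  constructor
  · intro h
    have := ae_eq_of_integral_smooth (I := Ioi L) isOpen_Ioi (f := mode csin w) (g := fun _ => 0)
      (locallyIntegrableOn_mode isProfile_csin (memLp_box_of_strip hL (locMemLp hw)))
      (continuous_const.locallyIntegrable.locallyIntegrableOn _) fun η h1 h2 h3 => by
        have t := isTest_sep (contDiff_conj h1) (cc h2) contDiff_csin
        rw [← key η h1 h2 h3 ((t.memLp _).toLp _) (MemLp.coeFn_toLp _)]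
        simp only [zero_mul, integral_zero]
        refine (Submodule.mem_orthogonal _ _).1 h _ (Submodule.subset_span
          ⟨_, contDiff_conj h1, cc h2, by rw [supp]; exact h3, MemLp.coeFn_toLp _⟩)
    exact this
  · intro h
    rw [tailSpan, Submodule.mem_orthogonal]
    intro g hg
    induction hg using Submodule.span_induction with
    | mem g hg =>
      obtain ⟨η, h1, h2, h3, h4⟩ := hg
      rw [key (fun s => conj (η s)) (contDiff_conj h1) (cc h2) (by rw [supp]; exact h3) g
        (by simpa using h4)]
      rw [← setIntegral_eq_integral_of_forall_compl_eq_zero (s := Ioi L) fun s hs => by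
        rw [eq_zero_off fun h' => hs (h3 h')]; simp]
      rw [setIntegral_congr_ae (g := fun _ => (0 : ℂ)) measurableSet_Ioi]
      · simp
      · filter_upwards [h] with s hs hs'
        rw [hs hs', zero_mul]
    | zero => simp
    | add x y _ _ hx hy => rw [inner_add_left, hx, hy, add_zero]
    | smul c x _ hx => rw [inner_smul_left, hx, mul_zero]

/-- The projection onto the functions without first mode on the tail. -/
def freeProj (L : ℝ) : L2 strip →L[ℂ] L2 strip := (tailSpan L)ᗮ.starProjection

lemma tailFree_freeProj (hL : 0 ≤ L) (w : L2 strip) : TailFree L (freeProj L w) :=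
  (mem_orthogonal_tailSpan_iff hL).1 (Submodule.starProjection_apply_mem _ w)

lemma freeProj_eq_self (hL : 0 ≤ L) {w : L2 strip} (h : TailFree L w) : freeProj L w = w :=
  Submodule.starProjection_eq_self_iff.2 ((mem_orthogonal_tailSpan_iff hL).2 h)

lemma isSelfAdjoint_freeProj (L : ℝ) (v w : L2 strip) :
    ⟪freeProj L v, w⟫_ℂ = ⟪v, freeProj L w⟫_ℂ := Submodule.inner_starProjection_left_eq_right _ v w

lemma inner_freeProj_self (L : ℝ) (v : L2 strip) :
    ⟪v, freeProj L v⟫_ℂ = (‖freeProj L v‖ ^ 2 : ℝ) := by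
  have : freeProj L (freeProj L v) = freeProj L v :=
    Submodule.starProjection_eq_self_iff.2 (Submodule.starProjection_apply_mem _ v)
  rw [← this, ← isSelfAdjoint_freeProj, this, inner_self_eq_norm_sq_to_K]
  norm_cast

/-- `E` as an element of `L²`. -/
def Evec (hL : 0 ≤ L) : L2 strip := (memLp_Efun hL).toLp _

lemma nexp_one_conj (L s : ℝ) : conj (nexp L 1 s) = nexp L 1 s := by
  rw [nexp, map_mul, ← exp_conj, nrm, conj_ofReal]
  simp [conj_ofReal]

lemma Efun_conj (L : ℝ) (x : ℝ²) : conj (Efun L x) = Efun L x := by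
  by_cases h : L < x.1
  · rw [Efun, onTail_of_lt h, map_mul, csin_conj, nexp_one_conj]
  · rw [Efun, onTail_of_le (not_lt.1 h), map_zero]

lemma inner_Evec (hL : 0 ≤ L) (w : L2 strip) : ⟪Evec hL, w⟫_ℂ = ∫ x in strip, w x * Efun L x :=
  inner_eq_integral (by
    filter_upwards [(memLp_Efun hL).coeFn_toLp] with x hx
    rw [Efun_conj]; exact hx)

/-- `E` consists of a first mode on the tail alone, so it is orthogonal to all functions without
such a mode. Thus the projection turns `w` with first mode `β E` into `w - β E`. -/
lemma freeProj_Evec (hL : 0 ≤ L) : freeProj L (Evec hL) = 0 := by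
  refine (Submodule.starProjection_apply_eq_zero_iff _).2 ?_
  rw [Submodule.mem_orthogonal']
  intro w hw
  rw [mem_orthogonal_tailSpan_iff hL] at hw
  rw [inner_Evec, Efun, integral_tail_mode isProfile_csin norm_csin_le hL (Lp.memLp w)
    (memLp_nexp (by simp)), setIntegral_congr_ae (g := fun _ => (0 : ℂ)) measurableSet_Ioi]
  · simp
  · filter_upwards [hw] with s hs hs'
    rw [hs hs', zero_mul]

lemma freeProj_of_tailFree_sub (hL : 0 ≤ L) {w : L2 strip} {β : ℂ}
    (h : TailFree L (fun x => w x - β * Efun L x)) :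
    freeProj L w =ᵐ[μ[strip]] fun x => w x - β * Efun L x := by
  have e : (w - β • Evec hL : L2 strip) =ᵐ[μ[strip]] fun x => w x - β * Efun L x := by
    filter_upwards [Lp.coeFn_sub w (β • Evec hL), Lp.coeFn_smul β (Evec hL),
      (memLp_Efun hL).coeFn_toLp] with x h1 h2 h3
    rw [h1, Pi.sub_apply, h2, Pi.smul_apply, smul_eq_mul, Evec, h3]
  have h1 : TailFree L (w - β • Evec hL : L2 strip) := by
    have := mode_congr csin (ae_restrict_of_ae_restrict_of_subset (tail_subset hL) e)
    rw [EventuallyEq, ae_restrict_iff' measurableSet_Ioi] at this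
    filter_upwards [this, h] with s h1 h2 hs
    rw [h1 hs, h2 hs]
  have h2 := freeProj_eq_self hL h1
  rw [map_sub, map_smul, freeProj_Evec, smul_zero, sub_zero] at h2
  rwa [h2]

/-- The components of an element of the energy space. -/
def cmp (a : ℝ) (p : Parity) (Ω : Set ℝ²) (α : MultiIndex 1) : energyMod a p Ω →L[ℂ] L2 Ω :=
  (PiLp.proj 2 _ α).comp (energyMod a p Ω).subtypeL

abbrev Energy (a : ℝ) (p : Parity) : Type := energyMod a p strip

abbrev val (v : Energy a p) : L2 strip := cmp a p strip (MultiIndex.zero 1) v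
abbrev dx₁ (v : Energy a p) : L2 strip := cmp a p strip e₁ v
abbrev dx₂ (v : Energy a p) : L2 strip := cmp a p strip e₂ v

lemma Energy.inEnergy (v : Energy a p) : InEnergy a p strip (val v) (dx₁ v) (dx₂ v) :=
  mem_energyMod_iff.1 v.2

lemma Energy.ext_val {v w : Energy a p} (h : val v = val w) : v = w := by
  refine Subtype.ext (Tuple.ext h ?_ ?_)
  · exact Lp.ext (v.inEnergy.unique₁ w.inEnergy isOpen_strip (by rw [h]))
  · exact Lp.ext (v.inEnergy.unique₂ w.inEnergy isOpen_strip (by rw [h]))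

lemma inner_energy (v w : Energy a p) :
    ⟪v, w⟫_ℂ = ⟪val v, val w⟫_ℂ + ⟪dx₁ v, dx₁ w⟫_ℂ + ⟪dx₂ v, dx₂ w⟫_ℂ := by
  rw [Submodule.coe_inner, PiLp.inner_apply, Tuple.sum]
  rfl

lemma norm_sq_energy (v : Energy a p) : ‖v‖ ^ 2 = ‖val v‖ ^ 2 + ‖dx₁ v‖ ^ 2 + ‖dx₂ v‖ ^ 2 := by
  have h : ⟪v, v⟫_ℂ = (‖v‖ : ℂ) ^ 2 := inner_self_eq_norm_sq_to_K v
  have := inner_energy v v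
  rw [h, inner_self_eq_norm_sq_to_K, inner_self_eq_norm_sq_to_K, inner_self_eq_norm_sq_to_K] at this
  refine ofReal_injective ?_
  push_cast
  exact this

/-- The normalized trace of the first mode at the end of the tail. -/
def tau (a : ℝ) (p : Parity) (hL : 0 ≤ L) : Energy a p →L[ℂ] ℂ :=
  (innerSL ℂ (Evec hL)).comp (cmp a p strip (MultiIndex.zero 1) - cmp a p strip e₁)

lemma tau_apply (hL : 0 ≤ L) (v : Energy a p) :
    tau a p hL v = ∫ x in strip, (val v x - dx₁ v x) * Efun L x := by
  change ⟪Evec hL, val v - dx₁ v⟫_ℂ = _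
  rw [inner_Evec]
  refine integral_congr_ae ?_
  filter_upwards [Lp.coeFn_sub (val v) (dx₁ v)] with x hx
  rw [hx, Pi.sub_apply]

open ContinuousLinearMap in
/-- The reduced operator, whose form is
`⟨∇v, ∇w⟩ - (1 - m²)⟨(1 - P)v, w⟩ + (m - 1) τ(v) τ(w)`. -/
def redOp (a : ℝ) (p : Parity) (hL : 0 ≤ L) (m : ℂ) : Energy a p →L[ℂ] Energy a p :=
  adjoint (cmp a p strip e₁) ∘L cmp a p strip e₁ + adjoint (cmp a p strip e₂) ∘L cmp a p strip e₂ -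
    (1 - m ^ 2) • (adjoint (cmp a p strip (MultiIndex.zero 1)) ∘L freeProj L ∘L
      cmp a p strip (MultiIndex.zero 1)) + (m - 1) • (adjoint (tau a p hL) ∘L tau a p hL)

/-- The right-hand side as an element of the energy space. -/
def src (a : ℝ) (p : Parity) : L2 strip →L[ℂ] Energy a p :=
  ContinuousLinearMap.adjoint (cmp a p strip (MultiIndex.zero 1))

lemma inner_src (w : Energy a p) (F : L2 strip) : ⟪w, src a p F⟫_ℂ = ⟪val w, F⟫_ℂ :=
  ContinuousLinearMap.adjoint_inner_right _ _ _

lemma inner_redOp (hL : 0 ≤ L) (m : ℂ) (v w : Energy a p) :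
    ⟪w, redOp a p hL m v⟫_ℂ = ⟪dx₁ w, dx₁ v⟫_ℂ + ⟪dx₂ w, dx₂ v⟫_ℂ -
      (1 - m ^ 2) * ⟪val w, freeProj L (val v)⟫_ℂ +
      (m - 1) * (conj (tau a p hL w) * tau a p hL v) := by
  simp only [redOp, ContinuousLinearMap.add_apply, ContinuousLinearMap.sub_apply,
    ContinuousLinearMap.smul_apply, ContinuousLinearMap.comp_apply, inner_add_right,
    inner_sub_right, ContinuousLinearMap.adjoint_inner_right]
  have hs : ∀ (c : ℂ) (z : Energy a p), ⟪w, c • z⟫_ℂ = c * ⟪w, z⟫_ℂ := fun c z =>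
    inner_smul_right w z c
  rw [hs, hs, ContinuousLinearMap.adjoint_inner_right, ContinuousLinearMap.adjoint_inner_right,
    RCLike.inner_apply, mul_comm (tau a p hL v)]

lemma tau_conj (hL : 0 ≤ L) (h : InEnergy a p strip w w₁ w₂) :
    conj (tau a p hL h.star.toTuple) = ∫ x in strip, (w x - w₁ x) * Efun L x := by
  rw [tau_apply, ← integral_conj]
  refine integral_congr_ae ?_
  filter_upwards [h.star.toTuple_zero, h.star.toTuple_e₁] with x h0 h1
  change conj (((h.star.toTuple : Tuple strip) (MultiIndex.zero 1) x -
    (h.star.toTuple : Tuple strip) e₁ x) * Efun L x) = _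
  rw [h0, h1, map_mul, map_sub, conj_conj, conj_conj, Efun_conj]

lemma InEnergy.inner_val (hw : InEnergy a p strip w w₁ w₂) (B : L2 strip) :
    ⟪val hw.star.toTuple, B⟫_ℂ = ∫ x in strip, B x * w x := inner_eq_integral hw.star.toTuple_zero

lemma InEnergy.inner_dx₁ (hw : InEnergy a p strip w w₁ w₂) (B : L2 strip) :
    ⟪dx₁ hw.star.toTuple, B⟫_ℂ = ∫ x in strip, B x * w₁ x := inner_eq_integral hw.star.toTuple_e₁

lemma InEnergy.inner_dx₂ (hw : InEnergy a p strip w w₁ w₂) (B : L2 strip) :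
    ⟪dx₂ hw.star.toTuple, B⟫_ℂ = ∫ x in strip, B x * w₂ x := inner_eq_integral hw.star.toTuple_e₂

lemma inner_redOp_add_src (hL : 0 ≤ L) (m : ℂ) (v : Energy a p) (F : L2 strip)
    (hw : InEnergy a p strip w w₁ w₂) :
    ⟪hw.star.toTuple, redOp a p hL m v + src a p F⟫_ℂ =
      (∫ x in strip, (dx₁ v x * w₁ x + dx₂ v x * w₂ x)) -
      ((1 - m ^ 2) * (∫ x in strip, freeProj L (val v) x * w x) - (∫ x in strip, F x * w x) -
        (m - 1) * tau a p hL v * ∫ x in strip, (w x - w₁ x) * Efun L x) := by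
  rw [inner_add_right, inner_redOp, inner_src, tau_conj hL hw, hw.inner_val, hw.inner_val, hw.inner_dx₁, hw.inner_dx₂,
    integral_add (memLp_mul (Lp.memLp _) hw.memLp₁) (memLp_mul (Lp.memLp _) hw.memLp₂)]
  ring

/-- The reduced equation, tested with an element of the energy space. -/
lemma redOp_test (hL : 0 ≤ L) {v : Energy a p} {F : L2 strip}
    (h : redOp a p hL m v = - src a p F) (hw : InEnergy a p strip w w₁ w₂) :
    ∫ x in strip, (dx₁ v x * w₁ x + dx₂ v x * w₂ x) =
      (1 - m ^ 2) * (∫ x in strip, freeProj L (val v) x * w x) - (∫ x in strip, F x * w x) -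
        (m - 1) * tau a p hL v * ∫ x in strip, (w x - w₁ x) * Efun L x := by
  have := inner_redOp_add_src hL m v F hw
  rw [h, neg_add_cancel, inner_zero_right] at this
  exact (sub_eq_zero.1 this.symm)

/-- The reduced equation in weak form. -/
lemma redOp_iff (hL : 0 ≤ L) {v : Energy a p} {F : L2 strip} : redOp a p hL m v = - src a p F ↔
    WeakSol a p (dx₁ v) (dx₂ v)
      (fun x => (1 - m ^ 2) * freeProj L (val v) x - F x - (m - 1) * tau a p hL v * Efun L x)
      (fun x => (m - 1) * tau a p hL v * Efun L x) := by
  have hE := memLp_Efun hL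
  have reg : ∀ φ, IsTest φ → (1 - m ^ 2) * (∫ x in strip, freeProj L (val v) x * φ x) -
      (∫ x in strip, F x * φ x) - (m - 1) * tau a p hL v *
        ∫ x in strip, (φ x - pd₁ φ x) * Efun L x = ∫ x in strip, (((1 - m ^ 2) *
      freeProj L (val v) x - F x - (m - 1) * tau a p hL v * Efun L x) * φ x +
      (m - 1) * tau a p hL v * Efun L x * pd₁ φ x) := fun φ hφ =>
    (((((memLp_mul (Lp.memLp _) (hφ.memLp _)).hi.mul _).sub
      (memLp_mul (Lp.memLp _) (hφ.memLp _)).hi).sub ((memLp_mul ((hφ.memLp _).sub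
      (hφ.d₁.memLp _)) hE).hi.mul _)).congr (ae_of_all _ fun x => by
        simp only [Pi.sub_apply]; ring)).2.symm
  refine ⟨fun h => ⟨locMemLp (Lp.memLp _), locMemLp (Lp.memLp _), locMemLp
    ((((Lp.memLp _).const_mul _).sub (Lp.memLp _)).sub (hE.const_mul _)),
    locMemLp (hE.const_mul _), fun φ hφ => (redOp_test hL h (.of_test hφ)).trans (reg φ hφ.1)⟩,
    fun h => ?_⟩
  set X := redOp a p hL m v + src a p F with hX
  suffices hz : X = 0 from eq_neg_of_add_eq_zero_left hz
  -- The defect `X` is orthogonal to the boundary test functions, hence to their closure, to which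
  -- `X` itself belongs.
  have key : ∀ W ∈ closure (testTuples a p strip), ⟪W, (X : Tuple strip)⟫_ℂ = 0 := by
    intro W hW
    refine closure_minimal (t := {W | ⟪W, (X : Tuple strip)⟫_ℂ = 0}) ?_
      (isClosed_eq (by fun_prop) continuous_const) hW
    rintro W ⟨φ, hφ, hWφ⟩
    have hw : InEnergy a p strip _ _ _ := InEnergy.of_test hφ.star
    have h1 := inner_redOp_add_src hL m v F hw
    rw [h.weak _ hφ.star, reg _ hφ.star.1, sub_self] at h1
    have e : W = (hw.star.toTuple : Tuple strip) := by
      refine Tuple.ext (Lp.ext ?_) (Lp.ext ?_) (Lp.ext ?_)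
      · filter_upwards [hWφ (MultiIndex.zero 1), hw.star.toTuple_zero] with x h1 h2
        rw [h1, h2, partialD_zero, conj_conj]
      · filter_upwards [hWφ e₁, hw.star.toTuple_e₁] with x h1 h2
        rw [h1, h2, partialD_e₁, pd₁_conj, conj_conj]
      · filter_upwards [hWφ e₂, hw.star.toTuple_e₂] with x h1 h2
        rw [h1, h2, partialD_e₂, pd₂_conj, conj_conj]
    rw [mem_setOf_eq, e]
    exact h1
  have hm : (X : Tuple strip) ∈ closure (testTuples a p strip) := X.2
  have := key _ hm
  rw [inner_self_eq_zero] at this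
  exact Subtype.ext this

end

section

/-! ### From the reduced equation to solutions -/

lemma eq_zero_of_memLp_exp {κ A : ℂ} (hκ : 0 ≤ κ.re)
    (h : MemLp (fun s : ℝ => A * exp (κ * s)) 2 μ[Ioi L]) : A = 0 := by
  by_contra hA
  have hi := memLp_norm_sq h
  have h1 : IntegrableOn (fun s : ℝ => ‖A * exp (κ * s)‖ ^ 2) (Ioi (max L 0)) :=
    IntegrableOn.mono_set hi (Ioi_subset_Ioi (le_max_left _ _))
  have h2 : IntegrableOn (fun _ : ℝ => ‖A‖ ^ 2) (Ioi (max L 0)) := by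
    refine Integrable.mono' h1 (by fun_prop) ?_
    filter_upwards [ae_restrict_mem measurableSet_Ioi] with s hs
    have hs0 : 0 < s := lt_of_le_of_lt (le_max_right _ _) hs
    rw [norm_mul, norm_exp, mul_pow, norm_eq_abs, abs_of_nonneg (by positivity)]
    have : (1 : ℝ) ≤ Real.exp (κ * s).re := by
      rw [Real.one_le_exp_iff, mul_re, ofReal_re, ofReal_im]
      simpa using mul_nonneg hκ hs0.le
    nlinarith [sq_nonneg ‖A‖, one_le_pow₀ this (n := 2)]
  rw [integrableOn_const_iff] at h2
  rcases h2 with h2 | h2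
  · simp [hA] at h2
  · simp at h2

/-- A square integrable solution of `q'' = κ² q` on a half-line decays. -/
lemma weak_ode_decay {q : ℝ → ℂ} (hq : MemLp q 2 μ[Ioi L]) {κ : ℂ} (hκ : 0 < κ.re)
    (h : ∀ η : ℝ → ℂ, Smooth η → HasCompactSupport η → tsupport η ⊆ Ioi L →
      ∫ x, q x * (deriv (deriv η) x - κ ^ 2 * η x) = 0) :
    ∃ B : ℂ, ∀ᵐ s, s ∈ Ioi L → q s = B * exp (-κ * s) := by
  have hκ0 : κ ≠ 0 := fun h => by simp [h] at hκ
  obtain ⟨A, B, hAB⟩ := weak_ode isOpen_Ioi ordConnected_Ioi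
    (hq.locallyIntegrable (by norm_num) |>.mono_measure le_rfl |> fun h =>
      locallyIntegrableOn_of_locallyIntegrable_restrict h) κ
    -- For `κ ≠ 0` this solves `F' + κ F = e^{κ x}`. Being a multiple of the growing exponential, it
    -- is excluded by square integrability.
    (F := fun x => exp (κ * x) / (2 * κ)) (fun x => by
      refine ((hasDerivAt_cexp_mul κ x).div_const (2 * κ)).congr_deriv ?_
      field_simp; ring) h
  have h1 : MemLp (fun s : ℝ => A / (2 * κ) * exp (κ * s)) 2 μ[Ioi L] := by
    have h2 : MemLp (fun s : ℝ => B * exp (-κ * s)) 2 μ[Ioi L] := by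
      refine ((memLp_nexp (L := L) hκ).const_mul (B / nrm * exp (-κ * L))).ae_eq
        (ae_of_all _ fun s => ?_)
      simp only [nexp]
      have : exp (-κ * s) = exp (-κ * L) * exp (-κ * (s - L)) := by
        rw [← exp_add]; congr 1; ring
      rw [this]
      have := nrm_ne_zero
      field_simp
    refine (hq.sub h2).ae_eq ?_
    filter_upwards [ae_restrict_of_ae hAB, ae_restrict_mem measurableSet_Ioi] with s h1 h2
    rw [Pi.sub_apply, h1 h2]; ring
  have hA := eq_zero_of_memLp_exp hκ.le h1
  refine ⟨B, ?_⟩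
  filter_upwards [hAB] with s h1 h2
  rw [h1 h2]
  linear_combination exp (κ * s) * hA

lemma sep_vanish (hL : 0 ≤ L) (hs : tsupport η ⊆ Ioi L)
    (h0 : k 0 = 0) (hpi : k π = 0) : ∀ x ∈ dirichletSet a p, sep η k x = 0 := by
  rintro x ((⟨hx, -⟩ | ⟨hx, -⟩) | ⟨-, hx, -⟩)
  · rw [sep, hx, hpi]; simp
  · rw [sep, hx, h0]; simp
  · rw [sep, hx, eq_zero_off (fun h => not_lt.2 hL (hs h))]; simp

/-- The integral is a trace at `x₁ = L`, which vanishes with `η(L)`. So `τ` drops out of the reduced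
equation tested inside the tail. -/
lemma integral_sep_sub_mul_Efun (hL : 0 ≤ L) (hη : Smooth η)
    (hc : HasCompactSupport η) (h0 : η L = 0) :
    ∫ x in strip, (sep η csin x - pd₁ (sep η csin) x) * Efun L x = 0 := by
  have t := isTest_sep hη hc contDiff_csin
  have cg : Smooth (fun x : ℝ² => nexp L 1 x.1 * csin x.2) :=
    ((contDiff_nexp L 1).comp contDiff_fst).mul (contDiff_csin.comp contDiff_snd)
  have i := integral_tail_pd₁ (L := L) (t.mul cg) (fun y _ _ => by simp [sep, h0])
  rw [Efun, integral_strip_onTail hL, ← neg_eq_zero, ← integral_neg, ← i]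
  congr 1; ext x
  rw [pd₁_mul (cg.diff x) (t.1.diff x),
    (hasFDerivAt_prod_mul ((contDiff_nexp L 1).diff _)
      (contDiff_csin.diff _)).1, deriv_nexp]
  ring

variable {v : Energy a p} {F : L2 strip}

lemma eq_zero_of_tsupport_Ioi (hs : tsupport η ⊆ Ioi L) (h : s ≤ L) : η s = 0 ∧ deriv η s = 0 :=
  ⟨eq_zero_off fun h' => not_lt.2 h (hs h'),
    eq_zero_off fun h' => not_lt.2 h (hs (tsupport_deriv_subset _ h'))⟩

/-- For a solution of the reduced equation the first mode on the tail is `τ e^{-(s - L)}`. -/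
lemma redOp_tailFree (hL : a ≤ L) (hL0 : 0 ≤ L) (hF : ∀ᵐ x ∂μ[strip], L < x.1 → F x = 0)
    (h : redOp a p hL0 m v = - src a p F) :
    TailFree L (fun x => val v x - tau a p hL0 v * Efun L x) := by
  have hv := v.inEnergy
  have tailm : ∀ {w : ℝ² → ℂ}, MemLp w 2 μ[strip] → MemLp w 2 μ[box (Ioi L)] := fun hw =>
    hw.mono_set (tail_subset hL0)
  -- Tested with `η(x₁) sin x₂`, the right-hand side of the reduced equation disappears: neither
  -- `freeProj L (val v)` nor `F` has a first mode on the tail. So the mode satisfies `q'' = q`,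
  -- independently of `m`.
  obtain ⟨B, hB⟩ := weak_ode_decay (memLp_mode (tailm hv.memLp) isProfile_csin).1
    (κ := 1) (by simp) (fun η h1 h2 h3 => by
      have t := isTest_sep h1 h2 contDiff_csin
      have e := integral_sep_laplacian (fun r _ => hv.mono (stripTo_subset r)) h1 h2 contDiff_csin
        (ν := -1) (fun y => by rw [deriv_csin, deriv_ccos]; ring)
        (fun s _ hs => by rw [(eq_zero_of_tsupport_Ioi h3 (hs.le.trans hL)).1, zero_mul])
        (fun _ => (eq_zero_of_tsupport_Ioi h3 hL0).2)
      have e' := redOp_test hL0 h (InEnergy.of_vanish (Ω := strip) t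
        (sep_vanish (a := a) (p := p) hL0 h3 csin_zero csin_pi))
      rw [integral_sep_sub_mul_Efun hL0 h1 h2 (eq_zero_of_tsupport_Ioi h3 le_rfl).1, mul_zero,
        sub_zero] at e'
      have z1 : ∫ x in strip, freeProj L (val v) x * sep η csin x = 0 := by
        rw [setIntegral_congr_fun isOpen_strip.measurableSet
          (g := fun x => freeProj L (val v) x * (η x.1 * csin x.2)) fun x hx => by
            simp only [sep_eq (abs_le_four_of_mem hx).le],
          integral_strip_mode hL0 isProfile_csin (locMemLp (Lp.memLp _)) h1.continuous h2 h3]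
        refine integral_eq_zero_of_ae ?_
        filter_upwards [tailFree_freeProj hL0 (val v)] with s hs
        by_cases hsL : L < s
        · simp [hs hsL]
        · simp [(eq_zero_of_tsupport_Ioi h3 (not_lt.1 hsL)).1]
      have z2 : ∫ x in strip, F x * sep η csin x = 0 := by
        refine integral_eq_zero_of_ae ?_
        filter_upwards [hF] with x hx
        by_cases hsL : L < x.1
        · simp [hx hsL]
        · simp [sep, (eq_zero_of_tsupport_Ioi h3 (not_lt.1 hsL)).1]
      rw [e', z1, z2] at e
      have h1' : Smooth (fun s => deriv (deriv η) s + -1 * η s) :=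
        (contDiff_deriv (contDiff_deriv h1)).add (contDiff_const.mul h1)
      rw [integral_strip_mode (η := fun s => deriv (deriv η) s + -1 * η s) hL0 isProfile_csin
        (locMemLp hv.memLp) h1'.continuous (h2.deriv.deriv.add (h2.mul_left (f := fun _ => -1)))
        ((tsupport_add _ _).trans (union_subset (((tsupport_deriv_subset _).trans
          (tsupport_deriv_subset _)).trans h3) ((tsupport_mul_subset_right).trans h3)))] at e
      rw [← show (-((1 - m ^ 2) * 0 - 0) : ℂ) = 0 by ring, ← e]
      congr 1; ext s; ring)
  set β : ℂ := B * exp (-L) * nrm with hβ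
  have hfree : TailFree L (fun x => val v x - β * Efun L x) := by
    have h1 := mode_add isProfile_csin (tailm hv.memLp) (tailm (memLp_Efun hL0)) (-β)
    rw [ae_restrict_iff' measurableSet_Ioi] at h1
    filter_upwards [h1, hB] with s h1 h2 hs
    have e : (fun x => val v x + -β * Efun L x) = fun x => val v x - β * Efun L x := by
      ext x; ring
    rw [← e, h1 hs, h2 hs, mode_Efun hs, hβ, nexp]
    have : exp (-1 * s) = exp (-L) * exp (-1 * (s - L)) := by
      rw [← exp_add]; congr 1; ring
    rw [this]
    linear_combination -(B * exp (-L) * exp (-1 * (s - L))) * nrm_sq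
  have := hv.tau_eq hL0 hfree
  rw [← tau_apply hL0] at this
  rw [this]
  exact hfree

/-- A solution of the reduced equation, corrected on the tail, solves the boundary value problem. -/
lemma redOp_locSol (ha : 0 < a) (hL : a ≤ L) (hL0 : 0 ≤ L) (hF : ∀ᵐ x ∂μ[strip], L < x.1 → F x = 0)
    (h : redOp a p hL0 m v = - src a p F) :
    LocSol a p (fun x => val v x + tau a p hL0 v * onTail L (gam L m) csin x)
      (fun x => dx₁ v x + tau a p hL0 v * onTail L (deriv (gam L m)) csin x)
      (fun x => dx₂ v x + tau a p hL0 v * onTail L (gam L m) ccos x)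
      (fun x => (1 - m ^ 2) * (val v x + tau a p hL0 v * onTail L (gam L m) csin x) - F x) := by
  have hfree := redOp_tailFree hL hL0 hF h
  have hE : ∀ r, 0 < r → InEnergy a p (stripTo r) _ _ _ := fun r _ =>
    (v.inEnergy.mono (stripTo_subset r)).add
      ((inEnergy_onTail ha hL r (p := p) (contDiff_gam L m) (gam_self L m)).const_mul
        (tau a p hL0 v))
  have h' := ((redOp_iff hL0).1 h).add_mul (weakSol_gam ha hL m) (tau a p hL0 v)
  have h' := h'.congr .rfl .rfl (F := fun x =>
    (1 - m ^ 2) * (val v x + tau a p hL0 v * onTail L (gam L m) csin x) - F x) (S := 0) (by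
      filter_upwards [freeProj_of_tailFree_sub hL0 hfree] with x hx
      rw [hx]; ring) (ae_of_all _ fun x => by simp only [Pi.zero_apply]; ring)
  exact ⟨hE, h'.source, fun φ hφ => by simpa using h'.weak φ hφ⟩

end

section

/-! ### Pointwise decay on the tail -/

/-- The function `sin (n y)`. -/
def snn (n : ℕ) (y : ℝ) : ℂ := (Real.sin (n * y) : ℝ)

lemma contDiff_snn (n : ℕ) : Smooth (snn n) :=
  ofRealCLM.contDiff.comp (Real.contDiff_sin.comp (contDiff_const.mul contDiff_id))

lemma isProfile_snn (n : ℕ) : IsProfile (snn n) := isProfile_sin n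

lemma snn_one : snn 1 = csin := by ext y; simp [snn, csin]

lemma norm_snn_le (n : ℕ) (y : ℝ) : ‖snn n y‖ ≤ 1 := by
  rw [snn, norm_real]; exact Real.abs_sin_le_one _

lemma snn_zero (n : ℕ) : snn n 0 = 0 := by simp [snn]

lemma snn_pi (n : ℕ) : snn n π = 0 := by simp [snn, Real.sin_nat_mul_pi]

lemma deriv_deriv_snn (n : ℕ) (y : ℝ) : deriv (deriv (snn n)) y = -(n : ℂ) ^ 2 * snn n y := by
  have h1 : ∀ y, HasDerivAt (snn n) ((Real.cos (n * y) * n : ℝ) : ℂ) y := fun y => by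
    have : HasDerivAt (fun y => Real.sin (n * y)) (Real.cos (n * y) * n) y := by
      simpa using ((hasDerivAt_id y).const_mul (n : ℝ)).sin
    exact this.ofReal_comp
  have h2 : HasDerivAt (fun y : ℝ => ((Real.cos (n * y) * n : ℝ) : ℂ))
      ((-Real.sin (n * y) * n * n : ℝ) : ℂ) y := by
    have : HasDerivAt (fun y => Real.cos (n * y) * n) (-Real.sin (n * y) * n * n) y := by
      simpa using (((hasDerivAt_id y).const_mul (n : ℝ)).cos).mul_const (n : ℝ)
    exact this.ofReal_comp
  rw [show deriv (snn n) = fun y : ℝ => ((Real.cos (n * y) * n : ℝ) : ℂ) from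
    funext fun y => (h1 y).deriv, h2.deriv, snn]
  push_cast; ring

lemma integral_cos_int_mul {j : ℤ} (hj : j ≠ 0) : ∫ y in (0)..π, Real.cos (j * y) = 0 := by
  rw [intervalIntegral.integral_comp_mul_left (fun y => Real.cos y) (by exact_mod_cast hj)]
  simp [Real.sin_int_mul_pi]

lemma integral_snn_mul_snn {n k : ℕ} (hn : 1 ≤ n) (hnk : n ≠ k) :
    ∫ y in Ioo 0 π, snn n y * snn k y = 0 := by
  have h : ∀ y : ℝ, snn n y * snn k y = (((1 / 2) * (Real.cos (((n - k : ℤ) : ℝ) * y) -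
      Real.cos (((n + k : ℤ) : ℝ) * y)) : ℝ) : ℂ) := fun y => by
    rw [snn, snn, ← ofReal_mul]
    congr 1
    push_cast
    rw [sub_mul, add_mul, Real.cos_sub, Real.cos_add]
    ring
  simp_rw [h]
  rw [integral_complex_ofReal, ← integral_Ioc_eq_integral_Ioo,
    ← intervalIntegral.integral_of_le pi_pos.le, intervalIntegral.integral_const_mul,
    intervalIntegral.integral_sub, integral_cos_int_mul (by omega), integral_cos_int_mul (by omega)]
  · simp
  · exact Continuous.intervalIntegrable (by fun_prop) _ _
  · exact Continuous.intervalIntegrable (by fun_prop) _ _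

lemma integral_snn_sq {n : ℕ} (hn : 1 ≤ n) : ∫ y in Ioo 0 π, snn n y * snn n y = (π / 2 : ℝ) := by
  have h : ∀ y : ℝ, snn n y * snn n y = (((1 / 2) - (1 / 2) * Real.cos (((2 * n : ℤ) : ℝ) * y) : ℝ)
      : ℂ) := fun y => by
    rw [snn, ← ofReal_mul]
    congr 1
    push_cast
    rw [mul_assoc, Real.cos_two_mul']
    nlinarith [Real.sin_sq_add_cos_sq (n * y)]
  simp_rw [h]
  rw [integral_complex_ofReal, ← integral_Ioc_eq_integral_Ioo,
    ← intervalIntegral.integral_of_le pi_pos.le, intervalIntegral.integral_sub,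
    intervalIntegral.integral_const_mul, integral_cos_int_mul (by omega)]
  · simp; ring
  · exact Continuous.intervalIntegrable (by fun_prop) _ _
  · exact Continuous.intervalIntegrable (by fun_prop) _ _

/-- A function whose sine coefficients decay exponentially is bounded. -/
lemma ae_norm_le_of_sine_coeff {f : ℝ → ℂ} (hf : MemLp f 2 μ[Ioo 0 π]) {M : ℝ} (h : ∀ n : ℕ, 1 ≤ n →
      ‖∫ y in Ioo 0 π, f y * snn n y‖ ≤ M * Real.exp (-n)) :
    ∀ᵐ y ∂μ[Ioo 0 π], ‖f y‖ ≤ M * ∑' n : ℕ, Real.exp (-(n + 1 : ℕ)) := by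
  have hpi := pi_pos
  set b : ℕ → ℂ := fun n => ∫ y in Ioo 0 π, f y * snn (n + 1) y with hb
  have hsum : Summable fun n : ℕ => Real.exp (-(n + 1 : ℕ)) := by
    have := (Real.summable_exp_neg_nat).comp_injective (add_left_injective 1)
    exact this
  set T : ℕ → ℝ → ℂ := fun n y => ((2 / π : ℝ) : ℂ) * b n * snn (n + 1) y with hT
  have hTn : ∀ n y, ‖T n y‖ ≤ M * Real.exp (-(n + 1 : ℕ)) := fun n y => by
    have h1 := h (n + 1) (by omega)
    have h2 : (2 / π) ≤ 1 := by
      rw [div_le_one hpi]; exact Real.two_le_pi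
    simp only [hT]
    rw [norm_mul, norm_mul, norm_real, norm_eq_abs, abs_of_pos (by positivity)]
    calc 2 / π * ‖b n‖ * ‖snn (n + 1) y‖ ≤ 1 * ‖b n‖ * 1 := by
          gcongr; exact norm_snn_le _ _
      _ ≤ _ := by simpa [hb] using h1
  have hTs : Summable fun n : ℕ => M * Real.exp (-(n + 1 : ℕ)) := hsum.mul_left M
  have hTc : ∀ n, Continuous (T n) := fun n =>
    continuous_const.mul (contDiff_snn _).continuous
  set g : ℝ → ℂ := fun y => ∑' n, T n y with hg
  have hgc : Continuous g := continuous_tsum hTc hTs hTn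
  have hcoef : ∀ k : ℕ, ∫ y in Ioo 0 π, g y * snn (k + 1) y = b k := by
    intro k
    have hs : ∀ n, Integrable (fun y => T n y * snn (k + 1) y) μ[Ioo 0 π] :=
      fun n => memLp_mul (memLp_Ioo_of_continuous (hTc n))
        (memLp_Ioo_of_continuous (contDiff_snn _).continuous)
    have e1 : ∫ y in Ioo 0 π, g y * snn (k + 1) y =
        ∫ y in Ioo 0 π, ∑' n, T n y * snn (k + 1) y := by
      congr 1; ext y; simp only [hg]; rw [tsum_mul_right]
    rw [e1, ← integral_tsum_of_summable_integral_norm hs]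
    · rw [tsum_eq_single k]
      · simp only [hT, mul_assoc]
        rw [integral_const_mul, integral_const_mul, integral_snn_sq (by omega)]
        have : (π : ℂ) ≠ 0 := by exact_mod_cast hpi.ne'
        push_cast; field_simp
      · intro n hn
        simp only [hT, mul_assoc]
        rw [integral_const_mul, integral_const_mul, integral_snn_mul_snn (by omega) (by omega)]
        simp
    · refine Summable.of_nonneg_of_le (fun n => integral_nonneg fun _ => norm_nonneg _)
        (fun n => ?_) (hTs.mul_right π)
      have : ∫ y in Ioo 0 π, ‖T n y * snn (k + 1) y‖ ≤
          ∫ y in Ioo 0 π, M * Real.exp (-(n + 1 : ℕ)) := by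
        refine integral_mono_ae (hs n).norm (integrable_const _) (ae_of_all _ fun y => ?_)
        simp only [norm_mul]
        calc ‖T n y‖ * ‖snn (k + 1) y‖ ≤ ‖T n y‖ * 1 := by gcongr; exact norm_snn_le _ _
          _ ≤ _ := by rw [mul_one]; exact hTn n y
      refine this.trans (le_of_eq ?_)
      simp [hpi.le, mul_comm]
  -- The sine series `g` converges uniformly and has the coefficients of `f`, so completeness of the
  -- sines gives `f = g` almost everywhere.
  have hz := ae_eq_zero_of_sine (f := fun y => f y - g y) (hf.sub (memLp_Ioo_of_continuous hgc))
    (fun n hn => by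
      obtain ⟨k, rfl⟩ : ∃ k, n = k + 1 := ⟨n - 1, by omega⟩
      have e : ∀ y : ℝ, (f y - g y) * ((Real.sin ((k + 1 : ℕ) * y) : ℝ) : ℂ) =
        f y * snn (k + 1) y - g y * snn (k + 1) y := fun y => by simp only [snn]; ring
      simp_rw [e]
      rw [integral_sub (memLp_mul hf (memLp_Ioo_of_continuous (contDiff_snn _).continuous))
        (memLp_mul (memLp_Ioo_of_continuous hgc)
          (memLp_Ioo_of_continuous (contDiff_snn _).continuous)), hcoef, sub_self])
  filter_upwards [hz] with y hy
  rw [sub_eq_zero.1 hy, ← tsum_mul_left]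
  exact tsum_of_norm_bounded hTs.hasSum fun n => hTn n y

/-- The `L²` norm on `(L, L + 1)` bounds the amplitude of each mode. Beyond `L + 2` there is one
more unit of length, over which the `n`-th mode loses a factor of order `e^{-n}`. This makes the
sine series summable, with the rate of the second mode as the common decay. -/
lemma sine_decay (hz : MemLp z 2 μ[box (Ioi L)])
    {κ : ℕ → ℂ} (h1 : ∀ᵐ s, s ∈ Ioi L → mode (snn 1) z s = 0)
    (hn : ∀ n, 2 ≤ n → ∃ B : ℂ, ∀ᵐ s, s ∈ Ioi L → mode (snn n) z s = B * exp (-κ n * s))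
    (hκ : ∀ n, 2 ≤ n → (κ 2).re ≤ (κ n).re ∧ (n : ℝ) - 1 ≤ (κ n).re) :
    ∃ C, ∀ᵐ x ∂μ[box (Ioi (L + 2))], ‖z x‖ ≤ C * Real.exp (-(κ 2).re * x.1) := by
  set K := π * ∫ x in box (Ioi L), ‖z x‖ ^ 2 with hK
  have K0 : 0 ≤ K := mul_nonneg pi_pos.le (integral_nonneg fun _ => by positivity)
  set ρ := (κ 2).re
  set C₀ := √K * Real.exp (ρ * (L + 2)) * Real.exp 1 with hC₀
  have C₀0 : 0 ≤ C₀ := by positivity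
  have bound : ∀ n : ℕ, 1 ≤ n → ∀ᵐ s, s ∈ Ioi (L + 2) →
      ‖mode (snn n) z s‖ ≤ C₀ * Real.exp (-ρ * s) * Real.exp (-n) := by
    intro n hn1
    rcases hn1.eq_or_lt with rfl | hn2
    · filter_upwards [h1] with s hs hs'
      rw [hs (lt_trans (by linarith) (show L + 2 < s from hs')), norm_zero]
      positivity
    · obtain ⟨B, hB⟩ := hn n hn2
      obtain ⟨hr1, hr2⟩ := hκ n hn2
      set r := (κ n).re
      have nexpB : ∀ s : ℝ, ‖B * exp (-κ n * s)‖ = ‖B‖ * Real.exp (-r * s) := fun s => by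
        rw [norm_mul, norm_exp, mul_re, ofReal_re, ofReal_im]
        simp [r]
      have hmm := memLp_mode hz (isProfile_snn n)
      have hBK : (‖B‖ * Real.exp (-r * (L + 1))) ^ 2 ≤ K := by
        have r0 : 0 ≤ r := by
          have : (2 : ℝ) ≤ n := by exact_mod_cast hn2
          linarith
        have i1 := memLp_norm_sq hmm.1
        have i2 : ∫ s in Ioo L (L + 1), ‖mode (snn n) z s‖ ^ 2 ≤ K :=
          (setIntegral_mono_set i1 (ae_of_all _ fun _ => by positivity)
            (Ioo_subset_Ioi_self.eventuallyLE)).trans hmm.2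
        refine le_trans ?_ i2
        have i3 : ∫ s in Ioo L (L + 1), (‖B‖ * Real.exp (-r * (L + 1))) ^ 2 ≤
            ∫ s in Ioo L (L + 1), ‖mode (snn n) z s‖ ^ 2 := by
          refine integral_mono_ae (integrable_const _) (IntegrableOn.mono_set i1 Ioo_subset_Ioi_self)
            ?_
          filter_upwards [ae_restrict_mem measurableSet_Ioo, ae_restrict_of_ae hB] with s hs h2
          rw [h2 hs.1, nexpB]
          have : Real.exp (-r * (L + 1)) ≤ Real.exp (-r * s) :=
            Real.exp_le_exp.2 (by nlinarith [hs.2])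
          gcongr
        simpa using i3
      have hB2 : ‖B‖ * Real.exp (-r * (L + 1)) ≤ √K := le_sqrt_of_sq_le hBK
      filter_upwards [hB] with s h2 hs
      have hs' : L + 2 < s := hs
      rw [h2 (by show L < s; linarith), nexpB]
      have e1 : Real.exp (-r * s) = Real.exp (-r * (L + 1)) * Real.exp (-r * (s - L - 1)) := by
        rw [← Real.exp_add]; congr 1; ring
      -- Split `s - L - 1 = (s - L - 2) + 1`: on the first part use `r ≥ ρ`, on the remaining unit
      -- use `r ≥ n - 1`.
      have e2 : Real.exp (-r * (s - L - 1)) ≤ Real.exp (ρ * (L + 2) + 1 + -ρ * s + -n) := by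
        apply Real.exp_le_exp.2
        nlinarith
      rw [e1, ← mul_assoc]
      calc ‖B‖ * Real.exp (-r * (L + 1)) * Real.exp (-r * (s - L - 1)) ≤
          √K * Real.exp (ρ * (L + 2) + 1 + -ρ * s + -n) := by gcongr
        _ = _ := by rw [hC₀, Real.exp_add, Real.exp_add, Real.exp_add]; ring
  have hall : ∀ᵐ s, ∀ n : ℕ, 1 ≤ n → s ∈ Ioi (L + 2) →
      ‖mode (snn n) z s‖ ≤ C₀ * Real.exp (-ρ * s) * Real.exp (-n) := by
    rw [ae_all_iff]; intro n
    by_cases hn1 : 1 ≤ n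
    · filter_upwards [bound n hn1] with s hs _; exact hs
    · exact ae_of_all _ fun s h => absurd h hn1
  have hz2 : MemLp z 2 μ[box (Ioi (L + 2))] :=
    hz.mono_set (box_mono (Ioi_subset_Ioi (by linarith)))
  set S := ∑' n : ℕ, Real.exp (-(n + 1 : ℕ)) with hS
  have hsl : ∀ᵐ s ∂μ[Ioi (L + 2)], ∀ᵐ y ∂μ[Ioo 0 π], ‖z (s, y)‖ ≤ C₀ * S * Real.exp (-ρ * s) := by
    filter_upwards [ae_slice_memLp hz2, ae_restrict_of_ae hall, ae_restrict_mem measurableSet_Ioi]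
      with s k1 k2 k3
    have := ae_norm_le_of_sine_coeff k1 (fun n hn => k2 n hn k3)
    filter_upwards [this] with y hy
    refine hy.trans (le_of_eq ?_)
    ring
  refine ⟨C₀ * S, ?_⟩
  have hm := hz2.1
  rw [restrict_box] at hm ⊢
  -- A measurable representative is needed to pass from almost every slice to almost every point of
  -- the product.
  set z' := hm.mk z
  have hzz := hm.ae_eq_mk
  have hsl' : ∀ᵐ s ∂μ[Ioi (L + 2)], ∀ᵐ y ∂μ[Ioo 0 π],
      ‖z' (s, y)‖ ≤ C₀ * S * Real.exp (-ρ * (s, y).1) := by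
    filter_upwards [hsl, Measure.ae_ae_of_ae_prod hzz] with s k1 k2
    filter_upwards [k1, k2] with y k3 k4
    have k4' : z (s, y) = z' (s, y) := k4
    rw [← k4']; exact k3
  have hset : MeasurableSet {x : ℝ² | ‖z' x‖ ≤ C₀ * S * Real.exp (-ρ * x.1)} :=
    measurableSet_le hm.stronglyMeasurable_mk.measurable.norm (by fun_prop)
  have := (Measure.ae_prod_iff_ae_ae hset).2 hsl'
  filter_upwards [this, hzz] with x k1 k2
  have k2' : z x = z' x := k2
  rw [k2']; exact k1

end

section

/-! ### Solutions of the reduced equation have the prescribed asymptotics -/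

/-- The sine modes of a solution on the tail satisfy `q'' = (n² - 1 + m²) q`. -/
lemma LocSol.mode_ode (h : LocSol a p u u₁ u₂ g) (hL : a ≤ L)
    (hL0 : 0 ≤ L) (hg : ∀ᵐ x ∂μ[strip], L < x.1 → g x = (1 - m ^ 2) * u x)
    (n : ℕ) (h1 : Smooth η) (h2 : HasCompactSupport η)
    (h3 : tsupport η ⊆ Ioi L) :
    ∫ s, mode (snn n) u s * (deriv (deriv η) s - ((n : ℂ) ^ 2 - 1 + m ^ 2) * η s) = 0 := by
  have e := h.mode_test (b := 1 - m ^ 2) h1 h2 (contDiff_snn n) (deriv_deriv_snn n)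
    (fun s _ hs => by rw [(eq_zero_of_tsupport_Ioi h3 (hs.le.trans hL)).1, zero_mul])
    (fun _ => (eq_zero_of_tsupport_Ioi h3 hL0).2) (sep_vanish hL0 h3 (snn_zero n) (snn_pi n))
    (hg.mono fun x hx => (lt_or_ge L x.1).symm.imp (fun h => (eq_zero_of_tsupport_Ioi h3 h).1) hx)
  rw [setIntegral_eq_integral_of_forall_compl_eq_zero fun s hs => ?_] at e
  · rw [← e]
    congr 1; ext s; ring
  · have hs' : s ≤ L := (not_lt.1 hs).trans hL0
    simp [(eq_zero_of_tsupport_Ioi h3 hs').1, (eq_zero_of_tsupport_Ioi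
      ((tsupport_deriv_subset η).trans h3) hs').2]

/-- The last formula combines `|√w|² = |w|` with `Re (√w)² = Re w`. It makes the real part of the
root monotone along real shifts of `w`, which orders the decay rates. -/
lemma re_sqrt {w : ℂ} (hw : 0 < w.re) : (w ^ (1 / 2 : ℂ)) ^ 2 = w ∧
    0 ≤ (w ^ (1 / 2 : ℂ)).re ∧ (w ^ (1 / 2 : ℂ)).re ^ 2 = (‖w‖ + w.re) / 2 := by
  have h0 : w ≠ 0 := fun h => by simp [h] at hw
  have h1 : (w ^ (1 / 2 : ℂ)) ^ 2 = w := by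
    rw [← cpow_nat_mul]; simp
  have h2 : 0 ≤ (w ^ (1 / 2 : ℂ)).re := by
    rw [cpow_def_of_ne_zero h0, exp_re]
    refine mul_nonneg (Real.exp_pos _).le (Real.cos_nonneg_of_mem_Icc ?_)
    have e : (log w * (1 / 2)).im = w.arg / 2 := by
      rw [show (1 / 2 : ℂ) = ((1 / 2 : ℝ) : ℂ) by push_cast; ring, im_mul_ofReal, log_im]; ring
    rw [e]
    constructor <;> linarith [neg_pi_lt_arg w, arg_le_pi w]
  refine ⟨h1, h2, ?_⟩
  have h3 : ‖w ^ (1 / 2 : ℂ)‖ ^ 2 = ‖w‖ := by rw [← norm_pow, h1]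
  have h4 : ((w ^ (1 / 2 : ℂ)) ^ 2).re = w.re := by rw [h1]
  rw [← normSq_eq_norm_sq, normSq_apply] at h3
  rw [pow_two, mul_re] at h4
  nlinarith

lemma re_sqrt_mono {w : ℂ} (hw : 0 < w.re) {t : ℝ} (ht : 0 ≤ t) :
    (w ^ (1 / 2 : ℂ)).re ≤ ((w + t) ^ (1 / 2 : ℂ)).re := by
  have hw' : 0 < (w + t).re := by simp; linarith
  obtain ⟨-, a1, a2⟩ := re_sqrt hw
  obtain ⟨-, b1, b2⟩ := re_sqrt hw'
  have hn : ‖w‖ ≤ ‖w + t‖ := by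
    refine (sq_le_sq₀ (norm_nonneg _) (norm_nonneg _)).1 ?_
    rw [← normSq_eq_norm_sq, ← normSq_eq_norm_sq, normSq_apply, normSq_apply]
    simp only [add_re, ofReal_re, add_im, ofReal_im, add_zero]
    nlinarith
  refine (sq_le_sq₀ a1 b1).1 ?_
  rw [a2, b2]
  simp only [add_re, ofReal_re]
  linarith

lemma le_re_sqrt {w : ℂ} {c : ℝ} (hc : 0 ≤ c) (h : c ^ 2 ≤ w.re) (hw : 0 < w.re) :
    c ≤ (w ^ (1 / 2 : ℂ)).re := by
  obtain ⟨-, b1, b2⟩ := re_sqrt hw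
  refine (sq_le_sq₀ hc b1).1 ?_
  rw [b2]
  linarith [re_le_norm w]

/-- The decay rates `√(n² - 1 + m²)` of the modes. -/
def rate (m : ℂ) (n : ℕ) : ℂ := (((n : ℂ) ^ 2 - 1) + m ^ 2) ^ (1 / 2 : ℂ)

lemma rate_two (m : ℂ) : rate m 2 = (3 + m ^ 2) ^ (1 / 2 : ℂ) := by
  unfold rate; norm_num

lemma abs_re_sq_le (hm : ‖m‖ < 1 / 2) : |(m ^ 2).re| ≤ 1 / 4 := by
  refine (abs_re_le_norm _).trans ?_
  rw [norm_pow]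
  nlinarith [norm_nonneg m]

/-- For `|m| < 1/2` the real part of `m²` is at most `1/4` in absolute value, so every radicand with
`n ≥ 2` has positive real part, at least `(n - 1)²`. This is one reason for keeping the disc within
radius `1/2`. -/
lemma rate_spec (hm : ‖m‖ < 1 / 2) {n : ℕ} (hn : 2 ≤ n) :
    rate m n ^ 2 = (n : ℂ) ^ 2 - 1 + m ^ 2 ∧ (rate m 2).re ≤ (rate m n).re ∧
      (n : ℝ) - 1 ≤ (rate m n).re := by
  have hn' : (2 : ℝ) ≤ n := by exact_mod_cast hn
  obtain ⟨h1, h2⟩ := abs_le.1 (abs_re_sq_le hm)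
  have re : ∀ n : ℕ, (((n : ℂ) ^ 2 - 1) + m ^ 2).re = (n : ℝ) ^ 2 - 1 + (m ^ 2).re := by
    intro n
    rw [show ((n : ℂ) ^ 2 - 1) = (((n : ℝ) ^ 2 - 1 : ℝ) : ℂ) by push_cast; ring, add_re, ofReal_re]
  have pos : 0 < (((n : ℂ) ^ 2 - 1) + m ^ 2).re := by rw [re]; nlinarith
  have pos2 : 0 < ((((2 : ℕ) : ℂ) ^ 2 - 1) + m ^ 2).re := by rw [re]; norm_num; linarith
  refine ⟨(re_sqrt pos).1, ?_, le_re_sqrt (by linarith) (by rw [re]; nlinarith) pos⟩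
  have := re_sqrt_mono pos2 (t := (n : ℝ) ^ 2 - 4) (by nlinarith)
  have e : (((2 : ℕ) : ℂ) ^ 2 - 1) + m ^ 2 + (((n : ℝ) ^ 2 - 4 : ℝ) : ℂ) =
      ((n : ℂ) ^ 2 - 1) + m ^ 2 := by push_cast; ring
  rw [e] at this
  exact this

/-- The function `Γ_m` that carries the first mode on the tail. -/
def gamCls (L : ℝ) (m : ℂ) : StripFun :=
  AEEqFun.mk (onTail L (gam L m) csin) (aestronglyMeasurable_onTail (contDiff_gam L m).continuous
    contDiff_csin.continuous _)

/-- The solution of the boundary value problem that belongs to a solution of the reduced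
equation. -/
def lift (a : ℝ) (p : Parity) (hL : 0 ≤ L) (m : ℂ) : Energy a p →ₗ[ℂ] StripFun where
  toFun v := (val v : StripFun) + tau a p hL v • gamCls L m
  map_add' v w := by
    have : ((val (v + w) : L2 strip) : StripFun) = (val v : StripFun) + (val w : StripFun) := by
      rw [show val (v + w) = val v + val w from map_add _ _ _]; rfl
    have e : (tau a p hL v + tau a p hL w) • gamCls L m =
      tau a p hL v • gamCls L m + tau a p hL w • gamCls L m :=
      Module.add_smul (R := ℂ) (M := StripFun) _ _ _
    rw [this, map_add, e]
    abel
  map_smul' c v := by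
    have : ((val (c • v) : L2 strip) : StripFun) = c • (val v : StripFun) := by
      rw [show val (c • v) = c • val v from map_smul _ _ _]; rfl
    rw [this, map_smul, RingHom.id_apply, smul_add, smul_assoc]

lemma lift_ae (hL : 0 ≤ L) (m : ℂ) (v : Energy a p) : lift a p hL m v =ᵐ[μ[strip]]
      fun x => val v x + tau a p hL v * onTail L (gam L m) csin x := by
  have e : lift a p hL m v = (val v : StripFun) + tau a p hL v • gamCls L m := rfl
  rw [e]
  filter_upwards [AEEqFun.coeFn_add (val v : StripFun) (tau a p hL v • gamCls L m),
    AEEqFun.coeFn_smul (tau a p hL v) (gamCls L m), AEEqFun.coeFn_mk (onTail L (gam L m) csin)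
      (aestronglyMeasurable_onTail (contDiff_gam L m).continuous contDiff_csin.continuous
        μ[strip])] with x h1 h2 h3
  rw [h1, Pi.add_apply, h2, Pi.smul_apply, smul_eq_mul, gamCls, h3]

lemma LocSol.congr (h : LocSol a p u u₁ u₂ g) (hu : u =ᵐ[μ[strip]] u') (hg : g =ᵐ[μ[strip]] g') :
    LocSol a p u' u₁ u₂ g' := by
  have mono : ∀ r, μ[stripTo r] ≤ μ[strip] :=
    fun r => Measure.restrict_mono (stripTo_subset r) le_rfl
  refine ⟨fun r hr => (h.energy r hr).congr (ae_mono (mono r) hu) EventuallyEq.rfl EventuallyEq.rfl,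
    fun r hr => (h.source r hr).ae_eq (ae_mono (mono r) hg), fun φ hφ => ?_⟩
  rw [h.weak φ hφ]
  refine integral_congr_ae ?_
  filter_upwards [hg] with x hx
  rw [hx]

/-- Solutions of the reduced equation give solutions of the boundary value problem. -/
lemma redOp_isSolution (ha : 0 < a) (hL : a ≤ L) (hL0 : 0 ≤ L) (hm : ‖m‖ < 1 / 2)
    {v : Energy a p} {F : L2 strip} (hf : F =ᵐ[μ[strip]] f)
    (hF : ∀ᵐ x ∂μ[strip], L < x.1 → F x = 0)
    (h : redOp a p hL0 m v = - src a p F) :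
    IsWeakSolution a p m f (lift a p hL0 m v) ∧
      HasAsymptotics m (tau a p hL0 v * nrm * exp (m * L)) (lift a p hL0 m v) := by
  have hs := redOp_locSol ha hL hL0 hF h
  have hfree := redOp_tailFree hL hL0 hF h
  have hlift := lift_ae hL0 m v
  set t := tau a p hL0 v with ht
  constructor
  · rw [isWeakSolution_iff (fun r hr => (locMemLp (Lp.memLp F) r hr).ae_eq
      (ae_mono (Measure.restrict_mono (stripTo_subset r) le_rfl) hf))]
    refine ⟨_, _, hs.congr hlift.symm ?_⟩
    filter_upwards [hlift, hf] with x h1 h2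
    rw [h1, h2]
  have tailm : ∀ {w : ℝ² → ℂ}, MemLp w 2 μ[strip] → MemLp w 2 μ[box (Ioi L)] := fun hw =>
    hw.mono_set (tail_subset hL0)
  -- Beyond `x₁ = L` this is the solution minus its leading term, and it is square integrable with
  -- no first mode. Since `E` and `Γ_m` are multiples of `sin x₂` there, the modes with `n ≥ 2` of
  -- `z` and of the solution coincide.
  set z : ℝ² → ℂ := fun x => val v x + -t * Efun L x with hz
  have hzm : MemLp z 2 μ[box (Ioi L)] :=
    (tailm (Lp.memLp _)).add ((tailm (memLp_Efun hL0)).const_mul _)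
  have hz1 : ∀ᵐ s, s ∈ Ioi L → mode (snn 1) z s = 0 := by
    rw [snn_one]
    have : z = fun x => val v x - t * Efun L x := by ext x; simp only [hz]; ring
    rw [this]
    exact hfree
  have hg : ∀ᵐ x ∂μ[strip], L < x.1 →
      (1 - m ^ 2) * (val v x + t * onTail L (gam L m) csin x) - F x =
        (1 - m ^ 2) * (val v x + t * onTail L (gam L m) csin x) := by
    filter_upwards [hF] with x hx hxL
    rw [hx hxL, sub_zero]
  have hmode : ∀ n, 2 ≤ n → ∀ᵐ s, s ∈ Ioi L →
      mode (snn n) (fun x => val v x + t * onTail L (gam L m) csin x) s = mode (snn n) z s := by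
    intro n hn
    have hor : ∫ y in Ioo 0 π, csin y * snn n y = 0 := by
      rw [← snn_one]; exact integral_snn_mul_snn le_rfl (by omega)
    have h1 := mode_add (isProfile_snn n) (tailm (Lp.memLp (val v))) (tailm (memLp_Efun hL0)) (-t)
    -- Bounded intervals are used because `Γ_m` need not be square integrable on the whole tail.
    have h2 : ∀ k : ℕ, ∀ᵐ s ∂μ[Ioo L k],
        mode (snn n) (fun x => val v x + t * onTail L (gam L m) csin x) s =
          mode (snn n) (val v) s + t * mode (snn n) (onTail L (gam L m) csin) s := by
      intro k
      have sub : box (Ioo L k) ⊆ box (Ioi L) := box_mono fun s hs => hs.1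
      refine mode_add (isProfile_snn n) ((tailm (Lp.memLp (val v))).mono_set sub) ?_ t
      exact memLp_box_of_strip hL0 (fun r _ =>
        (inEnergy_onTail ha hL r (p := p) (contDiff_gam L m) (gam_self L m)).memLp) k
    have h2' := ae_all_iff.2 fun k => (ae_restrict_iff' measurableSet_Ioo).1 (h2 k)
    rw [ae_restrict_iff' measurableSet_Ioi] at h1
    filter_upwards [h1, h2'] with s h1 h2 hs
    obtain ⟨k, hk⟩ := exists_nat_gt s
    rw [h1 hs, h2 k ⟨hs, hk⟩, mode_onTail hs, Efun, mode_onTail hs, hor]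
    simp
  obtain ⟨C, hC⟩ := sine_decay hzm (κ := rate m) hz1 (fun n hn => by
      refine weak_ode_decay (memLp_mode hzm (isProfile_snn n)).1 (κ := rate m n) ?_ ?_
      · have := (rate_spec hm hn).2.2
        have hn' : (2 : ℝ) ≤ n := by exact_mod_cast hn
        linarith
      · intro η h1 h2 h3
        rw [(rate_spec hm hn).1, ← hs.mode_ode hL hL0 hg n h1 h2 h3]
        refine integral_congr_ae ?_
        filter_upwards [hmode n hn] with s hs
        by_cases hsL : L < s
        · simp only [hs hsL]
        · have e2 := eq_zero_off (f := deriv (deriv η)) fun h' =>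
            hsL (h3 (tsupport_deriv_subset _ (tsupport_deriv_subset _ h')))
          simp [(eq_zero_of_tsupport_Ioi h3 (not_lt.1 hsL)).1, e2])
    (fun n hn => (rate_spec hm hn).2)
  refine ⟨C, L + 2, ?_⟩
  rw [ae_restrict_iff' (measurableSet_box measurableSet_Ioi)] at hC
  have hlift := (ae_restrict_iff' isOpen_strip.measurableSet).1 hlift
  rw [ae_restrict_iff' isOpen_strip.measurableSet]
  filter_upwards [hC, hlift] with x h1 h2 hx hxL
  have hxL' : L < x.1 := by linarith
  have h1 := h1 ⟨hxL, hx.2⟩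
  rw [h2 hx, norm_exp, onTail_of_lt hxL', ← rate_two]
  convert h1 using 2
  · simp only [hz, Efun, onTail_of_lt hxL', gam, nexp, csin]
    have : exp (-m * (x.1 - L)) = exp (m * L) * exp (-m * x.1) := by
      rw [← exp_add]; congr 1; ring
    rw [this]
    ring
  · congr 1
    rw [re_mul_ofReal, neg_re]

end

section

/-! ### A Caccioppoli estimate: square integrable solutions have finite energy -/

/-- The bound is uniform in `N`: the cutoff varies only where `s² ≤ 2 (N² + 1)`, and there `2 |s| /
(N² + 1) ≤ 3`. -/
lemma exists_norm_deriv_plateau_le : ∃ K : ℝ, 0 ≤ K ∧ ∀ N s, ‖deriv (plateau N) s‖ ≤ K := by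
  obtain ⟨C, hC, h⟩ := exists_deriv_stepFun_le
  refine ⟨C * 3, by positivity, fun N s => ?_⟩
  have pos : 0 < N ^ 2 + 1 := by positivity
  have h1 : HasDerivAt (fun s : ℝ => s ^ 2 / (N ^ 2 + 1)) (2 * s / (N ^ 2 + 1)) s := by
    simpa using (hasDerivAt_pow 2 s).div_const (N ^ 2 + 1)
  have h2 : HasDerivAt (plateau N) (((-(deriv stepFun (s ^ 2 / (N ^ 2 + 1)) *
      (2 * s / (N ^ 2 + 1))) : ℝ)) : ℂ) s := by
    refine HasDerivAt.ofReal_comp ?_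
    have h3 : HasDerivAt stepFun (deriv stepFun (s ^ 2 / (N ^ 2 + 1))) (s ^ 2 / (N ^ 2 + 1)) :=
      (contDiff_stepFun.diff _).hasDerivAt
    exact (h3.comp s h1).const_sub 1
  rw [h2.deriv, norm_real, norm_eq_abs, abs_neg, abs_mul]
  by_cases hs : 2 < s ^ 2 / (N ^ 2 + 1)
  · rw [deriv_stepFun_of_gt hs]; simp; positivity
  · refine mul_le_mul (h _) ?_ (abs_nonneg _) hC
    have hs' : s ^ 2 ≤ 2 * (N ^ 2 + 1) := (div_le_iff₀ pos).1 (not_lt.1 hs)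
    rw [abs_div, abs_of_pos pos, div_le_iff₀ pos, abs_le]
    constructor <;> nlinarith [sq_nonneg N]

lemma deriv_plateau_of_lt {N s : ℝ} (h : |s| < |N|) : deriv (plateau N) s = 0 := by
  have : plateau N =ᶠ[𝓝 s] fun _ => 1 := by
    filter_upwards [(continuous_abs.isOpen_preimage _ isOpen_Iio).mem_nhds h] with t ht
    exact plateau_eq_one (le_of_lt ht)
  rw [this.deriv_eq]; simp

/-- The cut-off function `plateau N x₁` as a test function. -/
def cutoff (N : ℝ) : ℝ² → ℂ := sep (plateau N) fun _ => 1

lemma isTest_cutoff (N : ℝ) : IsTest (cutoff N) :=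
  isTest_sep (contDiff_plateau N) (hasCompactSupport_plateau N) contDiff_const

lemma cutoff_of_mem (N : ℝ) (hx : x ∈ strip) : cutoff N x = plateau N x.1 ∧
    pd₁ (cutoff N) x = deriv (plateau N) x.1 ∧ pd₂ (cutoff N) x = 0 := by
  have h := abs_le_four_of_mem hx
  refine ⟨by simp [cutoff, sep_eq h.le], ?_, ?_⟩
  · rw [cutoff, pd₁_sep (contDiff_plateau N) contDiff_const h, mul_one]
  · rw [cutoff, pd₂_sep (contDiff_plateau N) contDiff_const h]; simp

lemma memLp_mul_test (hw : MemLp w 2 μ[Ω]) (hχ : IsTest χ) : MemLp (fun x => w x * χ x) 2 μ[Ω] := by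
  obtain ⟨C, hC⟩ := hχ.1.continuous.bounded_above_of_compact_support hχ.2
  refine (memLp_bdd_mul hw (W := χ) hχ.1.continuous.aestronglyMeasurable
    (ae_of_all _ hC)).congr_norm
    (hw.1.mul hχ.1.continuous.aestronglyMeasurable) (ae_of_all _ fun x => by rw [mul_comm])

lemma aecover_strip : AECover μ[strip] atTop fun n : ℕ => stripTo (n + 1) where
  ae_eventually_mem := by
    filter_upwards [ae_restrict_mem isOpen_strip.measurableSet] with x hx
    filter_upwards [eventually_ge_atTop ⌈x.1⌉₊] with n hn
    refine ⟨hx, show x.1 < _ from ?_⟩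
    have : (⌈x.1⌉₊ : ℝ) ≤ n := by exact_mod_cast hn
    linarith [Nat.le_ceil x.1]
  measurableSet n := (isOpen_stripTo _).measurableSet

lemma restrict_strip_stripTo (r : ℝ) : ((volume : Measure (ℝ²)).restrict strip).restrict
    (stripTo r) = μ[stripTo r] := by
  rw [Measure.restrict_restrict (isOpen_stripTo r).measurableSet,
    inter_eq_self_of_subset_left (stripTo_subset r)]

lemma ae_eq_strip (h : ∀ r, 0 < r → f =ᵐ[μ[stripTo r]] g) : f =ᵐ[μ[strip]] g := by
  have h := ae_all_iff.2 fun n : ℕ => (ae_restrict_iff' (isOpen_stripTo (n + 1)).measurableSet).1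
    (h (n + 1) (by positivity))
  rw [EventuallyEq, ae_restrict_iff' isOpen_strip.measurableSet]
  filter_upwards [h] with x hx hxs
  obtain ⟨n, hn⟩ := exists_nat_gt x.1
  exact hx n ⟨hxs, show x.1 < n + 1 by linarith⟩

/-- Completing the square: both cross terms are at most `|b| |c|`, and `|b|² - 2 |b| |c| ≥ -|c|²`.
It absorbs the terms of the energy identity in which the cutoff is differentiated. -/
lemma neg_norm_sq_le_re {b c d : ℂ} (h : ‖d‖ = ‖b‖ * ‖c‖) :
    -‖c‖ ^ 2 ≤ (b * conj (b + c) + d).re := by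
  have h1 := (abs_le.1 (abs_re_le_norm (b * conj c))).1
  have h2 := (abs_le.1 (abs_re_le_norm d)).1
  rw [norm_mul, RCLike.norm_conj] at h1
  rw [map_add, mul_add, mul_conj, add_re, add_re, ofReal_re, normSq_eq_norm_sq]
  nlinarith [sq_nonneg (‖b‖ - ‖c‖)]

/-- Testing `Δz = z` with `χ² z̄` gives `∫ χ² |z|² ≤ ∫ |∇χ|² |z|²`. The cutoff has bounded gradient,
zero on `Π_{n+1}`, so `(1 + K²) ∫_{Π_{n+1}} |z|² ≤ K² ∫ |z|²`. Letting `n → ∞` forces the norm to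
vanish, with no smallness of `K` required. -/
lemma LocSol.ae_eq_zero (h : LocSol a p z u₁ u₂ fun x => -z x) (hz : MemLp z 2 μ[strip]) :
    z =ᵐ[μ[strip]] 0 := by
  obtain ⟨K, hK, hKb⟩ := exists_norm_deriv_plateau_le
  have iz := memLp_norm_sq hz
  have bound : ∀ n : ℕ, (1 + K ^ 2) * ∫ x in stripTo (n + 1), ‖z x‖ ^ 2 ≤
      K ^ 2 * ∫ x in strip, ‖z x‖ ^ 2 := by
    intro n
    set χ := cutoff (n + 1)
    have hχ : IsTest χ := isTest_cutoff _
    obtain ⟨r, hr, hs⟩ := hχ.exists_support_lt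
    have hE := h.energy r hr
    have c := (hE.mul_test hχ).star
    have key := h.weak_energy hr c hχ hs
    have i1 := (memLp_mul hE.memLp₁ ((c.mul_test hχ).memLp₁)).add
      (memLp_mul hE.memLp₂ ((c.mul_test hχ).memLp₂))
    have i2 := memLp_mul hE.memLp.neg (c.mul_test hχ).memLp
    have hre := ((integral_re (𝕜 := ℂ) (i1.sub i2)).trans (congrArg re ((integral_sub' i1 i2).trans
      (sub_eq_zero.2 key)))).trans zero_re
    have hone : ∀ x ∈ stripTo (n + 1), χ x = 1 ∧ pd₁ χ x = 0 := fun x hx => by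
      have : |x.1| < |(n + 1 : ℝ)| := by
        rw [abs_of_pos hx.1.1, abs_of_pos (by positivity)]; exact hx.2
      obtain ⟨k0, k1, -⟩ := cutoff_of_mem (n + 1) hx.1
      exact ⟨k0.trans (plateau_eq_one this.le), k1.trans (deriv_plateau_of_lt this)⟩
    have hsub : stripTo (n + 1) ⊆ stripTo r := fun x hx =>
      ⟨hx.1, hs (subset_tsupport _ (by simp [(hone x hx).1]))⟩
    have izr := IntegrableOn.mono_set iz (stripTo_subset r)
    have mS := (isOpen_stripTo (n + 1)).measurableSet
    have hI := setIntegral_mono_on (((izr.indicator mS).const_mul (1 + K ^ 2)).sub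
      (izr.const_mul (K ^ 2))) (i1.sub i2).re (isOpen_stripTo r).measurableSet fun x hx => by
        obtain ⟨-, k1, k2⟩ : χ x = _ ∧ pd₁ χ x = _ ∧ pd₂ χ x = 0 := cutoff_of_mem _ hx.1
        have hb : ‖pd₁ χ x‖ ≤ K := k1 ▸ hKb _ _
        have e := neg_norm_sq_le_re (b := χ x * u₁ x) (c := pd₁ χ x * z x)
          (d := u₁ x * pd₁ χ x * conj (χ x * z x)) (by simp only [norm_mul, RCLike.norm_conj]; ring)
        have e' : (1 + K ^ 2) * (stripTo (n + 1)).indicator (fun x => ‖z x‖ ^ 2) x -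
            K ^ 2 * ‖z x‖ ^ 2 ≤ ‖χ x * z x‖ ^ 2 - ‖pd₁ χ x * z x‖ ^ 2 := by
          by_cases hx' : x ∈ stripTo (n + 1)
          · simp [indicator_of_mem hx', hone x hx']; linarith
          · rw [indicator_of_notMem hx', norm_mul (pd₁ χ x), mul_pow]
            nlinarith [mul_le_mul_of_nonneg_right (pow_le_pow_left₀ (norm_nonneg _) hb 2)
              (sq_nonneg ‖z x‖), sq_nonneg ‖χ x * z x‖]
        have e2 : (χ x * u₁ x * conj (χ x * u₁ x + pd₁ χ x * z x) +
            u₁ x * pd₁ χ x * conj (χ x * z x)).re + ‖χ x * u₂ x‖ ^ 2 + ‖χ x * z x‖ ^ 2 =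
            (u₁ x * (χ x * conj (χ x * u₁ x + pd₁ χ x * z x) + pd₁ χ x * conj (χ x * z x)) +
            u₂ x * (χ x * conj (χ x * u₂ x + pd₂ χ x * z x) + pd₂ χ x * conj (χ x * z x)) -
            -z x * (χ x * conj (χ x * z x))).re := by
          simp only [← normSq_eq_norm_sq]
          rw [← ofReal_re (normSq _), ← add_re, ← ofReal_re (normSq (_ * z x)), ← add_re,
            ← mul_conj, ← mul_conj, k2]
          congr 1
          simp only [map_add, map_mul, map_zero]
          ring
        exact (e'.trans (by nlinarith [sq_nonneg ‖χ x * u₂ x‖])).trans e2.le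
    rw [hre, integral_sub' ((izr.indicator mS).const_mul _) (izr.const_mul _), integral_const_mul, integral_const_mul, setIntegral_indicator mS,
      inter_eq_self_of_subset_right hsub] at hI
    have := setIntegral_mono_set iz (ae_of_all _ fun x => by positivity)
      (stripTo_subset r).eventuallyLE
    nlinarith [sq_nonneg K]
  have lim := aecover_strip.integral_tendsto_of_countably_generated iz
  simp only [restrict_strip_stripTo] at lim
  have h0 := le_of_tendsto (lim.const_mul (1 + K ^ 2)) (Eventually.of_forall bound)
  have h1 := (setIntegral_eq_zero_iff_of_nonneg_ae (ae_of_all _ fun x => by positivity) iz).1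
    (le_antisymm (by linarith) (integral_nonneg fun x => by positivity))
  filter_upwards [h1] with x hx
  simpa using hx

/-- A square integrable weak solution with square integrable data has finite energy. -/
lemma inEnergy_strip_of_weak (hE : ∀ r, 0 < r → InEnergy a p (stripTo r) v v₁ v₂)
    (hv : MemLp v 2 μ[strip]) (hG : MemLp G 2 μ[strip]) (hG₁ : MemLp G₁ 2 μ[strip])
    (h : WeakSol a p v₁ v₂ G G₁) : InEnergy a p strip v v₁ v₂ := by
  -- By the Riesz representation in `H¹`, `W` is the finite energy solution of `-ΔW + W = G + v -
  -- ∂₁G₁`. The difference `v - W` is a square integrable solution of `Δz = z`, hence zero.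
  set W : Energy a p := src a p ((hG.add hv).toLp _) +
    ContinuousLinearMap.adjoint (cmp a p strip e₁) (hG₁.toLp _)
  have hEd := fun r hr => (hE r hr).sub (W.inEnergy.mono (stripTo_subset r))
  have hW : WeakSol a p (dx₁ W) (dx₂ W) (fun x => G x + v x - val W x) G₁ := by
    refine ⟨locMemLp (Lp.memLp _), locMemLp (Lp.memLp _), locMemLp ((hG.add hv).sub (Lp.memLp _)),
      locMemLp hG₁, fun φ hφ => ?_⟩
    set P := InEnergy.of_test hφ (Ω := strip)
    have e : ⟪P.star.toTuple, W⟫_ℂ = _ := inner_energy _ _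
    have ip : ∀ {w ψ : ℝ² → ℂ}, MemLp w 2 μ[strip] → IsTest ψ → HasInt μ[strip]
      (fun x => w x * ψ x) (∫ x in strip, w x * ψ x) := fun hw hψ => (memLp_mul hw (hψ.memLp _)).hi
    have t1 := hφ.1.d₁
    have g0 := ip (Lp.memLp ((hG.add hv).toLp _)) hφ.1
    have g1 := ip (Lp.memLp (hG₁.toLp _)) t1
    rw [inner_add_right, inner_src, ContinuousLinearMap.adjoint_inner_right, P.inner_val,
      P.inner_dx₁, P.inner_val, P.inner_dx₁, P.inner_dx₂] at e
    refine ((ip (Lp.memLp (dx₁ W)) t1).add (ip (Lp.memLp (dx₂ W)) hφ.1.d₂)).2.trans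
      (.trans ?_ (((g0.sub (ip (Lp.memLp (val W)) hφ.1)).add g1).congr (by
        filter_upwards [(hG.add hv).coeFn_toLp, hG₁.coeFn_toLp] with x h1 h2
        rw [h1, h2, Pi.add_apply]; ring)).2.symm)
    linear_combination -e
  have hz : LocSol a p (fun x => v x - val W x) (fun x => v₁ x - dx₁ W x)
      (fun x => v₂ x - dx₂ W x) fun x => -(v x - val W x) := by
    have h' := (h.add_mul hW (-1)).congr (v₁ := fun x => v₁ x - dx₁ W x)
      (v₂ := fun x => v₂ x - dx₂ W x) (F := fun x => -(v x - val W x)) (S := 0)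
      (ae_of_all _ fun x => by ring) (ae_of_all _ fun x => by ring) (ae_of_all _ fun x => by ring)
      (ae_of_all _ fun x => by simp only [Pi.zero_apply]; ring)
    exact ⟨hEd, h'.source, fun φ hφ => by simpa using h'.weak φ hφ⟩
  have h0 : val W =ᵐ[μ[strip]] v := (hz.ae_eq_zero (hv.sub (Lp.memLp _))).mono fun x hx =>
    (sub_eq_zero.1 hx).symm
  have h0r : ∀ r, val W =ᵐ[μ[stripTo r]] v := fun r =>
    ae_restrict_of_ae_restrict_of_subset (stripTo_subset r) h0
  have hWr := fun r => W.inEnergy.mono (stripTo_subset r)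
  exact W.inEnergy.congr h0
    (ae_eq_strip fun r hr => (hWr r).unique₁ (hE r hr) (isOpen_stripTo r) (h0r r))
    (ae_eq_strip fun r hr => (hWr r).unique₂ (hE r hr) (isOpen_stripTo r) (h0r r))

end

section

/-! ### From solutions to the reduced equation -/

lemma forall_le_of_ae {Y : ℝ} {G : ℝ → ℂ} {H : ℝ → ℝ} (hG : Continuous G) (hH : Continuous H)
    (h : ∀ᵐ s, Y < s → ‖G s‖ ≤ H s) : ∀ s, Y < s → ‖G s‖ ≤ H s := by
  by_contra! hc
  obtain ⟨s, hs, hlt⟩ := hc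
  have ho : IsOpen (Ioi Y ∩ {s | H s < ‖G s‖}) := isOpen_Ioi.inter (isOpen_lt hH hG.norm)
  have hpos := ho.measure_pos volume ⟨s, hs, hlt⟩
  refine hpos.ne' (measure_mono_null (fun t ht => ?_) h)
  intro hle
  exact absurd (hle ht.1) (not_le.2 ht.2)

/-- A solution of `q'' = m² q` that is close to `c e^{-ms}` at infinity equals it. -/
lemma weak_ode_eq_exp {q : ℝ → ℂ} (hq : LocallyIntegrableOn q (Ioi L)) (hm : ‖m‖ < 1 / 2)
    (h : ∀ η : ℝ → ℂ, Smooth η → HasCompactSupport η → tsupport η ⊆ Ioi L →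
      ∫ x, q x * (deriv (deriv η) x - m ^ 2 * η x) = 0) {c : ℂ} {C X : ℝ}
    (hd : ∀ᵐ s : ℝ, X < s → ‖q s - c * exp (-m * s)‖ ≤ C * Real.exp (-s)) :
    ∀ᵐ s : ℝ, s ∈ Ioi L → q s = c * exp (-m * s) := by
  have hexp : ∀ {k : ℂ}, ‖k‖ < 1 / 2 → ∀ s : ℝ, 0 < s → ‖exp (k * s)‖ ≤ Real.exp (s / 2) := by
    intro k hk s hs
    rw [norm_exp, re_mul_ofReal]
    refine Real.exp_le_exp.2 ?_
    have := (le_abs_self _).trans (abs_re_le_norm k)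
    nlinarith
  have dec : ∀ (D Y : ℝ) (G : ℝ → ℂ), (∀ s, Y < s → ‖G s‖ ≤ D * Real.exp (-s)) → ∀ {k : ℂ},
      ‖k‖ < 1 / 2 → Tendsto (fun s : ℝ => exp (k * s) * G s) atTop (𝓝 0) := by
    intro D Y G hG k hk
    rw [tendsto_zero_iff_norm_tendsto_zero]
    have h0 : Tendsto (fun s : ℝ => D * Real.exp (-(s / 2))) atTop (𝓝 0) := by
      have := (Real.tendsto_exp_neg_atTop_nhds_zero.comp
        (tendsto_id.atTop_div_const (r := (2 : ℝ)) (by norm_num))).const_mul D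
      simpa using this
    refine tendsto_of_tendsto_of_tendsto_of_le_of_le' tendsto_const_nhds h0
      (Eventually.of_forall fun s => norm_nonneg _) ?_
    filter_upwards [eventually_gt_atTop Y, eventually_gt_atTop 0] with s h1 h2
    rw [norm_mul]
    calc _ ≤ Real.exp (s / 2) * (D * Real.exp (-s)) :=
          mul_le_mul (hexp hk s h2) (hG s h1) (norm_nonneg _) (Real.exp_pos _).le
      _ = D * (Real.exp (s / 2) * Real.exp (-s)) := by ring
      _ = _ := by rw [← Real.exp_add]; congr 2; ring
  -- The function `e^{-ms} P(s)` is a second solution independent of `e^{-ms}` also at `m = 0`,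
  -- where `P(s) = s`. The pair `e^{±ms}` would degenerate there.
  set P : ℝ → ℂ := fun s => ∫ t in (0 : ℝ)..s, exp (2 * m * t)
  have hP : ∀ s : ℝ, HasDerivAt P (exp (2 * m * s)) s := fun s =>
    (Continuous.integral_hasStrictDerivAt (by fun_prop) 0 s).hasDerivAt
  have Pc : Continuous P := continuous_iff_continuousAt.2 fun s => (hP s).continuousAt
  obtain ⟨A, B, hAB⟩ := weak_ode isOpen_Ioi ordConnected_Ioi hq m
    (F := fun s : ℝ => exp (-m * s) * P s) (fun s => by
      refine ((hasDerivAt_cexp_mul (-m) s).mul (hP s)).congr_deriv ?_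
      rw [← exp_add, show -m * s + 2 * m * s = m * s by ring]; ring) h
  set G : ℝ → ℂ := fun s => A * (exp (-m * s) * P s) + (B - c) * exp (-m * s)
  have hG := forall_le_of_ae (Y := max L X) (G := G) (H := fun s => C * Real.exp (-s)) (by fun_prop)
    (by fun_prop) (by
      filter_upwards [hAB, hd] with s h1 h2 hs
      have := h2 ((le_max_right _ _).trans_lt hs)
      rw [h1 ((le_max_left _ _).trans_lt hs), add_sub_assoc, ← sub_mul] at this
      exact this)
  have ee : ∀ s : ℝ, exp (m * s) * exp (-m * s) = 1 := fun s => by rw [← exp_add]; simp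
  have t0 := dec _ _ _ hG (k := -m) (by rwa [norm_neg])
  have hA : A = 0 := by
    by_contra hA
    have hP0 : ∀ d, P d = 0 := fun d => by
      -- For `h(s) = e^{-ms} G(s) = e^{-2ms} (A P(s) + B - c)`, the combination `e^{2md} h(s + d) -
      -- h(s)` is constant, equal to `A P(d)`, and tends to zero. As `P` is not identically zero, `A
      -- = 0`.
      have t1 := ((t0.comp (tendsto_atTop_add_const_right atTop d tendsto_id)).const_mul
        (exp (2 * m * d))).sub t0
      have e : ∀ s : ℝ, P (s + d) = P s + exp (2 * m * s) * P d := fun s => by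
        have := intervalIntegral.integral_comp_add_left (fun t : ℝ => exp (2 * m * t)) s
          (a := 0) (b := d)
        rw [add_zero] at this
        simp only [P]
        rw [← intervalIntegral.integral_add_adjacent_intervals (b := s), ← this,
          ← intervalIntegral.integral_const_mul]
        · congr 2; ext t; rw [← exp_add]; push_cast; ring_nf
        all_goals exact Continuous.intervalIntegrable (by fun_prop) _ _
      have := tendsto_nhds_unique (tendsto_const_nhds (x := A * P d)) (t1.congr fun s => by
        simp only [Function.comp, id, G, e s]
        have k : exp (2 * m * d) * (exp (-m * (s + d : ℝ)) * exp (-m * (s + d : ℝ))) =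
            exp (-m * s) * exp (-m * s) := by
          simp only [← exp_add]; push_cast; ring_nf
        have k' : exp (-m * s) * exp (-m * s) * exp (2 * m * s) = 1 := by
          simp only [← exp_add]; ring_nf; simp
        linear_combination (A * (P s + exp (2 * m * s) * P d) + (B - c)) * k + A * P d * k')
      simpa [hA] using this
    have := (hP 0).unique ((hasDerivAt_const (0 : ℝ) (0 : ℂ)).congr_of_eventuallyEq (.of_forall hP0))
    simp at this
  have hB : B - c = 0 := tendsto_nhds_unique tendsto_const_nhds ((dec _ _ _ hG hm).congr fun s => by
    simp only [G, hA]; linear_combination (B - c) * ee s)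
  filter_upwards [hAB] with s hs hsL
  rw [hs hsL, hA, sub_eq_zero.1 hB]
  ring

lemma norm_exp_rate_le (hm : ‖m‖ < 1 / 2) (C : ℝ) (hs : 0 < s) :
    C * ‖exp (-(3 + m ^ 2) ^ (1 / 2 : ℂ) * s)‖ ≤ |C| * Real.exp (-s) := by
  have hr := (rate_spec hm (le_refl 2)).2.2
  refine mul_le_mul (le_abs_self C) ?_ (norm_nonneg _) (abs_nonneg C)
  rw [← rate_two, norm_exp, re_mul_ofReal, neg_re]
  refine Real.exp_le_exp.2 ?_
  norm_num at hr
  nlinarith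

/-- The first mode of a solution on the tail. -/
lemma LocSol.first_mode {u : StripFun} (h : LocSol a p u u₁ u₂ g)
    (hL : a ≤ L) (hL0 : 0 ≤ L) (hm : ‖m‖ < 1 / 2)
    (hg : ∀ᵐ x ∂μ[strip], L < x.1 → g x = (1 - m ^ 2) * u x) {c : ℂ}
    (hc : HasAsymptotics m c u) :
    ∀ᵐ s : ℝ, s ∈ Ioi L → mode csin u s = c * (π / 2 : ℝ) * exp (-m * s) := by
  obtain ⟨C, X, hCX⟩ := hc
  have hloc : ∀ r, 0 < r → MemLp u 2 μ[stripTo r] := fun r hr =>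
    (h.energy r hr).memLp
  have hsl : ∀ᵐ s : ℝ, s ∈ Ioi 0 → MemLp (fun y => u (s, y)) 2 μ[Ioo 0 π] := by
    have h1 : ∀ k : ℕ, ∀ᵐ s ∂μ[Ioo 0 (k + 1 : ℝ)], MemLp (fun y => u (s, y)) 2
        μ[Ioo 0 π] := fun k => ae_slice_memLp (by
      rw [← stripTo_eq_box]; exact hloc _ (by positivity))
    have h2 := ae_all_iff.2 fun k => (ae_restrict_iff' measurableSet_Ioo).1 (h1 k)
    filter_upwards [h2] with s hs hs0
    obtain ⟨k, hk⟩ := exists_nat_gt s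
    exact hs k ⟨hs0, by linarith⟩
  refine weak_ode_eq_exp (C := |C| * π) (X := max X 0) (locallyIntegrableOn_mode
    isProfile_csin (memLp_box_of_strip hL0 hloc)) hm ?_ ?_
  · intro η h1 h2 h3
    have := h.mode_ode hL hL0 hg 1 h1 h2 h3
    rw [snn_one] at this
    simpa using this
  · have hprod : ∀ P : ℝ² → Prop, (∀ᵐ x ∂μ[strip], P x) → ∀ᵐ x ∂(μ[Ioi 0].prod μ[Ioo 0 π]), P x :=
      fun P h => by rwa [restrict_strip] at h
    have hCX := hprod _ hCX
    have h3 := (ae_restrict_iff' measurableSet_Ioi).1 (Measure.ae_ae_of_ae_prod hCX)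
    filter_upwards [h3, hsl] with s h3 h4 hs
    have hs0 : 0 < s := (le_max_right _ _).trans_lt hs
    have hsX : X < s := (le_max_left _ _).trans_lt hs
    have e : mode csin u s - c * (π / 2 : ℝ) * exp (-m * s) =
        ∫ y in Ioo 0 π, (u (s, y) - c * exp (-m * s) * csin y) * csin y := by
      have i1 : Integrable (fun y => u (s, y) * csin y) μ[Ioo 0 π] :=
        memLp_mul (h4 hs0) (memLp_Ioo_of_continuous contDiff_csin.continuous)
      have i2 : Integrable (fun y => csin y * csin y) μ[Ioo 0 π] :=
        memLp_mul (memLp_Ioo_of_continuous contDiff_csin.continuous)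
          (memLp_Ioo_of_continuous contDiff_csin.continuous)
      refine Eq.trans ?_ ((i1.hi.sub (i2.hi.mul (c * exp (-m * s)))).congr
        (ae_of_all _ fun y => by ring)).2.symm
      rw [integral_csin_sq, mode]
      ring
    rw [e]
    have hb := norm_setIntegral_le_of_norm_le_const_ae' (μ := volume) (s := Ioo 0 π)
      (f := fun y => (u (s, y) - c * exp (-m * s) * csin y) * csin y)
      (C := |C| * Real.exp (-s)) (by simp) (by
        filter_upwards [(ae_restrict_iff' measurableSet_Ioo).1 (h3 hs0)] with y hy hy'
        have := hy hy' hsX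
        rw [norm_mul]
        have hcs : ‖csin y‖ ≤ 1 := by
          rw [csin, norm_real]; exact Real.abs_sin_le_one y
        exact (mul_le_of_le_one_right (norm_nonneg _) hcs).trans
          (this.trans (norm_exp_rate_le hm C hs0)))
    refine hb.trans (le_of_eq ?_)
    simp [Measure.real, pi_pos.le]
    ring

lemma memLp_of_tail {Y : ℝ} (hv : AEStronglyMeasurable v μ[strip])
    (h : MemLp v 2 μ[stripTo Y]) (hD : MemLp D 2 μ[strip])
    (hle : ∀ᵐ x ∂μ[strip], Y ≤ x.1 → ‖v x‖ ≤ ‖D x‖) :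
    MemLp v 2 μ[strip] := by
  have h1 : MemLp ((stripTo Y).indicator v) 2 μ[strip] := by
    rw [memLp_indicator_iff_restrict (isOpen_stripTo Y).measurableSet, restrict_strip_stripTo]
    exact h
  refine (h1.norm.add hD.norm).mono' hv ?_
  filter_upwards [hle, ae_restrict_mem isOpen_strip.measurableSet] with x hx hxs
  by_cases hxY : x.1 < Y
  · simp only [Pi.add_apply]
    rw [indicator_of_mem (show x ∈ stripTo Y from ⟨hxs, hxY⟩)]
    linarith [norm_nonneg (D x)]
  · simp only [Pi.add_apply]
    linarith [hx (not_lt.1 hxY), norm_nonneg ((stripTo Y).indicator v x)]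

/-- Solutions of the boundary value problem come from solutions of the reduced equation. -/
lemma exists_redOp_of_isWeakSolution (ha : 0 < a) (hL : a ≤ L) (hL0 : 0 ≤ L) (hm : ‖m‖ < 1 / 2)
    {u : StripFun} {F : L2 strip} (hf : F =ᵐ[μ[strip]] f)
    (hF : ∀ᵐ x ∂μ[strip], L < x.1 → F x = 0) {c : ℂ}
    (hw : IsWeakSolution a p m f u) (hc : HasAsymptotics m c u) :
    ∃ v : Energy a p, redOp a p hL0 m v = - src a p F ∧ lift a p hL0 m v = u ∧
      tau a p hL0 v * nrm * exp (m * L) = c := by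
  rw [isWeakSolution_iff (fun r hr => (locMemLp (Lp.memLp F) r hr).ae_eq
    (ae_mono (Measure.restrict_mono (stripTo_subset r) le_rfl) hf))] at hw
  obtain ⟨u₁, u₂, hu⟩ := hw
  have hg : ∀ᵐ x ∂μ[strip], L < x.1 → (1 - m ^ 2) * u x - f x = (1 - m ^ 2) * u x := by
    filter_upwards [hF, hf] with x h1 h2 hx
    rw [← h2, h1 hx, sub_zero]
  have hmode := hu.first_mode hL hL0 hm hg hc
  -- Normalized so that `t * nexp L m s = c e^{-ms}`. Subtracting `t Γ_m` then replaces the leading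
  -- term of `u` by `t E`.
  set t : ℂ := c * exp (-m * L) / nrm with ht
  have htc : t * nrm * exp (m * L) = c := by
    have : exp (-m * L) * exp (m * L) = 1 := by rw [← exp_add]; simp
    rw [ht, div_mul_cancel₀ _ nrm_ne_zero, mul_assoc, this, mul_one]
  have hnexp : ∀ s : ℝ, t * nexp L m s = c * exp (-m * s) := fun s => by
    have : exp (-m * s) = exp (-m * L) * exp (-m * (s - L)) := by
      rw [← exp_add]; congr 1; ring
    rw [ht, nexp, this]
    field_simp [nrm_ne_zero]
  set v : ℝ² → ℂ := fun x => u x + -t * onTail L (gam L m) csin x with hv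
  set v₁ : ℝ² → ℂ := fun x => u₁ x + -t * onTail L (deriv (gam L m)) csin x with hv₁
  set v₂ : ℝ² → ℂ := fun x => u₂ x + -t * onTail L (gam L m) ccos x with hv₂
  have hE : ∀ r, 0 < r → InEnergy a p (stripTo r) v v₁ v₂ := fun r hr =>
    (hu.energy r hr).add ((inEnergy_onTail ha hL r (p := p) (contDiff_gam L m)
      (gam_self L m)).const_mul (-t))
  have hEf := memLp_Efun hL0
  -- Far out, `v` is the remainder of the asymptotics plus `t E`. The remainder is at most `|C|
  -- e^{-x₁}`, which is expressed by a multiple of `nexp 0 1` in order to reuse its square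
  -- integrability.
  have hvm : MemLp v 2 μ[strip] := by
    obtain ⟨C, X, hCX⟩ := hc
    have hnn : ‖nrm‖ ≠ 0 := norm_ne_zero_iff.2 nrm_ne_zero
    have hD1 : MemLp (fun x => (|C| / ‖nrm‖) * ‖onTail 0 (nexp 0 1) (fun _ => 1) x‖) 2 μ[strip] :=
      ((memLp_onTail (memLp_nexp (by simp)) continuous_const (by simp) le_rfl).norm).const_mul _
    have hD2 : MemLp (fun x => ‖t * Efun L x‖) 2 μ[strip] :=
      (hEf.const_mul t).norm
    refine memLp_of_tail (Y := max (max L X) 0 + 1) (D := fun x =>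
      (((|C| / ‖nrm‖) * ‖onTail 0 (nexp 0 1) (fun _ => 1) x‖ + ‖t * Efun L x‖ : ℝ) : ℂ))
      ((u.aestronglyMeasurable).add ((aestronglyMeasurable_onTail (contDiff_gam L m).continuous
        contDiff_csin.continuous _).const_mul _)) (hE _ (by positivity)).memLp
      (hD1.add hD2).ofReal ?_
    filter_upwards [hCX] with x hx hxY
    have hxL : L < x.1 := by
      linarith [le_max_left L X, le_max_left (max L X) 0]
    have hxX : X < x.1 := by
      linarith [le_max_right L X, le_max_left (max L X) 0]
    have hx0 : 0 < x.1 := by linarith [le_max_right (max L X) 0]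
    have e : v x = (u x - c * exp (-m * x.1) * csin x.2) + t * Efun L x := by
      simp only [hv, Efun, onTail_of_lt hxL, gam]
      linear_combination -csin x.2 * hnexp x.1
    rw [e, norm_real, norm_of_nonneg (by positivity)]
    refine (norm_add_le _ _).trans (add_le_add_left ?_ _)
    rw [onTail_of_lt hx0, mul_one, norm_nexp]
    refine ((hx hxX).trans (norm_exp_rate_le hm C hx0)).trans_eq ?_
    field_simp
    simp
  set G : ℝ² → ℂ := fun x => (1 - m ^ 2) * (v x - t * Efun L x) - F x -
    t * (m - 1) * Efun L x with hG
  set G₁ : ℝ² → ℂ := fun x => t * (m - 1) * Efun L x with hG₁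
  have hGm : MemLp G 2 μ[strip] :=
    (((hvm.sub (hEf.const_mul t)).const_mul _).sub (Lp.memLp F)).sub (hEf.const_mul _)
  have hG₁m : MemLp G₁ 2 μ[strip] := hEf.const_mul _
  have hweak : WeakSol a p v₁ v₂ G G₁ := (hu.weakSol.add_mul (weakSol_gam ha hL m) (-t)).congr .rfl
    .rfl (by filter_upwards [hf] with x hx; simp only [hG, hv]; rw [hx]; ring)
    (ae_of_all _ fun x => by simp only [hG₁, Pi.zero_apply]; ring)
  have hEs := inEnergy_strip_of_weak hE hvm hGm hG₁m hweak
  set V : Energy a p := hEs.toTuple with hV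
  have c0 : val V =ᵐ[μ[strip]] v := hEs.toTuple_zero
  have c1 : dx₁ V =ᵐ[μ[strip]] v₁ := hEs.toTuple_e₁
  have c2 : dx₂ V =ᵐ[μ[strip]] v₂ := hEs.toTuple_e₂
  have tailm : ∀ {w : ℝ² → ℂ}, MemLp w 2 μ[strip] → MemLp w 2 μ[box (Ioi L)] := fun hw =>
    hw.mono_set (tail_subset hL0)
  have hfree : TailFree L (fun x => val V x - t * Efun L x) := by
    have h1 := mode_congr (I := Ioi L) csin (u := fun x => val V x - t * Efun L x)
      (v := fun x => v x + -t * Efun L x) (by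
        filter_upwards [ae_mono (Measure.restrict_mono (tail_subset hL0) le_rfl) c0] with x hx
        rw [hx]; ring)
    have h2 := mode_add isProfile_csin (tailm hvm) (tailm hEf) (-t)
    have h3 : ∀ k : ℕ, ∀ᵐ s ∂μ[Ioo L k], mode csin v s =
        mode csin u s + -t * mode csin (onTail L (gam L m) csin) s := fun k =>
      mode_add isProfile_csin (memLp_box_of_strip hL0 (fun r hr => (hu.energy r hr).memLp) k)
        (memLp_box_of_strip hL0 (fun r _ =>
          (inEnergy_onTail ha hL r (p := p) (contDiff_gam L m) (gam_self L m)).memLp) k) (-t)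
    have h3' := ae_all_iff.2 fun k => (ae_restrict_iff' measurableSet_Ioo).1 (h3 k)
    have h1 := (ae_restrict_iff' measurableSet_Ioi).1 h1
    rw [ae_restrict_iff' measurableSet_Ioi] at h2
    filter_upwards [h1, h2, h3', hmode] with s h1 h2 h3 h4 hs
    obtain ⟨k, hk⟩ := exists_nat_gt s
    rw [h1 hs, h2 hs, h3 k ⟨hs, hk⟩, h4 hs, mode_onTail hs, integral_csin_sq, mode_Efun hs, gam]
    linear_combination -(π / 2 : ℝ) * hnexp s
  have htau : tau a p hL0 V = t := by
    rw [tau_apply hL0]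
    exact V.inEnergy.tau_eq hL0 hfree
  refine ⟨V, (redOp_iff hL0).2 (hweak.congr c1.symm c2.symm ?_ (ae_of_all _ fun x => ?_)), ?_,
    by rw [htau, htc]⟩
  · filter_upwards [c0, freeProj_of_tailFree_sub hL0 hfree] with x h0 h1
    rw [h1, h0, htau]; simp only [hG]; ring
  · rw [htau]; simp only [hG₁]; ring
  · refine AEEqFun.ext ?_
    filter_upwards [lift_ae hL0 m V, c0] with x h1 h2
    rw [h1, h2, htau]
    simp only [hv]
    ring

end

section

variable {I : Set ℝ}

/-! ### Operators that are coercive up to a compact perturbation -/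

section Abstract

variable {E : Type*} [NormedAddCommGroup E] [InnerProductSpace ℂ E]

/-- The quadratic expression `q` is bounded by the form of a compact operator. -/
def CompactBdd (q : E → ℝ) : Prop :=
  ∃ K : E →L[ℂ] E, IsCompactOperator K ∧ ∀ v, q v ≤ (⟪v, K v⟫_ℂ).re

namespace CompactBdd

variable {q r : E → ℝ}

lemma mono (h : CompactBdd q) (hr : ∀ v, r v ≤ q v) : CompactBdd r := by
  obtain ⟨K, hK, hq⟩ := h
  exact ⟨K, hK, fun v => (hr v).trans (hq v)⟩

lemma zero : CompactBdd (fun _ : E => 0) := ⟨0, isCompactOperator_zero, fun v => by simp⟩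

lemma add (h : CompactBdd q) (h' : CompactBdd r) : CompactBdd (fun v => q v + r v) := by
  obtain ⟨K, hK, hq⟩ := h
  obtain ⟨K', hK', hq'⟩ := h'
  refine ⟨K + K', hK.add hK', fun v => ?_⟩
  rw [ContinuousLinearMap.add_apply, inner_add_right, add_re]
  exact add_le_add (hq v) (hq' v)

lemma const_mul (h : CompactBdd q) {c : ℝ} (hc : 0 ≤ c) : CompactBdd (fun v => c * q v) := by
  obtain ⟨K, hK, hq⟩ := h
  refine ⟨(c : ℂ) • K, hK.smul (c : ℂ), fun v => ?_⟩
  rw [ContinuousLinearMap.smul_apply, inner_smul_right, re_ofReal_mul]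
  exact mul_le_mul_of_nonneg_left (hq v) hc

variable [CompleteSpace E]

lemma functional (l : E →L[ℂ] ℂ) : CompactBdd (fun v => ‖l v‖ ^ 2) := by
  refine ⟨ContinuousLinearMap.adjoint l ∘L l, ?_, fun v => ?_⟩
  · have h : IsCompactOperator (id : ℂ → ℂ) := isCompactOperator_id_iff_locallyCompactSpace.2
      inferInstance
    have h1 : IsCompactOperator l := h.comp_clm l
    exact h1.clm_comp (ContinuousLinearMap.adjoint l)
  · rw [ContinuousLinearMap.comp_apply, ContinuousLinearMap.adjoint_inner_right,
      inner_self_eq_norm_sq_to_K]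
    norm_cast

end CompactBdd

variable [CompleteSpace E]

/-- The Lax–Milgram argument: coercivity bounds `S` from below, so its range is closed, and a vector
orthogonal to the range is annihilated by the coercive form. -/
lemma isUnit_of_coercive {S : E →L[ℂ] E} {c : ℝ} (hc : 0 < c)
    (h : ∀ v, c * ‖v‖ ^ 2 ≤ (⟪v, S v⟫_ℂ).re) : IsUnit S := by
  have hb : ∀ v, c * ‖v‖ ≤ ‖S v‖ := by
    intro v
    rcases eq_or_ne v 0 with rfl | hv
    · simp
    have h1 := (h v).trans ((re_le_norm _).trans (norm_inner_le_norm v (S v)))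
    have hv' : 0 < ‖v‖ := norm_pos_iff.2 hv
    refine le_of_mul_le_mul_left ?_ hv'
    nlinarith
  have ha : AntilipschitzWith (Real.toNNReal c⁻¹) S := by
    refine S.antilipschitz_of_bound fun v => ?_
    rw [Real.coe_toNNReal _ (by positivity), inv_mul_eq_div, le_div_iff₀ hc]
    linarith [hb v]
  rw [ContinuousLinearMap.isUnit_iff_bijective]
  refine ⟨ha.injective, ?_⟩
  have hcl : IsClosed (S.range : Set E) := ha.isClosed_range S.uniformContinuous
  have := hcl.completeSpace_coe
  suffices hr : S.range = ⊤ from LinearMap.range_eq_top.1 hr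
  rw [← Submodule.orthogonal_eq_bot_iff, Submodule.eq_bot_iff]
  intro w hw
  have h0 : ⟪S w, w⟫_ℂ = 0 := (Submodule.mem_orthogonal _ _).1 hw _ ⟨w, rfl⟩
  have h1 := h w
  rw [← inner_conj_symm, h0] at h1
  simp at h1
  have : ‖w‖ ^ 2 = 0 := le_antisymm (by nlinarith [sq_nonneg ‖w‖]) (sq_nonneg _)
  simpa using this

/-- An injective operator that is coercive up to a compact perturbation is invertible. -/
lemma isUnit_of_compactBdd {T : E →L[ℂ] E} {c : ℝ} (hc : 0 < c)
    (h : CompactBdd fun v => c * ‖v‖ ^ 2 - (⟪v, T v⟫_ℂ).re)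
    (hinj : ∀ v, T v = 0 → v = 0) : IsUnit T := by
  obtain ⟨K, hK, hq⟩ := h
  have hS : IsUnit (T + K) := isUnit_of_coercive hc fun v => by
    rw [ContinuousLinearMap.add_apply, inner_add_right, add_re]
    linarith [hq v]
  obtain ⟨S, hS⟩ := hS
  set M : E →L[ℂ] E := (↑S⁻¹ : E →L[ℂ] E) * K with hM
  have hMc : IsCompactOperator M := hK.clm_comp (↑S⁻¹ : E →L[ℂ] E)
  -- With `S = T + K` invertible and `M = S⁻¹ K` compact, the Fredholm alternative for `M` at the
  -- value `1` reduces invertibility of `T` to injectivity.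
  have hT : T = (S : E →L[ℂ] E) * (1 - M) := by
    rw [mul_sub, mul_one, hM, ← mul_assoc, Units.mul_inv, one_mul, hS]
    abel
  have hres : (1 : ℂ) ∈ resolventSet ℂ M := by
    refine (hMc.hasEigenvalue_or_mem_resolventSet one_ne_zero).resolve_left fun he => ?_
    obtain ⟨v, hv⟩ := he.exists_hasEigenvector
    have hv' : M v = v := by simpa using hv.apply_eq_smul
    refine hv.2 (hinj v ?_)
    rw [hT, ContinuousLinearMap.mul_apply, ContinuousLinearMap.sub_apply, hv',
      ContinuousLinearMap.one_apply, sub_self, map_zero]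
  rw [hT]
  refine S.isUnit.mul ?_
  have := spectrum.mem_resolventSet_iff.1 hres
  simpa using this

end Abstract

/-! ### Wirtinger inequalities on the energy space -/

lemma L2Lim.mode (hk : IsProfile k) {fn : ℕ → ℝ² → ℂ} (h : L2Lim μ[box I] fn f) :
    L2Lim μ[I] (fun n => mode k (fn n)) (mode k f) := by
  refine ⟨fun n => (memLp_mode (h.mem n) hk).1, (memLp_mode h.mem_lim hk).1, ?_⟩
  have hd : ∀ n, MemLp (fun x => fn n x + (-1) * f x) 2 μ[box I] := fun n =>
    (h.mem n).add (h.mem_lim.const_mul _)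
  have hle : ∀ n, eLpNorm (Halfstrip.mode k (fn n) - Halfstrip.mode k f) 2 μ[I] ≤
      ENNReal.ofReal ((π * ∫ x in box I, ‖fn n x + (-1) * f x‖ ^ 2) ^ (2 : ℝ)⁻¹) := by
    intro n
    have hm := memLp_mode (hd n) hk
    have e : (Halfstrip.mode k (fn n) - Halfstrip.mode k f) =ᵐ[μ[I]]
        Halfstrip.mode k (fun x => fn n x + (-1) * f x) := by
      filter_upwards [mode_add hk (h.mem n) h.mem_lim (-1)] with s hs
      rw [hs, Pi.sub_apply]; ring
    rw [eLpNorm_congr_ae e, hm.1.eLpNorm_eq_integral_rpow_norm (by simp) (by simp)]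
    refine ENNReal.ofReal_le_ofReal ?_
    simp only [ENNReal.toReal_ofNat, Real.rpow_ofNat]
    exact Real.rpow_le_rpow (by positivity) hm.2 (by norm_num)
  have l0 : L2Lim μ[box I] (fun n x => fn n x + (-1) * f x)
      (fun x => f x + (-1) * f x) := h.add (L2Lim.const (h.mem_lim.const_mul (-1)))
  have l1 := l0.norm_sq
  simp only [neg_mul, one_mul, add_neg_cancel, norm_zero] at l1
  have l2 : Tendsto (fun n => ENNReal.ofReal
      ((π * ∫ x in box I, ‖fn n x + (-1) * f x‖ ^ 2) ^ (2 : ℝ)⁻¹)) atTop (𝓝 0) := by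
    have : Tendsto (fun n => (π * ∫ x in box I, ‖fn n x + (-1) * f x‖ ^ 2) ^ (2 : ℝ)⁻¹)
        atTop (𝓝 ((π * 0) ^ (2 : ℝ)⁻¹)) := by
      refine Tendsto.rpow_const (Tendsto.const_mul _ ?_) (Or.inr (by norm_num))
      simpa using l1
    simpa using ENNReal.tendsto_ofReal this
  exact tendsto_const_nhds.squeeze l2 (fun n => zero_le) hle

/-- The profile `cos (y / 2)` of the first mode over the Neumann part. -/
def chalf (y : ℝ) : ℂ := (Real.cos (y / 2) : ℝ)

lemma isProfile_chalf : IsProfile chalf := isProfile_cos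

lemma integral_box_norm_sq (hw : MemLp w 2 μ[box I]) :
    Integrable (fun s => ∫ y in Ioo 0 π, ‖w (s, y)‖ ^ 2) μ[I] ∧
    ∫ x in box I, ‖w x‖ ^ 2 = ∫ s in I, ∫ y in Ioo 0 π, ‖w (s, y)‖ ^ 2 := by
  have h := memLp_norm_sq hw
  rw [restrict_box] at h ⊢
  exact ⟨h.integral_prod_left, integral_prod _ h⟩

/-- The inequality on the slices of a test function is integrated over `I` and passes to the limit
in the energy space. Thus no slices of general elements have to be differentiated. -/
lemma wirtinger_box (hI : MeasurableSet I) (hk : IsProfile k) {c d : ℝ}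
    (hsl : ∀ φ : ℝ² → ℂ, IsBdryTest a p φ → ∀ s ∈ I,
      c * (∫ y in Ioo 0 π, ‖φ (s, y)‖ ^ 2) - d * ‖mode k φ s‖ ^ 2 ≤
        ∫ y in Ioo 0 π, ‖pd₂ φ (s, y)‖ ^ 2)
    (hv : InEnergy a p (box I) v v₁ v₂) :
    c * (∫ x in box I, ‖v x‖ ^ 2) - d * (∫ s in I, ‖mode k v s‖ ^ 2) ≤
      ∫ x in box I, ‖v₂ x‖ ^ 2 := by
  obtain ⟨φ, hφ, l0, l1, l2⟩ := hv
  refine le_of_tendsto_of_tendsto' ((l0.norm_sq.const_mul c).sub ((l0.mode hk).norm_sq.const_mul d))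
    l2.norm_sq fun n => ?_
  obtain ⟨i0, e0⟩ := integral_box_norm_sq (l0.mem n)
  obtain ⟨i2, e2⟩ := integral_box_norm_sq (l2.mem n)
  have im := memLp_norm_sq (memLp_mode (l0.mem n) hk).1
  rw [e0, e2, ← integral_const_mul, ← integral_const_mul,
    ← integral_sub (i0.const_mul c) (im.const_mul d)]
  exact setIntegral_mono_on ((i0.const_mul c).sub (im.const_mul d)) i2 hI
    fun s hs => hsl _ (hφ n) s hs

lemma hasDerivAt_slice (hφ : IsTest φ) (s y : ℝ) :
    HasDerivAt (fun y => φ (s, y)) (pd₂ φ (s, y)) y :=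
  hasDerivAt_pd₂ (hφ.1.diff _)

lemma wirtinger_left (hI : MeasurableSet I) (hI0 : I ⊆ Ioi 0) (hv : InEnergy a p (box I) v v₁ v₂) :
    9 / 4 * (∫ x in box I, ‖v x‖ ^ 2) - 4 / π * (∫ s in I, ‖mode chalf v s‖ ^ 2) ≤
      ∫ x in box I, ‖v₂ x‖ ^ 2 :=
  wirtinger_box hI isProfile_chalf (fun φ hφ s hs =>
    wirtinger_mixed (hasDerivAt_slice hφ.1 s)
      (hφ.1.d₂.1.continuous.comp (by fun_prop)) (hφ.eq_zero_pi (hI0 hs).le)) hv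

lemma wirtinger_right (ha : 0 ≤ a) (hI : MeasurableSet I) (hI0 : I ⊆ Ioi a)
    (hv : InEnergy a p (box I) v v₁ v₂) :
    4 * (∫ x in box I, ‖v x‖ ^ 2) - 6 / π * (∫ s in I, ‖mode csin v s‖ ^ 2) ≤
      ∫ x in box I, ‖v₂ x‖ ^ 2 :=
  wirtinger_box hI isProfile_csin (fun φ hφ s hs =>
    wirtinger_dirichlet (hasDerivAt_slice hφ.1 s)
      (hφ.1.d₂.1.continuous.comp (by fun_prop)) (hφ.eq_zero_zero le_rfl (hI0 hs))
      (hφ.eq_zero_pi (ha.trans (hI0 hs).le))) hv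

/-! ### A Poincaré inequality for modes -/

/-- On a short interval the derivative enters with the small factor `2 δ²`, and what remains is one
linear functional of `P`. Such functionals give compact forms, which is how compactness is obtained
here. -/
lemma poincare_interval {P P' : ℝ → ℂ} (hP : ∀ s, HasDerivAt P (P' s) s) (hP' : Continuous P')
    {α δ : ℝ} (hδ : 0 < δ) :
    ∫ s in Ioo α (α + δ), ‖P s‖ ^ 2 ≤ 2 * δ ^ 2 * (∫ s in Ioo α (α + δ), ‖P' s‖ ^ 2) +
      2 / δ * ‖∫ s in Ioo α (α + δ), P s‖ ^ 2 := by
  set I := Ioo α (α + δ) with hI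
  have hPc : Continuous P := continuous_iff_continuousAt.2 fun s => (hP s).continuousAt
  have vol : volume.real I = δ := by simp [hI, Measure.real, hδ.le]
  have ci : ∀ {E : Type} [NormedAddCommGroup E] {f : ℝ → E}, Continuous f → IntegrableOn f I :=
    fun hf => (hf.integrableOn_Icc (a := α) (b := α + δ)).mono_set Ioo_subset_Icc_self
  set J := ∫ s in I, ‖P' s‖ ^ 2
  set A := ∫ s in I, P s
  have hosc : ∀ s ∈ I, ∀ t ∈ I, ‖P s - P t‖ ^ 2 ≤ δ * J := by
    intro s hs t ht
    have h1 : ‖P s - P t‖ ≤ ∫ r in I, ‖P' r‖ := by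
      have e : P s - P t = ∫ r in t..s, P' r :=
        (intervalIntegral.integral_eq_sub_of_hasDerivAt (fun r _ => hP r)
          (hP'.intervalIntegrable _ _)).symm
      rw [e]
      refine intervalIntegral.norm_integral_le_integral_norm_uIoc.trans ?_
      refine setIntegral_mono_set (ci hP'.norm) (ae_of_all _ fun _ => norm_nonneg _) ?_
      have : uIoc t s ⊆ I := by
        intro r hr
        rcases le_total t s with h | h
        · rw [uIoc_of_le h] at hr; exact ⟨ht.1.trans hr.1, hr.2.trans_lt hs.2⟩
        · rw [uIoc_of_ge h] at hr; exact ⟨hs.1.trans hr.1, hr.2.trans_lt ht.2⟩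
      exact this.eventuallyLE
    have h2 : (∫ r in I, ‖P' r‖) ^ 2 ≤ δ * J := by
      set B := ∫ r in I, ‖P' r‖
      -- Cauchy–Schwarz, in the form that the variance of `‖P'‖` on an interval of length `δ` is
      -- nonnegative.
      have h0 : 0 ≤ ∫ r in I, (‖P' r‖ - B / δ) ^ 2 := integral_nonneg fun _ => sq_nonneg _
      have e : ∫ r in I, (‖P' r‖ - B / δ) ^ 2 = J - B ^ 2 / δ := by
        have : ∀ r, (‖P' r‖ - B / δ) ^ 2 = ‖P' r‖ ^ 2 - (2 * (B / δ)) * ‖P' r‖ + (B / δ) ^ 2 :=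
          fun r => by ring
        simp_rw [this]
        have j1 : IntegrableOn (fun r => ‖P' r‖ ^ 2) I := ci (hP'.norm.pow 2)
        have j2 : IntegrableOn (fun r => 2 * (B / δ) * ‖P' r‖) I := (ci hP'.norm).const_mul _
        have j3 : IntegrableOn (fun r => ‖P' r‖ ^ 2 - 2 * (B / δ) * ‖P' r‖) I := j1.sub j2
        rw [integral_add j3 (ci continuous_const), integral_sub j1 j2,
          integral_const_mul, setIntegral_const, vol, smul_eq_mul]
        change J - 2 * (B / δ) * B + _ = _
        field_simp
        ring
      rw [e, sub_nonneg, div_le_iff₀ hδ] at h0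
      linarith
    nlinarith [norm_nonneg (P s - P t)]
  have hpt : ∀ s ∈ I, ‖P s‖ ^ 2 ≤ 2 * (δ * J) + 2 * (‖A‖ / δ) ^ 2 := by
    intro s hs
    have e : (δ : ℂ) * P s = (∫ t in I, (P s - P t)) + A := by
      rw [integral_sub (ci continuous_const) (ci hPc), setIntegral_const, vol]
      simp [A]
    have hJ : 0 ≤ δ * J := (sq_nonneg _).trans (hosc s hs s hs)
    have hb : ‖∫ t in I, (P s - P t)‖ ≤ √(δ * J) * δ := by
      rw [← vol]
      refine norm_setIntegral_le_of_norm_le_const (by simp [hI]) fun t ht => ?_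
      rw [vol]
      exact le_sqrt_of_sq_le (hosc s hs t ht)
    have h1 : δ * ‖P s‖ ≤ √(δ * J) * δ + ‖A‖ := by
      calc δ * ‖P s‖ = ‖(δ : ℂ) * P s‖ := by rw [norm_mul, norm_real, norm_of_nonneg hδ.le]
        _ ≤ _ := by rw [e]; exact (norm_add_le _ _).trans (add_le_add_left hb _)
    have h2 : ‖P s‖ ≤ √(δ * J) + ‖A‖ / δ := by
      rw [← mul_le_mul_iff_right₀ hδ]
      refine h1.trans (le_of_eq ?_)
      field_simp
    have h3 := sq_sqrt hJ
    nlinarith [norm_nonneg (P s), sq_nonneg (√(δ * J) - ‖A‖ / δ)]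
  calc ∫ s in I, ‖P s‖ ^ 2 ≤ ∫ _ in I, (2 * (δ * J) + 2 * (‖A‖ / δ) ^ 2) :=
        setIntegral_mono_on (ci (hPc.norm.pow 2)) (ci continuous_const) measurableSet_Ioo hpt
    _ = δ * (2 * (δ * J) + 2 * (‖A‖ / δ) ^ 2) := by rw [setIntegral_const, vol, smul_eq_mul]
    _ = _ := by field_simp

end

section

variable {I : Set ℝ}

/-! ### Coercivity of the reduced operator up to a compact perturbation -/

lemma hasDerivAt_mode (hφ : IsTest φ) (hk : Continuous k) (s : ℝ) :
    HasDerivAt (mode k φ) (mode k (pd₁ φ) s) s := by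
  obtain ⟨C, hC⟩ := hφ.d₁.1.continuous.bounded_above_of_compact_support hφ.d₁.2
  have hc := hφ.1.continuous
  have hc1 := hφ.d₁.1.continuous
  have ci : ∀ {f : ℝ → ℂ}, Continuous f → IntegrableOn f (Ioo 0 π) := fun hf =>
    (hf.integrableOn_Icc (a := 0) (b := π)).mono_set Ioo_subset_Icc_self
  have ci' : ∀ {f : ℝ → ℝ}, Continuous f → IntegrableOn f (Ioo 0 π) := fun hf =>
    (hf.integrableOn_Icc (a := 0) (b := π)).mono_set Ioo_subset_Icc_self
  refine (hasDerivAt_integral_of_dominated_loc_of_deriv_le (bound := fun y => C * ‖k y‖)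
    (F := fun s y => φ (s, y) * k y) (F' := fun s y => pd₁ φ (s, y) * k y) univ_mem ?_ ?_ ?_ ?_ ?_
    ?_).2
  · exact Eventually.of_forall fun s => (by fun_prop : Continuous fun y => φ (s, y) * k y).aestronglyMeasurable
  · exact ci (by fun_prop)
  · exact (by fun_prop : Continuous fun y => pd₁ φ (s, y) * k y).aestronglyMeasurable
  · exact ae_of_all _ fun y t _ => by
      rw [norm_mul]; exact mul_le_mul_of_nonneg_right (hC _) (norm_nonneg _)
  · exact ci' (by fun_prop)
  · exact ae_of_all _ fun y t _ =>
      HasDerivAt.mul_const (hasDerivAt_pd₁ (hφ.1.diff _)) (k y)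

lemma mode_poincare (hk : IsProfile k) {α δ : ℝ} (hδ : 0 < δ)
    (hv : InEnergy a p (box (Ioo α (α + δ))) v v₁ v₂) :
    ∫ s in Ioo α (α + δ), ‖mode k v s‖ ^ 2 ≤
      2 * δ ^ 2 * (π * ∫ x in box (Ioo α (α + δ)), ‖v₁ x‖ ^ 2) +
        2 / δ * ‖∫ s in Ioo α (α + δ), mode k v s‖ ^ 2 := by
  obtain ⟨φ, hφ, l0, l1, -⟩ := hv
  have lm := l0.mode hk
  have hone : MemLp (fun _ : ℝ => (1 : ℂ)) 2 μ[Ioo α (α + δ)] := memLp_const 1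
  have lint := lm.integral_mul_const hone
  simp only [mul_one] at lint
  refine le_of_tendsto_of_tendsto' lm.norm_sq (((l1.norm_sq.const_mul _).const_mul _).add
    ((lint.norm.pow 2).const_mul _)) fun n => ?_
  have hd := hasDerivAt_mode (hφ n).1 hk.1
  have hd' := hasDerivAt_mode (hφ n).1.d₁ hk.1
  refine (poincare_interval hd (continuous_iff_continuousAt.2 fun s => (hd' s).continuousAt)
    hδ).trans ?_
  gcongr
  exact (memLp_mode (l1.mem n) hk).2

lemma memLp_box (hw : MemLp w 2 μ[strip]) (hI : I ⊆ Ioi 0) : MemLp w 2 μ[box I] :=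
  hw.mono_set (by rw [strip_eq_box]; exact box_mono hI)

lemma box_subset_strip (hI : I ⊆ Ioi 0) : box I ⊆ strip := by
  rw [strip_eq_box]; exact box_mono hI

/-- Integrals of modes over bounded intervals are bounded functionals. -/
lemma exists_functional_mode (hk : IsProfile k) {α β : ℝ} (hα : 0 ≤ α) :
    ∃ l : Energy a p →L[ℂ] ℂ, ∀ v, l v = ∫ s in Ioo α β, mode k (val v) s := by
  have hsub : Ioo α β ⊆ Ioi 0 := fun s hs => hα.trans_lt hs.1
  have hmeas := measurableSet_box (measurableSet_Ioo (a := α) (b := β))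
  obtain ⟨C, hC⟩ := isCompact_Icc.exists_bound_of_continuousOn (s := Icc 0 π) hk.1.continuousOn
  have hfin : IsFiniteMeasure μ[box (Ioo α β)] := by
    rw [restrict_box]; infer_instance
  have hkm : MemLp (fun x : ℝ² => k x.2) 2 μ[box (Ioo α β)] := by
    refine MemLp.of_bound (hk.1.comp continuous_snd).aestronglyMeasurable C ?_
    filter_upwards [ae_restrict_mem hmeas] with x hx
    exact hC _ ⟨hx.2.1.le, hx.2.2.le⟩
  have hw : MemLp ((box (Ioo α β)).indicator fun x => conj (k x.2)) 2 μ[strip] := by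
    rw [memLp_indicator_iff_restrict hmeas, Measure.restrict_restrict hmeas,
      inter_eq_self_of_subset_left (box_subset_strip hsub)]
    exact hkm.star
  refine ⟨(innerSL ℂ (hw.toLp _)).comp (cmp a p strip (MultiIndex.zero 1)), fun v => ?_⟩
  have e : ⟪hw.toLp _, val v⟫_ℂ = ∫ x in strip, val v x *
      (box (Ioo α β)).indicator (fun x => k x.2) x := by
    refine inner_eq_integral ?_
    filter_upwards [hw.coeFn_toLp] with x hx
    rw [hx]
    by_cases h : x ∈ box (Ioo α β)
    · simp [h]
    · simp [h]
  change ⟪hw.toLp _, val v⟫_ℂ = _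
  have e2 : ∀ x, val v x * (box (Ioo α β)).indicator (fun x => k x.2) x =
      (box (Ioo α β)).indicator (fun x => val v x * ((fun _ => (1 : ℂ)) x.1 * k x.2)) x := fun x => by
    by_cases h : x ∈ box (Ioo α β)
    · simp [h]
    · simp [h]
  simp_rw [e, e2]
  rw [setIntegral_indicator hmeas, inter_eq_self_of_subset_right (box_subset_strip hsub)]
  refine (integral_mode (η := fun _ => 1) ?_).trans (by simp)
  refine (memLp_mul (memLp_box (Lp.memLp (val v)) hsub) hkm).congr (ae_of_all _ fun x => ?_)
  simp

/-- The interval is cut into `n` pieces of length `δ`. On each piece the Poincaré inequality leaves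
one bounded functional, so the total compact part has finite rank. The condition on `ε` absorbs the
derivative terms. -/
lemma compactBdd_mode_aux (hk : IsProfile k) {α : ℝ} (hα : 0 ≤ α) {ε δ : ℝ}
    (hδ : 0 < δ) (hε : 2 * δ ^ 2 * π ≤ ε) (n : ℕ) :
    CompactBdd fun v : Energy a p => ∫ s in α..(α + n * δ),
      (‖mode k (val v) s‖ ^ 2 - ε * ∫ y in Ioo 0 π, ‖dx₁ v (s, y)‖ ^ 2) := by
  induction n with
  | zero => simpa using CompactBdd.zero
  | succ n ih =>
    set β := α + n * δ with hβ
    have hβ0 : 0 ≤ β := by positivity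
    have hγ : α + ((n + 1 : ℕ) : ℝ) * δ = β + δ := by push_cast; rw [hβ]; ring
    rw [hγ]
    have hi : ∀ v : Energy a p, ∀ I : Set ℝ, I ⊆ Ioi 0 → IntegrableOn (fun s =>
        (‖mode k (val v) s‖ ^ 2 - ε * ∫ y in Ioo 0 π, ‖dx₁ v (s, y)‖ ^ 2)) I := by
      intro v I hI
      exact (memLp_norm_sq (memLp_mode (memLp_box (Lp.memLp (val v)) hI) hk).1).sub
        ((integral_box_norm_sq (memLp_box (Lp.memLp (dx₁ v)) hI)).1.const_mul ε)
    obtain ⟨l, hl⟩ := exists_functional_mode (a := a) (p := p) hk (β := β + δ) hβ0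
    refine (ih.add ((CompactBdd.functional l).const_mul (c := 2 / δ) (by positivity))).mono
      fun v => ?_
    have hαβ : α ≤ β := by rw [hβ]; linarith [mul_nonneg (Nat.cast_nonneg (α := ℝ) n) hδ.le]
    have sub1 : Ioc α β ⊆ Ioi 0 := fun s hs => hα.trans_lt hs.1
    have sub2 : Ioc β (β + δ) ⊆ Ioi 0 := fun s hs => hβ0.trans_lt hs.1
    have sub3 : Ioo β (β + δ) ⊆ Ioi 0 := fun s hs => hβ0.trans_lt hs.1
    rw [← intervalIntegral.integral_add_adjacent_intervals (b := β)
      ((intervalIntegrable_iff_integrableOn_Ioc_of_le hαβ).2 (hi v _ sub1))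
      ((intervalIntegrable_iff_integrableOn_Ioc_of_le (by linarith)).2 (hi v _ sub2))]
    refine add_le_add_right ?_ _
    rw [intervalIntegral.integral_of_le (by linarith), integral_Ioc_eq_integral_Ioo]
    have i1 := memLp_norm_sq (memLp_mode (memLp_box (Lp.memLp (val v)) sub3) hk).1
    have i2 := integral_box_norm_sq (memLp_box (Lp.memLp (dx₁ v)) sub3)
    rw [integral_sub i1 (i2.1.const_mul ε), integral_const_mul, ← i2.2, hl v]
    have hp := mode_poincare hk hδ (v.inEnergy.mono (box_subset_strip sub3))
    have h0 : 0 ≤ ∫ x in box (Ioo β (β + δ)), ‖dx₁ v x‖ ^ 2 := integral_nonneg fun _ => sq_nonneg _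
    nlinarith

/-- The modes over a bounded interval are compact relative to the energy. -/
lemma compactBdd_mode (hk : IsProfile k) {α β ε : ℝ} (hα : 0 ≤ α) (hαβ : α < β)
    (hε : 0 < ε) : CompactBdd fun v : Energy a p => (∫ s in Ioo α β, ‖mode k (val v) s‖ ^ 2) -
      ε * ∫ x in box (Ioo α β), ‖dx₁ v x‖ ^ 2 := by
  have sub : Ioo α β ⊆ Ioi 0 := fun s hs => hα.trans_lt hs.1
  have hlim : Tendsto (fun n : ℕ => 2 * ((β - α) / ((n : ℝ) + 1)) ^ 2 * π) atTop
      (𝓝 (2 * 0 ^ 2 * π)) := by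
    have h1 : Tendsto (fun n : ℕ => (β - α) / ((n : ℝ) + 1)) atTop (𝓝 0) :=
      tendsto_const_nhds.div_atTop (tendsto_atTop_add_const_right _ _ tendsto_natCast_atTop_atTop)
    exact ((h1.pow 2).const_mul 2).mul_const _
  obtain ⟨n, hn⟩ := (hlim.eventually (gt_mem_nhds (show 2 * 0 ^ 2 * π < ε by simpa))).exists
  have hn1 : (0 : ℝ) < n + 1 := by positivity
  have := compactBdd_mode_aux (a := a) (p := p) hk hα (δ := (β - α) / (n + 1))
    (div_pos (by linarith) hn1) hn.le (n + 1)
  refine this.mono fun v => le_of_eq ?_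
  have e : α + ((n + 1 : ℕ) : ℝ) * ((β - α) / (n + 1)) = β := by push_cast; field_simp; ring
  rw [e, intervalIntegral.integral_of_le hαβ.le, integral_Ioc_eq_integral_Ioo]
  have i1 := memLp_norm_sq (memLp_mode (memLp_box (Lp.memLp (val v)) sub) hk).1
  have i2 := integral_box_norm_sq (memLp_box (Lp.memLp (dx₁ v)) sub)
  rw [integral_sub i1 (i2.1.const_mul ε), integral_const_mul, ← i2.2]

lemma integral_strip_split (ha : 0 ≤ a) (hL : a ≤ L) (hw : MemLp w 2 μ[strip]) :
    ∫ x in strip, ‖w x‖ ^ 2 = (∫ x in box (Ioo 0 a), ‖w x‖ ^ 2) +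
      (∫ x in box (Ioo a L), ‖w x‖ ^ 2) + ∫ x in box (Ioi L), ‖w x‖ ^ 2 := by
  have g := fun (I : Set ℝ) (hI : I ⊆ Ioi 0) => integral_box_norm_sq (memLp_box hw hI)
  have s1 : Ioo 0 a ⊆ Ioi 0 := fun s hs => hs.1
  have s2 : Ioo a L ⊆ Ioi 0 := fun s hs => ha.trans_lt hs.1
  have s3 : Ioi L ⊆ Ioi 0 := Ioi_subset_Ioi (ha.trans hL)
  have s4 : Ioi a ⊆ Ioi 0 := Ioi_subset_Ioi ha
  rw [strip_eq_box, (g _ subset_rfl).2, (g _ s1).2, (g _ s2).2, (g _ s3).2,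
    ← integral_Ioc_eq_integral_Ioo, ← integral_Ioc_eq_integral_Ioo,
    ← Ioc_union_Ioi_eq_Ioi ha, setIntegral_union (Ioc_disjoint_Ioi le_rfl) measurableSet_Ioi
      (g _ fun s hs => hs.1).1 (g _ s4).1, ← Ioc_union_Ioi_eq_Ioi hL,
    setIntegral_union (Ioc_disjoint_Ioi le_rfl) measurableSet_Ioi
      (g _ fun s hs => ha.trans_lt hs.1).1 (g _ s3).1]
  ring

lemma norm_sq_eq_integral (w : L2 strip) : ‖w‖ ^ 2 = ∫ x in strip, ‖w x‖ ^ 2 := by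
  have h : ⟪w, w⟫_ℂ = ∫ x in strip, ((‖w x‖ ^ 2 : ℝ) : ℂ) := by
    rw [inner_eq_integral (w := fun x => conj (w x)) (ae_of_all _ fun x => by simp)]
    refine integral_congr_ae (ae_of_all _ fun x => ?_)
    simp only [mul_conj, normSq_eq_norm_sq]
  rw [integral_complex_ofReal] at h
  rw [← inner_self_eq_norm_sq (𝕜 := ℂ) w, h]
  simp

/-- Bessel's inequality for the first sine mode. -/
lemma integral_mode_csin_le (hw : MemLp w 2 μ[box I]) :
    ∫ s in I, ‖mode csin w s‖ ^ 2 ≤ π / 2 * ∫ x in box I, ‖w x‖ ^ 2 := by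
  obtain ⟨i, e⟩ := integral_box_norm_sq hw
  rw [e, ← integral_const_mul]
  refine integral_mono_ae (memLp_norm_sq (memLp_mode hw isProfile_csin).1) (i.const_mul _) ?_
  filter_upwards [ae_slice_memLp hw] with s hs
  have h := sum_le_hasSum {1, -1} (fun _ _ => by positivity) (parseval_sin 0 hs)
  rw [Finset.sum_pair (by norm_num)] at h
  have e1 : ∫ y in Ioo 0 π, w (s, y) * (Real.sin (((1 : ℤ) - 0) * y) : ℝ) =
      mode csin w s := by simp [mode, csin]
  have e2 : ∫ y in Ioo 0 π, w (s, y) * (Real.sin (((-1 : ℤ) - 0) * y) : ℝ) =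
      -mode csin w s := by simp [mode, csin, integral_neg]
  rw [e1, e2, norm_neg] at h
  linarith

/-- Let `g` be the first mode part `(2/π) q(x₁) sin x₂` of `w` on the tail, with `q` the mode. It is
orthogonal to all functions without first mode, so `P w = P (w - g)`, and Pythagoras evaluates the
norm of `w - g`. -/
lemma norm_freeProj_sq_le (hL : 0 ≤ L) (w : L2 strip) :
    ‖freeProj L w‖ ^ 2 ≤ ‖w‖ ^ 2 - 2 / π * ∫ s in Ioi L, ‖mode csin w s‖ ^ 2 := by
  set q := mode csin w with hq
  have hqm : MemLp q 2 μ[Ioi L] :=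
    (memLp_mode (memLp_box (Lp.memLp w) (Ioi_subset_Ioi hL)) isProfile_csin).1
  set η : ℝ → ℂ := fun s => (2 / π : ℝ) * q s with hη
  have hηm : MemLp η 2 μ[Ioi L] := hqm.const_mul _
  have hηc : MemLp (fun s => conj (η s)) 2 μ[Ioi L] := hηm.star
  have hg := memLp_onTail hηm contDiff_csin.continuous norm_csin_le hL
  set g : L2 strip := hg.toLp _ with hgd
  have hinner : ∀ B : L2 strip, ⟪g, B⟫_ℂ = ∫ s in Ioi L, mode csin B s * conj (η s) := by
    intro B
    rw [← integral_tail_mode isProfile_csin norm_csin_le hL (Lp.memLp B) hηc]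
    refine inner_eq_integral ?_
    filter_upwards [hg.coeFn_toLp] with x hx
    rw [hx]
    by_cases h : L < x.1
    · rw [onTail_of_lt h, onTail_of_lt h]; simp [csin_conj]
    · rw [onTail_of_le (not_lt.1 h), onTail_of_le (not_lt.1 h)]; simp
  have hg0 : freeProj L g = 0 := by
    refine (Submodule.starProjection_apply_eq_zero_iff _).2 ?_
    rw [Submodule.mem_orthogonal']
    intro B hB
    rw [mem_orthogonal_tailSpan_iff hL] at hB
    rw [hinner, setIntegral_congr_ae (g := fun _ => (0 : ℂ)) measurableSet_Ioi]
    · simp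
    · filter_upwards [hB] with s hs hs'
      rw [hs hs', zero_mul]
  set P := ∫ s in Ioi L, ‖q s‖ ^ 2 with hP
  have e1 : ⟪g, w⟫_ℂ = ((2 / π * P : ℝ) : ℂ) := by
    rw [hinner, hP, ← integral_const_mul, ← integral_complex_ofReal]
    refine integral_congr_ae (ae_of_all _ fun s => ?_)
    simp only [hη, map_mul, conj_ofReal]
    rw [← hq, mul_left_comm, mul_conj, normSq_eq_norm_sq]
    push_cast; ring
  have e2 : ⟪g, g⟫_ℂ = ((2 / π * P : ℝ) : ℂ) := by
    rw [← e1, hinner, hinner]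
    have : mode csin g =ᵐ[μ[Ioi L]] mode csin (onTail L η csin) :=
      mode_congr csin (ae_restrict_of_ae_restrict_of_subset (tail_subset hL) hg.coeFn_toLp)
    refine integral_congr_ae ?_
    filter_upwards [this, ae_restrict_mem measurableSet_Ioi] with s hs hs'
    rw [hs, mode_onTail hs', integral_csin_sq]
    have hpi : ((2 / π : ℝ) : ℂ) * ((π / 2 : ℝ) : ℂ) = 1 := by
      rw [← ofReal_mul]; field_simp; simp
    simp only [hη]
    linear_combination (q s * (conj) (((2 / π : ℝ) : ℂ) * q s)) * hpi
  have hle : ‖freeProj L w‖ ≤ ‖w - g‖ := by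
    have : freeProj L w = freeProj L (w - g) := by rw [map_sub, hg0, sub_zero]
    rw [this]
    exact Submodule.norm_starProjection_apply_le _ _
  have hsq : ‖w - g‖ ^ 2 = ‖w‖ ^ 2 - 2 / π * P := by
    have h1 := norm_sub_sq (𝕜 := ℂ) w g
    rw [h1, ← inner_conj_symm, e1]
    have h2 : ‖g‖ ^ 2 = 2 / π * P := by
      rw [← inner_self_eq_norm_sq (𝕜 := ℂ) g, e2]
      simp
    rw [h2, conj_ofReal]
    simp only [RCLike.re_to_complex, ofReal_re]
    ring
  rw [← hsq]
  exact pow_le_pow_left₀ (norm_nonneg _) hle 2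

lemma re_inner_redOp (hL : 0 ≤ L) (m : ℂ) (v : Energy a p) :
    (⟪v, redOp a p hL m v⟫_ℂ).re = ‖dx₁ v‖ ^ 2 + ‖dx₂ v‖ ^ 2 -
      (1 - m ^ 2).re * ‖freeProj L (val v)‖ ^ 2 + (m - 1).re * ‖tau a p hL v‖ ^ 2 := by
  have h := inner_redOp hL m v v
  rw [inner_self_eq_norm_sq_to_K, inner_self_eq_norm_sq_to_K, inner_freeProj_self,
    ← normSq_eq_conj_mul_self, normSq_eq_norm_sq] at h
  rw [h, add_re, sub_re, re_mul_ofReal, re_mul_ofReal]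
  congr 2
  simp only [add_re]
  norm_cast

/-- The reduced operator is coercive up to a compact perturbation. -/
lemma redOp_compactBdd (ha : 0 < a) (hL : a < L) (hL0 : 0 ≤ L) (hm : ‖m‖ < 1 / 2) :
    CompactBdd fun v : Energy a p => 1 / 4 * ‖v‖ ^ 2 - (⟪v, redOp a p hL0 m v⟫_ℂ).re := by
  have c1 := compactBdd_mode (a := a) (p := p) isProfile_chalf le_rfl ha
    (show (0 : ℝ) < 1 / 2 by norm_num)
  have c2 := compactBdd_mode (a := a) (p := p) isProfile_csin ha.le hL
    (show (0 : ℝ) < 1 / 2 by norm_num)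
  have c3 := CompactBdd.functional (tau a p hL0)
  -- After `1/4 ‖v‖²` is taken off, three quarters of the gradient remain to be compared with at
  -- most `1/4 + 5/4 = 3/2` of `‖val v‖²`. Over the window `3/4 · 9/4 > 3/2` and elsewhere `3/4 · 4
  -- > 3/2` suffice up to the lowest modes. Their coefficients `4/π` and `6/π` are at most `2`,
  -- hence the weight `3/4 · 2 = 3/2`. On the unbounded tail the first mode is controlled by `P` and
  -- Bessel's inequality instead.
  refine (((c1.const_mul (c := 3 / 2) (by norm_num)).add (c2.const_mul (c := 3 / 2)
    (by norm_num))).add (c3.const_mul (c := 2) (by norm_num))).mono fun v => ?_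
  have hv := v.inEnergy
  have s1 : Ioo 0 a ⊆ Ioi 0 := fun s hs => hs.1
  have s2 : Ioo a L ⊆ Ioi a := fun s hs => hs.1
  have w1 := wirtinger_left measurableSet_Ioo s1 (hv.mono (box_subset_strip s1))
  have w2 := wirtinger_right ha.le measurableSet_Ioo s2
    (hv.mono (box_subset_strip (s2.trans (Ioi_subset_Ioi ha.le))))
  have w3 := wirtinger_right ha.le measurableSet_Ioi (Ioi_subset_Ioi hL.le)
    (hv.mono (box_subset_strip (Ioi_subset_Ioi hL0)))
  have b3 := integral_mode_csin_le (memLp_box (Lp.memLp (val v)) (Ioi_subset_Ioi hL0))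
  have fp := norm_freeProj_sq_le hL0 (val v)
  rw [re_inner_redOp, norm_sq_energy]
  have sp := integral_strip_split ha.le hL.le (Lp.memLp (val v))
  have sp1 := integral_strip_split ha.le hL.le (Lp.memLp (dx₁ v))
  have sp2 := integral_strip_split ha.le hL.le (Lp.memLp (dx₂ v))
  rw [← norm_sq_eq_integral] at sp sp1 sp2
  have hm1 : (1 - m ^ 2).re ≤ 5 / 4 ∧ 0 ≤ (1 - m ^ 2).re := by
    have := abs_le.1 (abs_re_sq_le hm)
    rw [sub_re, one_re]
    constructor <;> linarith
  have hm2 : -2 ≤ (m - 1).re := by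
    have := (abs_le.1 ((abs_re_le_norm m).trans hm.le)).1
    rw [sub_re, one_re]
    linarith
  have nn : ∀ {α : Type} [MeasurableSpace α] (μ : Measure α) (f : α → ℂ), 0 ≤ ∫ x, ‖f x‖ ^ 2 ∂μ :=
    fun μ f => integral_nonneg fun _ => sq_nonneg _
  have q1 := nn μ[Ioo 0 a] (mode chalf (val v))
  have q2 := nn μ[Ioo a L] (mode csin (val v))
  have q3 := nn μ[Ioi L] (mode csin (val v))
  have u1 := nn μ[box (Ioo 0 a)] (val v)
  have u2 := nn μ[box (Ioo a L)] (val v)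
  have u3 := nn μ[box (Ioi L)] (val v)
  have u4 := nn μ[box (Ioi L)] (dx₁ v)
  set V1 := ∫ x in box (Ioo 0 a), ‖val v x‖ ^ 2
  set V2 := ∫ x in box (Ioo a L), ‖val v x‖ ^ 2
  set V3 := ∫ x in box (Ioi L), ‖val v x‖ ^ 2
  set P1 := ∫ s in Ioo 0 a, ‖mode chalf (val v) s‖ ^ 2
  set P2 := ∫ s in Ioo a L, ‖mode csin (val v) s‖ ^ 2
  set P3 := ∫ s in Ioi L, ‖mode csin (val v) s‖ ^ 2
  have hpi := pi_gt_three
  have r1 : 4 / π * P1 ≤ 2 * P1 :=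
    mul_le_mul_of_nonneg_right (by rw [div_le_iff₀ pi_pos]; linarith) q1
  have r2 : 6 / π * P2 ≤ 2 * P2 :=
    mul_le_mul_of_nonneg_right (by rw [div_le_iff₀ pi_pos]; linarith) q2
  set Q := P3 / π with hQ
  have r3 : 6 / π * P3 = 6 * Q := by rw [hQ]; ring
  have r4 : 2 / π * P3 = 2 * Q := by rw [hQ]; ring
  have r5 : Q ≤ 1 / 2 * V3 := by rw [hQ, div_le_iff₀ pi_pos]; linarith
  have hQ0 : 0 ≤ Q := by positivity
  rw [r3] at w3
  rw [r4] at fp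
  have f0 := sq_nonneg ‖freeProj L (val v)‖
  have f1 : (1 - m ^ 2).re * ‖freeProj L (val v)‖ ^ 2 ≤ 5 / 4 * (‖val v‖ ^ 2 - 2 * Q) :=
    (mul_le_mul_of_nonneg_right hm1.1 f0).trans (by linarith)
  have f2 : -2 * ‖tau a p hL0 v‖ ^ 2 ≤ (m - 1).re * ‖tau a p hL0 v‖ ^ 2 :=
    mul_le_mul_of_nonneg_right hm2 (sq_nonneg _)
  linarith

end

section

/-! ### The kernel of the reduced operator at the threshold -/

lemma contDiff_chalf : Smooth chalf :=
  ofRealCLM.contDiff.comp (Real.contDiff_cos.comp (contDiff_id.div_const 2))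

lemma deriv_chalf : deriv chalf = fun y => ((-(1 / 2) * Real.sin (y / 2) : ℝ) : ℂ) := by
  ext y
  refine HasDerivAt.deriv (HasDerivAt.ofReal_comp ?_)
  have := (Real.hasDerivAt_cos (y / 2)).comp y ((hasDerivAt_id y).div_const 2)
  refine this.congr_deriv ?_
  simp; ring

lemma deriv_deriv_chalf (y : ℝ) : deriv (deriv chalf) y = -(1 / 4) * chalf y := by
  rw [deriv_chalf]
  have : HasDerivAt (fun y : ℝ => -(1 / 2) * Real.sin (y / 2)) (-(1 / 4) * Real.cos (y / 2)) y := by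
    have := ((Real.hasDerivAt_sin (y / 2)).comp y ((hasDerivAt_id y).div_const 2)).const_mul
      (-(1 / 2))
    refine this.congr_deriv ?_
    simp; ring
  rw [this.ofReal_comp.deriv, chalf]
  push_cast; ring

/-- The frequency `κ` with `κ² = -3/4`. -/
def kap : ℂ := I * (√3 / 2 : ℝ)

lemma kap_sq : kap ^ 2 = -(3 / 4) := by
  have : ((√3 : ℝ) : ℂ) ^ 2 = 3 := by
    rw [← ofReal_pow, sq_sqrt (by norm_num)]; norm_num
  rw [kap, mul_pow, I_sq]
  push_cast
  rw [div_pow, this]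
  norm_num

lemma kap_ne_zero : kap ≠ 0 := fun h => by
  have := kap_sq
  rw [h] at this
  norm_num at this

/-- The solution of `F'' = -3/4 F` with `F 0 = 0`, `F' 0 = 1`. -/
def kapF (s : ℝ) : ℂ := (exp (kap * s) - exp (-kap * s)) / (2 * kap)

lemma hasDerivAt_kapF (s : ℝ) : HasDerivAt kapF (exp (kap * s) - kap * kapF s) s := by
  have := ((hasDerivAt_cexp_mul kap s).sub (hasDerivAt_cexp_mul (-kap) s)).div_const (2 * kap)
  refine this.congr_deriv ?_
  have h := kap_ne_zero
  rw [kapF]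
  field_simp
  ring

lemma kapF_zero : kapF 0 = 0 := by simp [kapF]

/-- The profile of the first mode over the Neumann part. -/
def leftProfile : Parity → ℝ → ℂ
  | Parity.even => fun s => kap * kapF s + exp (-kap * s)
  | Parity.odd => kapF

/-- The integrand is the derivative of `G η' - G' η` for the solution `G` of `G'' = kap² G`, where
`G(0) = B` and `G'(0) = A - kap B`. The boundary term lets a test function that reaches `0` read off
the boundary condition. -/
lemma integral_wronskian (A B : ℂ) (hη : Smooth η) (hc : HasCompactSupport η) :
    ∫ s in Ioi (0 : ℝ), (A * kapF s + B * exp (-kap * s)) *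
      (deriv (deriv η) s - kap ^ 2 * η s) = -(B * deriv η 0 - (A - kap * B) * η 0) := by
  set G : ℝ → ℂ := fun s => A * kapF s + B * exp (-kap * s) with hG
  set G' : ℝ → ℂ := fun s => A * (exp (kap * s) - kap * kapF s) +
    B * (-kap * exp (-kap * s)) with hG'
  have d1 : ∀ s, HasDerivAt G (G' s) s := fun s =>
    (HasDerivAt.const_mul A (hasDerivAt_kapF s)).add
      (HasDerivAt.const_mul B (hasDerivAt_cexp_mul (-kap) s))
  have d2 : ∀ s, HasDerivAt G' (kap ^ 2 * G s) s := fun s => by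
    refine ((HasDerivAt.const_mul A ((hasDerivAt_cexp_mul kap s).sub
      (HasDerivAt.const_mul kap (hasDerivAt_kapF s)))).add (HasDerivAt.const_mul B
      (HasDerivAt.const_mul (-kap) (hasDerivAt_cexp_mul (-kap) s)))).congr_deriv ?_
    simp only [hG]; ring
  have sk : Smooth kapF := ((contDiff_cexp_mul _).sub (contDiff_cexp_mul _)).div_const _
  have sG : Smooth G := (contDiff_const.mul sk).add (contDiff_const.mul (contDiff_cexp_mul _))
  have sG' : Smooth G' := (funext fun s => (d1 s).deriv : deriv G = G') ▸ contDiff_deriv sG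
  have hd : ∀ s, HasDerivAt (fun s => G s * deriv η s - G' s * η s)
      (G s * (deriv (deriv η) s - kap ^ 2 * η s)) s := fun s =>
    (((d1 s).mul ((contDiff_deriv hη).diff s).hasDerivAt).sub
      ((d2 s).mul (hη.diff s).hasDerivAt)).congr_deriv (by ring)
  have hcs : HasCompactSupport (fun s => G s * deriv η s - G' s * η s) :=
    (hc.deriv.mul_left (f := G)).sub (hc.mul_left (f := G'))
  have := hcs.integral_Ioi_deriv_eq (((sG.mul (contDiff_deriv hη)).sub (sG'.mul hη)).of_le
    (by simp)) 0
  simp only [(hd _).deriv] at this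
  rw [this]
  simp only [hG, hG', kapF_zero, ofReal_zero, mul_zero, exp_zero]
  ring

/-- The test functions may reach the cut `x₁ = 0` and need only satisfy the parity condition there:
`cos(x₂/2)` is compatible with the Neumann condition below and the Dirichlet condition above. -/
lemma LocSol.left_test (h : LocSol a p u u₁ u₂ g) (ha : 0 < a)
    (hg : ∀ᵐ x ∂μ[strip], x.1 < a → g x = u x) (h1 : Smooth η)
    (h2 : HasCompactSupport η) (h3 : tsupport η ⊆ Iio a) (he : p = Parity.even → deriv η 0 = 0)
    (ho : p = Parity.odd → η 0 = 0) :
    ∫ s in Ioi (0 : ℝ), mode chalf u s * (deriv (deriv η) s - kap ^ 2 * η s) = 0 := by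
  have z : ∀ {s}, a ≤ s → η s = 0 := fun {s} hs =>
    eq_zero_off fun h' => not_lt.2 hs (h3 h')
  have hd0 : deriv chalf 0 = 0 := by rw [deriv_chalf]; simp
  have e := h.mode_test (b := 1) h1 h2 contDiff_chalf deriv_deriv_chalf
    (fun s _ _ => by rw [hd0, mul_zero]) he (fun x hx => by
      rcases hx with (⟨hx, -⟩ | ⟨-, hx⟩) | ⟨hp, hx, -⟩
      · have : chalf x.2 = 0 := by rw [hx]; simp [chalf]
        simp [sep, this]
      · simp [sep, z hx]
      · rw [sep, hx, ho hp, zero_mul])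
    (hg.mono fun x hx => (lt_or_ge x.1 a).symm.imp z fun h => by rw [hx h, one_mul])
  rw [← e, kap_sq]
  congr 1; ext s; ring

/-- The first mode over the Neumann part is determined up to a factor. -/
lemma LocSol.left_mode (h : LocSol a p u u₁ u₂ g) (ha : 0 < a)
    (hg : ∀ᵐ x ∂μ[strip], x.1 < a → g x = u x) :
    ∃ A : ℂ, ∀ᵐ s, s ∈ Ioo 0 a → mode chalf u s = A * leftProfile p s := by
  have hmem : MemLp (mode chalf u) 2 μ[Ioo 0 a] := by
    refine (memLp_mode ?_ isProfile_chalf).1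
    rw [← stripTo_eq_box]
    exact (h.energy a ha).memLp
  have hloc : LocallyIntegrableOn (mode chalf u) (Ioo 0 a) := by
    have : IntegrableOn (mode chalf u) (Ioo 0 a) := hmem.integrable (by norm_num)
    exact this.locallyIntegrableOn
  have z : ∀ {η : ℝ → ℂ}, tsupport η ⊆ Ioo 0 a → ∀ s, s ≤ 0 → η s = 0 ∧ deriv η s = 0 ∧
      deriv (deriv η) s = 0 := fun {η} h3 s hs => by
    have h0 : s ∉ tsupport η := fun h' => not_lt.2 hs (h3 h').1
    exact ⟨eq_zero_off h0, eq_zero_off fun h' => h0 (tsupport_deriv_subset _ h'),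
      eq_zero_off fun h' => h0 (tsupport_deriv_subset _ (tsupport_deriv_subset _ h'))⟩
  obtain ⟨A, B, hAB⟩ := weak_ode isOpen_Ioo ordConnected_Ioo hloc kap hasDerivAt_kapF
    (fun η h1 h2 h3 => by
      rw [← setIntegral_eq_integral_of_forall_compl_eq_zero (s := Ioi 0) fun s hs => by
        obtain ⟨z0, -, z2⟩ := z h3 s (not_lt.1 hs); simp [z0, z2]]
      exact h.left_test ha hg h1 h2 (fun s hs => (h3 hs).2) (fun _ => (z h3 0 le_rfl).2.1)
        (fun _ => (z h3 0 le_rfl).1))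
  -- The differential equation leaves two constants. Test functions that reach `0` impose one linear
  -- relation between them, which is the parity condition at the cut.
  have key : ∀ η : ℝ → ℂ, Smooth η → HasCompactSupport η → tsupport η ⊆ Iio a →
      (p = Parity.even → deriv η 0 = 0) → (p = Parity.odd → η 0 = 0) →
      B * deriv η 0 - (A - kap * B) * η 0 = 0 := by
    intro η h1 h2 h3 he ho
    have e := h.left_test ha hg h1 h2 h3 he ho
    have e' := integral_wronskian A B h1 h2
    have : ∫ s in Ioi (0 : ℝ), mode chalf u s * (deriv (deriv η) s - kap ^ 2 * η s) =
        ∫ s in Ioi (0 : ℝ), (A * kapF s + B * exp (-kap * s)) *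
          (deriv (deriv η) s - kap ^ 2 * η s) := by
      refine setIntegral_congr_ae measurableSet_Ioi ?_
      filter_upwards [hAB] with s hs hs0
      by_cases hsa : s < a
      · rw [hs ⟨hs0, hsa⟩]
      · have h0 : s ∉ tsupport η := fun h' => hsa (h3 h')
        rw [eq_zero_off h0, eq_zero_off
          fun h' => h0 (tsupport_deriv_subset _ (tsupport_deriv_subset _ h'))]
        simp
    rw [this, e'] at e
    exact neg_eq_zero.1 e
  obtain ⟨β, ⟨bs, bc, bt⟩, b1, -⟩ := exists_bump isOpen_Iio (show (0 : ℝ) ∈ Iio a from ha)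
  have b0 : β 0 = 1 := b1.self_of_nhds
  have bd : deriv β 0 = 0 := by rw [b1.deriv_eq]; simp
  cases p with
  | even =>
    have e := key β bs bc bt (fun _ => bd) (fun h => by cases h)
    rw [bd, b0] at e
    have hA : A = kap * B := by linear_combination -e
    refine ⟨B, ?_⟩
    filter_upwards [hAB] with s hs hs'
    rw [hs hs', hA, leftProfile]; ring
  | odd =>
    have hd : deriv (fun s : ℝ => (s : ℂ) * β s) 0 = 1 := by
      have := ((hasDerivAt_id (0 : ℝ)).ofReal_comp).mul ((bs.diff 0).hasDerivAt)
      refine (show deriv (fun s : ℝ => (s : ℂ) * β s) 0 = _ from this.deriv).trans ?_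
      simp [b0]
    have e := key (fun s => (s : ℂ) * β s) (ofRealCLM.contDiff.mul bs) bc.mul_left
      (tsupport_mul_subset_right.trans bt) (fun h => by cases h) (fun _ => by simp)
    rw [hd] at e
    have hB : B = 0 := by simpa using e
    refine ⟨A, ?_⟩
    filter_upwards [hAB] with s hs hs'
    rw [hs hs', hB, leftProfile]; ring

end

/-! ### The kernel at the threshold is at most one-dimensional. -/

section

variable {I : Set ℝ}

lemma ae_eq_zero_of_integral_norm_sq {α : Type*} [MeasurableSpace α] {μ : Measure α} {f : α → ℂ}
    (hf : MemLp f 2 μ) (h : ∫ x, ‖f x‖ ^ 2 ∂μ = 0) : f =ᵐ[μ] 0 := by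
  filter_upwards [(integral_eq_zero_iff_of_nonneg (fun _ => sq_nonneg _) (memLp_norm_sq hf)).1 h]
    with x hx
  simpa using hx

lemma integral_norm_nexp_sq (β : ℂ) :
    ∫ s in Ioi L, ‖β * (nexp L 1 s * (π / 2 : ℝ))‖ ^ 2 = ‖β‖ ^ 2 * (π / 4) := by
  have hn : ∀ s, ‖nexp L 1 s‖ ^ 2 = (nexp L 1 s * nexp L 1 s).re := fun s => by
    nth_rewrite 2 [← nexp_one_conj]
    rw [← normSq_eq_conj_mul_self, ofReal_re, normSq_eq_norm_sq]
  have e : ∀ s, ‖β * (nexp L 1 s * (π / 2 : ℝ))‖ ^ 2 =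
      (‖β‖ ^ 2 * (π / 2) ^ 2) * (nexp L 1 s * nexp L 1 s).re := fun s => by
    rw [← hn, norm_mul, norm_mul, norm_real, norm_of_nonneg (by positivity)]
    ring
  simp_rw [e]
  have hi : Integrable (fun s => nexp L 1 s * nexp L 1 s) μ[Ioi L] :=
    memLp_mul (memLp_nexp (by simp)) (memLp_nexp (by simp))
  rw [integral_const_mul, show ∫ s in Ioi L, (nexp L 1 s * nexp L 1 s).re =
    (∫ s in Ioi L, nexp L 1 s * nexp L 1 s).re from integral_re hi, integral_nexp_sq]
  have h2 : nrm * nrm * (1 / 2) = ((1 / π : ℝ) : ℂ) := by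
    have := nrm_sq
    have hpi : (π : ℂ) ≠ 0 := by exact_mod_cast Real.pi_ne_zero
    push_cast at this ⊢
    field_simp at this ⊢
    linear_combination this
  rw [h2, ofReal_re]
  field_simp
  ring

lemma setIntegral_norm_sq_congr {q g : ℝ → ℂ} (hI : MeasurableSet I)
    (h : ∀ᵐ s, s ∈ I → q s = g s) : ∫ s in I, ‖q s‖ ^ 2 = ∫ s in I, ‖g s‖ ^ 2 :=
  setIntegral_congr_ae hI (h.mono fun s hs hs' => by rw [hs hs'])

lemma TestOn.integral_eq_zero {q : ℝ → ℂ} (h : TestOn I η) (hq : ∀ᵐ s, s ∈ I → q s = 0) :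
    ∫ s, q s * η s = 0 :=
  integral_eq_zero_of_ae (hq.mono fun s hs => by
    by_cases h' : s ∈ I
    · simp [hs h']
    · simp [eq_zero_off fun h'' => h' (h.2.2 h'')])

set_option maxHeartbeats 1000000 in
/-- An element of the kernel whose first mode over the Neumann part vanishes is zero. -/
lemma eq_zero_of_redOp_eq_zero (ha : 0 < a) (hL : a < L) (hL0 : 0 ≤ L) {v : Energy a p}
    (hv0 : redOp a p hL0 0 v = 0) (hp : ∀ᵐ s, s ∈ Ioo 0 a → mode chalf (val v) s = 0) : v = 0 := by
  have hv := v.inEnergy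
  obtain ⟨hq, hr⟩ := hv.mode_of_tailFree hL0 (redOp_tailFree (F := 0) (m := 0) hL.le hL0
    ((Lp.coeFn_zero ℂ 2 μ[strip]).mono fun x hx _ => hx) (by rw [hv0, map_zero, neg_zero]))
  have s1 : Ioo 0 a ⊆ Ioi 0 := fun s hs => hs.1
  have s2 : Ioo a L ⊆ Ioi a := fun s hs => hs.1
  have s2' : Ioo a L ⊆ Ioi 0 := s2.trans (Ioi_subset_Ioi ha.le)
  have s3 : Ioi L ⊆ Ioi 0 := Ioi_subset_Ioi hL0
  have s12 : Ioo 0 L ⊆ Ioi 0 := fun s hs => hs.1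
  have mV := Lp.memLp (val v)
  have mD := Lp.memLp (dx₁ v)
  have w1 := wirtinger_left measurableSet_Ioo s1 (hv.mono (box_subset_strip s1))
  have w2 := wirtinger_right ha.le measurableSet_Ioo s2 (hv.mono (box_subset_strip s2'))
  have w3 := wirtinger_right ha.le measurableSet_Ioi (Ioi_subset_Ioi hL.le)
    (hv.mono (box_subset_strip s3))
  have b2 := integral_mode_csin_le (memLp_box mV s2')
  have b3 := integral_mode_csin_le (memLp_box mV s3)
  have d3 := integral_mode_csin_le (memLp_box mD s3)
  have fp := norm_freeProj_sq_le hL0 (val v)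
  have form := re_inner_redOp hL0 0 v
  have sp := integral_strip_split ha.le hL.le mV
  have sp1 := integral_strip_split ha.le hL.le mD
  have sp2 := integral_strip_split ha.le hL.le (Lp.memLp (dx₂ v))
  rw [← norm_sq_eq_integral] at sp sp1 sp2
  rw [hv0, inner_zero_right] at form
  simp only [zero_re, zero_sub, neg_re, one_re, ne_eq, OfNat.ofNat_ne_zero,
    not_false_eq_true, zero_pow, sub_zero, one_mul] at form
  have nn : ∀ {α : Type} [MeasurableSpace α] (μ : Measure α) (f : α → ℂ), 0 ≤ ∫ x, ‖f x‖ ^ 2 ∂μ :=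
    fun μ f => integral_nonneg fun _ => sq_nonneg _
  have u1 := nn μ[box (Ioo 0 a)] (val v)
  have u2 := nn μ[box (Ioo a L)] (val v)
  have D1 := nn μ[box (Ioo 0 a)] (dx₁ v)
  have D2 := nn μ[box (Ioo a L)] (dx₁ v)
  have P3 := (setIntegral_norm_sq_congr measurableSet_Ioi hq).trans (integral_norm_nexp_sq _)
  rw [setIntegral_norm_sq_congr (g := fun _ => 0) measurableSet_Ioo hp] at w1
  rw [P3] at w3 b3 fp
  rw [setIntegral_norm_sq_congr (g := fun s => -tau a p hL0 v * (nexp L 1 s * (π / 2 : ℝ)))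
    measurableSet_Ioi (hr.mono fun s hs hs' => by rw [hs hs', neg_mul]), integral_norm_nexp_sq,
    norm_neg] at d3
  simp only [norm_zero, ne_eq, OfNat.ofNat_ne_zero, not_false_eq_true, zero_pow, integral_zero,
    mul_zero, sub_zero] at w1
  have hpi := pi_pos
  set t := ‖tau a p hL0 v‖ ^ 2 with ht
  have ht0 : 0 ≤ t := sq_nonneg _
  rw [show 6 / π * (t * (π / 4)) = 3 / 2 * t by field_simp; ring] at w3
  rw [show 2 / π * (t * (π / 4)) = 1 / 2 * t by field_simp; ring] at fp
  set V3 := ∫ x in box (Ioi L), ‖val v x‖ ^ 2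
  set E3 := ∫ x in box (Ioi L), ‖dx₁ v x‖ ^ 2
  have b3' : t ≤ 2 * V3 := by nlinarith
  have d3' : t ≤ 2 * E3 := by nlinarith
  set V2 := ∫ x in box (Ioo a L), ‖val v x‖ ^ 2
  set Q2 := ∫ s in Ioo a L, ‖mode csin (val v) s‖ ^ 2 with hQ2
  -- Over `(a, L)` this leaves only the eigenvalue `4 - 3 = 1`, which just balances the spectral
  -- parameter. Nothing is gained there yet.
  have b2' : 6 / π * Q2 ≤ 3 * V2 := by
    rw [div_mul_eq_mul_div, div_le_iff₀ hpi]
    nlinarith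
  have mz : ∀ {I : Set ℝ} {w : ℝ² → ℂ}, MeasurableSet I → MemLp w 2 μ[box I] →
      ∫ x in box I, ‖w x‖ ^ 2 = 0 → ∀ᵐ s, s ∈ I → mode csin w s = 0 := fun hI hw h =>
    ((ae_restrict_iff' hI).1 (mode_congr csin (ae_eq_zero_of_integral_norm_sq hw h))).mono
      fun s hs hs' => by rw [hs hs']; simp [mode]
  -- The inequalities add up to `0 ≥ D₁ + D₂ + (5/4) V₁ + 3 (V₃ - t/2)`, where `D₁`, `D₂` are the
  -- squared norms of `∂₁v` over `(0, a)` and `(a, L)`, and `V₁`, `V₃` those of `v` over `(0, a)`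
  -- and the tail. Since `t ≤ 2 V₃`, it follows that `v` vanishes over `(0, a)` and `∂₁v` over both
  -- intervals.
  have q1 := mz measurableSet_Ioo (memLp_box mV s1) (by linarith)
  have r1 := mz measurableSet_Ioo (memLp_box mD s1) (by linarith)
  have r2 := mz measurableSet_Ioo (memLp_box mD s2') (by linarith)
  have hne : ∀ b : ℝ, ∀ᵐ s : ℝ, s ≠ b := fun b => compl_mem_ae_iff.2 (measure_singleton b)
  have r12 : ∀ᵐ s, s ∈ Ioo 0 L → mode csin (dx₁ v) s = 0 := by
    filter_upwards [r1, r2, hne a] with s h1 h2 h3 hs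
    exact h3.lt_or_gt.elim (fun h => h1 ⟨hs.1, h⟩) fun h => h2 ⟨h, hs.2⟩
  -- The first mode has zero derivative on all of `(0, L)`, so it is constant there, and the
  -- constant is zero by its values on `(0, a)`.
  have q12 : ∀ᵐ s, s ∈ Ioo 0 L → mode csin (val v) s = 0 := by
    have qi : LocallyIntegrableOn (mode csin (val v)) (Ioo 0 L) :=
      IntegrableOn.locallyIntegrableOn
        ((memLp_mode (memLp_box mV s12) isProfile_csin).1.integrable (by norm_num))
    obtain ⟨c, hc⟩ := exists_const_of_twisted isOpen_Ioo ordConnected_Ioo ⟨a, ha, hL⟩ 0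
      (Λ := fun χ => ∫ s, mode csin (val v) s * χ s) (fun s h h' =>
        (((h.int qi).hi.sub ((h'.int qi).hi.mul s)).congr (ae_of_all _ fun x => by ring)).2)
      (fun ζ h => by
        have := hv.integral_mode_deriv h.1 h.2.1 (h.2.2.trans s12)
        simpa [h.integral_eq_zero r12] using this)
    obtain ⟨b, hb, -, hbi⟩ := exists_bump isOpen_Ioo (x₀ := a / 2) (I := Ioo 0 a)
      ⟨by linarith, by linarith⟩
    have h0 := hc b ⟨hb.1, hb.2.1, hb.2.2.trans (Ioo_subset_Ioo_right hL.le)⟩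
    simp only [hb.integral_eq_zero q1, neg_zero, zero_mul, exp_zero, mul_one] at h0
    refine ae_eq_of_integral_smooth (g := 0) isOpen_Ioo qi (locallyIntegrableOn_const 0)
      fun χ h1 h2 h3 => ?_
    rw [hc χ ⟨h1, h2, h3⟩, (mul_eq_zero.1 h0.symm).resolve_right hbi]
    simp
  -- The first mode has a square integrable derivative and so cannot jump at `L`. It vanishes to the
  -- left and starts with the multiple `τ nrm π/2` on the right, as a test function equal to `1`
  -- near `L` shows.
  have htau : tau a p hL0 v = 0 := by
    obtain ⟨β, ⟨bs, bc, bt⟩, b1, -⟩ := exists_bump isOpen_Ioi (show L ∈ Ioi 0 from ha.trans hL)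
    have key := hv.integral_mode_deriv bs bc bt
    have z := fun s => eq_zero_of_tsupport_Ioi (s := s) bt
    have ee : ∀ {q : ℝ → ℂ} {c : ℂ} {ζ : ℝ → ℂ}, (∀ s, s ≤ 0 → ζ s = 0) →
        (∀ᵐ s, s ∈ Ioo 0 L → q s = 0) →
        (∀ᵐ s, s ∈ Ioi L → q s = c * (nexp L 1 s * (π / 2 : ℝ))) →
        ∫ s, q s * ζ s = (c * (π / 2 : ℝ)) * ∫ s in Ioi L, nexp L 1 s * ζ s := by
      intro q c ζ hz h0 h1
      rw [← integral_const_mul, ← integral_indicator measurableSet_Ioi]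
      refine integral_congr_ae ?_
      filter_upwards [h0, h1, hne L] with s h0 h1 h2
      rcases h2.lt_or_gt with h | h
      · rw [indicator_of_notMem (show s ∉ Ioi L from not_lt.2 h.le)]
        by_cases hs : 0 < s
        · rw [h0 ⟨hs, h⟩, zero_mul]
        · rw [hz s (not_lt.1 hs), mul_zero]
      · rw [indicator_of_mem (show s ∈ Ioi L from h), h1 h]; ring
    rw [ee (fun s hs => (z s hs).2) q12 hq, ee (c := -tau a p hL0 v) (fun s hs => (z s hs).1) r12
      (hr.mono fun s hs hs' => by rw [hs hs', neg_mul])] at key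
    have cn := (contDiff_nexp L 1).continuous
    have e3 : ∫ s in Ioi L, (nexp L 1 * deriv β - nexp L 1 * β) s = _ :=
      integral_nexp_mul_deriv bs bc
    rw [integral_sub' (((cn.mul (contDiff_deriv bs).continuous).integrable_of_hasCompactSupport
      bc.deriv.mul_left).integrableOn) (((cn.mul bs.continuous).integrable_of_hasCompactSupport
      bc.mul_left).integrableOn), b1.self_of_nhds, mul_one] at e3
    simp only [Pi.mul_apply] at e3
    refine ((mul_eq_zero (b := ((π / 2 : ℝ) : ℂ) * nrm)).1 ?_).resolve_right (mul_ne_zero ?_ nrm_ne_zero)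
    · linear_combination -key + tau a p hL0 v * ((π / 2 : ℝ) : ℂ) * e3
    · exact_mod_cast (show π / 2 ≠ 0 by positivity)
  have t0 : t = 0 := by rw [ht, htau]; simp
  -- With no first mode over `(a, L)` the full eigenvalue `4` is available there, and the energy
  -- identity is now strictly coercive.
  rw [hQ2, setIntegral_norm_sq_congr (g := fun _ => 0) measurableSet_Ioo (q12.mono fun s hs hs' =>
    hs ⟨ha.trans hs'.1, hs'.2⟩)] at w2
  simp only [norm_zero, ne_eq, OfNat.ofNat_ne_zero, not_false_eq_true, zero_pow, integral_zero,
    mul_zero, sub_zero] at w2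
  have hV : ‖val v‖ ^ 2 = 0 := by linarith [nn μ[box (Ioi L)] (val v)]
  refine Energy.ext_val ?_
  rw [show val (0 : Energy a p) = 0 from map_zero _]
  simpa using hV

/-- The kernel of the reduced operator at the threshold is at most one-dimensional. -/
lemma redOp_ker_one_dim (ha : 0 < a) (hL : a < L) (hL0 : 0 ≤ L) {v₀ v : Energy a p}
    (h₀ : redOp a p hL0 0 v₀ = 0) (hne : v₀ ≠ 0) (h : redOp a p hL0 0 v = 0) :
    ∃ c : ℂ, v = c • v₀ := by
  have lm : ∀ w : Energy a p, redOp a p hL0 0 w = 0 →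
      ∃ A : ℂ, ∀ᵐ s, s ∈ Ioo 0 a → mode chalf (val w) s = A * leftProfile p s := fun w hw => by
    have hz : ∀ᵐ x ∂μ[strip], (0 : L2 strip) x = 0 := Lp.coeFn_zero ℂ 2 μ[strip]
    obtain ⟨A, hA⟩ := (redOp_locSol (F := 0) (m := 0) ha hL.le hL0 (hz.mono fun x hx _ => hx)
      (by rw [hw, map_zero, neg_zero])).left_mode ha (hz.mono fun x hx _ => by rw [hx]; simp)
    refine ⟨A, hA.mono fun s hs hs' => ?_⟩
    rw [← hs hs']
    refine congrArg (integral _) (funext fun y => ?_)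
    simp [onTail_of_le (show (s, y).1 ≤ L from (hs'.2.trans hL).le)]
  obtain ⟨A₀, hA₀⟩ := lm v₀ h₀
  obtain ⟨A, hA⟩ := lm v h
  have hne0 : A₀ ≠ 0 := by
    rintro rfl
    exact hne (eq_zero_of_redOp_eq_zero ha hL hL0 h₀ (hA₀.mono fun s hs hs' => by
      rw [hs hs', zero_mul]))
  refine ⟨A / A₀, sub_eq_zero.1 (eq_zero_of_redOp_eq_zero ha hL hL0 ?_ ?_)⟩
  · rw [map_sub, map_smul, h, h₀, smul_zero, sub_zero]
  · have s1 : Ioo 0 a ⊆ Ioi 0 := fun s hs => hs.1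
    have e : (val (v - (A / A₀) • v₀)) =ᵐ[μ[box (Ioo 0 a)]]
        fun x => val v x + -(A / A₀) * val v₀ x := by
      refine ae_restrict_of_ae_restrict_of_subset (box_subset_strip s1) ?_
      rw [show val (v - (A / A₀) • v₀) = val v - (A / A₀) • val v₀ by
        rw [← map_smul, ← map_sub]]
      filter_upwards [Lp.coeFn_sub (val v) ((A / A₀) • val v₀), Lp.coeFn_smul (A / A₀) (val v₀)]
        with x h1 h2
      rw [h1, Pi.sub_apply, h2, Pi.smul_apply, smul_eq_mul]; ring
    have m1 := (ae_restrict_iff' measurableSet_Ioo).1 (mode_congr chalf e)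
    have m2 := (ae_restrict_iff' measurableSet_Ioo).1 (mode_add isProfile_chalf
      (memLp_box (Lp.memLp (val v)) s1) (memLp_box (Lp.memLp (val v₀)) s1) (-(A / A₀)))
    filter_upwards [m1, m2, hA₀, hA] with s k1 k2 k3 k4 hs
    rw [k1 hs, k2 hs, k3 hs, k4 hs]
    field_simp
    ring

end

section

/-! ### Quadratic operator pencils with a simple kernel at the origin -/

section Pencil

open ContinuousLinearMap

variable {E : Type*} [NormedAddCommGroup E] [InnerProductSpace ℂ E] [CompleteSpace E]
  {T K : E →L[ℂ] E} {τ : E →L[ℂ] ℂ} {v₀ : E}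

/-- The pencil `T + m² K + m τ*τ`. -/
def pencil (T K : E →L[ℂ] E) (τ : E →L[ℂ] ℂ) (m : ℂ) : E →L[ℂ] E :=
  T + m ^ 2 • K + m • (adjoint τ ∘L τ)

/-- The pencil after division by `m` in the direction of the kernel vector `v₀`. -/
def desing (T K : E →L[ℂ] E) (τ : E →L[ℂ] ℂ) (v₀ : E) (m : ℂ) : E →L[ℂ] E :=
  T + adjoint τ ∘L τ + m ^ 2 • (K ∘L (1 - τ.smulRight v₀)) + m • τ.smulRight (K v₀)

lemma one_clm_apply (v : E) : (1 : E →L[ℂ] E) v = v := rfl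

lemma mul_clm_apply (A B : E →L[ℂ] E) (v : E) : (A * B) v = A (B v) := rfl

lemma adjoint_apply_eq_smul (τ : E →L[ℂ] ℂ) (c : ℂ) : adjoint τ c = c • adjoint τ 1 := by
  rw [← map_smul, smul_eq_mul, mul_one]

lemma pencil_apply_kernel (h0 : T v₀ = 0) (h1 : τ v₀ = 1) (m : ℂ) :
    pencil T K τ m v₀ = m • (adjoint τ 1 + m • K v₀) := by
  simp only [pencil, add_apply, smul_apply, comp_apply, h0, h1, zero_add]
  module

lemma desing_apply (h0 : T v₀ = 0) (h1 : τ v₀ = 1) (m : ℂ) (v : E) :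
    desing T K τ v₀ m v = pencil T K τ m (v - τ v • v₀) + τ v • (adjoint τ 1 + m • K v₀) := by
  rw [map_sub, map_smul, pencil_apply_kernel h0 h1]
  simp only [desing, pencil, add_apply, smul_apply, comp_apply, sub_apply, smulRight_apply, one_clm_apply, map_sub, map_smul]
  rw [adjoint_apply_eq_smul τ (τ v)]
  module

/-- The operator `Q = τ(·) v₀` is a projection because `τ(v₀) = 1`. On its range the pencil carries
a factor `m`, and `desing` is the pencil composed with `m⁻¹ Q + (1 - Q)`, in which the powers of
`m⁻¹` cancel. -/
lemma pencil_apply_of_desing (h0 : T v₀ = 0) (h1 : τ v₀ = 1) (hm : m ≠ 0) (v : E) :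
    pencil T K τ m (m⁻¹ • (τ v • v₀) + (v - τ v • v₀)) = desing T K τ v₀ m v := by
  rw [map_add, map_smul, map_smul, pencil_apply_kernel h0 h1, desing_apply h0 h1, smul_comm (τ v) m,
    smul_smul, inv_mul_cancel₀ hm, one_smul, add_comm]

/-- For `m ≠ 0` the factor `m⁻¹ Q + (1 - Q)` has the inverse `m Q + (1 - Q)`, where `Q = τ(·) v₀` is
idempotent. -/
lemma isUnit_pencil_iff (h0 : T v₀ = 0) (h1 : τ v₀ = 1) (hm : m ≠ 0) :
    IsUnit (pencil T K τ m) ↔ IsUnit (desing T K τ v₀ m) := by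
  have e : ∀ c d : ℂ, (c • τ.smulRight v₀ + (1 - τ.smulRight v₀)) *
      (d • τ.smulRight v₀ + (1 - τ.smulRight v₀)) =
      (c * d) • τ.smulRight v₀ + (1 - τ.smulRight v₀) := fun c d => by
    ext v
    simp only [mul_clm_apply, add_apply, smul_apply, sub_apply, one_clm_apply, smulRight_apply, map_add,
      map_sub, map_smul, h1, smul_eq_mul]
    module
  have hu : IsUnit (m⁻¹ • τ.smulRight v₀ + (1 - τ.smulRight v₀)) :=
    ⟨⟨_, m • τ.smulRight v₀ + (1 - τ.smulRight v₀),
      by rw [e, inv_mul_cancel₀ hm]; simp, by rw [e, mul_inv_cancel₀ hm]; simp⟩, rfl⟩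
  rw [show desing T K τ v₀ m = pencil T K τ m * (m⁻¹ • τ.smulRight v₀ + (1 - τ.smulRight v₀)) by
    ext v; rw [← pencil_apply_of_desing h0 h1 hm]; rfl]
  exact (hu.unit.isUnit_mul_units (pencil T K τ m)).symm

lemma differentiable_desing : Differentiable ℂ (desing T K τ v₀) := by
  unfold desing; fun_prop

lemma desing_zero : desing T K τ v₀ 0 = T + adjoint τ ∘L τ := by simp [desing]

lemma exists_isUnit_desing (h : IsUnit (T + adjoint τ ∘L τ)) :
    ∃ ρ : ℝ, 0 < ρ ∧ ∀ m : ℂ, ‖m‖ < ρ → IsUnit (desing T K τ v₀ m) := by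
  obtain ⟨ρ, hρ, hb⟩ := isOpen_iff.1 ((Units.isOpen (R := E →L[ℂ] E)).preimage
    (differentiable_desing (T := T) (K := K) (τ := τ) (v₀ := v₀)).continuous) 0 (by
      change IsUnit _
      rwa [desing_zero])
  exact ⟨ρ, hρ, fun m hm => hb (mem_ball_zero_iff.2 hm)⟩

/-- The inverse of the pencil has a simple pole at the origin, with the residue `v₀ ⟪v₀, ·⟫`. -/
lemma exists_pencil_inverse (h0 : T v₀ = 0) (h1 : τ v₀ = 1) {ρ : ℝ} (hρ : 0 < ρ)
    (hs : ∀ v w, ⟪T v, w⟫_ℂ = ⟪v, T w⟫_ℂ)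
    (hu : ∀ m ∈ ball (0 : ℂ) ρ, IsUnit (desing T K τ v₀ m)) :
    ∃ V : ℂ → E →L[ℂ] E, DifferentiableOn ℂ V (ball 0 ρ) ∧ ∀ m ∈ ball (0 : ℂ) ρ, m ≠ 0 → ∀ w,
        pencil T K τ m (m⁻¹ • (⟪v₀, w⟫_ℂ • v₀) + V m w) = w := by
  set W : ℂ → E →L[ℂ] E := fun m => Ring.inverse (desing T K τ v₀ m)
  have hW : DifferentiableOn ℂ W (ball 0 ρ) := fun m hm =>
    (((differentiableAt_inverse (𝕜 := ℂ) (hu m hm)).comp m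
      differentiable_desing.differentiableAt)).differentiableWithinAt
  have hb : ball (0 : ℂ) ρ ∈ 𝓝 0 := ball_mem_nhds _ hρ
  have hWm : ∀ m ∈ ball (0 : ℂ) ρ, ∀ w, desing T K τ v₀ m (W m w) = w := fun m hm w => by
    rw [← mul_clm_apply, Ring.mul_inverse_cancel _ (hu m hm), one_clm_apply]
  -- Pair `(T + τ*τ) W(0) w = w` with `v₀`. As `T` is symmetric and kills `v₀`, only the term with
  -- `τ` survives. This is the residue.
  have hr : ∀ w, τ (W 0 w) = ⟪v₀, w⟫_ℂ := fun w => by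
    conv_rhs => rw [← hWm 0 (mem_ball_self hρ) w]
    simp only [desing, ne_eq, OfNat.ofNat_ne_zero, not_false_eq_true, zero_pow, zero_smul, add_zero]
    rw [add_apply, inner_add_right, ← hs, h0, inner_zero_left, comp_apply, adjoint_inner_right, h1]
    simp
  -- The inverse of the pencil is `m⁻¹ Q W(m) + (1 - Q) W(m)` with `Q = τ(·) v₀`. Its singular part
  -- is `m⁻¹ Q W(0)`, and the difference quotient of `W` at `0` is the holomorphic rest.
  refine ⟨fun m => (1 - τ.smulRight v₀) ∘L W m + τ.smulRight v₀ ∘L dslope W 0 m, ?_, ?_⟩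
  · have hd := (differentiableOn_dslope hb).2 hW
    exact ((differentiableOn_const _).clm_comp hW).add ((differentiableOn_const _).clm_comp hd)
  · intro m hm hm0 w
    conv_rhs => rw [← hWm m hm w, ← pencil_apply_of_desing h0 h1 hm0]
    congr 1
    have hsl : τ (dslope W 0 m w) = m⁻¹ * (τ (W m w) - ⟪v₀, w⟫_ℂ) := by
      rw [dslope_of_ne _ hm0, slope_def_module, sub_zero, smul_apply, sub_apply, map_smul, map_sub,
        hr, smul_eq_mul]
    simp only [add_apply, comp_apply, sub_apply, one_clm_apply, smulRight_apply, hsl]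
    module

end Pencil

lemma redOp_eq_pencil (hL : 0 ≤ L) (m : ℂ) : redOp a p hL m = pencil (redOp a p hL 0)
    (ContinuousLinearMap.adjoint (cmp a p strip (MultiIndex.zero 1)) ∘L freeProj L ∘L
      cmp a p strip (MultiIndex.zero 1)) (tau a p hL) m := by
  simp only [pencil, redOp]
  module

lemma redOp_symm (hL : 0 ≤ L) (v w : Energy a p) :
    ⟪redOp a p hL 0 v, w⟫_ℂ = ⟪v, redOp a p hL 0 w⟫_ℂ := by
  refine (inner_conj_symm (𝕜 := ℂ) (E := Energy a p) _ _).symm.trans ?_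
  rw [inner_redOp, inner_redOp]
  simp only [map_add, map_sub, map_mul, inner_conj_symm, isSelfAdjoint_freeProj, conj_conj,
    map_one, map_zero, map_pow]
  ring

/-- The reduced operator with a rank one correction that removes the kernel. -/
lemma isUnit_redOp_add (ha : 0 < a) (hL : a < L) (hL0 : 0 ≤ L) {v₀ : Energy a p}
    (h0 : redOp a p hL0 0 v₀ = 0) (h1 : tau a p hL0 v₀ = 1) : IsUnit (redOp a p hL0 0 +
      ContinuousLinearMap.adjoint (tau a p hL0) ∘L tau a p hL0) := by
  have hne : v₀ ≠ 0 := by rintro rfl; simp at h1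
  have hin : ∀ v w : Energy a p, ⟪v, (ContinuousLinearMap.adjoint (tau a p hL0) ∘L tau a p hL0) w⟫_ℂ =
      conj (tau a p hL0 v) * tau a p hL0 w := fun v w => by
    rw [ContinuousLinearMap.comp_apply, ContinuousLinearMap.adjoint_inner_right, RCLike.inner_apply]
    ring
  refine isUnit_of_compactBdd (c := 1 / 4) (by norm_num)
    ((redOp_compactBdd ha hL hL0 (m := 0) (by norm_num)).mono fun v => ?_) fun v hv => ?_
  · rw [ContinuousLinearMap.add_apply, inner_add_right, hin, add_re,
      ← normSq_eq_conj_mul_self, ofReal_re]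
    linarith [normSq_nonneg (tau a p hL0 v)]
  -- Pairing with `v₀` gives `τ(v) = 0`, so `v` lies in the kernel of `redOp a p hL0 0`. It is then
  -- a multiple of `v₀`, and `τ(v₀) = 1` makes the multiple zero.
  · have e := congrArg (fun w => ⟪v₀, w⟫_ℂ) hv
    simp only [ContinuousLinearMap.add_apply, inner_add_right, ← redOp_symm, h0, inner_zero_left,
      hin, h1, map_one, one_mul, zero_add, inner_zero_right] at e
    rw [ContinuousLinearMap.add_apply, ContinuousLinearMap.comp_apply, e, map_zero, add_zero] at hv
    obtain ⟨c, rfl⟩ := redOp_ker_one_dim ha hL hL0 h0 hne hv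
    rw [map_smul, h1, smul_eq_mul, mul_one] at e
    rw [e, zero_smul]

lemma tau_of_resonance {t : ℂ} (h : t * nrm * exp (0 * L) = nrm) : t = 1 := by
  rw [zero_mul, exp_zero, mul_one] at h
  exact mul_right_cancel₀ nrm_ne_zero (h.trans (one_mul _).symm)

/-- The element of the energy space that represents the threshold resonance. -/
lemma exists_resonance (ha : 0 < a) (hL : a ≤ L) (hL0 : 0 ≤ L) {ψ : StripFun}
    (hψ : IsThresholdResonance a p ψ) : ∃ v₀ : Energy a p, redOp a p hL0 0 v₀ = 0 ∧
      tau a p hL0 v₀ = 1 ∧ lift a p hL0 0 v₀ = ψ := by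
  obtain ⟨v, h1, h2, h3⟩ := exists_redOp_of_isWeakSolution ha hL hL0 (m := 0) (by norm_num)
    (Lp.coeFn_zero ℂ 2 _) (by
      filter_upwards [Lp.coeFn_zero ℂ 2 μ[strip]] with x hx _
      rw [hx]; rfl) hψ.1 hψ.2
  exact ⟨v, by rw [h1, map_zero, neg_zero], tau_of_resonance h3, h2⟩

/-- Both resonances come from the one-dimensional kernel, and the normalization fixes the factor. It
is needed to see that the resonance equals its complex conjugate. -/
lemma IsThresholdResonance.unique (ha : 0 < a) {ψ φ : StripFun}
    (hψ : IsThresholdResonance a p ψ) (hφ : IsThresholdResonance a p φ) : ψ = φ := by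
  have hL0 : 0 ≤ a + 1 := by linarith
  obtain ⟨v, hv, hτ, rfl⟩ := exists_resonance ha (by linarith : a ≤ a + 1) hL0 hψ
  obtain ⟨w, hw, hσ, rfl⟩ := exists_resonance ha (by linarith : a ≤ a + 1) hL0 hφ
  obtain ⟨c, rfl⟩ := redOp_ker_one_dim ha (by linarith) hL0 hv (by rintro rfl; simp at hτ) hw
  rw [map_smul, hτ, smul_eq_mul, mul_one] at hσ
  rw [hσ, one_smul]

lemma integral_conj_eq (h : ∀ᵐ x ∂μ[Ω],
    f x = conj (g x)) : ∫ x in Ω, f x = conj (∫ x in Ω, g x) := by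
  rw [← integral_conj]; exact integral_congr_ae h

/-- The threshold resonance is real-valued. -/
lemma IsThresholdResonance.star (ha : 0 < a) {ψ : StripFun} (hψ : IsThresholdResonance a p ψ) :
    ∀ᵐ x ∂μ[strip], conj (ψ x) = ψ x := by
  have hc : Continuous (conj) := continuous_conj
  set φ : StripFun := ψ.comp _ hc
  have hφ : φ =ᵐ[μ[strip]] fun x => conj (ψ x) := AEEqFun.coeFn_comp _ hc ψ
  have h0 : ∀ r, 0 < r → MemLp (0 : ℝ² → ℂ) 2 μ[stripTo r] :=
    fun r _ => MemLp.zero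
  have hr : IsThresholdResonance a p φ := by
    refine ⟨(isWeakSolution_iff h0).2 ?_, ?_⟩
    · obtain ⟨u₁, u₂, h⟩ := (isWeakSolution_iff h0).1 hψ.1
      refine ⟨fun x => conj (u₁ x), fun x => conj (u₂ x), LocSol.congr
        (u := fun x => conj (ψ x)) (g := fun x => conj ((1 - 0 ^ 2) * ψ x - 0))
        ⟨fun r hr => (h.energy r hr).star, fun r hr => ?_, fun θ hθ => ?_⟩ hφ.symm ?_⟩
      · exact (MemLp.star (h.source r hr))
      · have := h.weak _ hθ.star
        rw [integral_conj_eq (g := fun x => u₁ x * pd₁ (fun x => conj (θ x)) x +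
          u₂ x * pd₂ (fun x => conj (θ x)) x) (ae_of_all _ fun x => by
            simp [pd₁_conj, pd₂_conj]), this, ← integral_conj]
        simp
      · filter_upwards [hφ] with x hx
        simp [hx]
    · obtain ⟨C, X, h⟩ := hψ.2
      refine ⟨C, X, ?_⟩
      filter_upwards [h, hφ] with x h1 h2 h3
      rw [h2, ← norm_conj]
      simpa [-ofReal_sin] using h1 h3
  filter_upwards [hφ, AEEqFun.ext_iff.1 (hψ.unique ha hr)] with x h1 h2
  rw [← h1, h2]

end

/-! ### Restriction and extension by zero, and the resolvent on a disc that does not depend on the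
truncation. -/

section

/-- Restriction of square integrable functions. -/
def restr (h : Ω' ⊆ Ω) : L2 Ω →L[ℂ] L2 Ω' :=
  LinearMap.mkContinuous
    { toFun u := ((Lp.memLp u).mono_set h).toLp u
      map_add' u v := by
        rw [← MemLp.toLp_add]
        exact MemLp.toLp_congr _ _ (ae_mono (Measure.restrict_mono h le_rfl) (Lp.coeFn_add u v))
      map_smul' c u := by
        rw [RingHom.id_apply, ← MemLp.toLp_const_smul]
        exact MemLp.toLp_congr _ _ (ae_mono (Measure.restrict_mono h le_rfl) (Lp.coeFn_smul c u)) }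
    1 fun u => by
      rw [one_mul, LinearMap.coe_mk, AddHom.coe_mk, Lp.norm_toLp, Lp.norm_def]
      exact ENNReal.toReal_mono (Lp.eLpNorm_ne_top u)
        (eLpNorm_mono_measure _ (Measure.restrict_mono h le_rfl))

lemma restr_ae (h : Ω' ⊆ Ω) (u : L2 Ω) : restr h u =ᵐ[μ[Ω']] u :=
  MemLp.coeFn_toLp ((Lp.memLp u).mono_set h)

lemma memLp_indicator_stripTo (f : L2 (stripTo R)) : MemLp ((stripTo R).indicator f) 2 μ[strip] :=
  (memLp_indicator_iff_restrict (isOpen_stripTo R).measurableSet).2 (by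
    rw [restrict_strip_stripTo]; exact Lp.memLp f)

/-- Extension by zero. -/
def extZero (R : ℝ) : L2 (stripTo R) →L[ℂ] L2 strip :=
  LinearMap.mkContinuous
    { toFun f := (memLp_indicator_stripTo f).toLp _
      map_add' f g := by
        rw [← MemLp.toLp_add]
        refine MemLp.toLp_congr _ _ (ae_restrict_of_ae ?_)
        filter_upwards [(ae_restrict_iff' (isOpen_stripTo R).measurableSet).1 (Lp.coeFn_add f g)]
          with x hx
        by_cases h : x ∈ stripTo R
        · simp only [indicator_of_mem h, hx h, Pi.add_apply]
        · simp [h]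
      map_smul' c f := by
        rw [RingHom.id_apply, ← MemLp.toLp_const_smul]
        refine MemLp.toLp_congr _ _ (ae_restrict_of_ae ?_)
        filter_upwards [(ae_restrict_iff' (isOpen_stripTo R).measurableSet).1 (Lp.coeFn_smul c f)]
          with x hx
        by_cases h : x ∈ stripTo R
        · simp [h, hx h]
        · simp [h] }
    1 fun f => by
      rw [one_mul, LinearMap.coe_mk, AddHom.coe_mk, Lp.norm_toLp, Lp.norm_def,
        eLpNorm_indicator_eq_eLpNorm_restrict (isOpen_stripTo R).measurableSet,
        restrict_strip_stripTo]

lemma extZero_ae (f : L2 (stripTo R)) : extZero R f =ᵐ[μ[strip]] (stripTo R).indicator f :=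
  MemLp.coeFn_toLp (memLp_indicator_stripTo f)

lemma extZero_tail (hR : R ≤ L) (f : L2 (stripTo R)) :
    ∀ᵐ x ∂μ[strip], L < x.1 → extZero R f x = 0 := by
  filter_upwards [extZero_ae f] with x hx hL
  rw [hx, indicator_of_notMem fun h => (hR.trans_lt hL).not_gt h.2]

lemma ae_zero_L2 : ∀ᵐ x ∂μ[strip], (0 : L2 strip) x = 0 := by
  filter_upwards [Lp.coeFn_zero ℂ 2 μ[strip]] with x hx using hx

/-- The homogeneous problem has no nontrivial solutions if the reduced operator for one value of
the truncation parameter is injective. -/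
lemma redOp_injective_of_injective (ha : 0 < a) {L' : ℝ} (hL : a ≤ L) (hL0 : 0 ≤ L)
    (hL' : a ≤ L') (hL0' : 0 ≤ L') (hm : ‖m‖ < 1 / 2)
    (h : ∀ v : Energy a p, redOp a p hL0 m v = 0 → v = 0) {v : Energy a p}
    (hv : redOp a p hL0' m v = 0) : v = 0 := by
  have z : redOp a p hL0' m v = - src a p 0 := by rw [hv, map_zero, neg_zero]
  obtain ⟨s1, s2⟩ := redOp_isSolution ha hL' hL0' hm (Lp.coeFn_zero ℂ 2 _)
    (ae_zero_L2.mono fun x hx _ => hx) z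
  obtain ⟨w, h1, h2, h3⟩ := exists_redOp_of_isWeakSolution ha hL hL0 hm (Lp.coeFn_zero ℂ 2 _)
    (ae_zero_L2.mono fun x hx _ => hx) s1 s2
  obtain rfl := h w (by rw [h1, map_zero, neg_zero])
  -- The solution that belongs to `v` also comes from the zero element for the parameter `L`. So its
  -- leading coefficient vanishes, which is `τ(v)` up to nonzero factors.
  have ht : tau a p hL0' v = 0 := by
    rw [map_zero, zero_mul, zero_mul, eq_comm, mul_assoc] at h3
    exact (mul_eq_zero.1 h3).resolve_right (mul_ne_zero nrm_ne_zero (exp_ne_zero _))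
  refine Energy.ext_val (Lp.ext ?_)
  have e : lift a p hL0' m v = (val v : StripFun) + tau a p hL0' v • gamCls L' m := rfl
  rw [ht, ← h2, map_zero] at e
  have e' : (val v : StripFun) = 0 := by
    rw [e]; exact (add_eq_left.2 (zero_smul ℂ (gamCls L' m))).symm
  rw [e', show val (0 : Energy a p) = 0 from map_zero _]
  exact AEEqFun.coeFn_zero.trans (Lp.coeFn_zero ℂ 2 _).symm

lemma isUnit_redOp (ha : 0 < a) (hL : a < L) (hL0 : 0 ≤ L) (hm : ‖m‖ < 1 / 2)
    (h : ∀ v : Energy a p, redOp a p hL0 m v = 0 → v = 0) : IsUnit (redOp a p hL0 m) :=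
  isUnit_of_compactBdd (c := 1 / 4) (by norm_num) (redOp_compactBdd ha hL hL0 hm) h

lemma eq_zero_of_isUnit {E : Type*} [NormedAddCommGroup E] [NormedSpace ℂ E] {T : E →L[ℂ] E}
    (h : IsUnit T) {v : E} (hv : T v = 0) : v = 0 := by
  obtain ⟨u, rfl⟩ := h
  have : (u⁻¹ * u : (E →L[ℂ] E)ˣ).1 v = v := by rw [inv_mul_cancel]; rfl
  rw [← this, Units.val_mul]
  change u⁻¹.1 (u.1 v) = 0
  rw [hv, map_zero]

/-- The inverse of the reduced operator near the threshold. -/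
lemma exists_resolvent (ha : 0 < a) {ψ : StripFun} (hψ : IsThresholdResonance a p ψ) :
    ∃ ρ : ℝ, 0 < ρ ∧ ρ ≤ 1 / 2 ∧ ∀ (L : ℝ) (_ : a < L) (hL0 : 0 ≤ L) (v₀ : Energy a p),
      redOp a p hL0 0 v₀ = 0 → tau a p hL0 v₀ = 1 →
      (∀ m ∈ ball (0 : ℂ) ρ, m ≠ 0 → ∀ v : Energy a p, redOp a p hL0 m v = 0 → v = 0) ∧
      ∃ V : ℂ → Energy a p →L[ℂ] Energy a p, DifferentiableOn ℂ V (ball 0 ρ) ∧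
        ∀ m ∈ ball (0 : ℂ) ρ, m ≠ 0 → ∀ w,
          redOp a p hL0 m (m⁻¹ • (⟪v₀, w⟫_ℂ • v₀) + V m w) = w := by
  have hL1 : a < a + 1 := by linarith
  have hL10 : 0 ≤ a + 1 := by linarith
  obtain ⟨w₀, k0, k1, -⟩ := exists_resonance ha hL1.le hL10 hψ
  set K : ∀ L : ℝ, Energy a p →L[ℂ] Energy a p := fun L =>
    ContinuousLinearMap.adjoint (cmp a p strip (MultiIndex.zero 1)) ∘L freeProj L ∘L
      cmp a p strip (MultiIndex.zero 1)
  obtain ⟨ρ, hρ, hb⟩ := exists_isUnit_desing (K := K (a + 1)) (v₀ := w₀)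
    (isUnit_redOp_add ha hL1 hL10 k0 k1)
  have hlt : ∀ {m : ℂ}, m ∈ ball (0 : ℂ) (min ρ (1 / 2)) → ‖m‖ < ρ ∧ ‖m‖ < 1 / 2 := by
    intro m hm
    rwa [mem_ball_zero_iff, lt_min_iff] at hm
  refine ⟨min ρ (1 / 2), by positivity, min_le_right _ _, fun L hL hL0 v₀ h0 h1 => ?_⟩
  -- The radius was found for the single value `a + 1` of the truncation parameter. Injectivity is
  -- carried over to every `L` through the boundary value problem itself, so that one disc serves
  -- all `R`.
  have hinj : ∀ m ∈ ball (0 : ℂ) (min ρ (1 / 2)), m ≠ 0 → ∀ v : Energy a p,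
      redOp a p hL0 m v = 0 → v = 0 := by
    intro m hm hm0 v hv
    refine redOp_injective_of_injective ha hL1.le hL10 hL.le hL0 (hlt hm).2 (fun w hw => ?_) hv
    rw [redOp_eq_pencil] at hw
    exact eq_zero_of_isUnit ((isUnit_pencil_iff k0 k1 hm0).2 (hb m (hlt hm).1)) hw
  refine ⟨hinj, ?_⟩
  obtain ⟨V, hV, h⟩ := exists_pencil_inverse (K := K L) h0 h1
    (show 0 < min ρ (1 / 2) by positivity) (redOp_symm hL0) (fun m hm => by
      rcases eq_or_ne m 0 with rfl | hm0
      · rw [desing_zero]; exact isUnit_redOp_add ha hL hL0 h0 h1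
      · rw [← isUnit_pencil_iff h0 h1 hm0, ← redOp_eq_pencil]
        exact isUnit_redOp ha hL hL0 (hlt hm).2 (hinj m hm hm0))
  exact ⟨V, hV, fun m hm hm0 w => by rw [redOp_eq_pencil hL0 m]; exact h m hm hm0 w⟩

end

/-! ### Regularity as a bounded operator, and the Laurent expansion with values in Sobolev spaces.
-/

section

variable {k : ℕ}

/-- Integration against a test function. -/
def testCLM (Ω : Set ℝ²) (hφ : IsTest φ) : L2 Ω →L[ℂ] ℂ :=
  innerSL ℂ ((hφ.star.memLp μ[Ω]).toLp _)

lemma testCLM_apply (hφ : IsTest φ) (B : L2 Ω) : testCLM Ω hφ B = ∫ x in Ω, B x * φ x :=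
  inner_eq_integral (MemLp.coeFn_toLp (hφ.star.memLp μ[Ω]))

lemma continuous_integral_mul (hφ : IsTest φ) : Continuous fun B : L2 Ω => ∫ x in Ω, B x * φ x :=
  (testCLM Ω hφ).continuous.congr fun B => testCLM_apply hφ B

lemma isClosed_sobolev (k : ℕ) (Ω : Set ℝ²) :
    IsClosed (Sobolev k Ω : Set (PiLp 2 (fun _ : MultiIndex k => L2 Ω))) := by
  have : (Sobolev k Ω : Set (PiLp 2 (fun _ : MultiIndex k => L2 Ω))) =
      ⋂ (α : MultiIndex k) (φ : ℝ² → ℂ) (_ : IsTest φ) (_ : tsupport φ ⊆ Ω),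
        {U | ∫ x in Ω, (U α) x * φ x = (-1) ^ ((α.1.1 : ℕ) + (α.1.2 : ℕ)) *
          ∫ x in Ω, (U (MultiIndex.zero k)) x * partialD α.1.1 α.1.2 φ x} := by
    ext U; simp [Sobolev]
  rw [this]
  refine isClosed_iInter fun α => isClosed_iInter fun φ => isClosed_iInter fun hφ =>
    isClosed_iInter fun _ => isClosed_eq ?_ ?_
  · exact (continuous_integral_mul hφ).comp (PiLp.continuous_apply 2 _ α)
  · exact continuous_const.mul ((continuous_integral_mul (hφ.partialD _ _)).comp
      (PiLp.continuous_apply 2 _ _))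

instance : CompleteSpace (Sobolev k Ω) := (isClosed_sobolev k Ω).completeSpace_coe

/-- The embedding of `H^k` into `L²`. -/
def toL2 (k : ℕ) (Ω : Set ℝ²) : Sobolev k Ω →L[ℂ] L2 Ω :=
  (PiLp.proj 2 _ (MultiIndex.zero k)).comp (Sobolev k Ω).subtypeL

lemma toL2_injective (hΩ : IsOpen Ω) : Function.Injective (toL2 k Ω) := by
  refine (injective_iff_map_eq_zero _).2 fun U hU => Subtype.ext (PiLp.ext fun α => ?_)
  have hU' : (U : PiLp 2 (fun _ : MultiIndex k => L2 Ω)) (MultiIndex.zero k) = 0 := hU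
  have hz := Lp.coeFn_zero ℂ 2 μ[Ω]
  refine Lp.ext ((ae_eq_of_integral_test hΩ (locallyIntegrableOn_of_memLp (Lp.memLp _))
    (locallyIntegrableOn_of_memLp MemLp.zero) fun φ hφ hs => ?_).trans hz.symm)
  rw [U.2 α φ hφ hs, hU', ← testCLM_apply (hφ.partialD _ _), map_zero, mul_zero]
  simp

/-- If the elements of a closed subspace have representatives in `H^k`, then these depend
continuously on them. -/
lemma exists_reg {X : Type*} [NormedAddCommGroup X] [InnerProductSpace ℂ X] [CompleteSpace X]
    (hΩ : IsOpen Ω) {D : Submodule ℂ X} (hD : IsClosed (D : Set X)) (ι : X →L[ℂ] L2 Ω)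
    (h : ∀ x ∈ D, ∃ U : Sobolev k Ω, toL2 k Ω U = ι x) :
    ∃ S : X →L[ℂ] Sobolev k Ω, ∀ x ∈ D, toL2 k Ω (S x) = ι x := by
  have : CompleteSpace D := hD.completeSpace_coe
  choose g hg using fun x : D => h x x.2
  have inj := toL2_injective (k := k) hΩ
  let G : D →ₗ[ℂ] Sobolev k Ω :=
    { toFun := g
      map_add' x y := inj (by rw [map_add, hg, hg, hg, Submodule.coe_add, map_add])
      map_smul' c x := inj (by
        rw [RingHom.id_apply, map_smul, hg, hg, Submodule.coe_smul, map_smul]) }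
  -- The graph is closed because the embedding into `L²` is continuous and injective.
  have hG : Continuous G := G.continuous_of_seq_closed_graph fun u x y hu hy => inj (by
    refine (tendsto_nhds_unique (((toL2 k Ω).continuous.tendsto y).comp hy) ?_).trans (hg x).symm
    refine ((ι.continuous.tendsto _).comp ((continuous_subtype_val.tendsto x).comp hu)).congr
      fun n => (hg (u n)).symm)
  refine ⟨(⟨G, hG⟩ : D →L[ℂ] Sobolev k Ω) ∘L D.orthogonalProjection, fun x hx => ?_⟩
  have e : D.orthogonalProjection x = ⟨x, hx⟩ :=
    Submodule.orthogonalProjection_mem_subspace_eq_self (⟨x, hx⟩ : D)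
  rw [ContinuousLinearMap.comp_apply, e]
  exact hg ⟨x, hx⟩

/-- The weak equation `-Δv = g` with the boundary conditions, in the part `x₁ < L` of the
halfstrip. -/
def WeakTo (L : ℝ) (v : Energy a p) (g : L2 strip) : Prop :=
  ∀ φ, IsTest φ → (∀ x ∈ dirichletSet a p, φ x = 0) → tsupport φ ⊆ {x | x.1 < L} →
    ∫ x in strip, (dx₁ v x * pd₁ φ x + dx₂ v x * pd₂ φ x) = ∫ x in strip, g x * φ x

lemma weakTo_of_redOp (ha : 0 < a) (hL : a ≤ L) (hL0 : 0 ≤ L) {F : L2 strip} {v : Energy a p}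
    (hF : ∀ᵐ x ∂μ[strip], L < x.1 → F x = 0)
    (h : redOp a p hL0 m v = - src a p F) : WeakTo L v ((1 - m ^ 2) • val v - F) := by
  intro φ hφ h0 hs
  have z : ∀ x : ℝ², x.1 ≤ L ∨ φ x = 0 ∧ pd₁ φ x = 0 ∧ pd₂ φ x = 0 := fun x =>
    (le_total x.1 L).imp_right fun hx => eq_zero_of_support_lt hs hx
  have e := (redOp_locSol ha hL hL0 hF h).weak_vanish hφ h0
  refine Eq.trans (integral_congr_ae (ae_of_all _ fun x => ?_)) (e.trans (integral_congr_ae ?_))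
  · rcases z x with hx | ⟨-, h1, h2⟩
    · simp [onTail_of_le hx]
    · simp [h1, h2]
  · filter_upwards [Lp.coeFn_sub ((1 - m ^ 2) • val v) F, Lp.coeFn_smul (1 - m ^ 2) (val v)]
      with x h1 h2
    rcases z x with hx | ⟨h0, -⟩
    · rw [h1, Pi.sub_apply, h2, Pi.smul_apply, onTail_of_le hx, mul_zero, add_zero, smul_eq_mul]
    · simp [h0]

/-- Regularity of the solutions of the weak equation as a bounded operator. -/
lemma exists_reg_weakTo (hΩ : IsOpen Ω) (hs : Ω ⊆ strip)
    (h : ∀ (v : Energy a p) (g : L2 strip), WeakTo L v g →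
      ∃ U : Sobolev k Ω, Represents U (val v)) :
    ∃ S : Energy a p × L2 strip →L[ℂ] Sobolev k Ω, ∀ (v : Energy a p) (g : L2 strip),
      WeakTo L v g → Represents (S (v, g)) (val v) := by
  -- The product carries its Hilbert norm, so that an operator on the closed subspace of admissible
  -- pairs extends to the whole space by orthogonal projection.
  let e := (WithLp.prodContinuousLinearEquiv 2 ℂ (Energy a p) (L2 strip)).toContinuousLinearMap
  let l : ∀ {φ : ℝ² → ℂ}, IsTest φ → WithLp 2 (Energy a p × L2 strip) →L[ℂ] ℂ := fun hφ =>
    ((testCLM strip hφ.d₁ ∘L cmp a p strip e₁ + testCLM strip hφ.d₂ ∘L cmp a p strip e₂).coprod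
      (-testCLM strip hφ)) ∘L e
  have hl : ∀ {φ : ℝ² → ℂ} (hφ : IsTest φ) (z : WithLp 2 (Energy a p × L2 strip)), l hφ z =
      (∫ x in strip, (dx₁ z.fst x * pd₁ φ x + dx₂ z.fst x * pd₂ φ x)) -
        ∫ x in strip, z.snd x * φ x := fun {φ} hφ z => by
    rw [integral_add (integrable_mul_test _ hφ.d₁) (integrable_mul_test _ hφ.d₂),
      ← testCLM_apply hφ.d₁, ← testCLM_apply hφ.d₂, ← testCLM_apply hφ, sub_eq_add_neg]
    rfl
  let D : Submodule ℂ (WithLp 2 (Energy a p × L2 strip)) := ⨅ (φ : ℝ² → ℂ)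
    (hφ : IsTest φ) (_ : ∀ x ∈ dirichletSet a p, φ x = 0) (_ : tsupport φ ⊆ {x | x.1 < L}), (l hφ).ker
  have hD : IsClosed (D : Set (WithLp 2 (Energy a p × L2 strip))) := by
    simp only [D, Submodule.coe_iInf]
    exact isClosed_iInter fun φ => isClosed_iInter fun hφ => isClosed_iInter fun _ =>
      isClosed_iInter fun _ => (l hφ).isClosed_ker
  have mD : ∀ z, z ∈ D ↔ WeakTo L z.fst z.snd := fun z => by
    simp only [D, Submodule.mem_iInf, LinearMap.mem_ker]
    refine forall₄_congr fun φ hφ _ _ => ?_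
    rw [← sub_eq_zero (b := ∫ x in strip, z.snd x * φ x), ← hl hφ]
    rfl
  obtain ⟨S, hS⟩ := exists_reg (k := k) hΩ hD (restr hs ∘L cmp a p strip (MultiIndex.zero 1) ∘L
      ContinuousLinearMap.fst ℂ _ _ ∘L e) fun z hz => by
    obtain ⟨U, hU⟩ := h z.fst z.snd ((mD z).1 hz)
    exact ⟨U, Lp.ext (hU.trans (restr_ae hs (val z.fst)).symm)⟩
  refine ⟨S ∘L (WithLp.prodContinuousLinearEquiv 2 ℂ (Energy a p) (L2 strip)).symm.toContinuousLinearMap,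
    fun v g hvg => ?_⟩
  exact (Lp.ext_iff.1 (hS (WithLp.toLp 2 (v, g)) ((mD _).2 hvg))).trans (restr_ae hs (val v))

/-- The restriction of the elements of the energy space belongs to `H¹`. -/
lemma exists_sobolev_one (hs : Ω ⊆ strip) (v : Energy a p) :
    ∃ U : Sobolev 1 Ω, Represents U (val v) := by
  have h := v.inEnergy.mono hs
  exact ⟨⟨h.toTuple, energyMod_le_sobolev a p Ω h.toTuple.2⟩, h.toTuple_zero⟩

section Laurent

variable {E F X Y : Type*} [NormedAddCommGroup E] [NormedSpace ℂ E] [NormedAddCommGroup F]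
  [NormedSpace ℂ F] [NormedAddCommGroup X] [NormedSpace ℂ X] [NormedAddCommGroup Y]
  [NormedSpace ℂ Y] [CompleteSpace Y]

/-- Everything is read off from `m⁻¹ B₀ + B₁(m)` with `B₁` holomorphic. The order is exactly `-1`
because `B₀ + m B₁(m)` is analytic with value `B₀ ≠ 0` at the origin. -/
lemma laurent_spec {ρ : ℝ} (hρ : 0 < ρ) (B₀ : X →L[ℂ] Y) {B₁ : ℂ → X →L[ℂ] Y}
    (hB₁ : DifferentiableOn ℂ B₁ (ball 0 ρ)) :
    MeromorphicOn (fun m : ℂ => m⁻¹ • B₀ + B₁ m) (ball 0 ρ) ∧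
    DifferentiableOn ℂ (fun m : ℂ => m⁻¹ • B₀ + B₁ m) (ball 0 ρ \ {0}) ∧
    (B₀ ≠ 0 → meromorphicOrderAt (fun m : ℂ => m⁻¹ • B₀ + B₁ m) 0 = -1) ∧
    ∀ f, MeromorphicOn (fun m : ℂ => (m⁻¹ • B₀ + B₁ m) f) (ball 0 ρ) := by
  have han : ∀ m ∈ ball (0 : ℂ) ρ, AnalyticAt ℂ B₁ m := fun m hm =>
    hB₁.analyticAt (isOpen_ball.mem_nhds hm)
  have hmer : MeromorphicOn (fun m : ℂ => m⁻¹ • B₀ + B₁ m) (ball 0 ρ) := fun m hm =>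
    ((MeromorphicAt.id m).inv.smul (MeromorphicAt.const B₀ m)).add (han m hm).meromorphicAt
  refine ⟨hmer, ?_, fun hne => ?_, fun f m hm => ?_⟩
  · refine DifferentiableOn.add (fun m hm => ?_) (hB₁.mono diff_subset)
    exact ((differentiableAt_inv hm.2).smul_const _).differentiableWithinAt
  · refine (meromorphicOrderAt_eq_int_iff (n := -1) (hmer 0 (mem_ball_self hρ))).2
      ⟨fun m => B₀ + m • B₁ m, analyticAt_const.add (analyticAt_id.smul
        (han 0 (mem_ball_self hρ))), by simpa using hne, ?_⟩
    filter_upwards [self_mem_nhdsWithin] with m hm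
    rw [sub_zero, zpow_neg_one, smul_add, smul_smul, inv_mul_cancel₀ hm, one_smul]
  · have hf : DifferentiableOn ℂ (fun m => B₁ m f) (ball 0 ρ) :=
      hB₁.clm_apply (differentiableOn_const f)
    exact ((MeromorphicAt.id m).inv.smul (MeromorphicAt.const (B₀ f) m)).add
      (hf.analyticAt (isOpen_ball.mem_nhds hm)).meromorphicAt

/-- The regular part of the Laurent expansion. -/
def regularPart (S : E × F →L[ℂ] Y) (V : ℂ → E →L[ℂ] E) (w : X →L[ℂ] E) (ι : E →L[ℂ] F)
    (J : X →L[ℂ] F) (v₀ : E) (l : X →L[ℂ] ℂ) (m : ℂ) : X →L[ℂ] Y :=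
  S ∘L ContinuousLinearMap.inl ℂ E F ∘L V m ∘L w + S ∘L ContinuousLinearMap.inr ℂ E F ∘L
    ((1 - m ^ 2) • (ι ∘L V m ∘L w) - m • l.smulRight (ι v₀) - J)

variable {S : E × F →L[ℂ] Y} {V : ℂ → E →L[ℂ] E} {w : X →L[ℂ] E} {ι : E →L[ℂ] F} {J : X →L[ℂ] F}
  {v₀ : E} {l : X →L[ℂ] ℂ}

/-- The regularity operator `S` acts on the pair of the solution `v` and its source `(1 - m²) v -
f`. Since `(1 - m²) m⁻¹ = m⁻¹ - m`, the singular part contributes `-m l(f) ι v₀` to the regular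
part. -/
lemma add_regularPart_apply (hm : m ≠ 0) (f : X) :
    (m⁻¹ • l.smulRight (S (v₀, ι v₀)) + regularPart S V w ι J v₀ l m) f =
      S (m⁻¹ • (l f • v₀) + V m (w f), (1 - m ^ 2) • ι (m⁻¹ • (l f • v₀) + V m (w f)) - J f) := by
  simp only [regularPart, ContinuousLinearMap.add_apply, ContinuousLinearMap.smul_apply,
    ContinuousLinearMap.smulRight_apply, ContinuousLinearMap.comp_apply,
    ContinuousLinearMap.inl_apply, ContinuousLinearMap.inr_apply, ContinuousLinearMap.sub_apply]
  rw [← map_smul, ← map_smul, ← map_add, ← map_add]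
  congr 1
  refine Prod.ext ?_ ?_
  · simp
  · simp only [Prod.snd_add, Prod.smul_snd, map_add, map_smul]
    match_scalars <;> field_simp
    ring

lemma differentiableOn_regularPart {s : Set ℂ} (hV : DifferentiableOn ℂ V s) :
    DifferentiableOn ℂ (regularPart S V w ι J v₀ l) s := by
  have hVw := hV.clm_comp (differentiableOn_const w)
  have hc : DifferentiableOn ℂ (fun m : ℂ => 1 - m ^ 2) s := by fun_prop
  have h1 : DifferentiableOn ℂ (fun m => (1 - m ^ 2) • (ι ∘L V m ∘L w)) s :=
    hc.smul ((differentiableOn_const ι).clm_comp hVw)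
  have h2 : DifferentiableOn ℂ (fun m : ℂ => m • l.smulRight (ι v₀)) s :=
    differentiableOn_id.smul_const _
  exact ((differentiableOn_const S).clm_comp ((differentiableOn_const _).clm_comp hVw)).add
    ((differentiableOn_const S).clm_comp ((differentiableOn_const _).clm_comp
      ((h1.sub h2).sub_const J)))

end Laurent

lemma setIntegral_strip_indicator (R : ℝ) (g : ℝ² → ℂ) :
    ∫ x in strip, (stripTo R).indicator g x = ∫ x in stripTo R, g x := by
  rw [setIntegral_indicator (isOpen_stripTo R).measurableSet, inter_eq_right.2 (stripTo_subset R)]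

lemma inner_extZero (u : L2 strip) (f : L2 (stripTo R)) :
    ⟪u, extZero R f⟫_ℂ = ∫ x in stripTo R, f x * conj (u x) := by
  rw [inner_eq_integral (w := fun x => conj (u x))
    (ae_of_all _ fun x => (conj_conj _).symm), ← setIntegral_strip_indicator]
  refine integral_congr_ae ?_
  filter_upwards [extZero_ae f] with x h1
  rw [h1]
  by_cases hx : x ∈ stripTo R
  · rw [indicator_of_mem hx, indicator_of_mem hx]
  · rw [indicator_of_notMem hx, indicator_of_notMem hx, zero_mul]

lemma val_ae_lift (hL0 : 0 ≤ L) (m : ℂ) (v : Energy a p) (hs : Ω ⊆ stripTo L) :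
    val v =ᵐ[μ[Ω]] lift a p hL0 m v := by
  refine ae_restrict_of_ae_restrict_of_subset hs ?_
  filter_upwards [ae_restrict_of_ae_restrict_of_subset (stripTo_subset L) (lift_ae hL0 m v),
    ae_restrict_mem (isOpen_stripTo L).measurableSet] with x h1 h2
  rw [h1, onTail_of_le (le_of_lt h2.2), mul_zero, add_zero]

/-- The solution operator, followed by a restriction with bounded regularity, has a simple pole. -/
lemma hasSimplePole_of_reg (ha : 0 < a) (hL : a ≤ L) (hL0 : 0 ≤ L) (hR : R ≤ L)
    (hs : Ω ⊆ stripTo L) {ψ : StripFun} (hψ : IsThresholdResonance a p ψ) {v₀ : Energy a p}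
    (h0 : redOp a p hL0 0 v₀ = 0) (hv₀ : lift a p hL0 0 v₀ = ψ)
    {ρ : ℝ} (hρ : 0 < ρ) {V : ℂ → Energy a p →L[ℂ] Energy a p}
    (hV : DifferentiableOn ℂ V (ball 0 ρ))
    (hres : ∀ m ∈ ball (0 : ℂ) ρ, m ≠ 0 → ∀ w, redOp a p hL0 m (m⁻¹ • (⟪v₀, w⟫_ℂ • v₀) + V m w) = w)
    {A : ℂ → L2 (stripTo R) →ₗ[ℂ] StripFun}
    (hA : ∀ m ∈ ball (0 : ℂ) ρ, m ≠ 0 → ∀ f v, redOp a p hL0 m v = - src a p (extZero R f) →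
      A m f = lift a p hL0 m v)
    (hne : ¬ ψ =ᵐ[μ[stripTo R]] 0)
    (hneΩ : Ω.Nonempty → ¬ ψ =ᵐ[μ[Ω]] 0)
    {S : Energy a p × L2 strip →L[ℂ] Sobolev k Ω} (hS : ∀ (v : Energy a p) (g : L2 strip),
      WeakTo L v g → Represents (S (v, g)) (val v)) : HasSimplePole k Ω ρ R ψ A := by
  -- The coefficient of the pole is `l(f) = ⟨v₀, w f⟩ = -∫ f v̄₀`. The conjugation disappears
  -- because the resonance is real, which gives `K₀[f]`.
  set w : L2 (stripTo R) →L[ℂ] Energy a p := -(src a p ∘L extZero R) with hw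
  set l : L2 (stripTo R) →L[ℂ] ℂ := innerSL ℂ v₀ ∘L w with hl
  have hlf : ∀ f, l f = -∫ x in stripTo R, f x * conj (val v₀ x) := fun f => by
    rw [← inner_extZero, ← inner_src]
    exact inner_neg_right (𝕜 := ℂ) v₀ (src a p (extZero R f))
  have hc : val v₀ =ᵐ[μ[stripTo R]] ψ := hv₀ ▸ val_ae_lift hL0 0 v₀ (stripTo_mono hR)
  have hlK : ∀ f, l f = K₀ R ψ f := fun f => by
    rw [hlf, K₀]
    congr 1
    refine integral_congr_ae ?_
    filter_upwards [hc, ae_restrict_of_ae_restrict_of_subset (stripTo_subset R) (hψ.star ha)]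
      with x h1 h2
    rw [h1, h2]
  have hwk : WeakTo L v₀ (val v₀) := by
    have := weakTo_of_redOp (F := 0) (m := 0) (v := v₀) ha hL hL0 (ae_zero_L2.mono fun x hx _ => hx)
      (by rw [h0, map_zero, neg_zero])
    rwa [zero_pow two_ne_zero, sub_zero, sub_zero, one_smul] at this
  have hU : Represents (S (v₀, val v₀)) ψ := (hS v₀ _ hwk).trans (hv₀ ▸ val_ae_lift hL0 0 v₀ hs)
  have hB₁ := differentiableOn_regularPart (S := S) (w := w) (J := extZero R) (v₀ := v₀) (l := l)
    (ι := cmp a p strip (MultiIndex.zero 1)) hV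
  obtain ⟨k1, k2, k3, k4⟩ := laurent_spec hρ (l.smulRight (S (v₀, val v₀))) hB₁
  refine ⟨_, _, _, fun m hm hm0 f => ?_, k1, k2, fun hn => k3 fun hB0 => ?_, k4, fun m _ _ => rfl,
    fun f => ?_, hB₁⟩
  · have hv' : redOp a p hL0 m (m⁻¹ • (l f • v₀) + V m (w f)) = - src a p (extZero R f) :=
      hres m hm hm0 (w f)
    rw [add_regularPart_apply hm0, hA m hm hm0 f _ hv']
    exact (hS _ _ (weakTo_of_redOp ha hL hL0 (extZero_tail hR f) hv')).trans (val_ae_lift hL0 m _ hs)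
  -- The residue does not vanish: evaluated at `f = v₀` its coefficient is minus the integral of
  -- `|v₀|²` over `Π_R`, and its vector represents `ψ` on `Ω`.
  · have e : l (restr (stripTo_subset R) (val v₀)) • S (v₀, val v₀) = 0 := by
      rw [← ContinuousLinearMap.smulRight_apply, hB0]; rfl
    rcases smul_eq_zero.1 e with e | e
    · refine hne (hc.symm.trans (ae_eq_zero_of_integral_norm_sq
        ((Lp.memLp (val v₀)).mono_set (stripTo_subset R)) ?_))
      rw [hlf, neg_eq_zero] at e
      rw [← ofReal_eq_zero, ← integral_complex_ofReal, ← e]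
      refine integral_congr_ae ?_
      filter_upwards [restr_ae (stripTo_subset R) (val v₀)] with x hx
      rw [hx, mul_conj, normSq_eq_norm_sq]
    · refine hneΩ hn (hU.symm.trans ?_)
      rw [e]
      exact Lp.coeFn_zero ℂ 2 _
  · rw [ContinuousLinearMap.smulRight_apply, hlK]
    filter_upwards [Lp.coeFn_smul (K₀ R ψ f) (weakD (S (v₀, val v₀)) (MultiIndex.zero k)), hU,
      ae_restrict_of_ae_restrict_of_subset (hs.trans (stripTo_subset L))
        (AEEqFun.coeFn_smul (K₀ R ψ f) ψ)] with x h1 h2 h3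
    rw [h3]
    exact h1.trans (congrArg (K₀ R ψ f • ·) h2)

end

/-! ### Second derivatives from the Laplacian in the whole plane. -/

section

section Elliptic

open TemperedDistribution Laplacian LineDeriv
open scoped SchwartzMap

/-- The Bessel potential of order two has the symbol `1 + |ξ|²`, so it maps `f` to `f - (2π)⁻² Δf`,
which is square integrable. -/
lemma memSobolev_two_of_laplacian {f g : Lp ℂ 2 (volume : Measure ℂ)}
    (h : Δ (f : 𝓢'(ℂ, ℂ)) = (g : 𝓢'(ℂ, ℂ))) : MemSobolev 2 2 (f : 𝓢'(ℂ, ℂ)) := by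
  set c : ℂ := ((-((2 * π) ^ 2)⁻¹ : ℝ) : ℂ)
  refine ⟨f + c • g, ?_⟩
  have e : (fun x : ℂ => (((1 + ‖x‖ ^ 2) ^ ((2 : ℝ) / 2) : ℝ) : ℂ)) =
      fun x : ℂ => ∑ i ∈ (Finset.univ : Finset (Fin 2)), (![1, fun x : ℂ => ((‖x‖ ^ 2 : ℝ) : ℂ)] i) x := by
    ext x; simp
  have hg : ∀ i ∈ (Finset.univ : Finset (Fin 2)),
      Function.HasTemperateGrowth (![1, fun x : ℂ => ((‖x‖ ^ 2 : ℝ) : ℂ)] i) := by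
    intro i _
    fin_cases i
    · exact Function.HasTemperateGrowth.const 1
    · change Function.HasTemperateGrowth fun x : ℂ => ((‖x‖ ^ 2 : ℝ) : ℂ)
      fun_prop
  rw [besselPotential, e, fourierMultiplierCLM_sum ℂ hg]
  have hl := laplacian_eq_fourierMultiplierCLM (f : 𝓢'(ℂ, ℂ))
  have h1 : fourierMultiplierCLM ℂ (1 : ℂ → ℂ) (f : 𝓢'(ℂ, ℂ)) = f := by
    change fourierMultiplierCLM ℂ (fun _ => (1 : ℂ)) (f : 𝓢'(ℂ, ℂ)) = f
    rw [fourierMultiplierCLM_const, one_smul]; rfl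
  have h2 : fourierMultiplierCLM ℂ (fun x : ℂ => ((‖x‖ ^ 2 : ℝ) : ℂ)) (f : 𝓢'(ℂ, ℂ)) =
      c • (g : 𝓢'(ℂ, ℂ)) := by
    rw [← h, hl, ← coe_smul, smul_smul]
    have : c * ((-(2 * π) ^ 2 : ℝ) : ℂ) = 1 := by
      have : (2 * π) ^ 2 ≠ 0 := by positivity
      rw [← ofReal_mul]
      norm_cast
      field_simp
    rw [this, one_smul]
  rw [Fin.sum_univ_two]
  change fourierMultiplierCLM ℂ (1 : ℂ → ℂ) (f : 𝓢'(ℂ, ℂ)) +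
    fourierMultiplierCLM ℂ (fun x : ℂ => ((‖x‖ ^ 2 : ℝ) : ℂ)) (f : 𝓢'(ℂ, ℂ)) = _
  rw [h1, h2, ← Lp.toTemperedDistributionCLM_apply, ← Lp.toTemperedDistributionCLM_apply,
    ← Lp.toTemperedDistributionCLM_apply, map_add, map_smul]

lemma iterate_lineDeriv {f : 𝓢'(ℂ, ℂ)} (hf : MemSobolev s 2 f) (m : ℂ) (n : ℕ) :
    MemSobolev (s - n) 2 ((fun g : 𝓢'(ℂ, ℂ) => ∂_{m} g)^[n] f) := by
  induction n with
  | zero => simpa using hf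
  | succ n ih =>
    rw [Function.iterate_succ_apply']
    rw [show s - (n + 1 : ℕ) = s - n - 1 by push_cast; ring]
    exact ih.lineDerivOp

lemma iterate_lineDeriv_apply (f : 𝓢'(ℂ, ℂ)) (m : ℂ) (n : ℕ) (φ : 𝓢(ℂ, ℂ)) :
    ((fun g : 𝓢'(ℂ, ℂ) => ∂_{m} g)^[n] f) φ =
      (-1) ^ n * f ((fun g : 𝓢(ℂ, ℂ) => ∂_{m} g)^[n] φ) := by
  induction n generalizing φ with
  | zero => simp
  | succ n ih =>
    have hn : ∀ (n : ℕ) (ψ : 𝓢(ℂ, ℂ)), (fun g : 𝓢(ℂ, ℂ) => ∂_{m} g)^[n] (-ψ) =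
        -(fun g : 𝓢(ℂ, ℂ) => ∂_{m} g)^[n] ψ := fun n => by
      induction n with
      | zero => simp
      | succ n ih =>
        intro ψ
        rw [Function.iterate_succ_apply, Function.iterate_succ_apply, ← ih]
        congr 1
        exact map_neg (lineDerivOpCLM ℂ 𝓢(ℂ, ℂ) m) ψ
    rw [Function.iterate_succ_apply', lineDerivOp_apply_apply, ih, Function.iterate_succ_apply, hn,
      map_neg, pow_succ]
    ring

lemma setIntegral_comp_equivRealProd (F : ℝ² → ℂ) : ∫ z, F (equivRealProdCLM z) = ∫ x, F x :=
  volume_preserving_equiv_real_prod.integral_comp measurableEquivRealProd.measurableEmbedding F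

lemma fderiv_comp_equivRealProd (hφ : Differentiable ℝ φ) (z w : ℂ) :
    fderiv ℝ (φ ∘ equivRealProdCLM) z w = fderiv ℝ φ (equivRealProdCLM z) (equivRealProdCLM w) := by
  rw [fderiv_comp z (hφ _) equivRealProdCLM.differentiableAt, ContinuousLinearEquiv.fderiv]
  rfl

/-- Square integrable functions on the plane with square integrable Laplacian have square integrable
second derivatives. -/
lemma exists_weak_partialD (hv : MemLp v 2) (hG : MemLp G 2) (h : ∀ φ : ℝ² → ℂ, Smooth φ →
      ∫ x, v x * (pd₁ (pd₁ φ) x + pd₂ (pd₂ φ) x) = ∫ x, G x * φ x) {i j : ℕ} (hij : i + j ≤ 2) :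
    ∃ H : ℝ² → ℂ, MemLp H 2 ∧ ∀ φ, IsTest φ →
      ∫ x, H x * φ x = (-1) ^ (i + j) * ∫ x, v x * partialD i j φ x := by
  -- The Fourier transform needs a Euclidean norm, whereas `ℝ × ℝ` carries the maximum norm. The
  -- plane is therefore replaced by `ℂ`.
  set e := equivRealProdCLM
  have hmp := volume_preserving_equiv_real_prod
  have hc : ∀ {w : ℝ² → ℂ}, MemLp w 2 → MemLp (fun z => w (e z)) 2 (volume : Measure ℂ) :=
    fun hw => hw.comp_measurePreserving hmp
  have hp : ∀ {w : ℝ² → ℂ} (hw : MemLp w 2) (φ : 𝓢(ℂ, ℂ)) (θ : ℝ² → ℂ),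
      (∀ z, φ z = θ (e z)) → ((hc hw).toLp _ : 𝓢'(ℂ, ℂ)) φ = ∫ x, w x * θ x := by
    intro w hw φ θ hθ
    rw [Lp.toTemperedDistribution_apply, ← setIntegral_comp_equivRealProd]
    refine integral_congr_ae ?_
    filter_upwards [(hc hw).coeFn_toLp] with z hz
    rw [hz, hθ, smul_eq_mul, mul_comm]
  have hd : ∀ {φ : 𝓢(ℂ, ℂ)} {θ}, (∀ z, φ z = θ (e z)) → Differentiable ℝ θ →
      (∀ z, (∂_{(1 : ℂ)} φ) z = pd₁ θ (e z)) ∧ ∀ z, (∂_{I} φ) z = pd₂ θ (e z) := by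
    intro φ θ hθ hd
    have : (φ : ℂ → ℂ) = θ ∘ e := funext hθ
    refine ⟨fun z => ?_, fun z => ?_⟩ <;>
      rw [SchwartzMap.lineDerivOp_apply_eq_fderiv, this, fderiv_comp_equivRealProd hd] <;>
      simp [pd₁, pd₂, e]
  have hlap : Δ ((hc hv).toLp _ : 𝓢'(ℂ, ℂ)) = ((hc hG).toLp _ : 𝓢'(ℂ, ℂ)) := by
    ext φ
    set θ : ℝ² → ℂ := fun x => φ (e.symm x) with hθd
    have hθ : ∀ z, φ z = θ (e z) := fun z => by simp [hθd]
    have sθ : Smooth θ := φ.smooth'.comp e.symm.contDiff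
    have d1 := hd hθ (sθ.diff)
    have d11 := (hd d1.1 ((contDiff_pd₁ sθ).diff)).1
    have d22 := (hd d1.2 ((contDiff_pd₂ sθ).diff)).2
    rw [laplacian_apply_apply, SchwartzMap.laplacian_eq_sum orthonormalBasisOneI,
      Fin.sum_univ_two, hp hG φ θ hθ, ← h θ sθ]
    refine hp hv _ _ fun z => ?_
    simp only [coe_orthonormalBasisOneI]
    simp [d11, d22]
  have hS := memSobolev_two_of_laplacian hlap
  have hS2 := (iterate_lineDeriv (iterate_lineDeriv hS 1 i) I j).mono (s' := 0) (by
    have : (i : ℝ) + j ≤ 2 := by exact_mod_cast hij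
    linarith)
  obtain ⟨H, hH⟩ := memSobolev_zero_iff.1 hS2
  have hHm : MemLp (fun x => H (e.symm x)) 2 (volume : Measure (ℝ²)) :=
    (Lp.memLp H).comp_measurePreserving hmp.symm
  refine ⟨fun x => H (e.symm x), hHm, fun φ hφ => ?_⟩
  set Φ : 𝓢(ℂ, ℂ) := (hφ.2.comp_homeomorph e.toHomeomorph).toSchwartzMap (hφ.1.comp e.contDiff)
  have it1 : ∀ (n : ℕ) {Φ : 𝓢(ℂ, ℂ)} {θ}, (∀ z, Φ z = θ (e z)) → Smooth θ →
      (∀ z, ((fun g : 𝓢(ℂ, ℂ) => ∂_{(1 : ℂ)} g)^[n] Φ) z = (pd₁^[n] θ) (e z)) := fun n => by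
    induction n with
    | zero => exact fun h _ => h
    | succ n ih => exact fun h hθ => ih (hd h (hθ.diff)).1 (contDiff_pd₁ hθ)
  have it2 : ∀ (n : ℕ) {Φ : 𝓢(ℂ, ℂ)} {θ}, (∀ z, Φ z = θ (e z)) → Smooth θ →
      (∀ z, ((fun g : 𝓢(ℂ, ℂ) => ∂_{I} g)^[n] Φ) z = (pd₂^[n] θ) (e z)) := fun n => by
    induction n with
    | zero => exact fun h _ => h
    | succ n ih => exact fun h hθ => ih (hd h (hθ.diff)).2 (contDiff_pd₂ hθ)
  have hΦ : ∀ z, Φ z = φ (e z) := fun z => rfl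
  have e1 := congrArg (fun T : 𝓢'(ℂ, ℂ) => T Φ) hH
  simp only [iterate_lineDeriv_apply] at e1
  rw [hp hv _ _ (it1 i (it2 j hΦ hφ.1) (hφ.partialD 0 j).1), Lp.toTemperedDistribution_apply] at e1
  rw [← setIntegral_comp_equivRealProd, partialD, pow_add, mul_comm ((-1) ^ i), mul_assoc, e1]
  refine integral_congr_ae (ae_of_all _ fun z => ?_)
  change H (e.symm (e z)) * φ (e z) = Φ z • H z
  rw [e.symm_apply_apply, hΦ, smul_eq_mul, mul_comm]

end Elliptic

end

section

/-! ### Regularity up to the smooth part of the boundary -/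

/-- The Laplacian of the product of `χ` with a solution of `-Δv = g`. -/
def cutLap (v : Energy a p) (g : L2 strip) (χ : ℝ² → ℂ) (x : ℝ²) : ℂ :=
  val v x * (pd₁ (pd₁ χ) x + pd₂ (pd₂ χ) x) + 2 * (dx₁ v x * pd₁ χ x + dx₂ v x * pd₂ χ x) -
    g x * χ x

lemma integrable_cutLap (v : Energy a p) (g : L2 strip) (hχ : IsTest χ) (hF : Smooth F) :
    Integrable (fun x => cutLap v g χ x * F x) μ[strip] := by
  have := (((integrable_mul_test (val v) (hχ.d₁.d₁.mul hF)).add (integrable_mul_test (val v)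
    (hχ.d₂.d₂.mul hF))).add (((integrable_mul_test (dx₁ v) (hχ.d₁.mul hF)).add
    (integrable_mul_test (dx₂ v) (hχ.d₂.mul hF))).const_mul 2)).sub
    (integrable_mul_test g (hχ.mul hF))
  refine this.congr (ae_of_all _ fun x => ?_)
  simp only [cutLap, Pi.add_apply, Pi.sub_apply]
  ring

/-- Green's formula for `χ v` against `F`. It combines integration by parts with the fields `χ ∇F`
and `F ∇χ` and the weak equation tested with `F χ`. The hypotheses make each of these free of
boundary terms. In the application `F` is a folded test function. -/
lemma WeakTo.integral_cut {v : Energy a p} {g : L2 strip} (h : WeakTo L v g) (hχ : IsTest χ) (hF : Smooth F) (hL : tsupport χ ⊆ {x | x.1 < L})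
    (hD : ∀ x ∈ dirichletSet a p, F x * χ x = 0)
    (hb : ∀ s, 0 < s → s < a → pd₂ F (s, 0) * χ (s, 0) = 0 ∧ F (s, 0) * pd₂ χ (s, 0) = 0)
    (hl : p = Parity.even → ∀ t, pd₁ F (0, t) = 0 ∧ pd₁ χ (0, t) = 0) :
    ∫ x in strip, (val v x * χ x) * (pd₁ (pd₁ F) x + pd₂ (pd₂ F) x) =
      ∫ x in strip, cutLap v g χ x * F x := by
  have f1 := contDiff_pd₁ hF
  have f2 := contDiff_pd₂ hF
  have dF := hF.diff
  have df1 := f1.diff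
  have df2 := f2.diff
  have t0 := hχ.mul hF
  have ibp : ∀ {S₁ S₂ : ℝ² → ℂ}, IsTest S₁ → IsTest S₂ → (∀ s, 0 < s → s < a → S₂ (s, 0) = 0) →
      (p = Parity.even → ∀ t, S₁ (0, t) = 0) → HasInt μ[strip]
      (fun x => val v x * (pd₁ S₁ x + pd₂ S₂ x) + dx₁ v x * S₁ x + dx₂ v x * S₂ x) 0 :=
    fun h1 h2 h3 h4 => ⟨((integrable_mul_test _ (h1.d₁.add h2.d₂)).add
      (integrable_mul_test _ h1)).add (integrable_mul_test _ h2),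
      v.inEnergy.ibp subset_rfl (fun _ _ => h1.1.contDiffAt) (fun _ _ => h2.1.contDiffAt)
      (h1.memLp _) (h2.memLp _) ((h1.d₁.add h2.d₂).memLp _) inter_subset_left inter_subset_left h3
      (fun hp t _ _ => h4 hp t)⟩
  have e1 := ibp (hχ.mul f1) (hχ.mul f2) (fun s h0 h1 => (hb s h0 h1).1)
    fun hp t => by simp [(hl hp t).1]
  have e2 := ibp (hχ.d₁.mul hF) (hχ.d₂.mul hF) (fun s h0 h1 => (hb s h0 h1).2)
    fun hp t => by simp [(hl hp t).2]
  have e3 := h _ t0 hD (tsupport_mul_subset_right.trans hL)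
  have i3 := ((integrable_mul_test (dx₁ v) t0.d₁).add (integrable_mul_test (dx₂ v) t0.d₂)).hi
  refine ((((integrable_cutLap v g hχ hF).hi.add e1).sub
    (e2.add (i3.sub (integrable_mul_test g t0).hi))).congr (ae_of_all _ fun x => by
      simp only [Pi.add_apply, pd₁_mul (df1 x) (hχ.diff x), pd₂_mul (df2 x) (hχ.diff x),
        pd₁_mul (dF x) (hχ.d₁.diff x), pd₂_mul (dF x) (hχ.d₂.diff x), pd₁_mul (dF x) (hχ.diff x),
        pd₂_mul (dF x) (hχ.diff x), cutLap]
      ring)).2.trans ?_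
  simp only [Pi.add_apply]
  rw [e3]
  ring

lemma memLp_cutLap (v : Energy a p) (g : L2 strip) (hχ : IsTest χ) :
    MemLp (cutLap v g χ) 2 μ[strip] :=
  ((memLp_mul_test (Lp.memLp (val v)) (hχ.d₁.d₁.add hχ.d₂.d₂)).add (((memLp_mul_test
    (Lp.memLp (dx₁ v)) hχ.d₁).add (memLp_mul_test (Lp.memLp (dx₂ v)) hχ.d₂)).const_mul 2)).sub
    (memLp_mul_test (Lp.memLp g) hχ)

/-- Symmetrization with respect to a reflection. -/
def symm (R : ℝ² → ℝ²) (c : ℂ) (w : ℝ² → ℂ) (x : ℝ²) : ℂ := w x + c * w (R x)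

/-- The reflection in the line `x₁ = 0`. -/
def refl₁ (x : ℝ²) : ℝ² := (-x.1, x.2)

/-- The reflection in the line `x₂ = y`. -/
def refl₂ (y : ℝ) (x : ℝ²) : ℝ² := (x.1, 2 * y - x.2)

/-- Multiplication with `w` maps smooth functions to integrable functions. -/
def SmoothDual (w : ℝ² → ℂ) : Prop := ∀ φ : ℝ² → ℂ, Smooth φ → Integrable fun x => w x * φ x

/-- Symmetrization is its own transpose, because the reflection preserves the measure and is an
involution. Hence a reflected function tested with `φ` equals the original function tested with the
folded `φ`. -/
lemma symm_spec {R : ℝ² → ℝ²} (hR : MeasurePreserving R) (hi : Function.Involutive R)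
    (hs : Smooth R) (c : ℂ) (hw : MemLp w 2) (hd : SmoothDual w) :
    MemLp (symm R c w) 2 ∧ SmoothDual (symm R c w) ∧
      ∀ φ, Smooth φ → ∫ x, symm R c w x * φ x = ∫ x, w x * symm R c φ x := by
  have me : MeasurableEmbedding R := (MeasurableEquiv.ofInvolutive R hi hR.measurable).measurableEmbedding
  have i : ∀ φ, Smooth φ → Integrable fun x => w (R x) * φ x := fun φ hφ => by
    have := hR.integrable_comp_of_integrable (hd _ (hφ.comp hs))
    refine this.congr (ae_of_all _ fun x => ?_)
    simp [hi x]
  refine ⟨hw.add ((hw.comp_measurePreserving hR).const_mul c), fun φ hφ => ?_, fun φ hφ => ?_⟩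
  · refine ((hd φ hφ).add ((i φ hφ).const_mul c)).congr (ae_of_all _ fun x => ?_)
    simp [symm]; ring
  · have e := hR.integral_comp me (fun x => w x * φ (R x))
    simp only [hi _] at e
    refine (((hd φ hφ).hi.add ((i φ hφ).hi.mul c)).congr (ae_of_all _ fun x => by
      simp only [symm]; ring)).2.trans (.trans ?_ (((hd φ hφ).hi.add ((hd _ (hφ.comp hs)).hi.mul
        c)).congr (ae_of_all _ fun x => by simp only [symm, Function.comp_apply]; ring)).2.symm)
    rw [e]
    rfl

lemma measurePreserving_refl₁ : MeasurePreserving refl₁ :=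
  (Measure.measurePreserving_neg (volume : Measure ℝ)).prod (MeasurePreserving.id volume)

lemma measurePreserving_refl₂ (y : ℝ) : MeasurePreserving (refl₂ y) :=
  (MeasurePreserving.id volume).prod (Measure.measurePreserving_sub_left volume (2 * y))

lemma involutive_refl₁ : Function.Involutive refl₁ := fun x => by simp [refl₁]

lemma involutive_refl₂ (y : ℝ) : Function.Involutive (refl₂ y) := fun x => by simp [refl₂]

lemma contDiff_refl₁ : Smooth refl₁ := by unfold refl₁; fun_prop

lemma contDiff_refl₂ (y : ℝ) : Smooth (refl₂ y) := by unfold refl₂; fun_prop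

lemma contDiff_symm {R : ℝ² → ℝ²} (hs : Smooth R) (c : ℂ) (hφ : Smooth φ) : Smooth (symm R c φ) :=
  hφ.add (contDiff_const.mul (hφ.comp hs))

/-- The Laplacian. -/
def lap (φ : ℝ² → ℂ) (x : ℝ²) : ℂ := pd₁ (pd₁ φ) x + pd₂ (pd₂ φ) x

lemma fderiv_symm {R : ℝ² → ℝ²} {A : ℝ² →L[ℝ] ℝ²} (hR : ∀ x, HasFDerivAt R A x)
    {e : ℝ²} {q : ℝ} (he : A e = q • e) (c : ℂ) (hφ : Smooth φ) :
    (fun x => fderiv ℝ (symm R c φ) x e) = symm R (c * q) fun x => fderiv ℝ φ x e := by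
  ext x
  have h1 := (hφ.diff x).hasFDerivAt
  have h2 := ((hφ.diff (R x)).hasFDerivAt.comp x (hR x)).const_mul c
  have h3 : fderiv ℝ (symm R c φ) x = _ := (h1.add h2).fderiv
  rw [h3]
  simp [symm, he, mul_assoc]

lemma lap_symm {R : ℝ² → ℝ²} {A : ℝ² →L[ℝ] ℝ²} (hR : ∀ x, HasFDerivAt R A x)
    {s t : ℝ} (hs : s * s = 1) (ht : t * t = 1) (h1 : A (1, 0) = s • (1, 0))
    (h2 : A (0, 1) = t • (0, 1)) (c : ℂ) (hφ : Smooth φ) :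
    lap (symm R c φ) = symm R c (lap φ) := by
  have e1 : pd₁ (pd₁ (symm R c φ)) = symm R c (pd₁ (pd₁ φ)) := by
    have k := fderiv_symm hR h1 c hφ
    have k' := fderiv_symm hR h1 (c * s) (contDiff_pd₁ hφ)
    rw [mul_assoc, ← ofReal_mul, hs, ofReal_one, mul_one] at k'
    exact (congrArg pd₁ k).trans k'
  have e2 : pd₂ (pd₂ (symm R c φ)) = symm R c (pd₂ (pd₂ φ)) := by
    have k := fderiv_symm hR h2 c hφ
    have k' := fderiv_symm hR h2 (c * t) (contDiff_pd₂ hφ)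
    rw [mul_assoc, ← ofReal_mul, ht, ofReal_one, mul_one] at k'
    exact (congrArg pd₂ k).trans k'
  ext x
  simp only [lap, e1, e2, symm]
  ring

/-- Symmetrization with respect to both reflections. -/
def fold (σ ε : ℂ) (y : ℝ) (φ : ℝ² → ℂ) : ℝ² → ℂ := symm refl₁ σ (symm (refl₂ y) ε φ)

lemma contDiff_fold (σ ε : ℂ) (y : ℝ) (hφ : Smooth φ) : Smooth (fold σ ε y φ) :=
  contDiff_symm contDiff_refl₁ _ (contDiff_symm (contDiff_refl₂ y) _ hφ)

variable {σ ε : ℂ} {y : ℝ}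

lemma lap_fold (hφ : Smooth φ) : lap (fold σ ε y φ) = fold σ ε y (lap φ) := by
  have h1 : ∀ x, HasFDerivAt refl₁ ((-ContinuousLinearMap.fst ℝ ℝ ℝ).prod
      (ContinuousLinearMap.snd ℝ ℝ ℝ)) x := fun x => hasFDerivAt_fst.neg.prodMk hasFDerivAt_snd
  have h2 : ∀ x, HasFDerivAt (refl₂ y) ((ContinuousLinearMap.fst ℝ ℝ ℝ).prod
      (-ContinuousLinearMap.snd ℝ ℝ ℝ)) x := fun x =>
    hasFDerivAt_fst.prodMk (hasFDerivAt_snd.const_sub _)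
  rw [fold, lap_symm (s := -1) (t := 1) h1 (by simp) (by simp) (by simp) (by simp) _
    (contDiff_symm (contDiff_refl₂ y) _ hφ), lap_symm (s := 1) (t := -1) h2 (by simp) (by simp)
    (by simp) (by simp) _ hφ]
  rfl

/-- The sign `-1` of a reflection makes folded functions vanish on its axis, and the sign `1` makes
their normal derivative vanish there. This is how folding produces admissible test functions for
either boundary condition. -/
lemma fold_zero_left (hσ : σ = -1) (t : ℝ) : fold σ ε y φ (0, t) = 0 := by
  simp [fold, symm, refl₁, hσ]

lemma fold_zero_right (hε : ε = -1) (s : ℝ) : fold σ ε y φ (s, y) = 0 := by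
  have : 2 * y - y = y := by ring
  simp [fold, symm, refl₁, refl₂, hε, this]

lemma pd₁_fold (hσ : σ = 1) (hφ : Smooth φ) (t : ℝ) : pd₁ (fold σ ε y φ) (0, t) = 0 := by
  have h := hasDerivAt_pd₁ ((contDiff_fold σ ε y hφ).diff (0, t))
  have h' := (HasDerivAt.scomp (0 : ℝ) (by simpa using h) (hasDerivAt_neg (0 : ℝ)))
  have e : (fun s : ℝ => fold σ ε y φ (s, t)) ∘ (fun s => -s) = fun s => fold σ ε y φ (s, t) := by
    ext s; simp [fold, symm, refl₁, hσ, add_comm]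
  have := h'.unique (e ▸ h)
  rw [neg_one_smul] at this
  exact self_eq_neg.1 this.symm

lemma pd₂_fold (hε : ε = 1) (hφ : Smooth φ) (s : ℝ) : pd₂ (fold σ ε y φ) (s, y) = 0 := by
  have h := hasDerivAt_pd₂ ((contDiff_fold σ ε y hφ).diff (s, y))
  have h2 : HasDerivAt (fun t' => fold σ ε y φ (s, t')) (pd₂ (fold σ ε y φ) (s, y)) (2 * y - y) := by
    rwa [show 2 * y - y = y by ring]
  have h' := HasDerivAt.scomp (h := fun t => 2 * y - t) y h2 ((hasDerivAt_id y).const_sub (2 * y))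
  have e : (fun t : ℝ => fold σ ε y φ (s, t)) ∘ (fun t => 2 * y - t) =
      fun t => fold σ ε y φ (s, t) := by
    ext t; simp [fold, symm, refl₁, refl₂, hε]; ring
  have := h'.unique (e ▸ h)
  rw [neg_one_smul] at this
  exact self_eq_neg.1 this.symm

/-- The reflections move the halfstrip off itself, so a function supported in it is unchanged there
by folding. The second derivatives found in the plane therefore are those of the original function.
-/
lemma fold_of_mem (hy : y = 0 ∨ y = π) (h : ∀ x ∉ strip, φ x = 0) (hx : x ∈ strip) : fold σ ε y φ x = φ x := by
  have h1 : refl₁ x ∉ strip := fun h => by linarith [show 0 < -x.1 from h.1, hx.1]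
  have h2 : refl₂ y x ∉ strip := fun h => by
    have k1 : 0 < 2 * y - x.2 := h.2.1
    have k2 : 2 * y - x.2 < π := h.2.2
    rcases hy with rfl | rfl <;> linarith [hx.2.1, hx.2.2]
  have h3 : refl₂ y (refl₁ x) ∉ strip := fun h => by linarith [show 0 < -x.1 from h.1, hx.1]
  simp [fold, symm, h _ h1, h _ h2, h _ h3]

lemma tsupport_partialD (i j : ℕ) (φ : ℝ² → ℂ) : tsupport (partialD i j φ) ⊆ tsupport φ := by
  have h2 : tsupport (pd₂^[j] φ) ⊆ tsupport φ := by
    induction j with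
    | zero => exact subset_rfl
    | succ j ih =>
      rw [Function.iterate_succ_apply']
      exact (tsupport_pd₂ _).trans ih
  unfold partialD
  induction i with
  | zero => exact h2
  | succ i ih =>
    rw [Function.iterate_succ_apply']
    exact (tsupport_pd₁ _).trans ih

/-- The sign of the reflection in the line `x₁ = 0`. -/
def parSign : Parity → ℂ
  | Parity.even => 1
  | Parity.odd => -1

/-- Second derivatives of a solution, localized to a part of the halfstrip that meets at most one
horizontal side, where one condition holds. -/
lemma WeakTo.exists_partialD {v : Energy a p} {g : L2 strip} (h : WeakTo L v g) (hχ : IsTest χ) (hL : tsupport χ ⊆ {x | x.1 < L}) (hl : ∀ t, pd₁ χ (0, t) = 0)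
    (hy : y = 0 ∨ y = π)
    (h1 : ∀ s, 0 < s → s < a → pd₂ χ (s, 0) = 0 ∧ (χ (s, 0) = 0 ∨ y = 0 ∧ ε = 1))
    (h2 : ∀ s, 0 ≤ s → χ (s, π) = 0 ∨ y = π ∧ ε = -1)
    (h3 : ∀ s, a ≤ s → χ (s, 0) = 0 ∨ y = 0 ∧ ε = -1) {i j : ℕ} (hij : i + j ≤ 2) :
    ∃ H : ℝ² → ℂ, MemLp H 2 ∧ ∀ φ, IsTest φ → tsupport φ ⊆ strip →
      ∫ x, H x * φ x = (-1) ^ (i + j) * ∫ x in strip, (val v x * χ x) * partialD i j φ x := by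
  have ms : MeasurableSet strip := isOpen_strip.measurableSet
  -- Extend by zero and symmetrize. An integral over the plane against `φ` becomes one over the
  -- halfstrip against the folded `φ`, to which Green's formula applies.
  have ext : ∀ {w : ℝ² → ℂ}, MemLp w 2 μ[strip] →
      (∀ φ : ℝ² → ℂ, Smooth φ → Integrable (fun x => w x * φ x) μ[strip]) →
      ∃ W : ℝ² → ℂ, MemLp W 2 ∧ ∀ φ : ℝ² → ℂ, Smooth φ →
        ∫ x, W x * φ x = ∫ x in strip, w x * fold (parSign p) ε y φ x := by
    intro w hw hi
    have e : ∀ φ : ℝ² → ℂ, (fun x => strip.indicator w x * φ x) =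
        strip.indicator fun x => w x * φ x := fun φ => by
      ext x; by_cases hx : x ∈ strip <;> simp [hx]
    obtain ⟨m1, d1, s1⟩ := symm_spec measurePreserving_refl₁ involutive_refl₁ contDiff_refl₁
      (parSign p) ((memLp_indicator_iff_restrict ms).2 hw) (fun φ hφ => by
        rw [e, integrable_indicator_iff ms]; exact hi φ hφ)
    obtain ⟨m2, -, s2⟩ := symm_spec (measurePreserving_refl₂ y) (involutive_refl₂ y)
      (contDiff_refl₂ y) ε m1 d1
    refine ⟨_, m2, fun φ hφ => ?_⟩
    rw [s2 φ hφ, s1 _ (contDiff_symm (contDiff_refl₂ y) _ hφ), e, integral_indicator ms]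
    rfl
  obtain ⟨V, mV, hV⟩ := ext (memLp_mul_test (Lp.memLp (val v)) hχ) fun φ hφ =>
    (integrable_mul_test (val v) (hχ.mul hφ)).congr (ae_of_all _ fun x => by ring)
  obtain ⟨G, mG, hG⟩ := ext (memLp_cutLap v g hχ) fun φ hφ =>
    integrable_cutLap v g hχ hφ
  have pe : p = Parity.even → parSign p = 1 := fun hp => by rw [hp]; rfl
  have po : p = Parity.odd → parSign p = -1 := fun hp => by rw [hp]; rfl
  obtain ⟨H, mH, hH⟩ := exists_weak_partialD mV mG (fun φ hφ => by
    have hl' : Smooth (lap φ) :=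
      (contDiff_pd₁ (contDiff_pd₁ hφ)).add (contDiff_pd₂ (contDiff_pd₂ hφ))
    refine (hV _ hl').trans (Eq.trans ?_ (hG _ hφ).symm)
    rw [← lap_fold hφ]
    refine h.integral_cut hχ (contDiff_fold _ _ y hφ) hL ?_ (fun s h0 h0' => ⟨?_, ?_⟩)
      fun hp t => ⟨pd₁_fold (pe hp) hφ t, hl t⟩
    · rintro ⟨s, t⟩ ((⟨rfl, h0⟩ | ⟨rfl, h0⟩) | ⟨hp, rfl, -, -⟩)
      · rcases h2 s h0 with e | ⟨rfl, hε⟩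
        · simp [e]
        · simp [fold_zero_right hε]
      · rcases h3 s h0 with e | ⟨rfl, hε⟩
        · simp [e]
        · simp [fold_zero_right hε]
      · simp [fold_zero_left (po hp)]
    · rcases (h1 s h0 h0').2 with e | ⟨rfl, hε⟩
      · simp [e]
      · simp [pd₂_fold hε hφ]
    · simp [(h1 s h0 h0').1]) hij
  refine ⟨H, mH, fun φ hφ hs => ?_⟩
  rw [hH φ hφ, hV _ (hφ.partialD i j).1]
  congr 1
  refine setIntegral_congr_fun ms fun x hx => ?_
  have : ∀ x ∉ strip, partialD i j φ x = 0 := fun x hx =>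
    eq_zero_off fun hx' => hx (hs (tsupport_partialD i j φ hx'))
  simp only [fold_of_mem hy this hx]

end

/-! ### Regularity in `H²` away from the endpoint of the Neumann window. -/

section

lemma isOpen_stripCut (a R s : ℝ) : IsOpen (stripCut a R s) :=
  (isOpen_stripTo R).inter (isOpen_lt (by fun_prop) (by fun_prop))

lemma integral_of_tsupport (hΩ : MeasurableSet Ω') (hs : Ω ⊆ Ω')
    (h : tsupport φ ⊆ Ω) : ∫ x in Ω', w x * φ x = ∫ x in Ω, w x * φ x :=
  setIntegral_eq_of_subset_of_forall_sdiff_eq_zero hΩ hs fun x hx => by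
    rw [eq_zero_off fun h' => hx.2 (h h'), mul_zero]

/-- Square integrable weak derivatives of all orders up to `k` form an element of `H^k`. The one of
order zero is `w` itself, by uniqueness. -/
lemma exists_sobolev {k : ℕ} (hΩ : IsOpen Ω) (hw : MemLp w 2 μ[Ω]) (h : ∀ i j, i + j ≤ k → ∃ H : ℝ² → ℂ, MemLp H 2 ∧
      ∀ φ, IsTest φ → tsupport φ ⊆ Ω →
        ∫ x in Ω, H x * φ x = (-1) ^ (i + j) * ∫ x in Ω, w x * partialD i j φ x) :
    ∃ U : Sobolev k Ω, Represents U w := by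
  choose H hH hi using h
  have hl : ∀ i j hij, MemLp (H i j hij) 2 μ[Ω] := fun i j hij => (hH i j hij).restrict Ω
  have h0 : H 0 0 (by simp) =ᵐ[μ[Ω]] w :=
    ae_eq_of_integral_test hΩ (locallyIntegrableOn_of_memLp (hl _ _ _))
      (locallyIntegrableOn_of_memLp hw) fun φ hφ hs => by
        have := hi 0 0 (by simp) φ hφ hs
        simpa [partialD] using this
  have e : ∀ i j hij, ((hl i j hij).toLp _ : L2 Ω) =ᵐ[μ[Ω]] H i j hij := fun i j hij =>
    (hl i j hij).coeFn_toLp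
  refine ⟨⟨WithLp.toLp 2 fun α => (hl α.1.1 α.1.2 α.2).toLp _, fun α φ hφ hs => ?_⟩,
    (e _ _ _).trans h0⟩
  have e1 : ∫ x in Ω, ((hl α.1.1 α.1.2 α.2).toLp _ : L2 Ω) x * φ x =
      ∫ x in Ω, H α.1.1 α.1.2 α.2 x * φ x :=
    integral_congr_ae ((e α.1.1 α.1.2 α.2).mono fun x hx => by simp only [hx])
  have e2 : ∫ x in Ω, ((hl 0 0 (by simp)).toLp _ : L2 Ω) x * partialD α.1.1 α.1.2 φ x =
      ∫ x in Ω, w x * partialD α.1.1 α.1.2 φ x :=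
    integral_congr_ae (((e 0 0 (by simp)).trans h0).mono fun x hx => by simp only [hx])
  exact e1.trans ((hi _ _ α.2 φ hφ hs).trans (congrArg _ e2.symm))

/-- A cutoff with separated variables whose normal derivatives vanish on `x₁ = 0` and `x₂ = 0`
respects the reflections. The bound on `L` keeps the support of `plateau R` inside the region where
the weak equation holds. -/
lemma WeakTo.exists_sep {v : Energy a p} {g : L2 strip} (h : WeakTo L v g) (hR : 0 < R)
    (hL : 2 * (R ^ 2 + 1) < L) {θ k : ℝ → ℂ} (hθ : Smooth θ) (hk : Smooth k)
    (hθ0 : deriv θ 0 = 0) (hk0 : deriv k 0 = 0) {y : ℝ} {ε : ℂ} (hy : y = 0 ∨ y = π)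
    (h1 : ∀ s, 0 < s → s < a → θ s * k 0 = 0 ∨ y = 0 ∧ ε = 1)
    (h2 : k π = 0 ∨ y = π ∧ ε = -1)
    (h3 : ∀ s, a ≤ s → θ s * k 0 = 0 ∨ y = 0 ∧ ε = -1) {i j : ℕ} (hij : i + j ≤ 2) :
    ∃ H : ℝ² → ℂ, MemLp H 2 ∧ ∀ φ, IsTest φ → tsupport φ ⊆ strip → ∫ x, H x * φ x =
      (-1) ^ (i + j) * ∫ x in strip, val v x * (plateau R x.1 * θ x.1 * k x.2) * partialD i j φ x := by
  have hη : Smooth fun s => plateau R s * θ s := (contDiff_plateau R).mul hθ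
  have hη0 : deriv (fun s => plateau R s * θ s) 0 = 0 := by
    rw [deriv_fun_mul ((contDiff_plateau R).diff _)
      (hθ.diff _), hθ0, deriv_plateau_of_lt (by simpa using hR.ne')]
    simp
  have p4 := pi_lt_four
  have p0 := pi_pos
  have v0 : ∀ s : ℝ, sep (fun s => plateau R s * θ s) k (s, 0) = plateau R s * (θ s * k 0) :=
    fun s => (sep_eq (by simp)).trans (mul_assoc _ _ _)
  have vπ : ∀ s : ℝ, sep (fun s => plateau R s * θ s) k (s, π) =
      plateau R s * θ s * k π := fun s => sep_eq (by rw [abs_of_pos p0]; exact p4.le)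
  obtain ⟨H, mH, hH⟩ := h.exists_partialD (χ := sep (fun s => plateau R s * θ s) k)
    (y := y) (ε := ε) (isTest_sep hη (hasCompactSupport_plateau R).mul_right hk)
    (fun x hx => lt_of_le_of_lt
      (tsupport_plateau R (tsupport_mul_subset_left (tsupport_sep hx).1)).2 hL)
    (fun t => (hasFDerivAt_prod_mul (x := ((0 : ℝ), t)) (η := fun s => plateau R s * θ s)
      (k := fun t => (bump₄ t : ℂ) * k t) (hη.diff _)
      (((ofRealCLM.contDiff.comp bump₄.contDiff).mul hk).diff t)).1.trans
      (by simp only [hη0, zero_mul])) hy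
    (fun s h0 h0' => ⟨by rw [pd₂_sep hη hk (by simp), hk0, mul_zero],
      (h1 s h0 h0').imp_left fun e => by rw [v0, e, mul_zero]⟩)
    (fun s _ => h2.imp_left fun e => by rw [vπ, e, mul_zero])
    (fun s hs => (h3 s hs).imp_left fun e => by rw [v0, e, mul_zero]) hij
  refine ⟨H, mH, fun φ hφ hs => (hH φ hφ hs).trans ?_⟩
  congr 1
  refine setIntegral_congr_fun isOpen_strip.measurableSet fun x hx => ?_
  simp only [sep_eq (abs_le_four_of_mem hx).le]

/-- A smooth step from `0` to `1` between `c + δ` and `c + 2δ`. -/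
def ramp (c δ t : ℝ) : ℂ := (stepFun ((t - c) / δ) : ℝ)

section ramp

variable {c δ t : ℝ}

lemma contDiff_ramp : Smooth (ramp c δ) :=
  ofRealCLM.contDiff.comp (contDiff_stepFun.comp ((contDiff_id.sub contDiff_const).div_const _))

lemma ramp_of_le (hδ : 0 < δ) (h : t ≤ c + δ) : ramp c δ t = 0 := by
  rw [ramp, stepFun_of_le ((div_le_one hδ).2 (by linarith)), ofReal_zero]

lemma ramp_of_ge (hδ : 0 < δ) (h : c + 2 * δ ≤ t) : ramp c δ t = 1 := by
  rw [ramp, stepFun_of_ge ((le_div_iff₀ hδ).2 (by linarith)), ofReal_one]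

lemma deriv_ramp (hδ : 0 < δ) (h : t < c + δ) : deriv (ramp c δ) t = 0 := by
  have : ramp c δ =ᶠ[𝓝 t] fun _ => 0 := by
    filter_upwards [Iio_mem_nhds h] with t ht using ramp_of_le hδ ht.le
  rw [this.deriv_eq, deriv_const]

end ramp

/-- Interior and boundary regularity of solutions away from the endpoint of the Neumann
window. -/
lemma WeakTo.exists_sobolev_two {v : Energy a p} {g : L2 strip} (h : WeakTo L v g) (ha : 0 < a)
    (hR : 0 < R) (hs : 0 < s) (hL : 2 * (R ^ 2 + 1) < L) :
    ∃ U : Sobolev 2 (stripCut a R s), Represents U (val v) := by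
  have hsub : stripCut a R s ⊆ strip := fun x hx => hx.1.1
  refine exists_sobolev (isOpen_stripCut a R s)
    ((Lp.memLp (val v)).mono_set hsub) fun i j hij => ?_
  -- With `3 δ < s` the square `|x₁ - a| < 2δ`, `0 < x₂ < 2δ` lies in the removed disc, since `8 δ²
  -- < 9 δ² < s²`. The bound `3 δ < a` keeps the cutoff constant near `x₁ = 0`.
  obtain ⟨δ, hδ, h1, h2, h3⟩ : ∃ δ, 0 < δ ∧ 3 * δ < a ∧ 3 * δ < s ∧ 2 * δ < π :=
    ⟨min (min (a / 4) (s / 4)) 1, by positivity, by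
      linarith [min_le_left (min (a / 4) (s / 4)) 1, min_le_left (a / 4) (s / 4)], by
      linarith [min_le_left (min (a / 4) (s / 4)) 1, min_le_right (a / 4) (s / 4)], by
      linarith [min_le_right (min (a / 4) (s / 4)) 1, pi_gt_three]⟩
  have cr : ∀ c, Smooth fun t => 1 - ramp c δ t := fun c => contDiff_const.sub contDiff_ramp
  have d1 : ∀ {c t : ℝ}, t < c + δ → deriv (fun t => 1 - ramp c δ t) t = 0 := fun h => by
    rw [deriv_const_sub, deriv_ramp hδ h, neg_zero]
  have r0 : ramp 0 δ 0 = 0 := ramp_of_le hδ (by linarith)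
  have rπ : 1 - ramp 0 δ π = 0 := by rw [ramp_of_ge hδ (by linarith), sub_self]
  -- The part away from the lower side sees only the Dirichlet condition on the upper side, which
  -- asks for an odd reflection.
  obtain ⟨H₁, m1, e1⟩ := h.exists_sep hR hL (θ := fun _ => 1) (k := ramp 0 δ) (ε := -1)
    contDiff_const contDiff_ramp (by simp) (deriv_ramp hδ (by linarith)) (Or.inr rfl)
    (fun _ _ _ => Or.inl (by rw [r0, mul_zero])) (Or.inr ⟨rfl, rfl⟩)
    (fun _ _ => Or.inl (by rw [r0, mul_zero])) hij
  -- Near the lower side to the left of `a`: the Neumann condition, with an even reflection.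
  obtain ⟨H₂, m2, e2⟩ := h.exists_sep hR hL (θ := fun t => 1 - ramp (a - 3 * δ) δ t)
    (k := fun t => 1 - ramp 0 δ t) (ε := 1) (cr _) (cr _) (d1 (by linarith)) (d1 (by linarith))
    (Or.inl rfl) (fun _ _ _ => Or.inr ⟨rfl, rfl⟩) (Or.inl rπ)
    (fun t ht => Or.inl (by rw [ramp_of_ge hδ (by linarith), sub_self, zero_mul])) hij
  -- Near the lower side to the right of `a`: the Dirichlet condition, with an odd reflection.
  obtain ⟨H₃, m3, e3⟩ := h.exists_sep hR hL (θ := ramp a δ) (k := fun t => 1 - ramp 0 δ t)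
    (ε := -1) contDiff_ramp (cr _) (deriv_ramp hδ (by linarith)) (d1 (by linarith))
    (Or.inl rfl) (fun t _ ht => Or.inl (by rw [ramp_of_le hδ (by linarith), zero_mul]))
    (Or.inl rπ) (fun _ _ => Or.inr ⟨rfl, rfl⟩) hij
  refine ⟨_, (m1.add m2).add m3, fun φ hφ hφs => ?_⟩
  have int : ∀ {H : ℝ² → ℂ}, MemLp H 2 → Integrable fun x => H x * φ x := fun hH =>
    hH.integrable_mul (q := 2) (hφ.1.continuous.memLp_of_hasCompactSupport hφ.2)
  have mD := hφ.partialD i j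
  have int' : ∀ {θ k : ℝ → ℂ}, Smooth θ → Smooth k → Integrable (fun x =>
      val v x * (plateau R x.1 * θ x.1 * k x.2) * partialD i j φ x) μ[strip] :=
    fun {θ k} hθ hk => (integrable_mul_test (val v) (mD.mul (χ := fun x =>
      plateau R x.1 * θ x.1 * k x.2) ((((contDiff_plateau R).mul hθ).comp contDiff_fst).mul
      (hk.comp contDiff_snd)))).congr (ae_of_all _ fun x => by ring)
  have t1 := int' (θ := fun _ => 1) (k := ramp 0 δ) contDiff_const contDiff_ramp
  have t2 := int' (cr (a - 3 * δ)) (cr 0)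
  have t3 := int' (contDiff_ramp (c := a) (δ := δ)) (cr 0)
  have ms := hφs.trans hsub
  rw [← integral_of_tsupport MeasurableSet.univ (subset_univ _) hφs, Measure.restrict_univ,
    ← integral_of_tsupport isOpen_strip.measurableSet hsub ((tsupport_partialD i j φ).trans hφs)]
  refine ((((int m1).hi.add (int m2).hi).add (int m3).hi).congr (ae_of_all _ fun x => by
    simp only [Pi.add_apply]; ring)).2.trans ?_
  rw [e1 φ hφ ms, e2 φ hφ ms, e3 φ hφ ms, ← mul_add, ← mul_add]
  refine congrArg _ ((((t1.hi.add t2.hi).add t3.hi).congr (g := fun x => (val v x *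
    (plateau R x.1 * (ramp 0 δ x.2 + (1 - ramp 0 δ x.2) * (1 - ramp (a - 3 * δ) δ x.1 +
      ramp a δ x.1)))) * partialD i j φ x) (ae_of_all _ fun x => by ring)).2.symm.trans ?_)
  · refine setIntegral_congr_fun isOpen_strip.measurableSet fun x _ => ?_
    by_cases hx : x ∈ tsupport (partialD i j φ)
    swap
    · simp only [eq_zero_off hx, mul_zero]
    obtain ⟨⟨⟨x0, x1, -⟩, x2⟩, x3⟩ := hφs (tsupport_partialD i j φ hx)
    have x2' : x.1 < R := x2
    have x3' : s ^ 2 < (x.1 - a) ^ 2 + x.2 ^ 2 := x3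
    have pl : plateau R x.1 = 1 := plateau_eq_one (by rw [abs_of_pos x0, abs_of_pos hR]; exact x2'.le)
    -- The three cutoffs add up to `1` outside the removed disc: below the height `2δ` such a point
    -- has horizontal distance at least `2δ` from `a`.
    have key : ramp 0 δ x.2 + (1 - ramp 0 δ x.2) * (1 - ramp (a - 3 * δ) δ x.1 + ramp a δ x.1) = 1 := by
      rcases le_or_gt (2 * δ) x.2 with hc | hc
      · rw [ramp_of_ge hδ (by linarith)]; ring
      · rcases le_total x.1 a with ho | ho
        · have : x.1 ≤ a - 2 * δ := by nlinarith
          rw [ramp_of_le (c := a) hδ (by linarith), ramp_of_le (c := a - 3 * δ) hδ (by linarith)]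
          ring
        · have : a + 2 * δ ≤ x.1 := by nlinarith
          rw [ramp_of_ge (c := a) hδ (by linarith), ramp_of_ge (c := a - 3 * δ) hδ (by linarith)]
          ring
    simp only [key, pl, mul_one]

end

section

/-! ### Unique continuation for the Helmholtz equation -/

/-- The complex coordinate centred at `c`. -/
def cz (c x : ℝ²) : ℂ := ((x.1 - c.1 : ℝ) : ℂ) + ((x.2 - c.2 : ℝ) : ℂ) * I

/-- The square of the distance from `c`. -/
def nz (c x : ℝ²) : ℝ := (x.1 - c.1) ^ 2 + (x.2 - c.2) ^ 2

/-- The disc about `c` with the square `ρ` of the radius. -/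
def disc (c : ℝ²) (ρ : ℝ) : Set ℝ² := {x | nz c x < ρ}

/-- `w` is a distributional solution of `Δw + w = 0` in `Ω`. -/
def Helmholtz (Ω : Set ℝ²) (w : ℝ² → ℂ) : Prop :=
  ∀ φ, IsTest φ → tsupport φ ⊆ Ω → ∫ x in Ω, w x * (lap φ x + φ x) = 0

variable {c : ℝ²} {ρ T e : ℝ}

lemma contDiff_cz : Smooth (cz c) := by
  unfold cz
  exact (ofRealCLM.contDiff.comp (contDiff_fst.sub contDiff_const)).add
    ((ofRealCLM.contDiff.comp (contDiff_snd.sub contDiff_const)).mul contDiff_const)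

lemma contDiff_nz : Smooth (nz c) := by unfold nz; fun_prop

lemma cz_mul_conj (x : ℝ²) : cz c x * conj (cz c x) = (nz c x : ℝ) := by
  simp only [cz, nz, map_add, map_mul, conj_ofReal, conj_I]
  push_cast
  linear_combination (-((x.2 : ℂ) - c.2) ^ 2) * I_sq

lemma nz_nonneg (x : ℝ²) : 0 ≤ nz c x := by unfold nz; positivity

lemma norm_cz_sq (x : ℝ²) : ‖cz c x‖ ^ 2 = nz c x := by
  have h := cz_mul_conj (c := c) x
  rw [mul_conj'] at h
  exact_mod_cast h

lemma isOpen_disc : IsOpen (disc c ρ) := isOpen_lt contDiff_nz.continuous continuous_const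

lemma isCompact_nz_le (c : ℝ²) (T : ℝ) : IsCompact {x | nz c x ≤ T} := by
  refine (isCompact_closedBall c (T + 1)).of_isClosed_subset
    (isClosed_le contDiff_nz.continuous continuous_const) fun x hx => ?_
  have hx' : (x.1 - c.1) ^ 2 + (x.2 - c.2) ^ 2 ≤ T := hx
  have k : ∀ b d : ℝ, b ^ 2 + d ^ 2 ≤ T → |b| ≤ T + 1 := fun b d h => by
    rw [abs_le]; constructor <;> nlinarith [sq_nonneg (b - 1), sq_nonneg (b + 1), sq_nonneg d]
  exact max_le (k _ _ hx') (k _ (x.1 - c.1) (by linarith))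

section radial

variable {P P' P'' : ℂ → ℂ} {G : ℝ → ℂ}

lemma hasDerivAt_radial (hP : ∀ z, HasDerivAt P (P' z) z) (hG : Differentiable ℝ G) (s t : ℝ) :
    HasDerivAt (fun s => P (cz c (s, t)) * G (nz c (s, t))) (P' (cz c (s, t)) * G (nz c (s, t)) +
        P (cz c (s, t)) * deriv G (nz c (s, t)) * (2 * (s - c.1) : ℝ)) s ∧
    HasDerivAt (fun t => P (cz c (s, t)) * G (nz c (s, t)))
      (P' (cz c (s, t)) * G (nz c (s, t)) * I +
        P (cz c (s, t)) * deriv G (nz c (s, t)) * (2 * (t - c.2) : ℝ)) t := by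
  constructor
  · have h1 : HasDerivAt (fun s => cz c (s, t)) 1 s :=
      HasDerivAt.congr_deriv (f' := ((1 : ℝ) : ℂ))
        (((hasDerivAt_id s).sub_const c.1).ofReal_comp.add_const
          (((t - c.2 : ℝ) : ℂ) * I)) (by simp)
    have h2 : HasDerivAt (fun s => nz c (s, t)) (2 * (s - c.1)) s :=
      HasDerivAt.congr_deriv (f' := (2 : ℕ) * (s - c.1) ^ (2 - 1) * 1)
        ((((hasDerivAt_id s).sub_const c.1).pow 2).add_const ((t - c.2) ^ 2)) (by simp)
    refine (((hP _).comp s h1).mul ((hG _).hasDerivAt.scomp s h2)).congr_deriv ?_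
    simp only [Function.comp_apply, real_smul]
    ring
  · have h1 : HasDerivAt (fun t => cz c (s, t)) I t :=
      HasDerivAt.congr_deriv (f' := ((1 : ℝ) : ℂ) * I)
        ((((hasDerivAt_id t).sub_const c.2).ofReal_comp.mul_const
          I).const_add ((s - c.1 : ℝ) : ℂ)) (by simp)
    have h2 : HasDerivAt (fun t => nz c (s, t)) (2 * (t - c.2)) t :=
      HasDerivAt.congr_deriv (f' := (2 : ℕ) * (t - c.2) ^ (2 - 1) * 1)
        ((((hasDerivAt_id t).sub_const c.2).pow 2).const_add ((s - c.1) ^ 2)) (by simp)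
    refine (((hP _).comp t h1).mul ((hG _).hasDerivAt.scomp t h2)).congr_deriv ?_
    simp only [Function.comp_apply, real_smul]
    ring

lemma contDiff_radial (hP : Smooth P) (hG : Smooth G) : Smooth fun x => P (cz c x) * G (nz c x) :=
  (hP.comp contDiff_cz).mul (hG.comp contDiff_nz)

/-- Since `P` is holomorphic its own Laplacian vanishes, and the cross term involves only `z P'`.
For `P = zⁿ` the result is `zⁿ (4 t G'' + 4 (n + 1) G')` with `t = |z|²`, an ordinary differential
operator in `t`. -/
lemma lap_radial (hP : ∀ z, HasDerivAt P (P' z) z) (hP' : ∀ z, HasDerivAt P' (P'' z) z)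
    (hcP : Smooth P) (hG : Smooth G) (x : ℝ²) :
    lap (fun x => P (cz c x) * G (nz c x)) x = 4 * (cz c x * P' (cz c x)) * deriv G (nz c x) +
      P (cz c x) * (4 * nz c x * deriv (deriv G) (nz c x) + 4 * deriv G (nz c x)) := by
  have hG' := contDiff_deriv hG
  have dG : Differentiable ℝ G := hG.diff
  have dG' : Differentiable ℝ (deriv G) := hG'.diff
  have hc := contDiff_radial (c := c) hcP hG
  have e1 : pd₁ (fun x => P (cz c x) * G (nz c x)) = fun x => P' (cz c x) * G (nz c x) +
      P (cz c x) * deriv G (nz c x) * (2 * (x.1 - c.1) : ℝ) := funext fun x =>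
    (hasDerivAt_pd₁ (hc.diff (x.1, x.2))).unique (hasDerivAt_radial hP dG _ _).1
  have e2 : pd₂ (fun x => P (cz c x) * G (nz c x)) = fun x => P' (cz c x) * G (nz c x) * I +
      P (cz c x) * deriv G (nz c x) * (2 * (x.2 - c.2) : ℝ) := funext fun x =>
    (hasDerivAt_pd₂ (hc.diff (x.1, x.2))).unique (hasDerivAt_radial hP dG _ _).2
  have d1 := (contDiff_pd₁ hc).diff (x.1, x.2)
  have d2 := (contDiff_pd₂ hc).diff (x.1, x.2)
  have k : ∀ b t : ℝ, HasDerivAt (fun s : ℝ => ((2 * (s - b) : ℝ) : ℂ)) 2 t := fun b t =>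
    (((hasDerivAt_id t).sub_const b).const_mul 2).ofReal_comp.congr_deriv (by simp)
  have f1 := hasDerivAt_pd₁ d1
  have f2 := hasDerivAt_pd₂ d2
  rw [e1] at f1
  rw [e2] at f2
  have g1 := f1.unique ((hasDerivAt_radial hP' dG _ _).1.add
    ((hasDerivAt_radial hP dG' _ _).1.mul (k c.1 x.1)))
  have g2 := f2.unique (((hasDerivAt_radial hP' dG _ _).2.mul_const I).add
    ((hasDerivAt_radial hP dG' _ _).2.mul (k c.2 x.2)))
  rw [lap, e1, e2]
  refine (congrArg₂ (· + ·) g1 g2).trans ?_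
  simp only [cz, nz]
  push_cast
  linear_combination (P'' _ * G _ ) * I_sq

lemma isTest_radial (hcP : Smooth P) (hG : Smooth G) (h : ∀ t, T ≤ t → G t = 0) :
    IsTest (fun x => P (cz c x) * G (nz c x)) ∧
      tsupport (fun x => P (cz c x) * G (nz c x)) ⊆ {x | nz c x ≤ T} := by
  have hs : tsupport (fun x => P (cz c x) * G (nz c x)) ⊆ {x | nz c x ≤ T} :=
    closure_minimal (fun x hx => show nz c x ≤ T from not_lt.1 fun h' =>
      hx (by simp only [h _ h'.le, mul_zero]))
      (isCompact_nz_le c T).isClosed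
  exact ⟨⟨contDiff_radial hcP hG, (isCompact_nz_le c T).of_isClosed_subset (isClosed_tsupport _) hs⟩,
    hs⟩

end radial

section primitive

variable {f : ℝ → ℂ}

lemma primitive_of_ge (h : ∀ t, T ≤ t → f t = 0) (t : ℝ) (ht : T ≤ t) : ∫ τ in T..t, f τ = 0 := by
  rw [intervalIntegral.integral_congr (g := fun _ => 0) fun τ hτ => h τ (by
    rw [uIcc_of_le ht] at hτ; exact hτ.1)]
  simp

/-- In the norm weighted by `e^{M (T - t)}` an integration from `T` gains the factor `1/M`. A large
`M` makes the Volterra operator a contraction. -/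
lemma norm_primitive_le {A M : ℝ} (hM : 0 < M) (hA : 0 ≤ A)
    (h : ∀ t ∈ Icc 0 T, ‖f t‖ ≤ A * Real.exp (M * (T - t))) (t : ℝ) (ht : t ∈ Icc 0 T) :
    ‖∫ τ in T..t, f τ‖ ≤ A / M * Real.exp (M * (T - t)) := by
  have hd : ∀ τ, HasDerivAt (fun τ => -(A / M * Real.exp (M * (T - τ))))
      (A * Real.exp (M * (T - τ))) τ := fun τ => by
    refine (((((hasDerivAt_id τ).const_sub T).const_mul M).exp).const_mul (A / M)).neg.congr_deriv ?_
    simp only [id]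
    field_simp
  have hc : Continuous fun τ => A * Real.exp (M * (T - τ)) := by fun_prop
  rw [intervalIntegral.integral_symm, norm_neg]
  refine (intervalIntegral.norm_integral_le_of_norm_le ht.2 (ae_of_all _ fun τ hτ =>
    h τ ⟨ht.1.trans hτ.1.le, hτ.2⟩) (hc.intervalIntegrable _ _)).trans ?_
  rw [intervalIntegral.integral_eq_sub_of_hasDerivAt (fun τ _ => hd τ) (hc.intervalIntegrable _ _)]
  have : 0 ≤ A / M * Real.exp (M * (T - T)) := by positivity
  linarith

end primitive

/-- The Volterra operator that inverts `4 t G'' + 4 (n + 1) G'` for `t ≥ e`. -/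
def volterra (n : ℕ) (e T : ℝ) (F : ℝ → ℂ) (t : ℝ) : ℂ :=
  ∫ τ in T..t, ((stepFun (4 * τ / e) * (τ ^ (n + 1))⁻¹ : ℝ) : ℂ) * ∫ σ in T..τ, ((σ ^ n / 4 : ℝ) : ℂ) * F σ

lemma contDiff_weight (he : 0 < e) (n : ℕ) :
    Smooth fun τ : ℝ => ((stepFun (4 * τ / e) * (τ ^ (n + 1))⁻¹ : ℝ) : ℂ) := by
  refine ofRealCLM.contDiff.comp (contDiff_iff_contDiffAt.2 fun τ => ?_)
  rcases lt_or_ge τ (e / 4) with h | h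
  · refine (contDiffAt_const (c := (0 : ℝ))).congr_of_eventuallyEq ?_
    filter_upwards [Iio_mem_nhds h] with t ht
    rw [stepFun_of_le ((div_le_one he).2 (by linarith [show t < e / 4 from ht]))]
    exact zero_mul _
  · exact (contDiff_stepFun.comp ((contDiff_const.mul contDiff_id).div_const e)).contDiffAt.mul
      ((contDiffAt_id.pow _).inv (pow_ne_zero _ (by simp only [id]; linarith)))

/-- The operator equals `4 t⁻ⁿ d/dt (tⁿ⁺¹ d/dt)`, so two integrations from `T` invert it. The cutoff
in the weight removes the singularity at `t = 0` and is `1` for `t ≥ e/2`, so the equation holds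
where `t ≥ e`. -/
lemma volterra_spec (he : 0 < e) (n : ℕ) {F : ℝ → ℂ} (hF : Smooth F) (h0 : ∀ t, T ≤ t → F t = 0) :
    Smooth (volterra n e T F) ∧ (∀ t, T ≤ t → volterra n e T F t = 0) ∧
      ∀ t, e ≤ t → 4 * t * deriv (deriv (volterra n e T F)) t +
        4 * (n + 1) * deriv (volterra n e T F) t = F t := by
  have c1 : Smooth fun σ : ℝ => ((σ ^ n / 4 : ℝ) : ℂ) * F σ :=
    (ofRealCLM.contDiff.comp ((contDiff_id.pow n).div_const 4)).mul hF
  obtain ⟨c2, d2⟩ := contDiff_primitive (T := T) c1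
  have z2 := primitive_of_ge (T := T) (f := fun σ : ℝ => ((σ ^ n / 4 : ℝ) : ℂ) * F σ)
    fun t ht => by simp only [h0 t ht, mul_zero]
  have cw := contDiff_weight he n
  obtain ⟨c3, d3⟩ := contDiff_primitive (T := T) (cw.mul c2)
  refine ⟨c3, primitive_of_ge fun t ht => by simp only [z2 t ht, mul_zero], fun t ht => ?_⟩
  have ht0 : t ≠ 0 := by linarith
  have hw : (fun τ : ℝ => ((stepFun (4 * τ / e) * (τ ^ (n + 1))⁻¹ : ℝ) : ℂ)) =ᶠ[𝓝 t]
      fun τ => (((τ ^ (n + 1))⁻¹ : ℝ) : ℂ) := by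
    filter_upwards [Ioi_mem_nhds (show e / 2 < t by linarith)] with τ hτ
    rw [stepFun_of_ge ((le_div_iff₀ he).2 (by linarith [show e / 2 < τ from hτ])), one_mul]
  have dw : HasDerivAt (fun τ : ℝ => ((stepFun (4 * τ / e) * (τ ^ (n + 1))⁻¹ : ℝ) : ℂ))
      ((-((n + 1 : ℕ) * t ^ n) / (t ^ (n + 1)) ^ 2 : ℝ) : ℂ) t :=
    ((hasDerivAt_pow (n + 1) t).inv (pow_ne_zero _ ht0)).ofReal_comp.congr_of_eventuallyEq hw
  have dp : HasDerivAt (fun t => ∫ τ in T..t, ((τ ^ n / 4 : ℝ) : ℂ) * F τ)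
      (((t ^ n / 4 : ℝ) : ℂ) * F t) t := by
    have := ((c2.diff) t).hasDerivAt
    rwa [d2] at this
  have e1 : deriv (volterra n e T F) = _ := d3
  have e2 := (dw.mul dp).deriv
  rw [hw.eq_of_nhds] at e2
  rw [e1]
  refine (congrArg₂ (fun A B => 4 * (t : ℂ) * A + 4 * (n + 1) * B) e2
    (congrArg (· * _) hw.eq_of_nhds)).trans ?_
  have ht0' : (t : ℂ) ≠ 0 := ofReal_ne_zero.2 ht0
  push_cast
  field_simp
  ring

lemma norm_volterra_le {n : ℕ} {A M C : ℝ} (hM : 0 < M) (hA : 0 ≤ A) (hC : 0 ≤ C)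
    (h1 : ∀ t ∈ Icc 0 T, ‖((stepFun (4 * t / e) * (t ^ (n + 1))⁻¹ : ℝ) : ℂ)‖ ≤ C)
    (h2 : ∀ t ∈ Icc 0 T, ‖((t ^ n / 4 : ℝ) : ℂ)‖ ≤ C) {F : ℝ → ℂ}
    (h : ∀ t ∈ Icc 0 T, ‖F t‖ ≤ A * Real.exp (M * (T - t))) (t : ℝ) (ht : t ∈ Icc 0 T) :
    ‖volterra n e T F t‖ ≤ C * (C * A / M) / M * Real.exp (M * (T - t)) := by
  refine norm_primitive_le hM (by positivity) (fun t ht => ?_) t ht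
  have := norm_primitive_le hM (A := C * A) (by positivity) (fun t ht => by
    rw [norm_mul, mul_assoc]
    exact mul_le_mul (h2 t ht) (h t ht) (norm_nonneg _) hC) t ht
  rw [norm_mul, mul_assoc]
  exact mul_le_mul (h1 t ht) this (norm_nonneg _) hC

lemma integrable_mul_of_continuous (hw : IntegrableOn w (disc c ρ)) (hφ : Continuous φ) : IntegrableOn (fun x => w x * φ x) (disc c ρ) := by
  obtain ⟨C, hC⟩ := (isCompact_nz_le c ρ).exists_bound_of_continuousOn hφ.continuousOn
  refine hw.mul_bdd (c := C) hφ.aestronglyMeasurable ((ae_restrict_iff' isOpen_disc.measurableSet).2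
    (ae_of_all _ fun x hx => hC x (show nz c x ≤ ρ from le_of_lt hx)))

/-- Let `V` be the Volterra operator. Testing the equation with `zⁿ (V F)(|z|²)` gives `∫ w zⁿ F =
-∫ w zⁿ V F`; the failure of the inversion near the centre is harmless because `w` vanishes there.
Iterating, the right-hand side tends to zero geometrically, since `V` is a contraction in a weighted
norm. -/
lemma Helmholtz.integral_radial (hH : Helmholtz (disc c ρ) w) (hw : IntegrableOn w (disc c ρ))
    (he : 0 < e) (h0 : ∀ x, x ∈ disc c e → w x = 0) (hT : 0 ≤ T) (hTρ : T < ρ) (n : ℕ)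
    {F : ℝ → ℂ} (hF : Smooth F) (hF0 : ∀ t, T ≤ t → F t = 0) :
    ∫ x in disc c ρ, w x * (cz c x ^ n * F (nz c x)) = 0 := by
  have step : ∀ {F : ℝ → ℂ}, Smooth F → (∀ t, T ≤ t → F t = 0) →
      ∫ x in disc c ρ, w x * (cz c x ^ n * F (nz c x)) =
        -∫ x in disc c ρ, w x * (cz c x ^ n * volterra n e T F (nz c x)) := by
    intro F hF hF0
    obtain ⟨cG, zG, eG⟩ := volterra_spec he n hF hF0
    have hc : Smooth fun z : ℂ => z ^ n := contDiff_id.pow n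
    obtain ⟨t1, t2⟩ := isTest_radial (c := c) hc cG zG
    have := hH _ t1 (t2.trans fun x hx => lt_of_le_of_lt hx hTρ)
    rw [(((integrable_mul_of_continuous hw (contDiff_radial hc hF).continuous).hi.add
      (integrable_mul_of_continuous hw (contDiff_radial hc cG).continuous).hi).congr
      (ae_of_all _ fun x => ?_)).2] at this
    · linear_combination this
    · rcases lt_or_ge (nz c x) e with hx | hx
      · simp only [h0 x hx, zero_mul, add_zero]
      · rw [lap_radial (P' := fun z => n * z ^ (n - 1)) (P'' := fun z => n * ((n - 1 : ℕ) * z ^ (n - 1 - 1)))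
          (fun z => hasDerivAt_pow n z) (fun z => (hasDerivAt_pow _ z).const_mul (n : ℂ)) hc cG, ← eG _ hx]
        have : cz c x * (n * cz c x ^ (n - 1)) = n * cz c x ^ n := by
          cases n with
          | zero => simp
          | succ n => simp [pow_succ]; ring
        rw [this]
        ring
  have cw := contDiff_weight he n
  have cp : Continuous fun t : ℝ => ((t ^ n / 4 : ℝ) : ℂ) := by fun_prop
  obtain ⟨C₁, h1⟩ := (isCompact_Icc (a := 0) (b := T)).exists_bound_of_continuousOn
    cw.continuous.continuousOn
  obtain ⟨C₂, h2⟩ := (isCompact_Icc (a := 0) (b := T)).exists_bound_of_continuousOn cp.continuousOn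
  have hm : (0 : ℝ) ∈ Icc 0 T := ⟨le_rfl, hT⟩
  set C := max C₁ C₂
  have hC : 0 ≤ C := (norm_nonneg _).trans ((h1 0 hm).trans (le_max_left _ _))
  -- Then `C / M ≤ 1/2`, so each application of the Volterra operator at least halves the weighted
  -- norm.
  set M := 2 * C + 1
  have hM : 0 < M := by positivity
  set Q := ∫ x in disc c ρ, ‖w x‖ * ((ρ + 1) ^ n * Real.exp (M * T))
  have key : ∀ (k : ℕ) (A : ℝ) (F : ℝ → ℂ), 0 ≤ A → Smooth F → (∀ t, T ≤ t → F t = 0) →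
      (∀ t ∈ Icc 0 T, ‖F t‖ ≤ A * Real.exp (M * (T - t))) →
      ‖∫ x in disc c ρ, w x * (cz c x ^ n * F (nz c x))‖ ≤ (1 / 2) ^ k * (A * Q) := by
    intro k
    induction k with
    | zero =>
      intro A F hA _ hF0 hb
      rw [pow_zero, one_mul, ← integral_const_mul]
      refine norm_integral_le_of_norm_le ((hw.norm.mul_const _).const_mul A)
        ((ae_restrict_iff' isOpen_disc.measurableSet).2 (ae_of_all _ fun x hx => ?_))
      have n1 : ‖cz c x‖ ≤ ρ + 1 := by
        have := norm_cz_sq (c := c) x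
        nlinarith [sq_nonneg (‖cz c x‖ - 1), show nz c x < ρ from hx, nz_nonneg (c := c) x]
      have n2 : ‖F (nz c x)‖ ≤ A * Real.exp (M * T) := by
        rcases le_total T (nz c x) with h | h
        · rw [hF0 _ h, norm_zero]; positivity
        · refine (hb _ ⟨nz_nonneg x, h⟩).trans (mul_le_mul_of_nonneg_left (Real.exp_le_exp.2
            (mul_le_mul_of_nonneg_left ?_ hM.le)) hA)
          linarith [nz_nonneg (c := c) x]
      have : 0 < ρ := hT.trans_lt hTρ
      rw [norm_mul, norm_mul, norm_pow]
      calc _ ≤ ‖w x‖ * ((ρ + 1) ^ n * (A * Real.exp (M * T))) := by gcongr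
        _ = _ := by ring
    | succ k ih =>
      intro A F hA hF hF0 hb
      obtain ⟨cG, zG, -⟩ := volterra_spec he n hF hF0
      rw [step hF hF0, norm_neg]
      have hle := fun t ht => norm_volterra_le (e := e) (n := n) hM hA hC
        (fun t ht => (h1 t ht).trans (le_max_left _ _))
        (fun t ht => (h2 t ht).trans (le_max_right _ _)) hb t ht
      refine (ih (A / 2) _ (by positivity) cG zG fun t ht => (hle t ht).trans ?_).trans_eq
        (by rw [pow_succ]; ring)
      have hCM : C / M ≤ 1 / 2 := by rw [div_le_div_iff₀ hM two_pos]; simp only [M]; linarith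
      have : C * (C * A / M) / M = A * (C / M * (C / M)) := by ring
      rw [this]
      have h0 : 0 ≤ C / M := by positivity
      refine mul_le_mul_of_nonneg_right ?_ (Real.exp_pos _).le
      nlinarith [mul_le_mul hCM hCM h0 (by norm_num)]
  obtain ⟨A, hA⟩ := (isCompact_Icc (a := 0) (b := T)).exists_bound_of_continuousOn
    hF.continuous.continuousOn
  have hA0 : 0 ≤ A := (norm_nonneg _).trans (hA 0 hm)
  have lim : Tendsto (fun k : ℕ => (1 / 2 : ℝ) ^ k * (A * Q)) atTop (𝓝 0) := by
    simpa using (tendsto_pow_atTop_nhds_zero_of_lt_one (r := (1 / 2 : ℝ)) (by norm_num)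
      (by norm_num)).mul_const (A * Q)
  refine norm_le_zero_iff.1 (ge_of_tendsto' lim fun k => key k A F hA0 hF hF0 fun t ht => ?_)
  refine (hA t ht).trans (le_mul_of_one_le_right hA0 (Real.one_le_exp ?_))
  exact mul_nonneg hM.le (by linarith [ht.2])

/-- Stone–Weierstrass on the closed disc: the star algebra generated by the coordinate `z` is dense
in the continuous functions, and its elements are polynomials in `z` and `z̄`. -/
lemma exists_polynomial_near (r : ℝ) {g : ℂ → ℂ} (hg : Continuous g) {ε : ℝ} (hε : 0 < ε) :
    ∃ q ∈ Submodule.span ℂ {q : ℂ → ℂ | ∃ i j : ℕ, q = fun z => z ^ i * conj z ^ j},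
      ∀ z, ‖z‖ ≤ r → ‖g z - q z‖ ≤ ε := by
  have : CompactSpace (closedBall (0 : ℂ) r) :=
    isCompact_iff_compactSpace.1 (isCompact_closedBall 0 r)
  set X : C(closedBall (0 : ℂ) r, ℂ) := ContinuousMap.restrict _ (.id ℂ)
  have hm : (⟨fun z => g z, by fun_prop⟩ : C(closedBall (0 : ℂ) r, ℂ)) ∈
      StarAlgebra.elemental ℂ X := by
    rw [ContinuousMap.elemental_id_eq_top]; trivial
  obtain ⟨f, hf, hd⟩ := mem_closure_iff.1 hm ε hε
  have hf' : f ∈ Submodule.span ℂ (Submonoid.closure {X, star X} : Set C(closedBall (0 : ℂ) r, ℂ)) := by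
    rw [← Algebra.adjoin_eq_span]
    have h2 : f ∈ Algebra.adjoin ℂ ({X} ∪ star {X}) := hf
    simpa [star_singleton, pair_comm] using h2
  have : ∃ q ∈ Submodule.span ℂ {q : ℂ → ℂ | ∃ i j : ℕ, q = fun z => z ^ i * conj z ^ j},
      ∀ z : closedBall (0 : ℂ) r, f z = q z := by
    clear hd hf
    induction hf' using Submodule.span_induction with
    | mem f h =>
      obtain ⟨i, j, rfl⟩ := (Submonoid.mem_closure_pair _ _ _).1 h
      exact ⟨_, Submodule.subset_span ⟨i, j, rfl⟩, fun z => rfl⟩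
    | zero => exact ⟨0, Submodule.zero_mem _, fun z => rfl⟩
    | add f f' _ _ h h' =>
      obtain ⟨q, hq, e⟩ := h
      obtain ⟨q', hq', e'⟩ := h'
      exact ⟨_, Submodule.add_mem _ hq hq', fun z => congrArg₂ (· + ·) (e z) (e' z)⟩
    | smul b f _ h =>
      obtain ⟨q, hq, e⟩ := h
      exact ⟨_, Submodule.smul_mem _ b hq, fun z => congrArg (b • ·) (e z)⟩
  obtain ⟨q, hq, e⟩ := this
  refine ⟨q, hq, fun z hz => ?_⟩
  have hz' : z ∈ closedBall (0 : ℂ) r := by simpa using hz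
  have := (ContinuousMap.dist_apply_le_dist ⟨z, hz'⟩).trans hd.le
  rw [dist_eq_norm, e] at this
  exact this

/-- A real solution that vanishes near the centre of a disc vanishes in the disc. -/
lemma Helmholtz.eq_zero_disc (hH : Helmholtz (disc c ρ) w) (hw : IntegrableOn w (disc c ρ))
    (he : 0 < e) (h0 : ∀ x, x ∈ disc c e → w x = 0) (hr : ∀ x, conj (w x) = w x)
    (hT : 0 < T) (hTρ : 2 * T < ρ) : w =ᵐ[μ[disc c T]] 0 := by
  set χ : ℝ → ℂ := fun t => ((1 - stepFun (t / T) : ℝ) : ℂ)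
  have hχ : Smooth χ := ofRealCLM.contDiff.comp
    (contDiff_const.sub (contDiff_stepFun.comp (contDiff_id.div_const T)))
  have χ0 : ∀ t, 2 * T ≤ t → χ t = 0 := fun t ht => by
    simp [χ, stepFun_of_ge ((le_div_iff₀ hT).2 ht)]
  have χ1 : ∀ t, t ≤ T → χ t = 1 := fun t ht => by
    simp [χ, stepFun_of_le ((div_le_one hT).2 ht)]
  have rad : ∀ (i j : ℕ), ∫ x in disc c ρ, w x *
      (χ (nz c x) * (cz c x ^ i * conj (cz c x) ^ j)) = 0 := by
    -- Here `z^{j+i} z̄^j = z^i |z|^{2j}` is a power of `z` times a radial function. The monomials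
    -- with more factors `z̄` follow by complex conjugation, as `w` is real.
    have pos : ∀ i j : ℕ, ∫ x in disc c ρ, w x *
        (χ (nz c x) * (cz c x ^ (j + i) * conj (cz c x) ^ j)) = 0 := fun i j => by
      rw [← hH.integral_radial hw he h0 (by linarith : 0 ≤ 2 * T) hTρ i
        (F := fun t => χ t * ((t ^ j : ℝ) : ℂ))
        (hχ.mul (ofRealCLM.contDiff.comp (contDiff_id.pow j)))
        (fun t ht => by simp only [χ0 t ht, zero_mul])]
      refine integral_congr_ae (ae_of_all _ fun x => ?_)
      simp only [ofReal_pow, ← cz_mul_conj, mul_pow, pow_add]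
      ring
    intro i j
    rcases le_total j i with h | h
    · obtain ⟨k, rfl⟩ := Nat.exists_eq_add_of_le h
      exact pos k j
    · obtain ⟨k, rfl⟩ := Nat.exists_eq_add_of_le h
      refine (conj).injective ?_
      rw [map_zero, ← integral_conj, ← pos k i]
      refine integral_congr_ae (ae_of_all _ fun x => ?_)
      simp only [map_mul, map_pow, hr, conj_conj, χ, conj_ofReal]
      ring
  have hcχ : Continuous fun x => χ (nz c x) := (hχ.comp contDiff_nz).continuous
  have intg : ∀ {q : ℂ → ℂ}, Continuous q →
      IntegrableOn (fun x => w x * (χ (nz c x) * q (cz c x))) (disc c ρ) := fun hq =>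
    integrable_mul_of_continuous hw (hcχ.mul (hq.comp contDiff_cz.continuous))
  have poly : ∀ q ∈ Submodule.span ℂ {q : ℂ → ℂ | ∃ i j : ℕ, q = fun z => z ^ i * conj z ^ j},
      Continuous q ∧ ∫ x in disc c ρ, w x * (χ (nz c x) * q (cz c x)) = 0 := fun q hq => by
    induction hq using Submodule.span_induction with
    | mem q h =>
      obtain ⟨i, j, rfl⟩ := h
      exact ⟨by fun_prop, rad i j⟩
    | zero => exact ⟨continuous_zero, by simp⟩
    | add q q' _ _ h h' =>
      refine ⟨h.1.add h'.1, ?_⟩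
      refine (((intg h.1).hi.add (intg h'.1).hi).congr (ae_of_all _ fun x => by
        simp only [Pi.add_apply]; ring)).2.trans ?_
      rw [h.2, h'.2, add_zero]
    | smul b q _ h =>
      refine ⟨h.1.const_smul b, ?_⟩
      rw [← mul_zero b, ← h.2, ← integral_const_mul]
      refine integral_congr_ae (ae_of_all _ fun x => ?_)
      simp only [Pi.smul_apply, smul_eq_mul]
      ring
  have cont : ∀ g : ℂ → ℂ, Continuous g →
      ∫ x in disc c ρ, w x * (χ (nz c x) * g (cz c x)) = 0 := fun g hg => by
    have hi := (integrable_mul_of_continuous hw hcχ).norm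
    set Q := ∫ x in disc c ρ, ‖w x * χ (nz c x)‖
    have hQ : 0 ≤ Q := integral_nonneg fun x => norm_nonneg _
    refine norm_le_zero_iff.1 (le_of_forall_pos_le_add fun ε hε => ?_)
    obtain ⟨q, hq, hqg⟩ := exists_polynomial_near (ρ + 1) hg (ε := ε / (Q + 1)) (by positivity)
    obtain ⟨cq, iq⟩ := poly q hq
    have := (((intg hg).hi.sub (intg cq).hi).congr (g := fun x => w x * χ (nz c x) *
      (g (cz c x) - q (cz c x))) (ae_of_all _ fun x => by ring)).2
    rw [iq, sub_zero] at this
    rw [← this, zero_add]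
    refine (norm_integral_le_of_norm_le (hi.mul_const (ε / (Q + 1)))
      ((ae_restrict_iff' isOpen_disc.measurableSet).2 (ae_of_all _ fun x hx => ?_))).trans ?_
    · rw [norm_mul]
      refine mul_le_mul_of_nonneg_left (hqg _ ?_) (norm_nonneg _)
      have := norm_cz_sq (c := c) x
      nlinarith [sq_nonneg (‖cz c x‖ - 1), show nz c x < ρ from hx, nz_nonneg (c := c) x]
    · rw [integral_mul_const, mul_div_assoc', div_le_iff₀ (by positivity)]
      nlinarith
  have sub : disc c T ⊆ disc c ρ := fun x hx => lt_trans (show nz c x < T from hx) (by linarith)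
  refine ae_eq_of_integral_test isOpen_disc ((hw.mono_set sub).locallyIntegrableOn)
    (locallyIntegrableOn_const 0) fun φ hφ hs => ?_
  -- Any test function supported in the smaller disc is a continuous function of `z`, and the radial
  -- cutoff equals `1` on its support.
  have hg : Continuous fun z : ℂ => φ (z.re + c.1, z.im + c.2) :=
    hφ.1.continuous.comp (by fun_prop)
  rw [← integral_of_tsupport isOpen_disc.measurableSet sub hs]
  simp only [Pi.zero_apply, zero_mul, integral_zero]
  rw [← cont _ hg]
  refine integral_congr_ae (ae_of_all _ fun x => ?_)
  have ex : ((cz c x).re + c.1, (cz c x).im + c.2) = x := by simp [cz]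
  simp only [ex]
  by_cases hx : x ∈ tsupport φ
  · rw [χ1 _ (le_of_lt (hs hx)), one_mul]
  · simp only [eq_zero_off hx, mul_zero]

/-- Unique continuation for real solutions of the Helmholtz equation. -/
lemma Helmholtz.eq_zero {Ω U : Set ℝ²} (hH : Helmholtz Ω w) (hΩ : IsOpen Ω)
    (hc : IsPreconnected Ω) (hw : LocallyIntegrableOn w Ω) (hr : ∀ x, conj (w x) = w x)
    (hU : IsOpen U) (hne : U.Nonempty) (hs : U ⊆ Ω) (h0 : w =ᵐ[μ[U]] 0) :
    w =ᵐ[μ[Ω]] 0 := by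
  set Z : Set ℝ² := {x | ∃ V, IsOpen V ∧ x ∈ V ∧ w =ᵐ[μ[V]] 0}
  have hZ : IsOpen Z := isOpen_iff_forall_mem_open.2 fun x ⟨V, h1, h2, h3⟩ =>
    ⟨V, fun y hy => ⟨V, h1, hy, h3⟩, h1, h2⟩
  have near : ∀ b d r : ℝ, |b| < r → |d| < r → b ^ 2 + d ^ 2 < 2 * r ^ 2 := fun b d r h1 h2 => by
    nlinarith [sq_lt_sq' (abs_lt.1 h1).1 (abs_lt.1 h1).2, sq_lt_sq' (abs_lt.1 h2).1 (abs_lt.1 h2).2]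
  have sub : Ω ⊆ Z := by
    obtain ⟨x₀, hx₀⟩ := hne
    refine hc.subset_of_closure_inter_subset hZ ⟨x₀, hs hx₀, U, hU, hx₀, h0⟩ fun x ⟨hx, hxΩ⟩ => ?_
    obtain ⟨r, hr0, hball⟩ := isOpen_iff.1 hΩ x hxΩ
    set q := r / 4
    -- The distance on the plane is the maximum norm. A centre `c` closer than `q` to `x` gives `nz
    -- c x < 2 q² < 3 q²`, while the disc `nz c ≤ 7 q²` stays inside the ball of radius `4 q` about
    -- `x`. Moreover `2 · 3 q² < 7 q²`, as the lemma on discs requires.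
    have hq : 0 < q := by positivity
    obtain ⟨c, ⟨V, hV, hcV, hV0⟩, hd⟩ := mem_closure_iff.1 hx q hq
    have hdx : |x.1 - c.1| < q ∧ |x.2 - c.2| < q := max_lt_iff.1 hd
    have far : {y | nz c y ≤ 7 * q ^ 2} ⊆ Ω := fun y hy => by
      have hy' : (y.1 - c.1) ^ 2 + (y.2 - c.2) ^ 2 ≤ 7 * q ^ 2 := hy
      have a1 : |y.1 - c.1| < 3 * q := abs_lt_of_sq_lt_sq (by nlinarith [sq_nonneg (y.2 - c.2)]) (by positivity)
      have a2 : |y.2 - c.2| < 3 * q := abs_lt_of_sq_lt_sq (by nlinarith [sq_nonneg (y.1 - c.1)]) (by positivity)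
      rw [abs_lt] at a1 a2
      have b1 := abs_lt.1 hdx.1
      have b2 := abs_lt.1 hdx.2
      have : r = 4 * q := by simp only [q]; ring
      have k1 : |y.1 - x.1| < r := abs_lt.2 ⟨by linarith, by linarith⟩
      have k2 : |y.2 - x.2| < r := abs_lt.2 ⟨by linarith, by linarith⟩
      exact hball (max_lt k1 k2)
    have fd : disc c (7 * q ^ 2) ⊆ Ω := fun y hy => far (show nz c y ≤ _ from le_of_lt hy)
    obtain ⟨e, he, heV⟩ : ∃ e, 0 < e ∧ disc c e ⊆ V := by
      obtain ⟨t, ht, hb⟩ := isOpen_iff.1 hV c hcV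
      refine ⟨t ^ 2, by positivity, fun y hy => hb ?_⟩
      have hy' : (y.1 - c.1) ^ 2 + (y.2 - c.2) ^ 2 < t ^ 2 := hy
      exact max_lt (abs_lt_of_sq_lt_sq (by nlinarith [sq_nonneg (y.2 - c.2)]) ht.le)
        (abs_lt_of_sq_lt_sq (by nlinarith [sq_nonneg (y.1 - c.1)]) ht.le)
    have me : MeasurableSet (disc c e) := isOpen_disc.measurableSet
    -- The function is changed on a null set so that it vanishes at every point of the small disc.
    have ae : (disc c e)ᶜ.indicator w =ᵐ[volume] w := by
      have := (ae_restrict_iff' me).1 (ae_restrict_of_ae_restrict_of_subset heV hV0)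
      filter_upwards [this] with y hy
      by_cases h : y ∈ disc c e
      · simp [h, hy h]
      · simp [h]
    have key := Helmholtz.eq_zero_disc (c := c) (ρ := 7 * q ^ 2) (T := 3 * q ^ 2) (e := e)
      (w := (disc c e)ᶜ.indicator w) (fun φ hφ hs => ?_)
      (((hw.integrableOn_compact_subset far (isCompact_nz_le c _)).mono_set
        fun y hy => show nz c y ≤ _ from le_of_lt hy).congr (ae_restrict_of_ae ae.symm)) he
      (fun y hy => by simp [hy]) (fun y => by by_cases h : y ∈ disc c e <;> simp [h, hr])
      (by positivity) (by nlinarith)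
    · refine ⟨disc c (3 * q ^ 2), isOpen_disc, ?_, EventuallyEq.trans (ae_restrict_of_ae ae.symm) key⟩
      have := near _ _ _ hdx.1 hdx.2
      exact lt_trans this (by nlinarith)
    · rw [← hH φ hφ (hs.trans fd)]
      refine (integral_congr_ae (ae_restrict_of_ae (ae.mono fun y hy => by simp only [hy]))).trans
        (setIntegral_eq_of_subset_of_forall_sdiff_eq_zero hΩ.measurableSet fd fun y hy => ?_).symm
      have k0 : ∀ i j, partialD i j φ y = 0 := fun i j =>
        eq_zero_off fun h => hy.2 (hs (tsupport_partialD i j φ h))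
      have k1 := k0 2 0
      have k2 := k0 0 2
      have k3 := k0 0 0
      simp only [partialD, Function.iterate_succ, Function.iterate_zero, Function.comp_apply, id]
        at k1 k2 k3
      rw [lap, k1, k2, k3, add_zero, add_zero, mul_zero]
  rw [EventuallyEq, ae_restrict_iff' hΩ.measurableSet, ae_iff]
  refine measure_null_of_locally_null _ fun x hx => ?_
  have hx' : x ∈ Ω := by by_contra h; exact hx fun h' => absurd h' h
  obtain ⟨V, h1, h2, h3⟩ := sub hx'
  refine ⟨_, inter_mem_nhdsWithin _ (h1.mem_nhds h2), ?_⟩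
  rw [EventuallyEq, ae_restrict_iff' h1.measurableSet, ae_iff] at h3
  refine measure_mono_null (fun y hy => ?_) h3
  exact fun h => hy.1 fun _ => h hy.2

end

/-! ### The resonance vanishes on no open set, and the solution operator. -/

section

lemma LocSol.helmholtz (h : LocSol a p u u₁ u₂ u) : Helmholtz strip u := by
  intro φ hφ hs
  obtain ⟨r, hr, hsr⟩ := hφ.exists_support_lt
  have hst : tsupport φ ⊆ stripTo r := fun x hx => ⟨hs hx, hsr hx⟩
  have hE := h.energy r hr
  have loc : ∀ {w χ : ℝ² → ℂ}, tsupport χ ⊆ tsupport φ →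
      ∫ x in strip, w x * χ x = ∫ x in stripTo r, w x * χ x := fun hχ =>
    integral_of_tsupport isOpen_strip.measurableSet inter_subset_left (hχ.trans hst)
  have s1 := tsupport_pd₁ φ
  have s2 := tsupport_pd₂ φ
  have e1 := hE.weak₁ hφ.d₁ (s1.trans hst)
  have e2 := hE.weak₂ hφ.d₂ (s2.trans hst)
  rw [← loc s1, ← loc ((tsupport_pd₁ _).trans s1)] at e1
  rw [← loc s2, ← loc ((tsupport_pd₂ _).trans s2)] at e2
  have i0 : LocL2 u := fun r hr => (h.energy r hr).memLp
  have k := h.weak φ (IsBdryTest.of_support hφ hs)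
  rw [integral_add (integrable_strip_mul h.weakSol.mem₁ hφ.d₁)
    (integrable_strip_mul h.weakSol.mem₂ hφ.d₂), e1, e2] at k
  refine ((((integrable_strip_mul i0 hφ.d₁.d₁).hi.add (integrable_strip_mul i0 hφ.d₂.d₂).hi).add
    (integrable_strip_mul i0 hφ).hi).congr (ae_of_all _ fun x => by
      simp only [lap]; ring)).2.trans ?_
  linear_combination -k

/-- The resonance function does not vanish on open sets. -/
lemma IsThresholdResonance.not_ae_eq_zero (ha : 0 < a) {ψ : StripFun}
    (hψ : IsThresholdResonance a p ψ) {U : Set ℝ²} (hU : IsOpen U) (hne : U.Nonempty)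
    (hs : U ⊆ strip) : ¬ ψ =ᵐ[μ[U]] 0 := by
  intro h0
  obtain ⟨u₁, u₂, hl⟩ := (isWeakSolution_iff fun r _ => MemLp.zero).1 hψ.1
  have hl' : LocSol a p ψ u₁ u₂ ψ := by simpa using hl
  -- Unique continuation is stated for functions that are real at every point, so the real part
  -- serves as the representative.
  have hw : (fun x => (((ψ x).re : ℝ) : ℂ)) =ᵐ[μ[strip]] ψ := by
    filter_upwards [hψ.star ha] with x hx using conj_eq_iff_re.1 hx
  have hz : ψ =ᵐ[μ[strip]] 0 := by
    refine hw.symm.trans (Helmholtz.eq_zero (fun φ hφ hφs => ?_) isOpen_strip ?_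
      (fun x hx => ?_) (fun x => conj_ofReal _) hU hne hs
      (EventuallyEq.trans (ae_restrict_of_ae_restrict_of_subset hs hw) h0))
    · rw [← hl'.helmholtz φ hφ hφs]
      exact integral_congr_ae (hw.mono fun x hx => by simp only [hx])
    · exact (((convex_Ioi (0 : ℝ)).prod (convex_Ioo 0 π))).isPreconnected
    · have hm : x ∈ stripTo (x.1 + 1) := ⟨hx, lt_add_one x.1⟩
      have : IntegrableAtFilter _ (𝓝[stripTo (x.1 + 1)] x) _ := locallyIntegrableOn_of_memLp (MemLp.ae_eq (ae_restrict_of_ae_restrict_of_subset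
        inter_subset_left hw.symm) (hl'.energy (x.1 + 1) (by linarith [hx.1])).memLp) x hm
      rwa [(isOpen_stripTo _).nhdsWithin_eq hm, ← isOpen_strip.nhdsWithin_eq hx] at this
  obtain ⟨C, X, hC⟩ := hψ.2
  have hr := (rate_spec (m := 0) (by simp) (le_refl 2)).2.2
  have lim : Tendsto (fun s : ℝ => C * Real.exp (-(rate 0 2).re * s)) atTop (𝓝 (C * 0)) := by
    refine (Real.tendsto_exp_atBot.comp (tendsto_id.const_mul_atTop_of_neg ?_)).const_mul C
    norm_num at hr; linarith
  have hc : 0 < √(2 / π) * (1 / 2) := by positivity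
  rw [mul_zero] at lim
  obtain ⟨N, hN⟩ := eventually_atTop.1 (lim.eventually (gt_mem_nhds hc))
  set M := max (max N X) 0
  -- On this set `sin x₂ ≥ 1/2`, while beyond `M` the remainder is smaller than half of `√(2/π)`.
  -- This contradicts the asymptotics of a vanishing function.
  have hsub : Ioi M ×ˢ Ioo (1 : ℝ) (3 / 2) ⊆ strip := fun x hx =>
    ⟨(le_max_right _ _).trans_lt hx.1, by linarith [hx.2.1], by linarith [hx.2.2, pi_gt_three]⟩
  have ho : IsOpen (Ioi M ×ˢ Ioo (1 : ℝ) (3 / 2)) := isOpen_Ioi.prod isOpen_Ioo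
  have hpos : μ[Ioi M ×ˢ Ioo (1 : ℝ) (3 / 2)] ≠ 0 := by
    rw [Ne, Measure.restrict_eq_zero]
    exact (ho.measure_pos _ ⟨(M + 1, 5 / 4), by simp, by norm_num, by norm_num⟩).ne'
  have := ae_neBot.2 hpos
  obtain ⟨x, ⟨h1, h2⟩, h3⟩ := ((ae_restrict_of_ae_restrict_of_subset hsub (hC.and hz)).and
    (ae_restrict_mem ho.measurableSet)).exists
  have hM : M < x.1 := h3.1
  have h1' := h1 (((le_max_right _ _).trans (le_max_left _ _)).trans_lt hM)
  rw [h2, ← rate_two, norm_exp, re_mul_ofReal, neg_re] at h1'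
  have h4 := hN x.1 (((le_max_left _ _).trans (le_max_left _ _)).trans hM.le)
  have h5 : (1 : ℝ) / 2 ≤ Real.sin x.2 := by
    have := Real.mul_le_sin (x := x.2) (by linarith [h3.2.1]) (by linarith [h3.2.2, pi_gt_three])
    refine le_trans ?_ this
    rw [div_mul_eq_mul_div, div_le_div_iff₀ two_pos pi_pos]
    linarith [h3.2.1, pi_lt_four]
  simp only [Pi.zero_apply, neg_zero, zero_mul, exp_zero, mul_one, zero_sub, norm_neg,
    norm_mul, norm_real, norm_eq_abs, abs_of_nonneg (Real.sqrt_nonneg _)] at h1'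
  rw [abs_of_pos (by linarith)] at h1'
  have := mul_le_mul_of_nonneg_left h5 (Real.sqrt_nonneg (2 / π))
  linarith

/-- Both directions of the reduction in one statement, for every `L ≥ R`. It allows `L` to be
enlarged without changing the solution. -/
lemma isSolution_extZero_iff (ha : 0 < a) (hL : a ≤ L) (hL0 : 0 ≤ L) (hR : R ≤ L)
    (hm : ‖m‖ < 1 / 2) (f : L2 (stripTo R)) (u : StripFun) :
    IsSolution a p m ((stripTo R).indicator f) u ↔
      ∃ v, redOp a p hL0 m v = -src a p (extZero R f) ∧ lift a p hL0 m v = u := by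
  constructor
  · rintro ⟨h, c, hc⟩
    obtain ⟨v, h1, h2, -⟩ := exists_redOp_of_isWeakSolution ha hL hL0 hm (extZero_ae f)
      (extZero_tail hR f) h hc
    exact ⟨v, h1, h2⟩
  · rintro ⟨v, h, rfl⟩
    obtain ⟨h1, h2⟩ := redOp_isSolution ha hL hL0 hm (extZero_ae f) (extZero_tail hR f) h
    exact ⟨h1, _, h2⟩

/-- The solution operator, given a right inverse of the reduced operator. -/
def solOp (hL0 : 0 ≤ L) (R : ℝ) (m : ℂ) (B : Energy a p →L[ℂ] Energy a p) :
    L2 (stripTo R) →ₗ[ℂ] StripFun :=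
  lift a p hL0 m ∘ₗ (-(B ∘L src a p ∘L extZero R) : L2 (stripTo R) →L[ℂ] Energy a p).toLinearMap

end

end Halfstrip

/-! ### Assembly of the theorem. -/

open Halfstrip in
theorem theorem3p3 (a : ℝ) (ha : 0 < a) (p : Parity) (ψ : StripFun)
    (hψ : IsThresholdResonance a p ψ) :
    ∃ ρ : ℝ, 0 < ρ ∧ ∀ R : ℝ, a < R →
      ∃ A : ℂ → L2 (stripTo R) →ₗ[ℂ] StripFun,
        (∀ m ∈ Metric.ball (0 : ℂ) ρ, m ≠ 0 → ∀ f : L2 (stripTo R),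
          IsSolution a p m ((stripTo R).indicator f) (A m f) ∧
          ∀ v : StripFun, IsSolution a p m ((stripTo R).indicator f) v → v = A m f) ∧
        ∀ R' s : ℝ, 0 < R' → 0 < s →
          HasSimplePole 1 (stripTo R') ρ R ψ A ∧
          HasSimplePole 2 (stripCut a R' s) ρ R ψ A := by
  obtain ⟨ρ, hρ, hρ2, hres⟩ := exists_resolvent ha hψ
  have lt : ∀ {m : ℂ}, m ∈ Metric.ball (0 : ℂ) ρ → ‖m‖ < 1 / 2 := fun hm =>
    (mem_ball_zero_iff.1 hm).trans_le hρ2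
  refine ⟨ρ, hρ, fun R hR => ?_⟩
  have hR0 : 0 ≤ R := ha.le.trans hR.le
  obtain ⟨v₁, k0, k1, -⟩ := exists_resonance ha hR.le hR0 hψ
  obtain ⟨inj, V, -, hV⟩ := hres R hR hR0 v₁ k0 k1
  have uniq : ∀ m ∈ Metric.ball (0 : ℂ) ρ, m ≠ 0 → ∀ (f : L2 (stripTo R)) (u v : StripFun),
      IsSolution a p m ((stripTo R).indicator f) u → IsSolution a p m ((stripTo R).indicator f) v →
      u = v := by
    intro m hm hm0 f u v hu hv
    obtain ⟨x, hx, rfl⟩ := (isSolution_extZero_iff ha hR.le hR0 le_rfl (lt hm) f u).1 hu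
    obtain ⟨y, hy, rfl⟩ := (isSolution_extZero_iff ha hR.le hR0 le_rfl (lt hm) f v).1 hv
    rw [sub_eq_zero.1 (inj m hm hm0 (x - y) (by rw [map_sub, hx, hy, sub_self]))]
  -- The solution operator is built with `L = R`, so that it depends on `R` only and not on the
  -- domain to which its values are restricted.
  set B : ℂ → Energy a p →L[ℂ] Energy a p := fun m =>
    m⁻¹ • (innerSL ℂ v₁).smulRight v₁ + V m
  have hB : ∀ m ∈ Metric.ball (0 : ℂ) ρ, m ≠ 0 → ∀ w, redOp a p hR0 m (B m w) = w := hV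
  have sol : ∀ m ∈ Metric.ball (0 : ℂ) ρ, m ≠ 0 → ∀ f : L2 (stripTo R),
      IsSolution a p m ((stripTo R).indicator f) (solOp hR0 R m (B m) f) := fun m hm hm0 f =>
    (isSolution_extZero_iff ha hR.le hR0 le_rfl (lt hm) f _).2
      ⟨-(B m (src a p (extZero R f))), by rw [map_neg, hB m hm hm0], rfl⟩
  refine ⟨fun m => solOp hR0 R m (B m), fun m hm hm0 f => ⟨sol m hm hm0 f, fun v hv =>
    uniq m hm hm0 f _ _ hv (sol m hm hm0 f)⟩, fun R' s hR' hs => ?_⟩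
  -- For a given `R'` a larger `L` is used: `Γ_m` then vanishes on `Π_{R'}`, where the solution
  -- coincides with its energy part, and the cutoffs of the regularity argument fit into `x₁ < L`.
  -- By uniqueness the solution operator is unchanged.
  obtain ⟨L, hLR, hL2, hLR'⟩ : ∃ L, R ≤ L ∧ 2 * (R' ^ 2 + 1) < L ∧ R' ≤ L :=
    ⟨R + R' + 2 * (R' ^ 2 + 1) + 1, by nlinarith, by linarith, by nlinarith⟩
  have hL : a < L := hR.trans_le hLR
  have hL0 := ha.le.trans hL.le
  obtain ⟨v₀, h0, h1, hv₀⟩ := exists_resonance ha hL.le hL0 hψ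
  obtain ⟨-, W, hW, hWres⟩ := hres L hL hL0 v₀ h0 h1
  have hA : ∀ m ∈ Metric.ball (0 : ℂ) ρ, m ≠ 0 → ∀ f v, redOp a p hL0 m v = -src a p (extZero R f) →
      solOp hR0 R m (B m) f = lift a p hL0 m v := fun m hm hm0 f v hv =>
    uniq m hm hm0 f _ _ (sol m hm hm0 f)
      ((isSolution_extZero_iff ha hL.le hL0 hLR (lt hm) f _).2 ⟨v, hv, rfl⟩)
  have sub : stripTo R' ⊆ stripTo L := stripTo_mono hLR'
  have hneR : ¬ ψ =ᵐ[volume.restrict (stripTo R)] 0 := hψ.not_ae_eq_zero ha (isOpen_stripTo R)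
    ⟨(a, 1), ⟨ha, one_pos, by linarith [Real.pi_gt_three]⟩, hR⟩ inter_subset_left
  have cut : stripCut a R' s ⊆ stripTo R' := inter_subset_left
  obtain ⟨S₁, hS₁⟩ := exists_reg_weakTo (a := a) (p := p) (L := L) (k := 1) (isOpen_stripTo R')
    inter_subset_left fun v _ _ => exists_sobolev_one inter_subset_left v
  obtain ⟨S₂, hS₂⟩ := exists_reg_weakTo (a := a) (p := p) (L := L) (k := 2) (isOpen_stripCut a R' s)
    (cut.trans inter_subset_left) fun v g h => h.exists_sobolev_two ha hR' hs hL2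
  exact ⟨hasSimplePole_of_reg ha hL.le hL0 hLR sub hψ h0 hv₀ hρ hW hWres hA hneR
    (fun hne => hψ.not_ae_eq_zero ha (isOpen_stripTo R') hne inter_subset_left) hS₁,
    hasSimplePole_of_reg ha hL.le hL0 hLR (cut.trans sub) hψ h0 hv₀ hρ hW hWres hA hneR
    (fun hne => hψ.not_ae_eq_zero ha (isOpen_stripCut a R' s) hne (cut.trans inter_subset_left)) hS₂⟩
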